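/- **Conventions.** $\mathbf C^*$ is the category of (not necessarily unital) $C^*$-algebras and $*$-homomorphisms, $\otimes$ is the maximal tensor product, and $\mathfrak D_A=A\otimes -$. An endofunctor $F$ of $\mathbf C^*$ is *decent* if it preserves zero objects and every pullback of a pair $(\varphi_1,\varphi_2)$ in which $\varphi_2$ is a split epimorphism. A *good endofunctor* is a decent endofunctor $F$ with a *labeling*, i.e. a family of natural transformations $\kappa^{A,F}\colon \mathfrak D_AF\Rightarrow F\mathfrak D_A$ that is natural in $A$ and compatible with the canonical maps $A\otimes(A'\otimes B)\to(A\otimes A')\otimes B$ and $B\to\mathbb C\otimes B$. The composite $FG$ has the labeling $\kappa^{A,FG}=F\kappa^{A,G}\circ\kappa^{A,F}G$. A natural transformation $\gamma\colon F\Rightarrow G$ of good endofunctors is *labeled* if $\kappa^{A,G}\circ\mathfrak D_A\gamma=\gamma\mathfrak D_A\circ\kappa^{A,F}$ for all $A$. Labeled $\gamma_0,\gamma_1\colon F\Rightarrow G$ are *homotopic* if there is a labeled $\Gamma\colon F\Rightarrow GI$, where $IB=C([0,1],B)$, with $G\,\mathrm{ev}_j\circ\Gamma=\gamma_j$ for $j=0,1$;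 $\mathbf{hGEFC}$ is the category of good endofunctors and homotopy classes of labeled natural transformations. Let $\mathfrak AB=C_b([0,\infty),B)/C_0([0,\infty),B)$, and write $\mathrm{as}_t f(t)$ for the class of $f$. Let $\mathbb KB$ be the completion of the finitely supported $\mathbb N\times\mathbb N$-matrices over $B$ in the operator norm on $\ell^2(\mathbb N,B)$, and let $\alpha\iota_{00}\colon\mathrm{Id}\Rightarrow\mathfrak A\mathbb K$ send $b$ to the class of the constant function $\mathrm{diag}(b,0,0,\dots)$. For a metric space $X$ of bounded geometry (for each $R$ the cardinalities of the $R$-balls are uniformly bounded) and $X_0\subset X$, let $\mathfrak M^u_XB$ be the completion, in the operator norm on $\ell^2(X,B)$, of the $X\times X$-matrices over $B$ of finite propagation with uniformly bounded entries, let $\mathfrak M^u_{X\supset X_0}B$ be its closed ideal $\overline{\bigcup_{R>0}\{m:\operatorname{supp}m\subset N_R(X_0)\times N_R(X_0)\}}$, and let $\mathfrak N^u_{X,X_0}=\mathfrak M^u_X/\mathfrak M^u_{X\supset X_0}$; $\mathrm{qmat}_{x,y}\,m_{x,y}$ is the class of the matrix $m$. For a closed subset $\mathsf X_0$ of a proper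 metric space $\mathsf X$ let $C_0(\mathsf X,\mathsf X_0,B)=\{f\in C_0(\mathsf X,B): f|_{\mathsf X_0}=0\}$, and write $f\otimes b$ for $z\mapsto f(z)b$. A *scaling* of $(\mathsf X,\mathsf X_0)$ is a continuous map $\mathsf X\times[0,\infty)\to\mathsf X$, $(z,t)\mapsto\mathrm{sc}_tz$, with $\mathrm{sc}_t(\mathsf X_0)\subset\mathsf X_0$ and $\mathrm{sc}_0=\mathrm{id}$, such that $\bigcup_{t\le T}\mathrm{sc}_t^{-1}(S)$ is bounded for all bounded $S$ and all $T$, and for which there are non-decreasing functions $\rho_t\colon[0,\infty)\to[0,\infty)$ with $\mathrm{dist}(\mathrm{sc}_tz,\mathrm{sc}_tw)\le\rho_t(\mathrm{dist}(z,w))$, such that for each $r$ the function $t\mapsto\rho_t(r)$ is bounded and tends to $0$ as $t\to\infty$. **Theorem.** Let $\mathsf X$ be a proper metric space, $\mathsf X_0\subset\mathsf X$ a closed subset, $\mathrm{sc}$ a scaling of $(\mathsf X,\mathsf X_0)$, and $\Delta>0$. Let $X\subset\mathsf X$ be a $\Delta$-separated $\Delta$-net (distinct points of $X$ have distance at least $\Delta$,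 and every point of $\mathsf X$ has distance less than $\Delta$ to some point of $X$) which has bounded geometry, and let $X_0=\{x\in X:\mathrm{dist}(x,\mathsf X_0)<\Delta\}$. Let $\{\alpha_x\}_{x\in X}$ be continuous real functions on $\mathsf X$ with $\sum_x\alpha_x^2=1$ pointwise, where $\alpha_x$ vanishes outside of the open ball $B_\Delta(x)$, and let $\chi_x=1$ if $\mathrm{dist}(x,\mathsf X_0)>\Delta$ and $\chi_x=0$ otherwise (with $\mathrm{dist}(x,\emptyset)=\infty$). Fix an injection $X\to\mathbb N$ (for instance, an enumeration of $X$), through which $X\times X$-matrices are regarded as $\mathbb N\times\mathbb N$-matrices. Then the endofunctors $S=C_0(\mathsf X,\mathsf X_0,-)$, $N=\mathfrak N^u_{X,X_0}$, $\mathfrak A$, $\mathbb K$ and $I$ are good endofunctors with the labelings given by $a\otimes f\mapsto(z\mapsto a\otimes f(z))$ for $S$ and $I$, $a\otimes\mathrm{as}_tf(t)\mapsto\mathrm{as}_t(a\otimes f(t))$, $a\otimes(m_{i,j})\mapsto(a\otimes m_{i,j})$ and $a\otimes\mathrm{qmat}_{x,y}m_{x,y}\mapsto\mathrm{qmat}_{x,y}(a\otimes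 m_{x,y})$. There are well-defined labeled natural transformations $\eta\colon\mathrm{Id}\Rightarrow NS$ and $\varepsilon\colon SN\Rightarrow\mathfrak A\mathbb K$ given by $$\eta_A\colon a\mapsto\mathrm{qmat}_{x,y}(\chi_x\chi_y\alpha_x\alpha_y\otimes a),\qquad \varepsilon_A\colon f\otimes\mathrm{qmat}_{x,y}m_{x,y}\mapsto\mathrm{as}_t\bigl(\mathrm{diag}_x f(\mathrm{sc}_tx)\cdot\mathrm{mat}_{x,y}m_{x,y}\bigr),$$ and they are the unit and the counit of an asymptotic adjunction $S\dashv_{\mathrm{as}}N$: in $\mathbf{hGEFC}$, i.e. up to homotopy, $$\varepsilon S\circ S\eta=(\alpha\iota_{00})S\colon S\Rightarrow\mathfrak A\mathbb KS,\qquad N\varepsilon\circ\eta N=N(\alpha\iota_{00})\colon N\Rightarrow N\mathfrak A\mathbb K.$$ -/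

import Mathlib

open CategoryTheory Filter Topology
open scoped CStarAlgebra NNReal ZeroAtInfty BoundedContinuousFunction TensorProduct

universe u

/-! ### C⋆-completions -/

/-- A complex ⋆-algebra with a C⋆-seminorm. -/
class PreCStarAlgebra (T : Type*) extends NonUnitalSeminormedRing T, StarRing T, NormedSpace ℂ T,
    IsScalarTower ℂ T T, SMulCommClass ℂ T T, StarModule ℂ T where
  norm_star_mul_self' : ∀ x : T, ‖star x * x‖ = ‖x‖ * ‖x‖

/-- The separated completion of a ⋆-algebra with respect to a C⋆-seminorm. -/
def CStarCompletion (T : Type*) [PreCStarAlgebra T] : Type _ := UniformSpace.Completion T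

noncomputable section

namespace CStarCompletion

open UniformSpace UniformSpace.Completion

variable {T : Type*} [PreCStarAlgebra T]

instance : NormedAddCommGroup (CStarCompletion T) :=
  inferInstanceAs (NormedAddCommGroup (Completion T))
instance : NormedSpace ℂ (CStarCompletion T) := inferInstanceAs (NormedSpace ℂ (Completion T))
instance : CompleteSpace (CStarCompletion T) := inferInstanceAs (CompleteSpace (Completion T))

/-- The canonical map into the completion. -/
def mk (x : T) : CStarCompletion T := (x : Completion T)

theorem isDenseInducing_mk : IsDenseInducing (mk : T → CStarCompletion T) :=
  Completion.isDenseInducing_coe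
theorem denseRange_mk : DenseRange (mk : T → CStarCompletion T) := isDenseInducing_mk.dense
theorem continuous_mk : Continuous (mk : T → CStarCompletion T) := isDenseInducing_mk.continuous
theorem norm_mk (x : T) : ‖(mk x : CStarCompletion T)‖ = ‖x‖ := Completion.norm_coe x
theorem mk_add (x y : T) : (mk (x + y) : CStarCompletion T) = mk x + mk y := Completion.coe_add x y
theorem mk_zero : (mk 0 : CStarCompletion T) = 0 := Completion.coe_zero
theorem mk_smul (c : ℂ) (x : T) : (mk (c • x) : CStarCompletion T) = c • mk x :=
  Completion.coe_smul c x

theorem norm_star' (x : T) : ‖star x‖ = ‖x‖ := by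
  have key : ∀ y : T, ‖y‖ ≤ ‖star y‖ := fun y => by
    rcases (norm_nonneg y).eq_or_lt with h | h
    · rw [← h]; exact norm_nonneg _
    · refine le_of_mul_le_mul_right ?_ h
      rw [← PreCStarAlgebra.norm_star_mul_self']
      exact norm_mul_le _ _
  exact le_antisymm (by simpa using key (star x)) (key x)

instance : Mul (CStarCompletion T) :=
  ⟨fun a b => (isDenseInducing_mk.prodMap isDenseInducing_mk).extend
    (fun p : T × T => (mk (p.1 * p.2) : CStarCompletion T)) (a, b)⟩

theorem mk_mul (x y : T) : (mk (x * y) : CStarCompletion T) = mk x * mk y :=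
  ((isDenseInducing_mk.prodMap isDenseInducing_mk).extend_eq
    (continuous_mk.comp continuous_mul) (x, y)).symm

instance : ContinuousMul (CStarCompletion T) where
  continuous_mul := by
    let m : T →+ T →+ Completion T := (AddMonoidHom.mul : T →+ T →+ T).compr₂ toCompl
    have hm : Continuous fun p : T × T => m p.1 p.2 := (Completion.continuous_coe T).comp continuous_mul
    have di : IsDenseInducing (toCompl : T → Completion T) := isDenseInducing_coe
    exact (di.extend_Z_bilin di hm :)

instance : Star (CStarCompletion T) := ⟨Completion.map star⟩

theorem uniformContinuous_star_pre : UniformContinuous (star : T → T) :=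
  (AddMonoidHomClass.isometry_of_norm (starAddEquiv : T ≃+ T) norm_star').uniformContinuous

theorem mk_star (x : T) : (mk (star x) : CStarCompletion T) = star (mk x) :=
  (Completion.map_coe uniformContinuous_star_pre x).symm

theorem continuous_star_completion : Continuous (star : CStarCompletion T → CStarCompletion T) :=
  Completion.continuous_map

@[elab_as_elim]
theorem ind {p : CStarCompletion T → Prop} (a : CStarCompletion T) (hp : IsClosed {a | p a})
    (h : ∀ x : T, p (mk x)) : p a := Completion.induction_on a hp h

@[elab_as_elim]
theorem ind₂ {p : CStarCompletion T → CStarCompletion T → Prop} (a b : CStarCompletion T)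
    (hp : IsClosed {x : CStarCompletion T × CStarCompletion T | p x.1 x.2})
    (h : ∀ x y : T, p (mk x) (mk y)) : p a b := Completion.induction_on₂ a b hp h

@[elab_as_elim]
theorem ind₃ {p : CStarCompletion T → CStarCompletion T → CStarCompletion T → Prop}
    (a b c : CStarCompletion T)
    (hp : IsClosed {x : CStarCompletion T × CStarCompletion T × CStarCompletion T |
      p x.1 x.2.1 x.2.2})
    (h : ∀ x y z : T, p (mk x) (mk y) (mk z)) : p a b c := Completion.induction_on₃ a b c hp h

instance : NonUnitalNormedRing (CStarCompletion T) where
  __ : NormedAddCommGroup (CStarCompletion T) := inferInstance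
  mul := (· * ·)
  left_distrib a b c := ind₃ a b c (isClosed_eq (by fun_prop) (by fun_prop)) fun a b c => by
    rw [← mk_add, ← mk_mul, ← mk_mul, ← mk_mul, ← mk_add, mul_add]
  right_distrib a b c := ind₃ a b c (isClosed_eq (by fun_prop) (by fun_prop)) fun a b c => by
    rw [← mk_add, ← mk_mul, ← mk_mul, ← mk_mul, ← mk_add, add_mul]
  zero_mul a := ind a (isClosed_eq (by fun_prop) (by fun_prop)) fun a => by
    rw [← mk_zero, ← mk_mul, zero_mul]
  mul_zero a := ind a (isClosed_eq (by fun_prop) (by fun_prop)) fun a => by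
    rw [← mk_zero, ← mk_mul, mul_zero]
  mul_assoc a b c := ind₃ a b c (isClosed_eq (by fun_prop) (by fun_prop)) fun a b c => by
    rw [← mk_mul, ← mk_mul, ← mk_mul, ← mk_mul, mul_assoc]
  norm_mul_le a b := ind₂ a b (isClosed_le (by fun_prop) (by fun_prop)) fun a b => by
    rw [← mk_mul, norm_mk, norm_mk, norm_mk]; exact norm_mul_le a b

instance : StarRing (CStarCompletion T) where
  star_involutive a := ind a
    (isClosed_eq (continuous_star_completion.comp continuous_star_completion) continuous_id)
    fun a => by rw [← mk_star, ← mk_star, star_star]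
  star_mul a b := ind₂ a b
    (isClosed_eq (continuous_star_completion.comp (by fun_prop))
      ((continuous_star_completion.comp continuous_snd).mul
        (continuous_star_completion.comp continuous_fst)))
    fun a b => by rw [← mk_mul, ← mk_star, ← mk_star, ← mk_star, ← mk_mul, star_mul]
  star_add a b := ind₂ a b
    (isClosed_eq (continuous_star_completion.comp (by fun_prop))
      ((continuous_star_completion.comp continuous_fst).add
        (continuous_star_completion.comp continuous_snd)))
    fun a b => by rw [← mk_add, ← mk_star, ← mk_star, ← mk_star, ← mk_add, star_add]

theorem smul_mul' (c : ℂ) (a b : CStarCompletion T) : (c • a) * b = c • (a * b) := by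
  refine ind₂ a b (isClosed_eq ?_ ?_) fun a b => ?_
  · exact (continuous_fst.const_smul c).mul continuous_snd
  · exact (continuous_fst.mul continuous_snd).const_smul c
  · rw [← mk_smul, ← mk_mul, ← mk_mul, ← mk_smul, smul_mul_assoc]

theorem mul_smul' (c : ℂ) (a b : CStarCompletion T) : a * (c • b) = c • (a * b) := by
  refine ind₂ a b (isClosed_eq ?_ ?_) fun a b => ?_
  · exact continuous_fst.mul (continuous_snd.const_smul c)
  · exact (continuous_fst.mul continuous_snd).const_smul c
  · rw [← mk_smul, ← mk_mul, ← mk_mul, ← mk_smul, mul_smul_comm]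

theorem star_smul' (c : ℂ) (a : CStarCompletion T) : star (c • a) = star c • star a := by
  refine ind a (isClosed_eq ?_ ?_) fun a => ?_
  · exact continuous_star_completion.comp (continuous_id.const_smul c)
  · exact continuous_star_completion.const_smul (star c)
  · rw [← mk_smul, ← mk_star, ← mk_star, ← mk_smul, star_smul]

theorem norm_star_mul_self_completion (a : CStarCompletion T) : ‖a‖ * ‖a‖ ≤ ‖star a * a‖ := by
  refine ind a (isClosed_le ?_ ?_) fun a => ?_
  · exact continuous_norm.mul continuous_norm
  · exact continuous_norm.comp (continuous_star_completion.mul continuous_id)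
  · rw [← mk_star, ← mk_mul, norm_mk, norm_mk, PreCStarAlgebra.norm_star_mul_self']

instance : NonUnitalCStarAlgebra (CStarCompletion T) where
  norm_mul_self_le := norm_star_mul_self_completion
  smul_assoc := smul_mul'
  smul_comm c a b := (mul_smul' c a b).symm
  star_smul := star_smul'

/-- The canonical map into the completion as a ⋆-homomorphism. -/
def mkHom : T →⋆ₙₐ[ℂ] CStarCompletion T where
  toFun := mk
  map_smul' := mk_smul
  map_zero' := mk_zero
  map_add' := mk_add
  map_mul' := mk_mul
  map_star' := mk_star

/-- The extension of a bounded linear map to the completion. -/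
def liftCLM {C : Type*} [NormedAddCommGroup C] [NormedSpace ℂ C] [CompleteSpace C] (f : T →ₗ[ℂ] C)
    (K : ℝ) (hf : ∀ x, ‖f x‖ ≤ K * ‖x‖) : CStarCompletion T →L[ℂ] C :=
  ContinuousLinearMap.extend (f.mkContinuous K hf)
    (UniformSpace.Completion.toComplL : T →L[ℂ] Completion T)

theorem liftCLM_mk {C : Type*} [NormedAddCommGroup C] [NormedSpace ℂ C] [CompleteSpace C]
    (f : T →ₗ[ℂ] C) (K : ℝ) (hf : ∀ x, ‖f x‖ ≤ K * ‖x‖) (x : T) : liftCLM f K hf (mk x) = f x :=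
  ContinuousLinearMap.extend_eq _ Completion.denseRange_coe
    (Completion.isUniformInducing_coe T) x

/-- The extension of a contractive ⋆-homomorphism to the completion. -/
def lift {C : Type*} [NonUnitalCStarAlgebra C] (f : T →⋆ₙₐ[ℂ] C) (hf : ∀ x, ‖f x‖ ≤ ‖x‖) :
    CStarCompletion T →⋆ₙₐ[ℂ] C :=
  let g := liftCLM (f : T →ₗ[ℂ] C) 1 (by simpa using hf)
  have hg : ∀ x, g (mk x) = f x := liftCLM_mk (f : T →ₗ[ℂ] C) 1 (by simpa using hf)
  { toFun := g
    map_smul' := map_smul g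
    map_zero' := map_zero g
    map_add' := map_add g
    map_mul' := fun a b => ind₂ a b (isClosed_eq (by fun_prop) (by fun_prop)) fun a b => by
      rw [← mk_mul, hg, hg, hg, map_mul]
    map_star' := fun a => ind a
      (isClosed_eq (g.continuous.comp continuous_star_completion) (by fun_prop)) fun a => by
      rw [← mk_star, hg, hg, map_star] }

theorem lift_mk {C : Type*} [NonUnitalCStarAlgebra C] (f : T →⋆ₙₐ[ℂ] C) (hf : ∀ x, ‖f x‖ ≤ ‖x‖)
    (x : T) : lift f hf (mk x) = f x := liftCLM_mk (f : T →ₗ[ℂ] C) 1 _ x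

theorem hom_ext {C : Type*} [NonUnitalCStarAlgebra C] {f g : CStarCompletion T →⋆ₙₐ[ℂ] C}
    (h : ∀ x : T, f (mk x) = g (mk x)) : f = g :=
  NonUnitalStarAlgHom.ext fun a => ind a (isClosed_eq
    (map_continuous f) (map_continuous g)) h

end CStarCompletion
end

/-! ### Quotients by closed ideals -/

/-- A closed two-sided (self-adjoint) ideal of a C⋆-algebra. -/
structure CStarIdeal (A : Type*) [NonUnitalCStarAlgebra A] extends Submodule ℂ A where
  isClosed' : IsClosed (carrier : Set A)
  mul_left' : ∀ a : A, ∀ x ∈ carrier, a * x ∈ carrier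
  mul_right' : ∀ a : A, ∀ x ∈ carrier, x * a ∈ carrier
  star' : ∀ x ∈ carrier, star x ∈ carrier

noncomputable section

namespace CStarIdeal

variable {A : Type*} [NonUnitalCStarAlgebra A] (J : CStarIdeal A)

/-- A closed ideal, as a ⋆-subalgebra. -/
def toSubalgebra : NonUnitalStarSubalgebra ℂ A where
  carrier := J.carrier
  add_mem' := J.add_mem'
  zero_mem' := J.zero_mem'
  smul_mem' := J.smul_mem'
  mul_mem' {a b} _ hb := J.mul_left' a b hb
  star_mem' {a} ha := J.star' a ha

/-- The quotient C⋆-algebra `A / J`, with the quotient norm. -/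
def Quot : Type _ := A ⧸ J.toSubmodule

instance : IsClosed (J.toSubmodule : Set A) := J.isClosed'

instance : NormedAddCommGroup J.Quot := inferInstanceAs (NormedAddCommGroup (A ⧸ J.toSubmodule))
instance : NormedSpace ℂ J.Quot := inferInstanceAs (NormedSpace ℂ (A ⧸ J.toSubmodule))
instance : CompleteSpace J.Quot := inferInstanceAs (CompleteSpace (A ⧸ J.toSubmodule))

/-- The quotient projection. -/
def proj (a : A) : J.Quot := Submodule.Quotient.mk a

variable {J}

theorem proj_surjective : Function.Surjective J.proj := Submodule.Quotient.mk_surjective _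
theorem proj_add (a b : A) : J.proj (a + b) = J.proj a + J.proj b := rfl
theorem proj_zero : J.proj 0 = 0 := rfl
theorem proj_smul (c : ℂ) (a : A) : J.proj (c • a) = c • J.proj a := rfl
theorem proj_eq_iff {a b : A} : J.proj a = J.proj b ↔ a - b ∈ J.toSubmodule := Submodule.Quotient.eq _
theorem norm_proj_le (a : A) : ‖J.proj a‖ ≤ ‖a‖ := Submodule.Quotient.norm_mk_le _ a

theorem exists_norm_lt (x : J.Quot) {ε : ℝ} (hε : 0 < ε) : ∃ a, J.proj a = x ∧ ‖a‖ < ‖x‖ + ε :=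
  Submodule.Quotient.norm_mk_lt (S := J.toSubmodule) x hε

instance : Mul J.Quot := ⟨Quotient.map₂ (· * ·) (by
  intro a a' h b b' h'
  have h1 : a - a' ∈ J.toSubmodule := (Submodule.quotientRel_def _).1 h
  have h2 : b - b' ∈ J.toSubmodule := (Submodule.quotientRel_def _).1 h'
  refine (Submodule.quotientRel_def _).2 ?_
  have : a * b - a' * b' = a * (b - b') + (a - a') * b' := by noncomm_ring
  rw [this]
  exact J.toSubmodule.add_mem (J.mul_left' _ _ h2) (J.mul_right' _ _ h1))⟩

theorem proj_mul (a b : A) : J.proj (a * b) = J.proj a * J.proj b := rfl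

instance : Star J.Quot := ⟨Quotient.map star (by
  intro a a' h
  have h1 : a - a' ∈ J.toSubmodule := (Submodule.quotientRel_def _).1 h
  refine (Submodule.quotientRel_def _).2 ?_
  rw [← star_sub]
  exact J.star' _ h1)⟩

theorem proj_star (a : A) : J.proj (star a) = star (J.proj a) := rfl

instance : NonUnitalNormedRing J.Quot where
  __ : NormedAddCommGroup J.Quot := inferInstance
  mul := (· * ·)
  left_distrib x y z := by
    obtain ⟨a, rfl⟩ := proj_surjective x; obtain ⟨b, rfl⟩ := proj_surjective y
    obtain ⟨c, rfl⟩ := proj_surjective z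
    rw [← proj_add, ← proj_mul, ← proj_mul, ← proj_mul, ← proj_add, mul_add]
  right_distrib x y z := by
    obtain ⟨a, rfl⟩ := proj_surjective x; obtain ⟨b, rfl⟩ := proj_surjective y
    obtain ⟨c, rfl⟩ := proj_surjective z
    rw [← proj_add, ← proj_mul, ← proj_mul, ← proj_mul, ← proj_add, add_mul]
  zero_mul x := by obtain ⟨a, rfl⟩ := proj_surjective x; rw [← proj_zero, ← proj_mul, zero_mul]
  mul_zero x := by obtain ⟨a, rfl⟩ := proj_surjective x; rw [← proj_zero, ← proj_mul, mul_zero]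
  mul_assoc x y z := by
    obtain ⟨a, rfl⟩ := proj_surjective x; obtain ⟨b, rfl⟩ := proj_surjective y
    obtain ⟨c, rfl⟩ := proj_surjective z
    rw [← proj_mul, ← proj_mul, ← proj_mul, ← proj_mul, mul_assoc]
  norm_mul_le x y := by
    refine le_of_forall_pos_le_add fun δ hδ => ?_
    have hc : Tendsto (fun ε : ℝ => (‖x‖ + ε) * (‖y‖ + ε)) (𝓝[>] 0) (𝓝 (‖x‖ * ‖y‖)) := by
      have : Continuous fun ε : ℝ => (‖x‖ + ε) * (‖y‖ + ε) := by fun_prop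
      simpa using (this.tendsto 0).mono_left nhdsWithin_le_nhds
    obtain ⟨ε, h1, h2⟩ := ((hc.eventually (gt_mem_nhds (lt_add_of_pos_right _ hδ))).and
      self_mem_nhdsWithin).exists
    obtain ⟨a, rfl, ha⟩ := exists_norm_lt x h2
    obtain ⟨b, rfl, hb⟩ := exists_norm_lt y h2
    rw [← proj_mul]
    calc ‖J.proj (a * b)‖ ≤ ‖a‖ * ‖b‖ := (norm_proj_le _).trans (norm_mul_le _ _)
      _ ≤ (‖J.proj a‖ + ε) * (‖J.proj b‖ + ε) := by gcongr
      _ ≤ _ := h1.le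

instance : StarRing J.Quot where
  star_involutive x := by
    obtain ⟨a, rfl⟩ := proj_surjective x; rw [← proj_star, ← proj_star, star_star]
  star_mul x y := by
    obtain ⟨a, rfl⟩ := proj_surjective x; obtain ⟨b, rfl⟩ := proj_surjective y
    rw [← proj_mul, ← proj_star, ← proj_star, ← proj_star, ← proj_mul, star_mul]
  star_add x y := by
    obtain ⟨a, rfl⟩ := proj_surjective x; obtain ⟨b, rfl⟩ := proj_surjective y
    rw [← proj_add, ← proj_star, ← proj_star, ← proj_star, ← proj_add, star_add]

theorem norm_conj_one_sub_le {a e : A} (he : ‖e‖ ≤ 1) (s : A) (hs : e = star s * s) :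
    ‖a - e * a - (a - e * a) * e‖ ≤ ‖a‖ ∧ ‖a - e * a - (a - e * a) * e‖ ≤ ‖a - a * e‖ := by
  let _ := CStarAlgebra.spectralOrder (Unitization ℂ A)
  let _ := CStarAlgebra.spectralOrderedRing (Unitization ℂ A)
  have h0 : (0 : Unitization ℂ A) ≤ (e : Unitization ℂ A) := by
    rw [hs, Unitization.inr_mul, Unitization.inr_star]; exact star_mul_self_nonneg _
  have h1 : (e : Unitization ℂ A) ≤ 1 := by
    rw [← CStarAlgebra.norm_le_one_iff_of_nonneg _ h0, Unitization.norm_inr]; exact he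
  have h2 : ‖(1 : Unitization ℂ A) - e‖ ≤ 1 :=
    (CStarAlgebra.norm_le_one_iff_of_nonneg _ (sub_nonneg.2 h1)).2 (sub_le_self _ h0)
  have e1 : ((a - e * a - (a - e * a) * e : A) : Unitization ℂ A) =
      (1 - (e : Unitization ℂ A)) * ((a : Unitization ℂ A) * (1 - (e : Unitization ℂ A))) := by
    simp only [Unitization.inr_sub, Unitization.inr_mul]; noncomm_ring
  have e2 : ((a - a * e : A) : Unitization ℂ A) =
      (a : Unitization ℂ A) * (1 - (e : Unitization ℂ A)) := by
    simp only [Unitization.inr_sub, Unitization.inr_mul]; noncomm_ring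
  have h3 : ‖a - e * a - (a - e * a) * e‖ ≤ ‖a - a * e‖ := by
    rw [← Unitization.norm_inr (𝕜 := ℂ), ← Unitization.norm_inr (𝕜 := ℂ) (a - a * e), e1, ← e2]
    exact (norm_mul_le _ _).trans (mul_le_of_le_one_left (norm_nonneg _) h2)
  refine ⟨h3.trans ?_, h3⟩
  rw [← Unitization.norm_inr (𝕜 := ℂ), e2, ← Unitization.norm_inr (𝕜 := ℂ) a]
  exact (norm_mul_le _ _).trans (mul_le_of_le_one_right (norm_nonneg _) h2)

theorem exists_approx (j : A) (hj : j ∈ J.toSubmodule) {ε : ℝ} (hε : 0 < ε) :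
    ∃ e ∈ J.toSubmodule, ‖e‖ ≤ 1 ∧ (∃ s, e = star s * s) ∧ ‖j - j * e‖ < ε := by
  have hcl : IsClosed (J.toSubalgebra : Set A) := J.isClosed'
  let _ := CStarAlgebra.spectralOrder J.toSubalgebra
  let _ := CStarAlgebra.spectralOrderedRing J.toSubalgebra
  have hu := CStarAlgebra.increasingApproximateUnit J.toSubalgebra
  have := hu.neBot
  have ht := hu.tendsto_mul_left ⟨j, hj⟩
  have h1 := (Metric.tendsto_nhds.1 ht ε hε).and (hu.eventually_norm.and hu.eventually_nonneg)
  obtain ⟨e, h2, h3, h4⟩ := h1.exists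
  refine ⟨e, e.2, h3, ?_, ?_⟩
  · obtain ⟨s, hs⟩ := CStarAlgebra.nonneg_iff_eq_star_mul_self.1 h4
    exact ⟨s, congrArg Subtype.val hs⟩
  · rw [dist_comm, dist_eq_norm] at h2
    exact h2

theorem norm_mul_self_le_quot (x : J.Quot) : ‖x‖ * ‖x‖ ≤ ‖star x * x‖ := by
  refine le_of_forall_pos_le_add fun ε hε => ?_
  obtain ⟨a, rfl⟩ := proj_surjective x
  obtain ⟨y, hy, hy'⟩ := exists_norm_lt (star (J.proj a) * J.proj a) (half_pos hε)
  rw [← proj_star, ← proj_mul, eq_comm, proj_eq_iff] at hy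
  obtain ⟨e, he, he1, ⟨s, hs⟩, hje⟩ := exists_approx _ hy (half_pos hε)
  have hmk : J.proj a = J.proj (a - a * e) := by
    rw [proj_eq_iff, sub_sub_cancel]; exact J.mul_left' _ _ he
  have hse : star e = e := by rw [hs]; simp
  set j := star a * a - y with hj
  have key : star (a - a * e) * (a - a * e) =
      (y - e * y - (y - e * y) * e) + (j - e * j - (j - e * j) * e) := by
    rw [hj, star_sub, star_mul, hse]; noncomm_ring
  calc ‖J.proj a‖ * ‖J.proj a‖ ≤ ‖a - a * e‖ * ‖a - a * e‖ := by
        rw [hmk]; gcongr <;> exact norm_proj_le _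
    _ = ‖star (a - a * e) * (a - a * e)‖ := CStarRing.norm_star_mul_self.symm
    _ ≤ ‖y‖ + ‖j - j * e‖ := by
        rw [key]
        exact (norm_add_le _ _).trans (add_le_add (norm_conj_one_sub_le he1 s hs).1
          (norm_conj_one_sub_le he1 s hs).2)
    _ ≤ _ := by linarith

instance : NonUnitalCStarAlgebra J.Quot where
  norm_mul_self_le := norm_mul_self_le_quot
  smul_assoc c x y := by
    obtain ⟨a, rfl⟩ := proj_surjective x; obtain ⟨b, rfl⟩ := proj_surjective y
    change J.proj ((c • a) * b) = J.proj (c • (a * b)); rw [smul_mul_assoc]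
  smul_comm c x y := by
    obtain ⟨a, rfl⟩ := proj_surjective x; obtain ⟨b, rfl⟩ := proj_surjective y
    change J.proj (c • (a * b)) = J.proj (a * (c • b)); rw [mul_smul_comm]
  star_smul c x := by
    obtain ⟨a, rfl⟩ := proj_surjective x
    change J.proj (star (c • a)) = J.proj (star c • star a); rw [star_smul]

/-- The quotient projection as a ⋆-homomorphism. -/
def projHom (J : CStarIdeal A) : A →⋆ₙₐ[ℂ] J.Quot where
  toFun := J.proj
  map_smul' := proj_smul
  map_zero' := proj_zero
  map_add' := proj_add
  map_mul' := proj_mul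
  map_star' := proj_star

/-- The map of quotients induced by a ⋆-homomorphism. -/
def mapHom {B : Type*} [NonUnitalCStarAlgebra B] (J : CStarIdeal A) (K : CStarIdeal B)
    (φ : A →⋆ₙₐ[ℂ] B) (h : ∀ a ∈ J.toSubmodule, φ a ∈ K.toSubmodule) :
    J.Quot →⋆ₙₐ[ℂ] K.Quot :=
  let f : J.Quot → K.Quot := Quotient.map φ (by
    intro a a' haa
    have h1 : a - a' ∈ J.toSubmodule := (Submodule.quotientRel_def _).1 haa
    refine (Submodule.quotientRel_def _).2 ?_
    rw [← map_sub]
    exact h _ h1)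
  have hf : ∀ a, f (J.proj a) = K.proj (φ a) := fun _ => rfl
  { toFun := f
    map_smul' := fun c x => by
      obtain ⟨a, rfl⟩ := proj_surjective x
      change f (c • J.proj a) = c • f (J.proj a)
      rw [← proj_smul, hf, hf, map_smul, proj_smul]
    map_zero' := by
      change f 0 = 0
      rw [← proj_zero, hf, map_zero, proj_zero]
    map_add' := fun x y => by
      obtain ⟨a, rfl⟩ := proj_surjective x; obtain ⟨b, rfl⟩ := proj_surjective y
      change f (J.proj a + J.proj b) = f (J.proj a) + f (J.proj b)
      rw [← proj_add, hf, hf, hf, map_add, proj_add]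
    map_mul' := fun x y => by
      obtain ⟨a, rfl⟩ := proj_surjective x; obtain ⟨b, rfl⟩ := proj_surjective y
      change f (J.proj a * J.proj b) = f (J.proj a) * f (J.proj b)
      rw [← proj_mul, hf, hf, hf, map_mul, proj_mul]
    map_star' := fun x => by
      obtain ⟨a, rfl⟩ := proj_surjective x
      change f (star (J.proj a)) = star (f (J.proj a))
      rw [← proj_star, hf, hf, map_star, proj_star] }

theorem mapHom_proj {B : Type*} [NonUnitalCStarAlgebra B] (J : CStarIdeal A) (K : CStarIdeal B)
    (φ : A →⋆ₙₐ[ℂ] B) (h : ∀ a ∈ J.toSubmodule, φ a ∈ K.toSubmodule) (a : A) :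
    mapHom J K φ h (J.proj a) = K.proj (φ a) := rfl

end CStarIdeal
end

/-! ### The maximal tensor product -/

noncomputable section

section MaxTensor

universe v

variable {A B C D : Type*} [NonUnitalCStarAlgebra A] [NonUnitalCStarAlgebra B]
  [NonUnitalCStarAlgebra C] [NonUnitalCStarAlgebra D]

/-- C⋆-seminorms on the algebraic tensor product of two C⋆-algebras. The last condition holds
automatically for every seminorm with the first two properties. -/
structure IsCStarSeminorm (p : Seminorm ℂ (A ⊗[ℂ] B)) : Prop where
  mul_le : ∀ s t, p (s * t) ≤ p s * p t
  star_mul_self : ∀ t, p (star t * t) = p t * p t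
  tmul_le : ∀ a b, p (a ⊗ₜ b) ≤ ‖a‖ * ‖b‖

/-- The maximal C⋆-seminorm on the algebraic tensor product. -/
def maxTensorNorm (t : A ⊗[ℂ] B) : ℝ := ⨆ p : {p : Seminorm ℂ (A ⊗[ℂ] B) // IsCStarSeminorm p}, p.1 t

instance : Nonempty {p : Seminorm ℂ (A ⊗[ℂ] B) // IsCStarSeminorm p} :=
  ⟨⟨0, by simp, by simp, by intros; simp; positivity⟩⟩

theorem maxTensorNorm_bdd (t : A ⊗[ℂ] B) : BddAbove (Set.range
    fun p : {p : Seminorm ℂ (A ⊗[ℂ] B) // IsCStarSeminorm p} => p.1 t) := by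
  suffices h : ∃ c, ∀ p : {p : Seminorm ℂ (A ⊗[ℂ] B) // IsCStarSeminorm p}, p.1 t ≤ c by
    obtain ⟨c, hc⟩ := h
    exact ⟨c, by rintro _ ⟨p, rfl⟩; exact hc p⟩
  induction t using TensorProduct.induction_on with
  | zero => exact ⟨0, fun p => by simp⟩
  | tmul a b => exact ⟨_, fun p => p.2.tmul_le a b⟩
  | add s t hs ht =>
    obtain ⟨c, hc⟩ := hs
    obtain ⟨d, hd⟩ := ht
    exact ⟨c + d, fun p => (map_add_le_add p.1 s t).trans (add_le_add (hc p) (hd p))⟩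

theorem le_maxTensorNorm {p : Seminorm ℂ (A ⊗[ℂ] B)} (hp : IsCStarSeminorm p) (t : A ⊗[ℂ] B) :
    p t ≤ maxTensorNorm t := le_ciSup (maxTensorNorm_bdd t) ⟨p, hp⟩

theorem maxTensorNorm_le {t : A ⊗[ℂ] B} {c : ℝ}
    (h : ∀ p : Seminorm ℂ (A ⊗[ℂ] B), IsCStarSeminorm p → p t ≤ c) : maxTensorNorm t ≤ c :=
  ciSup_le fun p => h p.1 p.2

theorem maxTensorNorm_nonneg (t : A ⊗[ℂ] B) : 0 ≤ maxTensorNorm t :=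
  Real.iSup_nonneg fun p => apply_nonneg p.1 t

variable (A B) in
/-- The maximal C⋆-seminorm, as a seminorm. -/
def maxSeminorm : Seminorm ℂ (A ⊗[ℂ] B) :=
  Seminorm.of maxTensorNorm
    (fun s t => maxTensorNorm_le fun p hp => (map_add_le_add p s t).trans
      (add_le_add (le_maxTensorNorm hp s) (le_maxTensorNorm hp t)))
    (fun c t => by
      simp only [maxTensorNorm, map_smul_eq_mul]
      exact (Real.mul_iSup_of_nonneg (norm_nonneg c) _).symm)

variable (A B) in
/-- The algebraic tensor product, endowed with the maximal C⋆-seminorm. -/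
def AlgTensor : Type _ := A ⊗[ℂ] B

namespace AlgTensor

instance : NonUnitalRing (AlgTensor A B) := inferInstanceAs (NonUnitalRing (A ⊗[ℂ] B))
instance : StarRing (AlgTensor A B) := inferInstanceAs (StarRing (A ⊗[ℂ] B))
instance : Module ℂ (AlgTensor A B) := inferInstanceAs (Module ℂ (A ⊗[ℂ] B))
instance : StarModule ℂ (AlgTensor A B) := inferInstanceAs (StarModule ℂ (A ⊗[ℂ] B))
instance : IsScalarTower ℂ (AlgTensor A B) (AlgTensor A B) :=
  inferInstanceAs (IsScalarTower ℂ (A ⊗[ℂ] B) (A ⊗[ℂ] B))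
instance : SMulCommClass ℂ (AlgTensor A B) (AlgTensor A B) :=
  inferInstanceAs (SMulCommClass ℂ (A ⊗[ℂ] B) (A ⊗[ℂ] B))

instance : SeminormedAddCommGroup (AlgTensor A B) :=
  (maxSeminorm A B).toAddGroupSeminorm.toSeminormedAddCommGroup

theorem norm_def (t : AlgTensor A B) : ‖t‖ = maxTensorNorm (A := A) (B := B) t := rfl

instance : NonUnitalSeminormedRing (AlgTensor A B) where
  __ : NonUnitalRing (AlgTensor A B) := inferInstance
  __ : SeminormedAddCommGroup (AlgTensor A B) := inferInstance
  norm_mul_le s t := by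
    simp only [norm_def]
    exact maxTensorNorm_le fun p hp => (hp.mul_le s t).trans (mul_le_mul (le_maxTensorNorm hp s)
      (le_maxTensorNorm hp t) (apply_nonneg p _) (maxTensorNorm_nonneg _))

instance : NormedSpace ℂ (AlgTensor A B) where
  __ : Module ℂ (AlgTensor A B) := inferInstance
  norm_smul_le c t := (map_smul_eq_mul (maxSeminorm A B) c t).le

theorem norm_star_mul_self (t : AlgTensor A B) : ‖star t * t‖ = ‖t‖ * ‖t‖ := by
  refine le_antisymm (maxTensorNorm_le fun p hp => ?_) ?_
  · exact (hp.star_mul_self t).le.trans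
      (mul_self_le_mul_self (apply_nonneg _ _) (le_maxTensorNorm hp t))
  · have h : ‖t‖ ≤ √‖star t * t‖ := maxTensorNorm_le fun p hp => Real.le_sqrt_of_sq_le <| by
      rw [sq]
      exact (hp.star_mul_self t).ge.trans (le_maxTensorNorm hp _)
    calc ‖t‖ * ‖t‖ ≤ √‖star t * t‖ * √‖star t * t‖ := mul_self_le_mul_self (norm_nonneg _) h
      _ = _ := Real.mul_self_sqrt (norm_nonneg _)

instance : PreCStarAlgebra (AlgTensor A B) where
  __ : NormedSpace ℂ (AlgTensor A B) := inferInstance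
  norm_star_mul_self' := norm_star_mul_self
  smul_assoc := smul_assoc
  smul_comm := smul_comm
  star_smul := star_smul

variable (A B) in
/-- The identity map from the algebraic tensor product. -/
def of : A ⊗[ℂ] B →⋆ₙₐ[ℂ] AlgTensor A B where
  toFun t := t
  map_smul' _ _ := rfl
  map_zero' := rfl
  map_add' _ _ := rfl
  map_mul' _ _ := rfl
  map_star' _ := rfl

variable (A B) in
/-- The identity map to the algebraic tensor product. -/
def unof : AlgTensor A B →⋆ₙₐ[ℂ] A ⊗[ℂ] B where
  toFun t := t
  map_smul' _ _ := rfl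
  map_zero' := rfl
  map_add' _ _ := rfl
  map_mul' _ _ := rfl
  map_star' _ := rfl

theorem of_unof (t : AlgTensor A B) : of A B (unof A B t) = t := rfl
theorem unof_of (t : A ⊗[ℂ] B) : unof A B (of A B t) = t := rfl
theorem norm_of (t : A ⊗[ℂ] B) : ‖of A B t‖ = maxTensorNorm t := rfl

end AlgTensor

variable (A B) in
/-- The maximal tensor product of two C⋆-algebras. -/
abbrev MaxTensor : Type _ := CStarCompletion (AlgTensor A B)

namespace MaxTensor

/-- Elementary tensors, as a bilinear map. -/
def tmulₗ : A →ₗ[ℂ] B →ₗ[ℂ] MaxTensor A B :=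
  (TensorProduct.mk ℂ A B).compr₂
    ((CStarCompletion.mkHom.comp (AlgTensor.of A B) : A ⊗[ℂ] B →⋆ₙₐ[ℂ] MaxTensor A B) :
      A ⊗[ℂ] B →ₗ[ℂ] MaxTensor A B)

/-- The elementary tensor `a ⊗ b`. -/
def tmul (a : A) (b : B) : MaxTensor A B := tmulₗ a b

theorem tmul_eq (a : A) (b : B) :
    tmul a b = CStarCompletion.mk (AlgTensor.of A B (a ⊗ₜ[ℂ] b)) := rfl

theorem norm_tmul_le (a : A) (b : B) : ‖tmul a b‖ ≤ ‖a‖ * ‖b‖ := by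
  rw [tmul_eq, CStarCompletion.norm_mk]
  exact maxTensorNorm_le fun p hp => hp.tmul_le a b

theorem tmul_mul_tmul (a a' : A) (b b' : B) :
    tmul a b * tmul a' b' = tmul (a * a') (b * b') := by
  rw [tmul_eq, tmul_eq, tmul_eq, ← CStarCompletion.mk_mul, ← map_mul,
    Algebra.TensorProduct.tmul_mul_tmul]

theorem star_tmul (a : A) (b : B) : star (tmul a b) = tmul (star a) (star b) := by
  rw [tmul_eq, tmul_eq, ← CStarCompletion.mk_star, ← map_star, TensorProduct.star_tmul]

/-- Tensoring with a fixed element of the first algebra. -/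
def tmulL (a : A) : B →L[ℂ] MaxTensor A B :=
  (tmulₗ a).mkContinuous ‖a‖ fun b => norm_tmul_le a b

theorem ext_hom {f g : MaxTensor A B →⋆ₙₐ[ℂ] C} (h : ∀ a b, f (tmul a b) = g (tmul a b)) :
    f = g := by
  refine CStarCompletion.hom_ext fun t => ?_
  rw [← AlgTensor.of_unof t]
  induction AlgTensor.unof A B t using TensorProduct.induction_on with
  | zero => rw [map_zero, CStarCompletion.mk_zero, map_zero, map_zero]
  | tmul a b => exact h a b
  | add s t hs ht => rw [map_add, CStarCompletion.mk_add, map_add, map_add, hs, ht]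

/-- The ⋆-homomorphism on the algebraic tensor product given by a multiplicative, ⋆-preserving
bilinear map. -/
def algLift (β : A →ₗ[ℂ] B →ₗ[ℂ] C) (hmul : ∀ a b a' b', β a b * β a' b' = β (a * a') (b * b'))
    (hstar : ∀ a b, star (β a b) = β (star a) (star b)) : A ⊗[ℂ] B →⋆ₙₐ[ℂ] C where
  toFun := TensorProduct.lift β
  map_smul' := map_smul _
  map_zero' := map_zero _
  map_add' := map_add _
  map_mul' s t := by
    induction s using TensorProduct.induction_on with
    | zero => simp
    | add s s' hs hs' => rw [add_mul, map_add, hs, hs', map_add, add_mul]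
    | tmul a b =>
      induction t using TensorProduct.induction_on with
      | zero => simp
      | add s s' hs hs' => rw [mul_add, map_add, hs, hs', map_add, mul_add]
      | tmul a' b' => simp [hmul]
  map_star' t := by
    induction t using TensorProduct.induction_on with
    | zero => simp
    | add s s' hs hs' => rw [star_add, map_add, hs, hs', map_add, star_add]
    | tmul a b => simp [hstar]

theorem norm_algLift_le (f : A ⊗[ℂ] B →⋆ₙₐ[ℂ] C) (hf : ∀ a b, ‖f (a ⊗ₜ b)‖ ≤ ‖a‖ * ‖b‖)
    (t : A ⊗[ℂ] B) : ‖f t‖ ≤ maxTensorNorm t :=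
  le_maxTensorNorm (p := (normSeminorm ℂ C).comp (f : A ⊗[ℂ] B →ₗ[ℂ] C))
    { mul_le := fun s t => by
        change ‖f (s * t)‖ ≤ ‖f s‖ * ‖f t‖
        rw [map_mul]; exact norm_mul_le _ _
      star_mul_self := fun t => by
        change ‖f (star t * t)‖ = ‖f t‖ * ‖f t‖
        rw [map_mul, map_star]; exact CStarRing.norm_star_mul_self
      tmul_le := hf } t

/-- The universal property of the maximal tensor product. -/
def lift (β : A →ₗ[ℂ] B →ₗ[ℂ] C) (hmul : ∀ a b a' b', β a b * β a' b' = β (a * a') (b * b'))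
    (hstar : ∀ a b, star (β a b) = β (star a) (star b)) (hnorm : ∀ a b, ‖β a b‖ ≤ ‖a‖ * ‖b‖) :
    MaxTensor A B →⋆ₙₐ[ℂ] C :=
  CStarCompletion.lift ((algLift β hmul hstar).comp (AlgTensor.unof A B)) fun t =>
    norm_algLift_le (algLift β hmul hstar) (by simpa [algLift] using hnorm) (AlgTensor.unof A B t)

theorem lift_tmul (β : A →ₗ[ℂ] B →ₗ[ℂ] C)
    (hmul : ∀ a b a' b', β a b * β a' b' = β (a * a') (b * b'))
    (hstar : ∀ a b, star (β a b) = β (star a) (star b)) (hnorm : ∀ a b, ‖β a b‖ ≤ ‖a‖ * ‖b‖)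
    (a : A) (b : B) : lift β hmul hstar hnorm (tmul a b) = β a b :=
  (CStarCompletion.lift_mk _ _ _).trans (TensorProduct.lift.tmul a b)

/-- The tensor product of two ⋆-homomorphisms. -/
def map (φ : A →⋆ₙₐ[ℂ] C) (ψ : B →⋆ₙₐ[ℂ] D) : MaxTensor A B →⋆ₙₐ[ℂ] MaxTensor C D :=
  lift (tmulₗ.compl₁₂ (φ : A →ₗ[ℂ] C) (ψ : B →ₗ[ℂ] D))
    (fun a b a' b' => by
      change tmul (φ a) (ψ b) * tmul (φ a') (ψ b') = tmul (φ (a * a')) (ψ (b * b'))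
      rw [tmul_mul_tmul, map_mul, map_mul])
    (fun a b => by
      change star (tmul (φ a) (ψ b)) = tmul (φ (star a)) (ψ (star b))
      rw [star_tmul, map_star, map_star])
    (fun a b => (norm_tmul_le (φ a) (ψ b)).trans (mul_le_mul
      (NonUnitalStarAlgHom.norm_apply_le φ a) (NonUnitalStarAlgHom.norm_apply_le ψ b)
      (norm_nonneg _) (norm_nonneg _)))

theorem map_tmul (φ : A →⋆ₙₐ[ℂ] C) (ψ : B →⋆ₙₐ[ℂ] D) (a : A) (b : B) :
    map φ ψ (tmul a b) = tmul (φ a) (ψ b) := lift_tmul _ _ _ _ a b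

theorem map_id : map (NonUnitalStarAlgHom.id ℂ A) (NonUnitalStarAlgHom.id ℂ B) =
    NonUnitalStarAlgHom.id ℂ (MaxTensor A B) :=
  ext_hom fun a b => by
    rw [map_tmul]; rfl

theorem map_comp {E F : Type*} [NonUnitalCStarAlgebra E] [NonUnitalCStarAlgebra F]
    (φ : A →⋆ₙₐ[ℂ] C) (ψ : B →⋆ₙₐ[ℂ] D) (φ' : C →⋆ₙₐ[ℂ] E) (ψ' : D →⋆ₙₐ[ℂ] F) :
    (map φ' ψ').comp (map φ ψ) = map (φ'.comp φ) (ψ'.comp ψ) :=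
  ext_hom fun a b => by
    rw [map_tmul, NonUnitalStarAlgHom.comp_apply, map_tmul, map_tmul,
      NonUnitalStarAlgHom.comp_apply, NonUnitalStarAlgHom.comp_apply]

variable (B) in
/-- The map `B → ℂ ⊗ B`, `b ↦ 1 ⊗ b`, for a copy of `ℂ` in another universe. -/
def unitMap : B →⋆ₙₐ[ℂ] MaxTensor (PUnit.{v + 1} → ℂ) B where
  toFun b := tmul (1 : PUnit.{v + 1} → ℂ) b
  map_smul' c b := map_smul (tmulₗ (1 : PUnit.{v + 1} → ℂ)) c b
  map_zero' := map_zero (tmulₗ (1 : PUnit.{v + 1} → ℂ))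
  map_add' b c := map_add (tmulₗ (1 : PUnit.{v + 1} → ℂ)) b c
  map_mul' b c := by rw [tmul_mul_tmul, one_mul]
  map_star' b := by rw [star_tmul, star_one]

/-! The associativity map `A ⊗ (B ⊗ C) → (A ⊗ B) ⊗ C`. -/

/-- For fixed `a`, the map `b ⊗ c ↦ (a ⊗ b) ⊗ c` on the algebraic tensor product. -/
def preAssoc : A →ₗ[ℂ] (B ⊗[ℂ] C →ₗ[ℂ] MaxTensor (MaxTensor A B) C) :=
  LinearMap.mk₂ ℂ (fun a t => TensorProduct.lift ((tmulₗ (A := MaxTensor A B) (B := C)).comp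
      (tmulₗ (A := A) (B := B) a)) t)
    (fun a a' t => by
      induction t using TensorProduct.induction_on with
      | zero => simp
      | tmul b c => simp
      | add s t hs ht => rw [map_add, hs, ht, map_add, map_add]; abel)
    (fun z a t => by
      induction t using TensorProduct.induction_on with
      | zero => simp
      | tmul b c => simp
      | add s t hs ht => rw [map_add, hs, ht, map_add, smul_add])
    (fun a s t => map_add _ s t) (fun z a t => map_smul _ z t)

theorem preAssoc_tmul (a : A) (b : B) (c : C) :
    preAssoc a (b ⊗ₜ[ℂ] c) = tmul (tmul a b) c := rfl

theorem preAssoc_mul (a a' : A) (s t : B ⊗[ℂ] C) :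
    preAssoc a s * preAssoc a' t = preAssoc (a * a') (s * t) := by
  induction s using TensorProduct.induction_on with
  | zero => simp
  | add s s' hs hs' => simp only [map_add, add_mul, hs, hs']
  | tmul b c =>
    induction t using TensorProduct.induction_on with
    | zero => simp
    | add s s' hs hs' => simp only [map_add, mul_add, hs, hs']
    | tmul b' c' =>
      simp only [Algebra.TensorProduct.tmul_mul_tmul, preAssoc_tmul, tmul_mul_tmul]

theorem preAssoc_star (a : A) (t : B ⊗[ℂ] C) :
    star (preAssoc a t) = preAssoc (star a) (star t) := by
  induction t using TensorProduct.induction_on with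
  | zero => simp
  | add s s' hs hs' => simp only [map_add, star_add, hs, hs']
  | tmul b c => simp only [TensorProduct.star_tmul, preAssoc_tmul, star_tmul]

theorem preAssoc_bdd (t : B ⊗[ℂ] C) : ∃ K, ∀ a : A, ‖preAssoc a t‖ ≤ K * ‖a‖ := by
  induction t using TensorProduct.induction_on with
  | zero => exact ⟨0, by simp⟩
  | add s t hs ht =>
    obtain ⟨K, hK⟩ := hs
    obtain ⟨L, hL⟩ := ht
    refine ⟨K + L, fun a => ?_⟩
    rw [map_add, add_mul]
    exact (norm_add_le _ _).trans (add_le_add (hK a) (hL a))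
  | tmul b c =>
    refine ⟨‖b‖ * ‖c‖, fun a => ?_⟩
    rw [preAssoc_tmul]
    calc _ ≤ ‖tmul a b‖ * ‖c‖ := norm_tmul_le _ _
      _ ≤ (‖a‖ * ‖b‖) * ‖c‖ := by gcongr; exact norm_tmul_le _ _
      _ = _ := by ring

theorem preAssoc_bddAbove (t : B ⊗[ℂ] C) :
    BddAbove (Set.range fun a : Metric.closedBall (0 : A) 1 => ‖preAssoc (a : A) t‖) := by
  obtain ⟨K, hK⟩ := preAssoc_bdd (A := A) t
  refine ⟨|K|, ?_⟩
  rintro _ ⟨a, rfl⟩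
  have ha : ‖(a : A)‖ ≤ 1 := mem_closedBall_zero_iff.1 a.2
  calc _ ≤ K * ‖(a : A)‖ := hK a
    _ ≤ |K| * 1 := mul_le_mul (le_abs_self K) ha (norm_nonneg _) (abs_nonneg _)
    _ = _ := mul_one _

variable (A B C) in
/-- The seminorm `t ↦ sup_{‖a‖ ≤ 1} ‖(a ⊗ ·) ⊗ ·‖`. -/
def assocSeminorm : Seminorm ℂ (B ⊗[ℂ] C) :=
  Seminorm.of (fun t => ⨆ a : Metric.closedBall (0 : A) 1, ‖preAssoc (a : A) t‖)
    (fun s t => by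
      have : Nonempty (Metric.closedBall (0 : A) 1) := ⟨⟨0, by simp⟩⟩
      refine ciSup_le fun a => ?_
      rw [map_add]
      exact (norm_add_le _ _).trans (add_le_add (le_ciSup (preAssoc_bddAbove s) a)
        (le_ciSup (preAssoc_bddAbove t) a)))
    (fun z t => by
      simp only [map_smul, norm_smul]
      exact (Real.mul_iSup_of_nonneg (norm_nonneg z) _).symm)

theorem le_assocSeminorm {a : A} (ha : ‖a‖ ≤ 1) (t : B ⊗[ℂ] C) :
    ‖preAssoc a t‖ ≤ assocSeminorm A B C t :=
  le_ciSup (preAssoc_bddAbove t) (⟨a, by simpa using ha⟩ : Metric.closedBall (0 : A) 1)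

theorem assocSeminorm_le {t : B ⊗[ℂ] C} {c : ℝ} (h : ∀ a : A, ‖a‖ ≤ 1 → ‖preAssoc a t‖ ≤ c) :
    assocSeminorm A B C t ≤ c := by
  have : Nonempty (Metric.closedBall (0 : A) 1) := ⟨⟨0, by simp⟩⟩
  exact ciSup_le fun a => h a (mem_closedBall_zero_iff.1 a.2)

theorem isCStarSeminorm_assocSeminorm : IsCStarSeminorm (assocSeminorm A B C) := by
  have hmul : ∀ s t, assocSeminorm A B C (s * t) ≤ assocSeminorm A B C s * assocSeminorm A B C t := by
    intro s t
    refine assocSeminorm_le fun a ha => ?_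
    let _ := CStarAlgebra.spectralOrder A
    let _ := CStarAlgebra.spectralOrderedRing A
    have hu := CStarAlgebra.increasingApproximateUnit A
    have := hu.neBot
    obtain ⟨K, hK⟩ := preAssoc_bdd (A := A) (s * t)
    let L : A →L[ℂ] MaxTensor (MaxTensor A B) C :=
      LinearMap.mkContinuous ((preAssoc (A := A) (B := B) (C := C)).flip (s * t)) K hK
    have ht : Tendsto (fun e => ‖L (a * e)‖) (CStarAlgebra.approximateUnit A) (𝓝 ‖L a‖) :=
      (L.continuous.norm.tendsto a).comp (hu.tendsto_mul_left a)
    refine le_of_tendsto ht (hu.eventually_norm.mono fun e he => ?_)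
    change ‖preAssoc (a * e) (s * t)‖ ≤ _
    rw [← preAssoc_mul]
    exact (norm_mul_le _ _).trans (mul_le_mul (le_assocSeminorm ha s) (le_assocSeminorm he t)
      (norm_nonneg _) (apply_nonneg _ _))
  have hstar : ∀ t, assocSeminorm A B C (star t) ≤ assocSeminorm A B C t := fun t =>
    assocSeminorm_le fun a ha => by
      rw [← norm_star, preAssoc_star, star_star]
      exact le_assocSeminorm (by rwa [norm_star]) t
  refine ⟨hmul, fun t => le_antisymm ?_ ?_, fun b c => assocSeminorm_le fun a ha => ?_⟩
  · exact (hmul _ _).trans (mul_le_mul_of_nonneg_right (hstar t) (apply_nonneg _ _))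
  · have h : assocSeminorm A B C t ≤ √(assocSeminorm A B C (star t * t)) :=
      assocSeminorm_le fun a ha => Real.le_sqrt_of_sq_le <| by
        rw [sq, ← CStarRing.norm_star_mul_self, preAssoc_star, preAssoc_mul]
        refine le_assocSeminorm ?_ _
        rw [CStarRing.norm_star_mul_self]
        exact mul_le_one₀ ha (norm_nonneg _) ha
    calc _ ≤ √(assocSeminorm A B C (star t * t)) * √(assocSeminorm A B C (star t * t)) :=
          mul_self_le_mul_self (apply_nonneg _ _) h
      _ = _ := Real.mul_self_sqrt (apply_nonneg _ _)
  · rw [preAssoc_tmul]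
    calc _ ≤ ‖tmul a b‖ * ‖c‖ := norm_tmul_le _ _
      _ ≤ (‖a‖ * ‖b‖) * ‖c‖ := by gcongr; exact norm_tmul_le _ _
      _ ≤ (1 * ‖b‖) * ‖c‖ := by gcongr
      _ = _ := by ring

theorem norm_preAssoc_le (a : A) (t : B ⊗[ℂ] C) : ‖preAssoc a t‖ ≤ ‖a‖ * maxTensorNorm t := by
  rcases eq_or_ne a 0 with rfl | ha
  · simp
  have h0 : ‖a‖ ≠ 0 := norm_ne_zero_iff.2 ha
  have h1 : ‖((‖a‖⁻¹ : ℝ) : ℂ) • a‖ ≤ 1 := by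
    rw [norm_smul]; simp [h0]
  have h2 := (le_assocSeminorm h1 t).trans (le_maxTensorNorm isCStarSeminorm_assocSeminorm t)
  rw [map_smul, LinearMap.smul_apply, norm_smul] at h2
  have h3 : ‖((‖a‖⁻¹ : ℝ) : ℂ)‖ = ‖a‖⁻¹ := by simp
  rw [h3, inv_mul_le_iff₀ (by positivity)] at h2
  exact h2

/-- For fixed `a`, the extension of `b ⊗ c ↦ (a ⊗ b) ⊗ c` to the maximal tensor product. -/
def assocL (a : A) : MaxTensor B C →L[ℂ] MaxTensor (MaxTensor A B) C :=
  CStarCompletion.liftCLM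
    ((preAssoc a).comp ((AlgTensor.unof B C : AlgTensor B C →ₗ[ℂ] B ⊗[ℂ] C))) ‖a‖
    fun t => norm_preAssoc_le a (AlgTensor.unof B C t)

theorem assocL_mk (a : A) (t : AlgTensor B C) :
    assocL a (CStarCompletion.mk t) = preAssoc a (AlgTensor.unof B C t) :=
  CStarCompletion.liftCLM_mk _ _ _ t

/-- The map `assocL` as a bilinear map. -/
def assocBilin : A →ₗ[ℂ] MaxTensor B C →ₗ[ℂ] MaxTensor (MaxTensor A B) C :=
  LinearMap.mk₂ ℂ (fun a x => assocL a x)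
    (fun a a' x => CStarCompletion.ind x (isClosed_eq (assocL (a + a')).continuous
      ((assocL a).continuous.add (assocL a').continuous)) fun t => by
      rw [assocL_mk, assocL_mk, assocL_mk, map_add, LinearMap.add_apply])
    (fun z a x => CStarCompletion.ind x (isClosed_eq (assocL (z • a)).continuous
      ((assocL a).continuous.const_smul z)) fun t => by
      rw [assocL_mk, assocL_mk, map_smul, LinearMap.smul_apply])
    (fun a x y => map_add _ x y) (fun z a x => map_smul _ z x)

/-- The canonical map `A ⊗ (B ⊗ C) → (A ⊗ B) ⊗ C`. -/
def assocInv : MaxTensor A (MaxTensor B C) →⋆ₙₐ[ℂ] MaxTensor (MaxTensor A B) C :=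
  lift assocBilin
    (fun a x a' y => by
      change assocL a x * assocL a' y = assocL (a * a') (x * y)
      refine CStarCompletion.ind₂ x y (isClosed_eq
        (((assocL a).continuous.comp continuous_fst).mul
          ((assocL a').continuous.comp continuous_snd))
        ((assocL (a * a')).continuous.comp (continuous_fst.mul continuous_snd))) fun s t => ?_
      rw [← CStarCompletion.mk_mul, assocL_mk, assocL_mk, assocL_mk, preAssoc_mul,
        map_mul (AlgTensor.unof B C)])
    (fun a x => by
      change star (assocL a x) = assocL (star a) (star x)
      refine CStarCompletion.ind x (isClosed_eq (continuous_star.comp (assocL a).continuous)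
        ((assocL (star a)).continuous.comp continuous_star)) fun t => ?_
      rw [← CStarCompletion.mk_star, assocL_mk, assocL_mk, preAssoc_star,
        map_star (AlgTensor.unof B C)])
    (fun a x => by
      change ‖assocL a x‖ ≤ ‖a‖ * ‖x‖
      refine CStarCompletion.ind x (isClosed_le (assocL a).continuous.norm
        (continuous_const.mul continuous_norm)) fun t => ?_
      rw [assocL_mk, CStarCompletion.norm_mk]
      exact norm_preAssoc_le a (AlgTensor.unof B C t))

theorem assocInv_tmul (a : A) (b : B) (c : C) :
    assocInv (tmul a (tmul b c)) = tmul (tmul a b) c := by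
  rw [assocInv, lift_tmul]
  exact assocL_mk a (AlgTensor.of B C (b ⊗ₜ[ℂ] c))

end MaxTensor

end MaxTensor
end

/-! ### Finite matrices over a C⋆-algebra -/

noncomputable section

section FiniteMatrices

attribute [local instance] CStarAlgebra.spectralOrder CStarAlgebra.spectralOrderedRing

variable {B : Type*} [NonUnitalCStarAlgebra B]

/-- The C⋆-norm of a finite matrix with entries in `B`, i.e. its norm as an operator on the
Hilbert module `Bⁿ`. -/
def matNorm {n : Type*} [Fintype n] (M : CStarMatrix n n B) : ℝ := ‖M‖

section lemmas

variable {n : Type*} [Fintype n]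

theorem matNorm_nonneg (M : CStarMatrix n n B) : 0 ≤ matNorm M := norm_nonneg M
theorem matNorm_zero : matNorm (0 : CStarMatrix n n B) = 0 := norm_zero
theorem matNorm_add_le (M N : CStarMatrix n n B) : matNorm (M + N) ≤ matNorm M + matNorm N :=
  norm_add_le M N
theorem matNorm_neg (M : CStarMatrix n n B) : matNorm (-M) = matNorm M := norm_neg M
theorem matNorm_smul (c : ℂ) (M : CStarMatrix n n B) : matNorm (c • M) = ‖c‖ * matNorm M :=
  norm_smul c M
theorem matNorm_mul_le (M N : CStarMatrix n n B) : matNorm (M * N) ≤ matNorm M * matNorm N :=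
  norm_mul_le M N
theorem matNorm_star (M : CStarMatrix n n B) : matNorm (star M) = matNorm M := norm_star M
theorem matNorm_star_mul_self (M : CStarMatrix n n B) :
    matNorm (star M * M) = matNorm M * matNorm M := CStarRing.norm_star_mul_self
theorem norm_entry_le_matNorm (M : CStarMatrix n n B) (i j : n) : ‖M i j‖ ≤ matNorm M :=
  CStarMatrix.norm_entry_le_norm

theorem matNorm_hom_le {m C : Type*} [Fintype m] [NonUnitalCStarAlgebra C]
    (φ : CStarMatrix n n B →⋆ₙₐ[ℂ] CStarMatrix m m C) (M : CStarMatrix n n B) :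
    matNorm (φ M) ≤ matNorm M := NonUnitalStarAlgHom.norm_apply_le φ M

open WithCStarModule in
theorem inner_toCLM_eq (M : CStarMatrix n n B) (v w : C⋆ᵐᵒᵈ(B, n → B)) :
    inner B w (CStarMatrix.toCLM M v) = ∑ j, ∑ i, v i * M i j * star (w j) := by
  simp only [CStarMatrix.toCLM_apply_eq_sum, pi_inner, equiv_symm_pi_apply, inner_def,
    Finset.sum_mul]

open WithCStarModule in
theorem matNorm_submatrix_le {m : Type*} [Fintype m] (f : m → n) (hf : Function.Injective f)
    (M : CStarMatrix n n B) :
    matNorm (CStarMatrix.ofMatrix fun i j => M (f i) (f j) : CStarMatrix m m B) ≤ matNorm M := by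
  classical
  let ext : (m → B) → C⋆ᵐᵒᵈ(B, n → B) := fun v => (equiv B (n → B)).symm (Function.extend f v (0 : n → B))
  have hext : ∀ (v : m → B) (i : m), ext v (f i) = v i := fun v i => hf.extend_apply v (0 : n → B) i
  have hext0 : ∀ (v : m → B) (i : n), i ∉ Set.range f → ext v i = 0 := fun v i hi =>
    Function.extend_apply' v (0 : n → B) i (by simpa using hi)
  have hsum : ∀ g : n → B, (∀ i, i ∉ Set.range f → g i = 0) → ∑ i, g i = ∑ i, g (f i) :=
    fun g hg => by
      refine Eq.trans ?_ (Finset.sum_map Finset.univ ⟨f, hf⟩ g)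
      exact (Finset.sum_subset (Finset.subset_univ _) fun i _ hi => hg i (by simpa using hi)).symm
  have hnorm : ∀ v : C⋆ᵐᵒᵈ(B, m → B), ‖ext (equiv B (m → B) v)‖ = ‖v‖ := fun v => by
    rw [pi_norm, pi_norm, hsum _ fun i hi => by simp [inner_def, hext0 _ i hi]]
    simp only [hext]; rfl
  refine CStarMatrix.norm_le_of_forall_inner_le (C := ⟨‖M‖, norm_nonneg M⟩) fun v w => ?_
  have : inner B w (CStarMatrix.toCLM (CStarMatrix.ofMatrix fun i j => M (f i) (f j) :
      CStarMatrix m m B) v) = inner B (ext (equiv B (m → B) w))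
        (CStarMatrix.toCLM M (ext (equiv B (m → B) v))) := by
    rw [inner_toCLM_eq, inner_toCLM_eq, hsum _ fun j hj => by simp [hext0 _ j hj]]
    refine Finset.sum_congr rfl fun j _ => ?_
    rw [hsum _ fun i hi => by simp [hext0 _ i hi]]
    simp only [hext]; rfl
  rw [this]
  calc _ ≤ ‖ext (equiv B (m → B) w)‖ * ‖CStarMatrix.toCLM M (ext (equiv B (m → B) v))‖ :=
        CStarModule.norm_inner_le _
    _ ≤ ‖w‖ * (‖M‖ * ‖v‖) := by
        rw [hnorm, ← hnorm v]; gcongr; exact (CStarMatrix.toCLM M).le_opNorm _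
    _ = ‖M‖ * ‖v‖ * ‖w‖ := by ring

open WithCStarModule in
theorem matNorm_le_of_sparse (M : CStarMatrix n n B) (C : ℝ) (hC : 0 ≤ C) (N : ℕ)
    (hM : ∀ i j, ‖M i j‖ ≤ C) (hrow : ∀ i, {j | M i j ≠ 0}.encard ≤ N)
    (hcol : ∀ j, {i | M i j ≠ 0}.encard ≤ N) : matNorm M ≤ N * C := by
  classical
  have hrow' : ∀ i, (Finset.univ.filter fun j => M i j ≠ 0).card ≤ N := fun i => by
    have := hrow i
    rw [← Finset.coe_filter_univ, Set.encard_coe_eq_coe_finsetCard] at this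
    exact_mod_cast this
  have hcol' : ∀ j, (Finset.univ.filter fun i => M i j ≠ 0).card ≤ N := fun j => by
    have := hcol j
    rw [← Finset.coe_filter_univ, Set.encard_coe_eq_coe_finsetCard] at this
    exact_mod_cast this
  refine CStarMatrix.norm_le_of_forall_inner_le (C := ⟨N * C, by positivity⟩) fun v w => ?_
  let v' : C⋆ᵐᵒᵈ(B, n × n → B) := (equiv B (n × n → B)).symm fun p => v p.1 * M p.1 p.2
  let w' : C⋆ᵐᵒᵈ(B, n × n → B) :=
    (equiv B (n × n → B)).symm fun p => if M p.1 p.2 = 0 then 0 else w p.2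
  have e : inner B w (CStarMatrix.toCLM M v) = inner B w' v' := by
    rw [inner_toCLM_eq, pi_inner, Fintype.sum_prod_type_right]
    refine Finset.sum_congr rfl fun j _ => Finset.sum_congr rfl fun i _ => ?_
    change _ = v i * M i j * star (if M i j = 0 then 0 else w j)
    split_ifs with h <;> simp [h]
  have hs : ∀ (s : Finset n) (b : B), 0 ≤ b → s.card ≤ N → (∑ _j ∈ s, b) ≤ (N : ℝ) • b := by
    intro s b hb hs
    rw [Finset.sum_const, ← Nat.cast_smul_eq_nsmul ℝ]
    exact smul_le_smul_of_nonneg_right (by exact_mod_cast hs) hb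
  have hv : ‖v'‖ ^ 2 ≤ N * C ^ 2 * ‖v‖ ^ 2 := by
    rw [pi_norm_sq, pi_norm_sq]
    have : ∑ p, inner B (v' p) (v' p) ≤ ((N : ℝ) * C ^ 2) • ∑ i, inner B (v i) (v i) := by
      rw [Fintype.sum_prod_type, Finset.smul_sum]
      refine Finset.sum_le_sum fun i _ => ?_
      have h1 : ∀ j, inner B (v' (i, j)) (v' (i, j)) ≤ (C ^ 2) • inner B (v i) (v i) := fun j => by
        change v i * M i j * star (v i * M i j) ≤ (C ^ 2) • (v i * star (v i))
        rw [star_mul, mul_assoc, ← mul_assoc (M i j), ← mul_assoc]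
        refine (CStarAlgebra.star_right_conjugate_le_norm_smul ?_).trans ?_
        · exact .mul_star_self _
        · refine smul_le_smul_of_nonneg_right ?_ (mul_star_self_nonneg _)
          rw [CStarRing.norm_self_mul_star, sq]
          exact mul_self_le_mul_self (norm_nonneg _) (hM i j)
      calc _ = ∑ j ∈ Finset.univ.filter (fun j => M i j ≠ 0), inner B (v' (i, j)) (v' (i, j)) := by
            rw [Finset.sum_filter_of_ne]
            intro j _ h h0
            refine h ?_
            change v i * M i j * star (v i * M i j) = 0
            simp [h0]
        _ ≤ ∑ j ∈ Finset.univ.filter (fun j => M i j ≠ 0), (C ^ 2) • inner B (v i) (v i) :=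
            Finset.sum_le_sum fun j _ => h1 j
        _ ≤ (N : ℝ) • (C ^ 2) • inner B (v i) (v i) :=
            hs _ _ (smul_nonneg (by positivity) (mul_star_self_nonneg (v i))) (hrow' i)
        _ = _ := by rw [smul_smul]
    refine (CStarAlgebra.norm_le_norm_of_nonneg_of_le ?_ this).trans ?_
    · exact Finset.sum_nonneg fun p _ => mul_star_self_nonneg (v' p)
    · rw [norm_smul, Real.norm_of_nonneg (by positivity)]
  have hw : ‖w'‖ ^ 2 ≤ N * ‖w‖ ^ 2 := by
    rw [pi_norm_sq, pi_norm_sq]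
    have : ∑ p, inner B (w' p) (w' p) ≤ (N : ℝ) • ∑ i, inner B (w i) (w i) := by
      rw [Fintype.sum_prod_type_right, Finset.smul_sum]
      refine Finset.sum_le_sum fun j _ => ?_
      calc _ = ∑ i ∈ Finset.univ.filter (fun i => M i j ≠ 0), inner B (w j) (w j) := by
            rw [Finset.sum_filter]
            refine Finset.sum_congr rfl fun i _ => ?_
            change (if M i j = 0 then 0 else w j) * star (if M i j = 0 then 0 else w j) = _
            by_cases h : M i j = 0 <;> simp [h, inner_def]
        _ ≤ _ := hs _ _ (mul_star_self_nonneg (w j)) (hcol' j)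
    refine (CStarAlgebra.norm_le_norm_of_nonneg_of_le ?_ this).trans ?_
    · exact Finset.sum_nonneg fun p _ => mul_star_self_nonneg (w' p)
    · rw [norm_smul, Real.norm_of_nonneg (by positivity)]
  rw [e]
  refine (CStarModule.norm_inner_le _).trans ?_
  refine le_of_sq_le_sq ?_ (mul_nonneg (mul_nonneg (mul_nonneg N.cast_nonneg hC)
    (norm_nonneg v)) (norm_nonneg w))
  calc (‖w'‖ * ‖v'‖) ^ 2 = ‖w'‖ ^ 2 * ‖v'‖ ^ 2 := by ring
    _ ≤ (N * ‖w‖ ^ 2) * (N * C ^ 2 * ‖v‖ ^ 2) := by gcongr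
    _ = (N * C * ‖v‖ * ‖w‖) ^ 2 := by ring

end lemmas
end FiniteMatrices
end

/-! ### Completed algebras of matrices with controlled supports -/

noncomputable section

/-- A family of subsets of `X × X` which are the admissible supports of `X`-by-`X` matrices. -/
structure SupportFamily (X : Type*) where
  IsControlled : Set (X × X) → Prop
  empty : IsControlled ∅
  mono : ∀ {E F}, E ⊆ F → IsControlled F → IsControlled E
  union : ∀ {E F}, IsControlled E → IsControlled F → IsControlled (E ∪ F)
  comp : ∀ {E F}, IsControlled E → IsControlled F →
    IsControlled {p | ∃ z, (p.1, z) ∈ E ∧ (z, p.2) ∈ F}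
  inv : ∀ {E}, IsControlled E → IsControlled {p | (p.2, p.1) ∈ E}
  bdd : ∀ {E}, IsControlled E → ∃ N : ℕ, ∀ x, {y | (x, y) ∈ E}.encard ≤ N

/-- The support of a matrix. -/
def matSupport {X B : Type*} [Zero B] (m : X → X → B) : Set (X × X) := {p | m p.1 p.2 ≠ 0}

section ControlledMatrix

variable {X : Type*} (𝓔 : SupportFamily X) (B : Type*) [NonUnitalCStarAlgebra B]

/-- Matrices with controlled support and uniformly bounded entries, as a subspace of the space of
all matrices. -/
def controlledSubmodule : Submodule ℂ (X → X → B) where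
  carrier := {m | 𝓔.IsControlled (matSupport m) ∧ ∃ C : ℝ, ∀ x y, ‖m x y‖ ≤ C}
  zero_mem' := ⟨𝓔.mono (fun p hp => (hp rfl).elim) 𝓔.empty, 0, fun x y => by simp⟩
  add_mem' := by
    rintro m n ⟨hm, C, hC⟩ ⟨hn, D, hD⟩
    refine ⟨𝓔.mono (fun p hp => ?_) (𝓔.union hm hn), C + D, fun x y =>
      (norm_add_le _ _).trans (add_le_add (hC x y) (hD x y))⟩
    by_contra h
    simp only [matSupport, Set.mem_union, Set.mem_ofPred_eq, not_or, not_not] at h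
    exact hp (by simp [h.1, h.2])
  smul_mem' := by
    rintro c m ⟨hm, C, hC⟩
    refine ⟨𝓔.mono (fun p hp => ?_) hm, ‖c‖ * C, fun x y => ?_⟩
    · exact fun h0 => hp (by simp [h0])
    · simp only [Pi.smul_apply, norm_smul]
      exact mul_le_mul_of_nonneg_left (hC x y) (norm_nonneg _)

/-- The ⋆-algebra of matrices with entries in `B`, with controlled support and with uniformly
bounded entries. -/
def ControlledMatrix : Type _ := controlledSubmodule 𝓔 B

end ControlledMatrix

namespace ControlledMatrix

variable {X : Type*} {𝓔 : SupportFamily X} {B : Type*} [NonUnitalCStarAlgebra B]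

instance : AddCommGroup (ControlledMatrix 𝓔 B) :=
  inferInstanceAs (AddCommGroup (controlledSubmodule 𝓔 B))
instance : Module ℂ (ControlledMatrix 𝓔 B) := inferInstanceAs (Module ℂ (controlledSubmodule 𝓔 B))

/-- The entries of a matrix. -/
def entry (m : ControlledMatrix 𝓔 B) (x y : X) : B := m.1 x y

/-- The matrix with given entries. -/
def ofEntries (m : X → X → B) (h : 𝓔.IsControlled (matSupport m)) (h' : ∃ C : ℝ, ∀ x y, ‖m x y‖ ≤ C) :
    ControlledMatrix 𝓔 B := ⟨m, h, h'⟩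

theorem entry_ofEntries (m : X → X → B) (h : 𝓔.IsControlled (matSupport m))
    (h' : ∃ C : ℝ, ∀ x y, ‖m x y‖ ≤ C) : entry (ofEntries m h h') = m := rfl

theorem ext {m n : ControlledMatrix 𝓔 B} (h : ∀ x y, entry m x y = entry n x y) : m = n :=
  Subtype.ext (funext fun x => funext fun y => h x y)

theorem entry_add (m n : ControlledMatrix 𝓔 B) (x y : X) :
    entry (m + n) x y = entry m x y + entry n x y := rfl
theorem entry_smul (c : ℂ) (m : ControlledMatrix 𝓔 B) (x y : X) :
    entry (c • m) x y = c • entry m x y := rfl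
theorem entry_zero (x y : X) : entry (0 : ControlledMatrix 𝓔 B) x y = 0 := rfl

theorem controlled (m : ControlledMatrix 𝓔 B) : 𝓔.IsControlled (matSupport (entry m)) := m.2.1

theorem entry_bdd (m : ControlledMatrix 𝓔 B) : ∃ C : ℝ, 0 ≤ C ∧ ∀ x y, ‖entry m x y‖ ≤ C := by
  obtain ⟨C, hC⟩ := m.2.2
  exact ⟨|C|, abs_nonneg C, fun x y => (hC x y).trans (le_abs_self C)⟩

theorem row_bdd (m : ControlledMatrix 𝓔 B) :
    ∃ N : ℕ, ∀ x, {y | entry m x y ≠ 0}.encard ≤ N := 𝓔.bdd m.controlled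

theorem col_bdd (m : ControlledMatrix 𝓔 B) :
    ∃ N : ℕ, ∀ y, {x | entry m x y ≠ 0}.encard ≤ N := 𝓔.bdd (𝓔.inv m.controlled)

theorem row_finite (m : ControlledMatrix 𝓔 B) (x : X) : {y | entry m x y ≠ 0}.Finite := by
  obtain ⟨N, hN⟩ := m.row_bdd
  exact Set.finite_of_encard_le_coe (hN x)

instance : Star (ControlledMatrix 𝓔 B) := ⟨fun m => ofEntries (fun x y => star (entry m y x))
  (𝓔.mono (fun p hp => show entry m p.2 p.1 ≠ 0 from fun h0 => hp (by simp [h0]))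
    (𝓔.inv m.controlled)) (by
    obtain ⟨C, _, hC⟩ := m.entry_bdd
    exact ⟨C, fun x y => by rw [norm_star]; exact hC y x⟩)⟩

theorem entry_star (m : ControlledMatrix 𝓔 B) (x y : X) :
    entry (star m) x y = star (entry m y x) := rfl

theorem finsum_eq_sum (m n : X → X → B) (x y : X) (G : Finset X) (hG : ∀ z, m x z ≠ 0 → z ∈ G) :
    ∑ᶠ z, m x z * n z y = ∑ z ∈ G, m x z * n z y :=
  finsum_eq_sum_of_support_subset _ fun z hz => hG z fun h0 => hz (by simp [h0])

theorem exists_mul_ne_zero {f : X → B} (h : ∑ᶠ z, f z ≠ 0) : ∃ z, f z ≠ 0 := by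
  by_contra! h0
  exact h (finsum_eq_zero_of_forall_eq_zero h0)

instance : Mul (ControlledMatrix 𝓔 B) := ⟨fun m n =>
  ofEntries (fun x y => ∑ᶠ z, entry m x z * entry n z y)
  (𝓔.mono (fun p hp => by
    obtain ⟨z, hz⟩ := exists_mul_ne_zero hp
    exact ⟨z, left_ne_zero_of_mul hz, right_ne_zero_of_mul hz⟩) (𝓔.comp m.controlled n.controlled)) (by
    obtain ⟨C, hC0, hC⟩ := m.entry_bdd
    obtain ⟨D, hD0, hD⟩ := n.entry_bdd
    obtain ⟨N, hN⟩ := m.row_bdd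
    refine ⟨N * (C * D), fun x y => ?_⟩
    rw [finsum_eq_sum _ _ x y (m.row_finite x).toFinset (by simp)]
    have hcard : (m.row_finite x).toFinset.card ≤ N := by
      have := hN x
      rw [(m.row_finite x).encard_eq_coe_toFinset_card] at this
      exact_mod_cast this
    calc _ ≤ ∑ _z ∈ (m.row_finite x).toFinset, C * D := norm_sum_le_of_le _ fun z _ =>
          (norm_mul_le _ _).trans (mul_le_mul (hC x z) (hD z y) (norm_nonneg _) hC0)
      _ ≤ N * (C * D) := by
          rw [Finset.sum_const, nsmul_eq_mul]
          gcongr)⟩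

theorem entry_mul (m n : ControlledMatrix 𝓔 B) (x y : X) :
    entry (m * n) x y = ∑ᶠ z, entry m x z * entry n z y := rfl

theorem entry_mul_eq_sum (m n : ControlledMatrix 𝓔 B) (x y : X) (G : Finset X)
    (hG : ∀ z, entry m x z ≠ 0 → z ∈ G) :
    entry (m * n) x y = ∑ z ∈ G, entry m x z * entry n z y := finsum_eq_sum _ _ x y G hG

theorem exists_finset (m : ControlledMatrix 𝓔 B) (F : Finset X) :
    ∃ G : Finset X, F ⊆ G ∧ ∀ x ∈ F, ∀ z, entry m x z ≠ 0 → z ∈ G := by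
  classical
  refine ⟨F ∪ F.biUnion fun x => (m.row_finite x).toFinset, Finset.subset_union_left,
    fun x hx z hz => Finset.mem_union_right _ (Finset.mem_biUnion.2 ⟨x, hx, by simpa using hz⟩)⟩

instance : NonUnitalRing (ControlledMatrix 𝓔 B) where
  __ : AddCommGroup (ControlledMatrix 𝓔 B) := inferInstance
  mul := (· * ·)
  zero_mul m := ext fun x y => by simp [entry_mul, entry_zero]
  mul_zero m := ext fun x y => by simp [entry_mul, entry_zero]
  left_distrib m n p := ext fun x y => by
    have h : ∀ z, entry m x z ≠ 0 → z ∈ (m.row_finite x).toFinset := by simp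
    rw [entry_add, entry_mul_eq_sum _ _ x y _ h, entry_mul_eq_sum _ _ x y _ h,
      entry_mul_eq_sum _ _ x y _ h, ← Finset.sum_add_distrib]
    exact Finset.sum_congr rfl fun z _ => by rw [entry_add, mul_add]
  right_distrib m n p := ext fun x y => by
    classical
    have hm : ∀ z, entry m x z ≠ 0 → z ∈ (m.row_finite x).toFinset ∪ (n.row_finite x).toFinset :=
      fun z hz => Finset.mem_union_left _ (by simpa using hz)
    have hn : ∀ z, entry n x z ≠ 0 → z ∈ (m.row_finite x).toFinset ∪ (n.row_finite x).toFinset :=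
      fun z hz => Finset.mem_union_right _ (by simpa using hz)
    have hmn : ∀ z, entry (m + n) x z ≠ 0 →
        z ∈ (m.row_finite x).toFinset ∪ (n.row_finite x).toFinset := fun z hz => by
      by_contra h
      refine hz ?_
      rw [entry_add, not_not.1 (mt (hm z) h), not_not.1 (mt (hn z) h), add_zero]
    rw [entry_add, entry_mul_eq_sum _ _ x y _ hmn, entry_mul_eq_sum _ _ x y _ hm,
      entry_mul_eq_sum _ _ x y _ hn, ← Finset.sum_add_distrib]
    exact Finset.sum_congr rfl fun z _ => by rw [entry_add, add_mul]
  mul_assoc m n p := ext fun x y => by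
    have h : ∀ z, entry m x z ≠ 0 → z ∈ (m.row_finite x).toFinset := by simp
    obtain ⟨G, -, hG⟩ := n.exists_finset (m.row_finite x).toFinset
    have hmn : ∀ w, entry (m * n) x w ≠ 0 → w ∈ G := fun w hw => by
      obtain ⟨z, hz⟩ := exists_mul_ne_zero (show ∑ᶠ z, entry m x z * entry n z w ≠ 0 from hw)
      exact hG z (h z (left_ne_zero_of_mul hz)) w (right_ne_zero_of_mul hz)
    rw [entry_mul_eq_sum _ _ x y G hmn, entry_mul_eq_sum _ _ x y _ h]
    have e1 : ∀ w ∈ G, entry (m * n) x w * entry p w y =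
        ∑ z ∈ (m.row_finite x).toFinset, entry m x z * entry n z w * entry p w y := fun w _ => by
      rw [entry_mul_eq_sum _ _ x w _ h, Finset.sum_mul]
    have e2 : ∀ z ∈ (m.row_finite x).toFinset, entry m x z * entry (n * p) z y =
        ∑ w ∈ G, entry m x z * entry n z w * entry p w y := fun z hz => by
      rw [entry_mul_eq_sum _ _ z y G (hG z hz), Finset.mul_sum]
      exact Finset.sum_congr rfl fun w _ => (mul_assoc _ _ _).symm
    rw [Finset.sum_congr rfl e1, Finset.sum_congr rfl e2, Finset.sum_comm]

instance : StarRing (ControlledMatrix 𝓔 B) where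
  star_involutive m := ext fun x y => by rw [entry_star, entry_star, star_star]
  star_add m n := ext fun x y => by simp only [entry_star, entry_add, star_add]
  star_mul m n := ext fun x y => by
    classical
    rw [entry_star]
    have h1 : ∀ z, entry m y z ≠ 0 → z ∈ (m.row_finite y).toFinset ∪ ((star n).row_finite x).toFinset :=
      fun z hz => Finset.mem_union_left _ (by simpa using hz)
    have h2 : ∀ z, entry (star n) x z ≠ 0 →
        z ∈ (m.row_finite y).toFinset ∪ ((star n).row_finite x).toFinset :=
      fun z hz => Finset.mem_union_right _ (by simpa using hz)
    rw [entry_mul_eq_sum _ _ y x _ h1, entry_mul_eq_sum _ _ x y _ h2, star_sum]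
    exact Finset.sum_congr rfl fun z _ => by rw [star_mul]; rfl

instance : StarModule ℂ (ControlledMatrix 𝓔 B) where
  star_smul c m := ext fun x y => by simp only [entry_star, entry_smul, star_smul]

instance : IsScalarTower ℂ (ControlledMatrix 𝓔 B) (ControlledMatrix 𝓔 B) where
  smul_assoc c m n := ext fun x y => by
    have h : ∀ z, entry m x z ≠ 0 → z ∈ (m.row_finite x).toFinset := by simp
    change entry ((c • m) * n) x y = entry (c • (m * n)) x y
    rw [entry_smul, entry_mul_eq_sum _ _ x y _ h, entry_mul_eq_sum (c • m) n x y _ fun z hz =>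
      h z fun h0 => hz (by rw [entry_smul, h0, smul_zero]), Finset.smul_sum]
    exact Finset.sum_congr rfl fun z _ => by rw [entry_smul, smul_mul_assoc]

instance : SMulCommClass ℂ (ControlledMatrix 𝓔 B) (ControlledMatrix 𝓔 B) where
  smul_comm c m n := ext fun x y => by
    have h : ∀ z, entry m x z ≠ 0 → z ∈ (m.row_finite x).toFinset := by simp
    change entry (c • (m * n)) x y = entry (m * (c • n)) x y
    rw [entry_smul, entry_mul_eq_sum _ _ x y _ h, entry_mul_eq_sum _ _ x y _ h, Finset.smul_sum]
    exact Finset.sum_congr rfl fun z _ => by rw [entry_smul, mul_smul_comm]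

/-- The finite corner of a matrix. -/
def corner (F : Finset X) (m : ControlledMatrix 𝓔 B) : CStarMatrix F F B :=
  CStarMatrix.ofMatrix fun i j => entry m i j

/-- The norm of a matrix as an operator on the Hilbert `B`-module `ℓ²(X, B)`, i.e. the supremum of
the norms of its finite corners. -/
def opNorm (m : ControlledMatrix 𝓔 B) : ℝ := ⨆ F : Finset X, matNorm (corner F m)

theorem opNorm_bddAbove (m : ControlledMatrix 𝓔 B) :
    BddAbove (Set.range fun F : Finset X => matNorm (corner F m)) := by
  obtain ⟨C, hC0, hC⟩ := m.entry_bdd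
  obtain ⟨N, hN⟩ := m.row_bdd
  obtain ⟨M, hM⟩ := m.col_bdd
  refine ⟨(max N M : ℕ) * C, ?_⟩
  rintro _ ⟨F, rfl⟩
  have key : ∀ (K : ℕ) (p : X → Prop), {y | p y}.encard ≤ K → {j : F | p j}.encard ≤ K :=
    fun K p hp => by
      rw [← Subtype.val_injective.encard_image]
      refine (Set.encard_le_encard ?_).trans hp
      rintro _ ⟨j, hj, rfl⟩
      exact hj
  refine matNorm_le_of_sparse _ C hC0 _ (fun i j => hC i j) (fun i => ?_) (fun j => ?_)
  · exact key _ (fun y => entry m i y ≠ 0) ((hN i).trans (by exact_mod_cast le_max_left N M))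
  · exact key _ (fun x => entry m x j ≠ 0) ((hM j).trans (by exact_mod_cast le_max_right N M))

theorem matNorm_corner_le (m : ControlledMatrix 𝓔 B) (F : Finset X) :
    matNorm (corner F m) ≤ opNorm m := le_ciSup (opNorm_bddAbove m) F

theorem opNorm_nonneg (m : ControlledMatrix 𝓔 B) : 0 ≤ opNorm m :=
  Real.iSup_nonneg fun _ => matNorm_nonneg _

variable (𝓔 B) in
/-- The operator norm, as a seminorm. -/
def opSeminorm : Seminorm ℂ (ControlledMatrix 𝓔 B) :=
  Seminorm.of opNorm
    (fun m n => ciSup_le fun F => (matNorm_add_le (corner F m) (corner F n)).trans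
      (add_le_add (matNorm_corner_le m F) (matNorm_corner_le n F)))
    (fun c m => by
      have : ∀ F, matNorm (corner F (c • m)) = ‖c‖ * matNorm (corner F m) := fun F =>
        matNorm_smul c (corner F m)
      simp only [opNorm, this]
      exact (Real.mul_iSup_of_nonneg (norm_nonneg c) _).symm)

theorem opNorm_star (m : ControlledMatrix 𝓔 B) : opNorm (star m) = opNorm m :=
  iSup_congr fun F => matNorm_star (corner F m)

theorem opNorm_mul_le (m n : ControlledMatrix 𝓔 B) : opNorm (m * n) ≤ opNorm m * opNorm n := by
  refine ciSup_le fun F => ?_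
  obtain ⟨G, hFG, hG⟩ := m.exists_finset F
  have e : corner F (m * n) = CStarMatrix.ofMatrix fun i j =>
      (corner G m * corner G n) (Set.inclusion hFG i) (Set.inclusion hFG j) := by
    ext i j
    change entry (m * n) i j = (corner G m * corner G n) (Set.inclusion hFG i) (Set.inclusion hFG j)
    rw [entry_mul_eq_sum _ _ _ _ G (hG i i.2), CStarMatrix.mul_apply]
    exact (Finset.sum_coe_sort G fun z => entry m i z * entry n z j).symm
  rw [e]
  calc _ ≤ matNorm (corner G m * corner G n) :=
        matNorm_submatrix_le _ (Set.inclusion_injective hFG) _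
    _ ≤ matNorm (corner G m) * matNorm (corner G n) := matNorm_mul_le _ _
    _ ≤ _ := mul_le_mul (matNorm_corner_le m G) (matNorm_corner_le n G) (matNorm_nonneg _)
        (opNorm_nonneg _)

/-- Extension of finite matrices by zero. -/
def extZeroFun [DecidableEq X] (F G : Finset X) (M : CStarMatrix F F B) : CStarMatrix G G B :=
  CStarMatrix.ofMatrix fun a b =>
    if ha : (a : X) ∈ F then if hb : (b : X) ∈ F then M ⟨a, ha⟩ ⟨b, hb⟩ else 0 else 0

theorem extZeroFun_apply [DecidableEq X] (F G : Finset X) (M : CStarMatrix F F B) (a b : G) :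
    extZeroFun F G M a b =
      if ha : (a : X) ∈ F then if hb : (b : X) ∈ F then M ⟨a, ha⟩ ⟨b, hb⟩ else 0 else 0 := rfl

/-- Extension of finite matrices by zero, as a ⋆-homomorphism. -/
def extZero [DecidableEq X] (F G : Finset X) (h : F ⊆ G) :
    CStarMatrix F F B →⋆ₙₐ[ℂ] CStarMatrix G G B where
  toFun := extZeroFun F G
  map_smul' c M := by
    ext a b
    simp only [extZeroFun_apply, CStarMatrix.smul_apply]
    split_ifs <;> simp
  map_zero' := by
    ext a b
    simp only [extZeroFun_apply, CStarMatrix.zero_apply]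
    split_ifs <;> simp
  map_add' M N := by
    ext a b
    simp only [extZeroFun_apply, CStarMatrix.add_apply]
    split_ifs <;> simp
  map_star' M := by
    ext a b
    simp only [extZeroFun_apply, CStarMatrix.star_apply]
    split_ifs <;> simp
  map_mul' M N := by
    ext a b
    rw [CStarMatrix.mul_apply]
    simp only [extZeroFun_apply, CStarMatrix.mul_apply]
    by_cases ha : (a : X) ∈ F
    · by_cases hb : (b : X) ∈ F
      · simp only [ha, hb, dite_true]
        let g : X → B := fun z => if hz : z ∈ F then M ⟨a, ha⟩ ⟨z, hz⟩ * N ⟨z, hz⟩ ⟨b, hb⟩ else 0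
        have h1 : ∀ c : F, M ⟨a, ha⟩ c * N c ⟨b, hb⟩ = g c := fun c => by simp [g]
        have h2 : ∀ c : G, (if hz : (c : X) ∈ F then M ⟨a, ha⟩ ⟨c, hz⟩ else 0) *
            (if hz : (c : X) ∈ F then N ⟨c, hz⟩ ⟨b, hb⟩ else 0) = g c := fun c => by
          simp only [g]; split_ifs <;> simp
        rw [Finset.sum_congr rfl fun c _ => h1 c, Finset.sum_congr rfl fun c _ => h2 c,
          Finset.sum_coe_sort F g, Finset.sum_coe_sort G g]
        exact Finset.sum_subset h fun z _ hz => by simp [g, hz]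
      · simp [ha, hb]
    · simp [ha]

theorem opNorm_mul_self_le (m : ControlledMatrix 𝓔 B) :
    opNorm m * opNorm m ≤ opNorm (star m * m) := by
  classical
  have h : opNorm m ≤ √(opNorm (star m * m)) := by
    refine ciSup_le fun F => Real.le_sqrt_of_sq_le ?_
    obtain ⟨G, hFG, hG⟩ := (star m).exists_finset F
    let R : CStarMatrix G G B :=
      CStarMatrix.ofMatrix fun a b => if (b : X) ∈ F then entry m a b else 0
    have hR : ∀ a b, R a b = if (b : X) ∈ F then entry m a b else 0 := fun _ _ => rfl
    have e1 : corner F m = CStarMatrix.ofMatrix fun i j =>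
        R (Set.inclusion hFG i) (Set.inclusion hFG j) := by
      ext i j
      exact (if_pos j.2).symm
    have e2 : star R * R = extZero F G hFG (corner F (star m * m)) := by
      ext a b
      change _ = extZeroFun F G (corner F (star m * m)) a b
      rw [extZeroFun_apply, CStarMatrix.mul_apply]
      simp only [CStarMatrix.star_apply, hR]
      by_cases ha : (a : X) ∈ F
      · by_cases hb : (b : X) ∈ F
        · simp only [ha, hb, dite_true, if_true]
          change _ = entry (star m * m) a b
          rw [entry_mul_eq_sum _ _ _ _ G (hG a ha)]
          exact Finset.sum_coe_sort G fun z => star (entry m z a) * entry m z b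
        · simp [hb]
      · simp [ha]
    calc matNorm (corner F m) ^ 2 ≤ matNorm R ^ 2 := by
          rw [e1]
          gcongr
          · exact matNorm_nonneg _
          · exact matNorm_submatrix_le _ (Set.inclusion_injective hFG) R
      _ = matNorm (star R * R) := by rw [sq, matNorm_star_mul_self]
      _ ≤ matNorm (corner F (star m * m)) := by rw [e2]; exact matNorm_hom_le _ _
      _ ≤ _ := matNorm_corner_le _ F
  calc _ ≤ √(opNorm (star m * m)) * √(opNorm (star m * m)) :=
        mul_self_le_mul_self (opNorm_nonneg m) h
    _ = _ := Real.mul_self_sqrt (opNorm_nonneg _)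

instance : SeminormedAddCommGroup (ControlledMatrix 𝓔 B) :=
  (opSeminorm 𝓔 B).toAddGroupSeminorm.toSeminormedAddCommGroup

theorem norm_def (m : ControlledMatrix 𝓔 B) : ‖m‖ = opNorm m := rfl

instance : NonUnitalSeminormedRing (ControlledMatrix 𝓔 B) where
  __ : NonUnitalRing (ControlledMatrix 𝓔 B) := inferInstance
  __ : SeminormedAddCommGroup (ControlledMatrix 𝓔 B) := inferInstance
  norm_mul_le := opNorm_mul_le

instance : NormedSpace ℂ (ControlledMatrix 𝓔 B) where
  __ : Module ℂ (ControlledMatrix 𝓔 B) := inferInstance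
  norm_smul_le c m := (map_smul_eq_mul (opSeminorm 𝓔 B) c m).le

instance : PreCStarAlgebra (ControlledMatrix 𝓔 B) where
  __ : NormedSpace ℂ (ControlledMatrix 𝓔 B) := inferInstance
  norm_star_mul_self' m := le_antisymm
    ((opNorm_mul_le _ _).trans (by rw [opNorm_star]; rfl)) (opNorm_mul_self_le m)
  smul_assoc := smul_assoc
  smul_comm := smul_comm
  star_smul := star_smul

theorem norm_entry_le (m : ControlledMatrix 𝓔 B) (x y : X) : ‖entry m x y‖ ≤ ‖m‖ := by
  classical
  exact (norm_entry_le_matNorm (corner {x, y} m) ⟨x, by simp⟩ ⟨y, by simp⟩).trans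
    (matNorm_corner_le m _)

variable {C : Type*} [NonUnitalCStarAlgebra C]

/-- Applying a ⋆-homomorphism to all entries of a matrix. -/
def map (φ : B →⋆ₙₐ[ℂ] C) : ControlledMatrix 𝓔 B →⋆ₙₐ[ℂ] ControlledMatrix 𝓔 C where
  toFun m := ofEntries (fun x y => φ (entry m x y))
    (𝓔.mono (fun p hp => show entry m p.1 p.2 ≠ 0 from fun h0 => hp (by simp [h0])) m.controlled)
    (by
      obtain ⟨K, _, hK⟩ := m.entry_bdd
      exact ⟨K, fun x y => (NonUnitalStarAlgHom.norm_apply_le φ _).trans (hK x y)⟩)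
  map_smul' c m := ext fun x y => map_smul φ c _
  map_zero' := ext fun x y => map_zero φ
  map_add' m n := ext fun x y => map_add φ _ _
  map_star' m := ext fun x y => map_star φ _
  map_mul' m n := ext fun x y => by
    have h : ∀ z, entry m x z ≠ 0 → z ∈ (m.row_finite x).toFinset := by simp
    change φ (entry (m * n) x y) = ∑ᶠ z, φ (entry m x z) * φ (entry n z y)
    rw [entry_mul_eq_sum _ _ x y _ h, map_sum,
      finsum_eq_sum (fun x z => φ (entry m x z)) (fun z y => φ (entry n z y)) x y
        (m.row_finite x).toFinset fun z hz => h z fun h0 => hz (by simp [h0])]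
    exact Finset.sum_congr rfl fun z _ => map_mul φ _ _

theorem entry_map (φ : B →⋆ₙₐ[ℂ] C) (m : ControlledMatrix 𝓔 B) (x y : X) :
    entry (map φ m) x y = φ (entry m x y) := rfl

theorem norm_map_le (φ : B →⋆ₙₐ[ℂ] C) (m : ControlledMatrix 𝓔 B) : ‖map φ m‖ ≤ ‖m‖ :=
  ciSup_le fun F => (matNorm_hom_le (CStarMatrix.mapₙₐ φ) (corner F m)).trans
    (matNorm_corner_le m F)

end ControlledMatrix

/-- The completion of the algebra of controlled matrices in the operator norm on `ℓ²(X, B)`. -/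
abbrev MatrixAlgebra {X : Type*} (𝓔 : SupportFamily X) (B : Type*) [NonUnitalCStarAlgebra B] :
    Type _ := CStarCompletion (ControlledMatrix 𝓔 B)

namespace MatrixAlgebra

open ControlledMatrix

variable {X : Type*} {𝓔 : SupportFamily X} {B C : Type*} [NonUnitalCStarAlgebra B]
  [NonUnitalCStarAlgebra C]

variable (𝓔 B) in
/-- The `(x, y)`-th matrix coefficient. -/
def coeffL (x y : X) : MatrixAlgebra 𝓔 B →L[ℂ] B :=
  CStarCompletion.liftCLM
    ({ toFun := fun m => entry m x y
       map_add' := fun _ _ => rfl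
       map_smul' := fun _ _ => rfl } : ControlledMatrix 𝓔 B →ₗ[ℂ] B) 1
    fun m => by rw [one_mul]; exact norm_entry_le m x y

/-- The `(x, y)`-th matrix coefficient. -/
def coeff (m : MatrixAlgebra 𝓔 B) (x y : X) : B := coeffL 𝓔 B x y m

theorem coeff_mk (m : ControlledMatrix 𝓔 B) (x y : X) :
    coeff (CStarCompletion.mk m) x y = entry m x y := CStarCompletion.liftCLM_mk _ _ _ m

theorem continuous_coeff (x y : X) : Continuous fun m : MatrixAlgebra 𝓔 B => coeff m x y :=
  (coeffL 𝓔 B x y).continuous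

theorem coeff_add (m n : MatrixAlgebra 𝓔 B) (x y : X) :
    coeff (m + n) x y = coeff m x y + coeff n x y := map_add _ m n
theorem coeff_smul (c : ℂ) (m : MatrixAlgebra 𝓔 B) (x y : X) :
    coeff (c • m) x y = c • coeff m x y := map_smul _ c m
theorem coeff_zero (x y : X) : coeff (0 : MatrixAlgebra 𝓔 B) x y = 0 := map_zero _

theorem coeff_star (m : MatrixAlgebra 𝓔 B) (x y : X) : coeff (star m) x y = star (coeff m y x) := by
  refine CStarCompletion.ind m (isClosed_eq ((continuous_coeff x y).comp continuous_star)
    (continuous_star.comp (continuous_coeff y x))) fun m => ?_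
  rw [← CStarCompletion.mk_star, coeff_mk, coeff_mk, entry_star]

theorem coeff_mk_mul (m : ControlledMatrix 𝓔 B) (n : MatrixAlgebra 𝓔 B) (x y : X) :
    coeff (CStarCompletion.mk m * n) x y =
      ∑ z ∈ (m.row_finite x).toFinset, entry m x z * coeff n z y := by
  refine CStarCompletion.ind n (isClosed_eq
    ((continuous_coeff x y).comp (continuous_const.mul continuous_id))
    (continuous_finsetSum _ fun z _ => continuous_const.mul (continuous_coeff z y))) fun n => ?_
  rw [← CStarCompletion.mk_mul, coeff_mk, entry_mul_eq_sum _ _ x y (m.row_finite x).toFinset (by simp)]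
  simp only [coeff_mk]

/-- Functoriality in the coefficient algebra. -/
def map (φ : B →⋆ₙₐ[ℂ] C) : MatrixAlgebra 𝓔 B →⋆ₙₐ[ℂ] MatrixAlgebra 𝓔 C :=
  CStarCompletion.lift (CStarCompletion.mkHom.comp (ControlledMatrix.map φ)) fun m => by
    change ‖CStarCompletion.mk (ControlledMatrix.map φ m)‖ ≤ _
    rw [CStarCompletion.norm_mk]; exact norm_map_le φ m

theorem map_mk (φ : B →⋆ₙₐ[ℂ] C) (m : ControlledMatrix 𝓔 B) :
    map φ (CStarCompletion.mk m) = CStarCompletion.mk (ControlledMatrix.map φ m) :=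
  CStarCompletion.lift_mk _ _ m

theorem coeff_map (φ : B →⋆ₙₐ[ℂ] C) (m : MatrixAlgebra 𝓔 B) (x y : X) :
    coeff (map φ m) x y = φ (coeff m x y) := by
  refine CStarCompletion.ind m (isClosed_eq ((continuous_coeff x y).comp (map_continuous (map φ)))
    ((map_continuous φ).comp (continuous_coeff x y))) fun m => ?_
  rw [map_mk, coeff_mk, coeff_mk, entry_map]

theorem map_id : map (NonUnitalStarAlgHom.id ℂ B) = NonUnitalStarAlgHom.id ℂ (MatrixAlgebra 𝓔 B) :=
  CStarCompletion.hom_ext fun m => map_mk _ m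

theorem map_comp {D : Type*} [NonUnitalCStarAlgebra D] (ψ : C →⋆ₙₐ[ℂ] D) (φ : B →⋆ₙₐ[ℂ] C) :
    (map (ψ.comp φ) : MatrixAlgebra 𝓔 B →⋆ₙₐ[ℂ] MatrixAlgebra 𝓔 D) = (map ψ).comp (map φ) :=
  CStarCompletion.hom_ext fun m => by
    rw [map_mk, NonUnitalStarAlgHom.comp_apply, map_mk, map_mk]; rfl

end MatrixAlgebra
end

/-! ### Compact matrices and uniform Roe algebras -/

noncomputable section

/-- Finite subsets of `X × X`. -/
def finiteSupports (X : Type*) : SupportFamily X where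
  IsControlled E := E.Finite
  empty := Set.finite_empty
  mono h hF := hF.subset h
  union hE hF := hE.union hF
  comp {E F} hE hF := by
    refine ((hE.image Prod.fst).prod (hF.image Prod.snd)).subset ?_
    rintro ⟨x, y⟩ ⟨z, h1, h2⟩
    exact ⟨⟨_, h1, rfl⟩, ⟨_, h2, rfl⟩⟩
  inv {E} hE := by
    refine (hE.image Prod.swap).subset ?_
    rintro ⟨x, y⟩ h
    exact ⟨(y, x), h, rfl⟩
  bdd {E} hE := ⟨E.ncard, fun x => by
    rw [← hE.cast_ncard_eq.symm]
    have hi : Function.Injective fun y : X => (x, y) := fun _ _ h => (Prod.mk.inj h).2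
    rw [← hi.encard_image]
    refine Set.encard_le_encard ?_
    rintro _ ⟨y, hy, rfl⟩
    exact hy⟩

/-- The algebra `𝕂 B` of compact `ℕ`-by-`ℕ` matrices with entries in `B`. -/
abbrev CompactMatrices (B : Type*) [NonUnitalCStarAlgebra B] : Type _ :=
  MatrixAlgebra (finiteSupports ℕ) B

/-- The matrix with the only non-zero entry `b`, in the upper left corner. -/
def cornerMatrix {B : Type*} [NonUnitalCStarAlgebra B] (b : B) :
    ControlledMatrix (finiteSupports ℕ) B :=
  ControlledMatrix.ofEntries (fun i j => if i = 0 ∧ j = 0 then b else 0)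
    ((Set.finite_singleton ((0, 0) : ℕ × ℕ)).subset (by
      rintro ⟨i, j⟩ h
      by_contra h0
      exact h (if_neg fun h' => h0 (Prod.ext h'.1 h'.2))))
    ⟨‖b‖, fun i j => by split_ifs <;> simp⟩

theorem entry_cornerMatrix {B : Type*} [NonUnitalCStarAlgebra B] (b : B) (i j : ℕ) :
    ControlledMatrix.entry (cornerMatrix b) i j = if i = 0 ∧ j = 0 then b else 0 := rfl

open ControlledMatrix in
/-- The corner embedding `b ↦ diag (b, 0, 0, …)`. -/
def cornerEmbedding (B : Type*) [NonUnitalCStarAlgebra B] : B →⋆ₙₐ[ℂ] CompactMatrices B :=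
  CStarCompletion.mkHom.comp
    { toFun := cornerMatrix
      map_smul' := fun c b => ControlledMatrix.ext fun i j => by
        simp only [entry_cornerMatrix, entry_smul, MonoidHom.id_apply]; split_ifs <;> simp
      map_zero' := ControlledMatrix.ext fun i j => by
        simp only [entry_cornerMatrix, entry_zero]; split_ifs <;> simp
      map_add' := fun b c => ControlledMatrix.ext fun i j => by
        simp only [entry_cornerMatrix, entry_add]; split_ifs <;> simp
      map_star' := fun b => ControlledMatrix.ext fun i j => by
        simp only [entry_cornerMatrix, entry_star, and_comm]; split_ifs <;> simp
      map_mul' := fun b c => ControlledMatrix.ext fun i j => by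
        rw [entry_mul_eq_sum _ _ i j {0} fun z hz => by
          by_contra h
          exact hz (if_neg fun h' => h (by simp [h'.2]))]
        simp only [entry_cornerMatrix, Finset.sum_singleton]
        by_cases hi : i = 0 <;> by_cases hj : j = 0 <;> simp [hi, hj] }

theorem cornerEmbedding_apply {B : Type*} [NonUnitalCStarAlgebra B] (b : B) :
    cornerEmbedding B b = CStarCompletion.mk (cornerMatrix b) := rfl

theorem map_cornerEmbedding {B C : Type*} [NonUnitalCStarAlgebra B] [NonUnitalCStarAlgebra C]
    (φ : B →⋆ₙₐ[ℂ] C) (b : B) :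
    MatrixAlgebra.map φ (cornerEmbedding B b) = cornerEmbedding C (φ b) := by
  rw [cornerEmbedding_apply, MatrixAlgebra.map_mk, cornerEmbedding_apply]
  congr 1
  refine ControlledMatrix.ext fun i j => ?_
  rw [ControlledMatrix.entry_map, entry_cornerMatrix, entry_cornerMatrix]
  split_ifs <;> simp

/-- Bounded geometry: for every `R`, the `R`-balls have uniformly bounded cardinalities. -/
def BoundedGeometry (X : Type*) [MetricSpace X] : Prop :=
  ∀ R : ℝ, ∃ N : ℕ, ∀ x : X, (Metric.ball x R).encard ≤ N

section Roe

variable {X : Type*} [MetricSpace X] (hX : BoundedGeometry X)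

/-- Sets of finite propagation: `dist x y ≤ R` for all `(x, y) ∈ E`, for some `R`. -/
def finitePropagation : SupportFamily X where
  IsControlled E := ∃ R : ℝ, ∀ p ∈ E, dist p.1 p.2 ≤ R
  empty := ⟨0, by simp⟩
  mono := fun h ⟨R, hR⟩ => ⟨R, fun p hp => hR p (h hp)⟩
  union := fun ⟨R, hR⟩ ⟨S, hS⟩ => ⟨max R S, fun p hp => hp.elim
    (fun h => (hR p h).trans (le_max_left _ _)) fun h => (hS p h).trans (le_max_right _ _)⟩
  comp := fun ⟨R, hR⟩ ⟨S, hS⟩ => ⟨R + S, fun p ⟨z, h1, h2⟩ =>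
    (dist_triangle p.1 z p.2).trans (add_le_add (hR _ h1) (hS _ h2))⟩
  inv := fun ⟨R, hR⟩ => ⟨R, fun p hp => by rw [dist_comm]; exact hR _ hp⟩
  bdd := fun ⟨R, hR⟩ => by
    obtain ⟨N, hN⟩ := hX (R + 1)
    refine ⟨N, fun x => (Set.encard_le_encard fun y hy => ?_).trans (hN x)⟩
    rw [Metric.mem_ball, dist_comm]
    exact (hR _ hy).trans_lt (lt_add_one R)

/-- The uniform Roe algebra of `X` with coefficients in `B`. -/
abbrev UniformRoe (B : Type*) [NonUnitalCStarAlgebra B] : Type _ :=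
  MatrixAlgebra (finitePropagation hX) B

/-- The `R`-neighbourhood of `X₀`. -/
def nbhdOf (X₀ : Set X) (R : ℝ) : Set X := {x | ∃ z ∈ X₀, dist x z < R}

theorem nbhdOf_mono (X₀ : Set X) {R S : ℝ} (h : R ≤ S) : nbhdOf X₀ R ⊆ nbhdOf X₀ S :=
  fun _ ⟨z, hz, hd⟩ => ⟨z, hz, hd.trans_le h⟩

variable (X₀ : Set X) (B : Type*) [NonUnitalCStarAlgebra B]

/-- The elements of the uniform Roe algebra with support in `N_R(X₀) × N_R(X₀)` for some `R`. -/
def supportedNear : Submodule ℂ (UniformRoe hX B) where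
  carrier := {m | ∃ R : ℝ, ∀ x y, MatrixAlgebra.coeff m x y ≠ 0 → x ∈ nbhdOf X₀ R ∧ y ∈ nbhdOf X₀ R}
  zero_mem' := ⟨0, fun x y h => (h (MatrixAlgebra.coeff_zero x y)).elim⟩
  add_mem' := by
    rintro m n ⟨R, hR⟩ ⟨S, hS⟩
    refine ⟨max R S, fun x y h => ?_⟩
    by_cases h0 : MatrixAlgebra.coeff m x y = 0
    · rw [MatrixAlgebra.coeff_add, h0, zero_add] at h
      exact (hS x y h).imp (fun h => nbhdOf_mono X₀ (le_max_right R S) h)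
        (fun h => nbhdOf_mono X₀ (le_max_right R S) h)
    · exact (hR x y h0).imp (fun h => nbhdOf_mono X₀ (le_max_left R S) h)
        (fun h => nbhdOf_mono X₀ (le_max_left R S) h)
  smul_mem' := by
    rintro c m ⟨R, hR⟩
    refine ⟨R, fun x y h => hR x y fun h0 => h ?_⟩
    rw [MatrixAlgebra.coeff_smul, h0, smul_zero]

variable {X₀ B}

theorem star_mem_supportedNear {m : UniformRoe hX B} (hm : m ∈ supportedNear hX X₀ B) :
    star m ∈ supportedNear hX X₀ B := by
  obtain ⟨R, hR⟩ := hm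
  refine ⟨R, fun x y h => (hR y x fun h0 => h ?_).symm⟩
  rw [MatrixAlgebra.coeff_star, h0, star_zero]

theorem mk_mul_mem_supportedNear (a : ControlledMatrix (finitePropagation hX) B)
    {m : UniformRoe hX B} (hm : m ∈ supportedNear hX X₀ B) :
    CStarCompletion.mk a * m ∈ supportedNear hX X₀ B := by
  obtain ⟨R, hR⟩ := hm
  obtain ⟨S, hS⟩ := a.controlled
  refine ⟨|S| + R, fun x y h => ?_⟩
  rw [MatrixAlgebra.coeff_mk_mul] at h
  obtain ⟨z, -, hz⟩ := Finset.exists_ne_zero_of_sum_ne_zero h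
  obtain ⟨⟨w, hw, hd⟩, hy⟩ := hR z y (right_ne_zero_of_mul hz)
  refine ⟨⟨w, hw, ?_⟩, nbhdOf_mono X₀ (by linarith [abs_nonneg S]) hy⟩
  have h1 : dist x z ≤ S := hS (x, z) (left_ne_zero_of_mul hz)
  linarith [dist_triangle x z w, le_abs_self S]

theorem mul_mem_closure_supportedNear (a m : UniformRoe hX B)
    (hm : m ∈ closure (supportedNear hX X₀ B : Set (UniformRoe hX B))) :
    a * m ∈ closure (supportedNear hX X₀ B : Set (UniformRoe hX B)) := by
  refine CStarCompletion.ind a (isClosed_closure.preimage (continuous_id.mul continuous_const))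
    fun a => ?_
  exact map_mem_closure (f := fun m => CStarCompletion.mk a * m)
    (continuous_const.mul continuous_id) hm fun m hm => mk_mul_mem_supportedNear hX a hm

theorem star_mem_closure_supportedNear (m : UniformRoe hX B)
    (hm : m ∈ closure (supportedNear hX X₀ B : Set (UniformRoe hX B))) :
    star m ∈ closure (supportedNear hX X₀ B : Set (UniformRoe hX B)) :=
  map_mem_closure continuous_star hm fun _ h => star_mem_supportedNear hX h

variable (X₀ B) in
/-- The closed ideal of the uniform Roe algebra spanned by the elements supported near `X₀`. -/
def relativeIdeal : CStarIdeal (UniformRoe hX B) where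
  __ := (supportedNear hX X₀ B).topologicalClosure
  isClosed' := (supportedNear hX X₀ B).isClosed_topologicalClosure
  mul_left' a m hm := mul_mem_closure_supportedNear hX a m hm
  mul_right' a m hm := by
    have h := star_mem_closure_supportedNear hX _ (mul_mem_closure_supportedNear hX (star a) _
      (star_mem_closure_supportedNear hX m hm))
    rwa [star_mul, star_star, star_star] at h
  star' m hm := star_mem_closure_supportedNear hX m hm

variable (X₀ B) in
/-- The relative uniform Roe algebra. -/
abbrev RelativeRoe : Type _ := (relativeIdeal hX X₀ B).Quot

theorem map_mem_relativeIdeal {C : Type*} [NonUnitalCStarAlgebra C] (φ : B →⋆ₙₐ[ℂ] C)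
    (m : UniformRoe hX B) (hm : m ∈ (relativeIdeal hX X₀ B).toSubmodule) :
    MatrixAlgebra.map φ m ∈ (relativeIdeal hX X₀ C).toSubmodule := by
  refine map_mem_closure (map_continuous (MatrixAlgebra.map φ)) hm fun m hm => ?_
  obtain ⟨R, hR⟩ := hm
  refine ⟨R, fun x y h => hR x y fun h0 => h ?_⟩
  rw [MatrixAlgebra.coeff_map, h0, map_zero]

variable (X₀) in
/-- Functoriality of the relative uniform Roe algebra. -/
def RelativeRoe.map {C : Type*} [NonUnitalCStarAlgebra C] (φ : B →⋆ₙₐ[ℂ] C) :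
    RelativeRoe hX X₀ B →⋆ₙₐ[ℂ] RelativeRoe hX X₀ C :=
  CStarIdeal.mapHom _ _ (MatrixAlgebra.map φ) (map_mem_relativeIdeal hX φ)

end Roe
end

/-! ### The category of C⋆-algebras and its endofunctors -/

noncomputable section

/-- The category of (not necessarily unital) C⋆-algebras and ⋆-homomorphisms. -/
structure CStar : Type (u + 1) where
  carrier : Type u
  [str : NonUnitalCStarAlgebra carrier]

namespace CStar

attribute [instance] CStar.str

instance : CoeSort CStar.{u} (Type u) := ⟨CStar.carrier⟩

instance : Category CStar.{u} where
  Hom A B := A →⋆ₙₐ[ℂ] B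
  id A := NonUnitalStarAlgHom.id ℂ A
  comp f g := g.comp f

instance : ConcreteCategory CStar.{u} (fun A B => A →⋆ₙₐ[ℂ] B) where
  hom f := f
  ofHom f := f

theorem hom_ext {A B : CStar.{u}} {f g : A ⟶ B} (h : ∀ a, f a = g a) : f = g :=
  NonUnitalStarAlgHom.ext h

end CStar

/-- Endofunctors of the category of C⋆-algebras. -/
abbrev CStarEndo := CStar.{u} ⥤ CStar.{u}

/-! The endofunctors `𝔇_A = A ⊗ –`. -/

/-- The maximal tensor product as an object of the category. -/
def tensorObj (A B : CStar.{u}) : CStar.{u} := ⟨MaxTensor A B⟩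

/-- The endofunctor `𝔇_A = A ⊗ –`. -/
def tensorFunctor (A : CStar.{u}) : CStarEndo.{u} where
  obj B := tensorObj A B
  map φ := MaxTensor.map (NonUnitalStarAlgHom.id ℂ A) φ
  map_id _ := MaxTensor.map_id
  map_comp φ ψ := (MaxTensor.map_comp (NonUnitalStarAlgHom.id ℂ A) φ
    (NonUnitalStarAlgHom.id ℂ A) ψ).symm

/-- The natural transformation `𝔇_φ : 𝔇_A ⟶ 𝔇_A'`. -/
def tensorFunctorMap {A A' : CStar.{u}} (φ : A ⟶ A') : tensorFunctor A ⟶ tensorFunctor A' where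
  app B := MaxTensor.map φ (NonUnitalStarAlgHom.id ℂ B)
  naturality B C ψ :=
    (MaxTensor.map_comp (NonUnitalStarAlgHom.id ℂ A) ψ φ (NonUnitalStarAlgHom.id ℂ C)).trans
      (MaxTensor.map_comp φ (NonUnitalStarAlgHom.id ℂ B) (NonUnitalStarAlgHom.id ℂ A') ψ).symm

/-- The map `A ⊗ (A' ⊗ B) → (A ⊗ A') ⊗ B`. -/
def tensorAssoc (A A' B : CStar.{u}) :
    (tensorFunctor A).obj ((tensorFunctor A').obj B) ⟶ (tensorFunctor (tensorObj A A')).obj B :=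
  MaxTensor.assocInv (A := A) (B := A') (C := B)

/-- The C⋆-algebra of complex numbers, in the universe `u`. -/
def complexObj : CStar.{u} := ⟨PUnit.{u + 1} → ℂ⟩

/-- The map `B → ℂ ⊗ B`, `b ↦ 1 ⊗ b`. -/
def tensorUnit (B : CStar.{u}) : B ⟶ (tensorFunctor complexObj.{u}).obj B :=
  MaxTensor.unitMap B

/-! Good endofunctors. -/

/-- Decent endofunctors: they preserve pullbacks along split epimorphisms and zero objects. -/
structure IsDecent (F : CStarEndo.{u}) : Prop where
  pullback : ∀ {P B₁ B₂ B : CStar.{u}} (p₁ : P ⟶ B₁) (p₂ : P ⟶ B₂) (φ₁ : B₁ ⟶ B) (φ₂ : B₂ ⟶ B),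
    IsSplitEpi φ₂ → IsPullback p₁ p₂ φ₁ φ₂ →
      IsPullback (F.map p₁) (F.map p₂) (F.map φ₁) (F.map φ₂)
  zero : ∀ Z : CStar.{u}, Limits.IsZero Z → Limits.IsZero (F.obj Z)

/-- The structure of a good endofunctor on `F`: a labeling
`κ A : 𝔇_A F ⟶ F 𝔇_A`, natural in `A` and compatible with `A ⊗ (A' ⊗ –) → (A ⊗ A') ⊗ –` and
`Id → ℂ ⊗ –`, where `F` is decent. -/
structure GoodStructure (F : CStarEndo.{u}) where
  κ : ∀ A : CStar.{u}, F ⋙ tensorFunctor A ⟶ tensorFunctor A ⋙ F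
  natural : ∀ {A A' : CStar.{u}} (φ : A ⟶ A') (B : CStar.{u}),
    (κ A).app B ≫ F.map ((tensorFunctorMap φ).app B) =
      (tensorFunctorMap φ).app (F.obj B) ≫ (κ A').app B
  assoc : ∀ A A' B : CStar.{u},
    (tensorFunctor A).map ((κ A').app B) ≫ (κ A).app ((tensorFunctor A').obj B) ≫
      F.map (tensorAssoc A A' B) = tensorAssoc A A' (F.obj B) ≫ (κ (tensorObj A A')).app B
  unit : ∀ B : CStar.{u}, tensorUnit (F.obj B) ≫ (κ complexObj).app B = F.map (tensorUnit B)
  decent : IsDecent F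

namespace GoodStructure

/-- The identity functor as a good endofunctor. -/
def id : GoodStructure (𝟭 CStar.{u}) where
  κ A := { app := fun B => 𝟙 _ }
  natural φ B := (Category.id_comp _).trans (Category.comp_id _).symm
  assoc A A' B := by
    refine Eq.trans ?_ (Category.comp_id _).symm
    refine Eq.trans (congrArg (· ≫ _) ((tensorFunctor A).map_id _)) ?_
    exact (Category.id_comp _).trans (Category.id_comp _)
  unit B := Category.comp_id _
  decent := ⟨fun _ _ _ _ _ h => h, fun _ h => h⟩

variable {F G : CStarEndo.{u}}

/-- The composite of good endofunctors: first `F`, then `G`. -/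
def comp (gF : GoodStructure F) (gG : GoodStructure G) : GoodStructure (F ⋙ G) where
  κ A :=
    { app := fun B => (gG.κ A).app (F.obj B) ≫ G.map ((gF.κ A).app B)
      naturality := fun B C φ => by
        have h1 := (gG.κ A).naturality (F.map φ)
        have h2 := (gF.κ A).naturality φ
        simp only [Functor.comp_map, Functor.comp_obj] at h1 h2 ⊢
        rw [reassoc_of% h1, ← G.map_comp, h2, G.map_comp, Category.assoc] }
  natural φ B := by
    have h1 := gG.natural φ (F.obj B)
    have h2 := gF.natural φ B
    simp only [Functor.comp_map, Functor.comp_obj, Category.assoc] at h1 h2 ⊢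
    rw [← G.map_comp, h2, G.map_comp, reassoc_of% h1]
  assoc A A' B := by
    have h1 := gG.assoc A A' (F.obj B)
    have h2 := gF.assoc A A' B
    have h3 := (gG.κ A).naturality ((gF.κ A').app B)
    simp only [Functor.comp_map, Functor.comp_obj, Functor.map_comp, Category.assoc] at h1 h2 h3 ⊢
    rw [reassoc_of% h3, ← G.map_comp, ← G.map_comp, h2, G.map_comp, reassoc_of% h1]
  unit B := by
    have h1 := gG.unit (F.obj B)
    have h2 := gF.unit B
    simp only [Functor.comp_map, Functor.comp_obj] at h1 h2 ⊢
    rw [reassoc_of% h1, ← G.map_comp, h2]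
  decent :=
    ⟨fun p₁ p₂ φ₁ φ₂ hs h => gG.decent.pullback _ _ _ _ (inferInstanceAs (IsSplitEpi (F.map φ₂)))
        (gF.decent.pullback p₁ p₂ φ₁ φ₂ hs h),
      fun Z hZ => gG.decent.zero _ (gF.decent.zero Z hZ)⟩

end GoodStructure

/-- Labeled natural transformations. -/
def IsLabeled {F G : CStarEndo.{u}} (gF : GoodStructure F) (gG : GoodStructure G) (γ : F ⟶ G) :
    Prop :=
  ∀ A B : CStar.{u}, (tensorFunctor A).map (γ.app B) ≫ (gG.κ A).app B =
    (gF.κ A).app B ≫ γ.app ((tensorFunctor A).obj B)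

end

/-! ### Function algebras and the asymptotic algebra -/

noncomputable section

section Functions

variable {B C D : Type*} [NonUnitalCStarAlgebra B] [NonUnitalCStarAlgebra C]
  [NonUnitalCStarAlgebra D]

/-- The map `C([0,1], B) → C([0,1], C)` induced by a ⋆-homomorphism. -/
def cylinderMap (φ : B →⋆ₙₐ[ℂ] C) : C(unitInterval, B) →⋆ₙₐ[ℂ] C(unitInterval, C) where
  toFun f := ⟨fun t => φ (f t), (map_continuous φ).comp f.continuous⟩
  map_smul' c f := ContinuousMap.ext fun t => map_smul φ c (f t)
  map_zero' := ContinuousMap.ext fun _ => map_zero φ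
  map_add' f g := ContinuousMap.ext fun t => map_add φ (f t) (g t)
  map_mul' f g := ContinuousMap.ext fun t => map_mul φ (f t) (g t)
  map_star' f := ContinuousMap.ext fun t => map_star φ (f t)

variable (B) in
/-- Evaluation at `t ∈ [0,1]`. -/
def cylinderEval (t : unitInterval) : C(unitInterval, B) →⋆ₙₐ[ℂ] B where
  toFun f := f t
  map_smul' _ _ := rfl
  map_zero' := rfl
  map_add' _ _ := rfl
  map_mul' _ _ := rfl
  map_star' _ := rfl

/-- The map `C_b([0,∞), B) → C_b([0,∞), C)` induced by a ⋆-homomorphism. -/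
def bddMap (φ : B →⋆ₙₐ[ℂ] C) : (ℝ≥0 →ᵇ B) →⋆ₙₐ[ℂ] (ℝ≥0 →ᵇ C) where
  toFun f := BoundedContinuousFunction.ofNormedAddCommGroup (fun t => φ (f t))
    ((map_continuous φ).comp f.continuous) ‖f‖
    fun t => (NonUnitalStarAlgHom.norm_apply_le φ (f t)).trans (f.norm_coe_le_norm t)
  map_smul' c f := BoundedContinuousFunction.ext fun t => map_smul φ c (f t)
  map_zero' := BoundedContinuousFunction.ext fun _ => map_zero φ
  map_add' f g := BoundedContinuousFunction.ext fun t => map_add φ (f t) (g t)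
  map_mul' f g := BoundedContinuousFunction.ext fun t => map_mul φ (f t) (g t)
  map_star' f := BoundedContinuousFunction.ext fun t => map_star φ (f t)

variable (B) in
/-- The ideal `C_0([0,∞), B)` of `C_b([0,∞), B)`. -/
def vanishingIdeal : CStarIdeal (ℝ≥0 →ᵇ B) where
  carrier := {f | Tendsto f atTop (𝓝 0)}
  zero_mem' := tendsto_const_nhds
  add_mem' {f g} hf hg := by
    have h := Tendsto.add hf hg
    rw [add_zero] at h
    exact h
  smul_mem' c f hf := by simpa using Tendsto.const_smul hf c
  isClosed' := by
    refine isClosed_of_closure_subset fun f hf => ?_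
    refine Metric.tendsto_nhds.2 fun ε hε => ?_
    obtain ⟨g, hg, hd⟩ := Metric.mem_closure_iff.1 hf (ε / 2) (half_pos hε)
    filter_upwards [Metric.tendsto_nhds.1 hg (ε / 2) (half_pos hε)] with t ht
    calc dist (f t) 0 ≤ dist (f t) (g t) + dist (g t) 0 := dist_triangle _ _ _
      _ < ε / 2 + ε / 2 := add_lt_add ((f.dist_coe_le_dist t).trans_lt hd) ht
      _ = ε := add_halves ε
  mul_left' a f hf := by
    refine squeeze_zero_norm (a := fun t => ‖a‖ * ‖f t‖) (fun t => ?_) ?_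
    · exact (norm_mul_le _ _).trans
        (mul_le_mul_of_nonneg_right (a.norm_coe_le_norm t) (norm_nonneg _))
    · simpa using (Tendsto.norm hf).const_mul ‖a‖
  mul_right' a f hf := by
    refine squeeze_zero_norm (a := fun t => ‖f t‖ * ‖a‖) (fun t => ?_) ?_
    · exact (norm_mul_le _ _).trans
        (mul_le_mul_of_nonneg_left (a.norm_coe_le_norm t) (norm_nonneg _))
    · simpa using (Tendsto.norm hf).mul_const ‖a‖
  star' f hf := by
    have h := Tendsto.star hf
    rw [star_zero] at h
    exact h

variable (B) in
/-- The asymptotic algebra `𝔄 B = C_b([0,∞), B) / C_0([0,∞), B)`. -/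
abbrev AsymptoticAlgebra : Type _ := (vanishingIdeal B).Quot

/-- The class of a function in the asymptotic algebra. -/
def asClass (f : ℝ≥0 →ᵇ B) : AsymptoticAlgebra B := (vanishingIdeal B).proj f

/-- Functoriality of the asymptotic algebra. -/
def asymptoticMap (φ : B →⋆ₙₐ[ℂ] C) : AsymptoticAlgebra B →⋆ₙₐ[ℂ] AsymptoticAlgebra C :=
  CStarIdeal.mapHom _ _ (bddMap φ) fun f hf => by
    have h := ((map_continuous φ).tendsto 0).comp (show Tendsto f atTop (𝓝 0) from hf)
    rw [map_zero] at h
    exact h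

variable (B) in
/-- The map `B → 𝔄 B` given by constant functions. -/
def asConst : B →⋆ₙₐ[ℂ] AsymptoticAlgebra B :=
  (vanishingIdeal B).projHom.comp
    { toFun := fun b => BoundedContinuousFunction.const ℝ≥0 b
      map_smul' := fun _ _ => rfl
      map_zero' := rfl
      map_add' := fun _ _ => rfl
      map_mul' := fun _ _ => rfl
      map_star' := fun _ => rfl }

variable {𝒳 : Type*} [MetricSpace 𝒳] (𝒳₀ : Set 𝒳)

variable (B) in
/-- The algebra `C₀(𝒳, 𝒳₀, B)` of functions in `C₀(𝒳, B)` which vanish on `𝒳₀`. -/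
def relC0 : NonUnitalStarSubalgebra ℂ C₀(𝒳, B) where
  carrier := {f | ∀ z ∈ 𝒳₀, f z = 0}
  zero_mem' _ _ := rfl
  add_mem' {f g} hf hg z hz := by simp [hf z hz, hg z hz]
  mul_mem' {f g} hf hg z hz := by simp [hf z hz]
  smul_mem' c f hf z hz := by simp [hf z hz]
  star_mem' {f} hf z hz := by simp [hf z hz]

instance : IsClosed (relC0 B 𝒳₀ : Set C₀(𝒳, B)) := by
  have : (relC0 B 𝒳₀ : Set C₀(𝒳, B)) = ⋂ z ∈ 𝒳₀, {f : C₀(𝒳, B) | f z = 0} := by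
    ext f; simp only [Set.mem_iInter]; exact Iff.rfl
  rw [this]
  refine isClosed_biInter fun z _ => isClosed_eq ?_ continuous_const
  exact (continuous_eval_const (F := 𝒳 →ᵇ B) z).comp
    ZeroAtInftyContinuousMap.isometry_toBCF.continuous

/-- Functoriality of `C₀(𝒳, 𝒳₀, –)`. -/
def relC0Map (φ : B →⋆ₙₐ[ℂ] C) : relC0 B 𝒳₀ →⋆ₙₐ[ℂ] relC0 C 𝒳₀ where
  toFun f := ⟨⟨⟨fun z => φ (f.1 z), (map_continuous φ).comp f.1.continuous⟩, by
      have h := ((map_continuous φ).tendsto 0).comp f.1.zero_at_infty'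
      rw [map_zero] at h
      exact h⟩, fun z hz => by
      change φ (f.1 z) = 0
      rw [f.2 z hz, map_zero]⟩
  map_smul' c f := Subtype.ext (ZeroAtInftyContinuousMap.ext fun z => map_smul φ c (f.1 z))
  map_zero' := Subtype.ext (ZeroAtInftyContinuousMap.ext fun _ => map_zero φ)
  map_add' f g := Subtype.ext (ZeroAtInftyContinuousMap.ext fun z => map_add φ (f.1 z) (g.1 z))
  map_mul' f g := Subtype.ext (ZeroAtInftyContinuousMap.ext fun z => map_mul φ (f.1 z) (g.1 z))
  map_star' f := Subtype.ext (ZeroAtInftyContinuousMap.ext fun z => map_star φ (f.1 z))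

/-- The function `f ⊗ b : z ↦ f z • b`. -/
def relC0Tensor (f : relC0 ℂ 𝒳₀) (b : B) : relC0 B 𝒳₀ :=
  ⟨⟨⟨fun z => f.1 z • b, f.1.continuous.smul continuous_const⟩, by
      have h := (show Tendsto f.1 _ (𝓝 0) from f.1.zero_at_infty').smul_const b
      rw [zero_smul] at h
      exact h⟩, fun z hz => by
      change f.1 z • b = 0
      rw [f.2 z hz, zero_smul]⟩

end Functions

/-! The endofunctors. -/

/-- The cylinder functor `I`. -/
def cylinderFunctor : CStarEndo.{u} where
  obj B := ⟨C(unitInterval, B)⟩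
  map φ := cylinderMap φ
  map_id _ := rfl
  map_comp _ _ := rfl

/-- Evaluation at `t`, as a morphism `I B ⟶ B`. -/
def evalAt (t : unitInterval) (B : CStar.{u}) : cylinderFunctor.obj B ⟶ B := cylinderEval B t

/-- The asymptotic algebra functor `𝔄`. -/
def asymptoticFunctor : CStarEndo.{u} where
  obj B := ⟨AsymptoticAlgebra B⟩
  map φ := asymptoticMap φ
  map_id B := NonUnitalStarAlgHom.ext fun x => by
    obtain ⟨f, rfl⟩ := CStarIdeal.proj_surjective x
    rfl
  map_comp φ ψ := NonUnitalStarAlgHom.ext fun x => by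
    obtain ⟨f, rfl⟩ := CStarIdeal.proj_surjective x
    rfl

/-- The stabilization functor `𝕂`. -/
def compactFunctor : CStarEndo.{u} where
  obj B := ⟨CompactMatrices B⟩
  map φ := MatrixAlgebra.map φ
  map_id _ := MatrixAlgebra.map_id
  map_comp φ ψ := MatrixAlgebra.map_comp ψ φ

/-- The functor `C₀(𝒳, 𝒳₀, –)`. -/
def relC0Functor {𝒳 : Type u} [MetricSpace 𝒳] (𝒳₀ : Set 𝒳) : CStarEndo.{u} where
  obj B := ⟨relC0 B 𝒳₀⟩
  map φ := relC0Map 𝒳₀ φ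
  map_id _ := rfl
  map_comp _ _ := rfl

/-- The relative uniform Roe functor `𝔑^u_{X, X₀}`. -/
def relRoeFunctor {X : Type u} [MetricSpace X] (hX : BoundedGeometry X) (X₀ : Set X) :
    CStarEndo.{u} where
  obj B := ⟨RelativeRoe hX X₀ B⟩
  map φ := RelativeRoe.map hX X₀ φ
  map_id B := NonUnitalStarAlgHom.ext fun x => by
    obtain ⟨m, rfl⟩ := CStarIdeal.proj_surjective x
    exact congrArg _ (congrArg (fun g => g m) MatrixAlgebra.map_id)
  map_comp φ ψ := NonUnitalStarAlgHom.ext fun x => by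
    obtain ⟨m, rfl⟩ := CStarIdeal.proj_surjective x
    exact congrArg _ (congrArg (fun g => g m) (MatrixAlgebra.map_comp ψ φ))

/-- The natural transformation `αι₀₀ : Id ⟶ 𝔄𝕂`, which sends `b` to the class of the constant
function with value `diag (b, 0, 0, …)`. -/
def alphaIota : 𝟭 CStar.{u} ⟶ compactFunctor ⋙ asymptoticFunctor where
  app B := (asConst (CompactMatrices B)).comp (cornerEmbedding B)
  naturality B C φ := NonUnitalStarAlgHom.ext fun b => by
    have h := map_cornerEmbedding φ b
    exact congrArg (asConst (CompactMatrices C)) h.symm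

end

/-! ### Homotopies and asymptotic adjunctions -/

noncomputable section

/-- Homotopy of labeled natural transformations: they are the endpoints of a labeled natural
transformation into `G I`, where `I` is the cylinder functor (with the good structure `gI`). -/
def LabeledHomotopic (gI : GoodStructure cylinderFunctor.{u}) {F G : CStarEndo.{u}}
    (gF : GoodStructure F) (gG : GoodStructure G) (γ₀ γ₁ : F ⟶ G) : Prop :=
  IsLabeled gF gG γ₀ ∧ IsLabeled gF gG γ₁ ∧
    ∃ Γ : F ⟶ cylinderFunctor ⋙ G, IsLabeled gF (gI.comp gG) Γ ∧
      (∀ B : CStar.{u}, Γ.app B ≫ G.map (evalAt 0 B) = γ₀.app B) ∧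
      ∀ B : CStar.{u}, Γ.app B ≫ G.map (evalAt 1 B) = γ₁.app B

section Adjunction

variable {S N : CStarEndo.{u}} (η : 𝟭 CStar.{u} ⟶ S ⋙ N)
  (ε : N ⋙ S ⟶ compactFunctor.{u} ⋙ asymptoticFunctor)

/-- The composite `S ⟶ S N S ⟶ 𝔄 𝕂 S` of `S η` and `ε S`. -/
def leftTriangle : S ⟶ S ⋙ (compactFunctor.{u} ⋙ asymptoticFunctor) where
  app B := S.map (η.app B) ≫ ε.app (S.obj B)
  naturality B C φ := by
    have h1 := η.naturality φ
    have h2 := ε.naturality (S.map φ)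
    simp only [Functor.comp_map, Functor.comp_obj, Functor.id_map] at h1 h2 ⊢
    rw [← Category.assoc, ← S.map_comp, h1, S.map_comp, Category.assoc, h2, Category.assoc]

/-- The composite `N ⟶ N S N ⟶ N 𝔄 𝕂` of `η N` and `N ε`. -/
def rightTriangle : N ⟶ (compactFunctor.{u} ⋙ asymptoticFunctor) ⋙ N where
  app B := η.app (N.obj B) ≫ N.map (ε.app B)
  naturality B C φ := by
    have h1 := η.naturality (N.map φ)
    have h2 := ε.naturality φ
    simp only [Functor.comp_map, Functor.comp_obj, Functor.id_map] at h1 h2 ⊢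
    rw [← Category.assoc, h1, Category.assoc, ← N.map_comp, h2, N.map_comp, Category.assoc]

variable (S N) in
/-- The natural transformation `αι₀₀ S : S ⟶ 𝔄 𝕂 S`. -/
def alphaIotaLeft : S ⟶ S ⋙ (compactFunctor.{u} ⋙ asymptoticFunctor) where
  app B := alphaIota.app (S.obj B)
  naturality _ _ φ := alphaIota.naturality (S.map φ)

variable (S N) in
/-- The natural transformation `N αι₀₀ : N ⟶ N 𝔄 𝕂`. -/
def alphaIotaRight : N ⟶ (compactFunctor.{u} ⋙ asymptoticFunctor) ⋙ N where
  app B := N.map (alphaIota.app B)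
  naturality B C φ := by
    have h := alphaIota.naturality φ
    simp only [Functor.comp_map, Functor.comp_obj, Functor.id_map] at h ⊢
    rw [← N.map_comp, h, N.map_comp]

/-- The natural transformations `η : Id ⟶ N S` and `ε : S N ⟶ 𝔄 𝕂` are labeled and are the unit
and the counit of an asymptotic adjunction between `S` and `N`: both triangle diagrams commute up
to labeled homotopy. -/
structure IsAsymptoticAdjunction (gI : GoodStructure cylinderFunctor.{u})
    (gA : GoodStructure asymptoticFunctor.{u}) (gK : GoodStructure compactFunctor.{u})
    (gS : GoodStructure S) (gN : GoodStructure N) : Prop where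
  unit_labeled : IsLabeled GoodStructure.id (gS.comp gN) η
  counit_labeled : IsLabeled (gN.comp gS) (gK.comp gA) ε
  left_triangle : LabeledHomotopic gI gS (gS.comp (gK.comp gA)) (leftTriangle η ε) (alphaIotaLeft S)
  right_triangle :
    LabeledHomotopic gI gN ((gK.comp gA).comp gN) (rightTriangle η ε) (alphaIotaRight N)

end Adjunction

/-! The formulas for the labelings. An element of a tensor product is determined by the elementary
tensors, so each of the following conditions determines the labeling. -/

/-- The component `A ⊗ F B → F (A ⊗ B)` of a labeling. -/
def GoodStructure.label {F : CStarEndo.{u}} (g : GoodStructure F) (A B : CStar.{u}) :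
    MaxTensor A (F.obj B) →⋆ₙₐ[ℂ] F.obj (tensorObj A B) := (g.κ A).app B

/-- `a ⊗ f ↦ (t ↦ a ⊗ f t)` for `f : [0,1] → B`. -/
def IsCylinderLabeling (g : GoodStructure cylinderFunctor.{u}) : Prop :=
  ∀ (A B : CStar.{u}) (a : A) (f : C(unitInterval, B)),
    ∃ h : C(unitInterval, MaxTensor A B), (∀ t, h t = MaxTensor.tmul a (f t)) ∧
      g.label A B (MaxTensor.tmul a f) = h

/-- `a ⊗ as_t (f t) ↦ as_t (a ⊗ f t)`. -/
def IsAsymptoticLabeling (g : GoodStructure asymptoticFunctor.{u}) : Prop :=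
  ∀ (A B : CStar.{u}) (a : A) (f : ℝ≥0 →ᵇ B),
    ∃ h : ℝ≥0 →ᵇ MaxTensor A B, (∀ t, h t = MaxTensor.tmul a (f t)) ∧
      g.label A B (MaxTensor.tmul a (asClass f)) = asClass h

/-- `a ⊗ (m i j) ↦ (a ⊗ m i j)` for compact matrices. -/
def IsCompactLabeling (g : GoodStructure compactFunctor.{u}) : Prop :=
  ∀ (A B : CStar.{u}) (a : A) (m : CompactMatrices B),
    ∃ n : CompactMatrices (MaxTensor A B),
      (∀ i j, MatrixAlgebra.coeff n i j = MaxTensor.tmul a (MatrixAlgebra.coeff m i j)) ∧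
      g.label A B (MaxTensor.tmul a m) = n

/-- `a ⊗ f ↦ (z ↦ a ⊗ f z)` for `f ∈ C₀(𝒳, 𝒳₀, B)`. -/
def IsC0Labeling {𝒳 : Type u} [MetricSpace 𝒳] (𝒳₀ : Set 𝒳) (g : GoodStructure (relC0Functor 𝒳₀)) :
    Prop :=
  ∀ (A B : CStar.{u}) (a : A) (f : relC0 B 𝒳₀),
    ∃ h : relC0 (MaxTensor A B) 𝒳₀, (∀ z, h.1 z = MaxTensor.tmul a (f.1 z)) ∧
      g.label A B (MaxTensor.tmul a f) = h

/-- The class `qmat m` of a matrix in the relative uniform Roe algebra. -/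
def qmat {X : Type*} [MetricSpace X] (hX : BoundedGeometry X) (X₀ : Set X) {B : Type*}
    [NonUnitalCStarAlgebra B] (m : UniformRoe hX B) : RelativeRoe hX X₀ B :=
  (relativeIdeal hX X₀ B).proj m

/-- `a ⊗ qmat (m x y) ↦ qmat (a ⊗ m x y)`. -/
def IsRoeLabeling {X : Type u} [MetricSpace X] (hX : BoundedGeometry X) (X₀ : Set X)
    (g : GoodStructure (relRoeFunctor hX X₀)) : Prop :=
  ∀ (A B : CStar.{u}) (a : A) (m : UniformRoe hX B),
    ∃ n : UniformRoe hX (MaxTensor A B),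
      (∀ x y, MatrixAlgebra.coeff n x y = MaxTensor.tmul a (MatrixAlgebra.coeff m x y)) ∧
      g.label A B (MaxTensor.tmul a (qmat hX X₀ m)) = qmat hX X₀ n

/-! ### Scalable pairs and discretizations -/

/-- `sc` is a scaling of the pair `(𝒳, 𝒳₀)`. -/
structure IsScaling {𝒳 : Type*} [MetricSpace 𝒳] (𝒳₀ : Set 𝒳) (sc : ℝ≥0 → 𝒳 → 𝒳) : Prop where
  continuous : Continuous fun p : 𝒳 × ℝ≥0 => sc p.2 p.1
  mapsTo : ∀ t, Set.MapsTo (sc t) 𝒳₀ 𝒳₀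
  zero : ∀ z, sc 0 z = z
  bounded : ∀ (s : Set 𝒳) (T : ℝ≥0), Bornology.IsBounded s →
    Bornology.IsBounded (⋃ t ∈ Set.Iic T, sc t ⁻¹' s)
  contracting : ∃ ρ : ℝ≥0 → ℝ≥0 → ℝ≥0,
    (∀ t z w, nndist (sc t z) (sc t w) ≤ ρ t (nndist z w)) ∧ (∀ t, Monotone (ρ t)) ∧
    ∀ r, BddAbove (Set.range fun t => ρ t r) ∧ Tendsto (fun t => ρ t r) atTop (𝓝 0)

/-- `X` is a `Δ`-separated `Δ`-net in `𝒳`. -/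
structure IsSeparatedNet {𝒳 : Type*} [MetricSpace 𝒳] (Δ : ℝ) (X : Set 𝒳) : Prop where
  separated : ∀ x ∈ X, ∀ y ∈ X, x ≠ y → Δ ≤ dist x y
  net : ∀ z, ∃ x ∈ X, dist z x < Δ

/-- The subset `X₀ = {x ∈ X | dist (x, 𝒳₀) < Δ}` of a `Δ`-separated `Δ`-net `X`. -/
def discretePart {𝒳 : Type*} [MetricSpace 𝒳] (Δ : ℝ) (𝒳₀ X : Set 𝒳) : Set X :=
  {x | ∃ z ∈ 𝒳₀, dist (x : 𝒳) z < Δ}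

/-- `α` is a square partition of unity subordinate to the cover of `𝒳` by the open `Δ`-balls with
centers in `X`. -/
structure IsSquarePartition {𝒳 : Type*} [MetricSpace 𝒳] (Δ : ℝ) (X : Set 𝒳) (α : X → C(𝒳, ℝ)) :
    Prop where
  hasSum : ∀ z, HasSum (fun x => α x z ^ 2) 1
  support_subset : ∀ x, Function.support (α x) ⊆ Metric.ball (x : 𝒳) Δ

open Classical in
/-- The cutoff `χ`: it is `1` at points `x` with `dist (x, 𝒳₀) > Δ` (where `dist (x, ∅) = ∞`), and
`0` otherwise. -/
def cutoff {𝒳 : Type*} [MetricSpace 𝒳] (Δ : ℝ) (𝒳₀ : Set 𝒳) (x : 𝒳) : ℝ :=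
  if ENNReal.ofReal Δ < Metric.infEDist x 𝒳₀ then 1 else 0

/-- The unit is `a ↦ qmat (χ_x χ_y α_x α_y ⊗ a)`. -/
def IsRoeUnit {𝒳 : Type u} [MetricSpace 𝒳] (𝒳₀ : Set 𝒳) (Δ : ℝ) (X : Set 𝒳)
    (hX : BoundedGeometry X) (α : X → C(𝒳, ℝ))
    (η : 𝟭 CStar.{u} ⟶ relC0Functor 𝒳₀ ⋙ relRoeFunctor hX (discretePart Δ 𝒳₀ X)) : Prop :=
  ∀ (A : CStar.{u}) (a : A), ∃ m : UniformRoe hX (relC0 A 𝒳₀),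
    (∀ (x y : X) (z : 𝒳), (MatrixAlgebra.coeff m x y).1 z =
      ((cutoff Δ 𝒳₀ x * cutoff Δ 𝒳₀ y * (α x z * α y z) : ℝ) : ℂ) • a) ∧
    η.app A a = qmat hX (discretePart Δ 𝒳₀ X) m

/-- The counit is `f ⊗ qmat m ↦ as_t (diag (f (sc_t x)) · mat m)`, where `X`-by-`X` matrices are
considered as `ℕ`-by-`ℕ` matrices through the injection `e : X → ℕ`. -/
def IsRoeCounit {𝒳 : Type u} [MetricSpace 𝒳] (𝒳₀ : Set 𝒳) (sc : ℝ≥0 → 𝒳 → 𝒳) (Δ : ℝ) (X : Set 𝒳)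
    (hX : BoundedGeometry X) (e : X → ℕ)
    (ε : relRoeFunctor hX (discretePart Δ 𝒳₀ X) ⋙ relC0Functor 𝒳₀ ⟶
      compactFunctor.{u} ⋙ asymptoticFunctor) : Prop :=
  ∀ (A : CStar.{u}) (f : relC0 ℂ 𝒳₀) (m : UniformRoe hX A), ∃ g : ℝ≥0 →ᵇ CompactMatrices A,
    (∀ (t : ℝ≥0) (x y : X),
      MatrixAlgebra.coeff (g t) (e x) (e y) = f.1 (sc t x) • MatrixAlgebra.coeff m x y) ∧
    (∀ (t : ℝ≥0) (i j : ℕ), i ∉ Set.range e ∨ j ∉ Set.range e →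
      MatrixAlgebra.coeff (g t) i j = 0) ∧
    ε.app A (relC0Tensor 𝒳₀ f (qmat hX (discretePart Δ 𝒳₀ X) m)) = asClass g

end

/-! ### Norm estimates in C⋆-algebras -/

noncomputable section

/-- A functional which is bounded by a multiple of `n`, and whose square can be estimated by its
value at a point of size at most `n x ^ 2`, is bounded by `n`. -/
theorem le_of_le_mul_of_sq_le {T : Type*} (r n : T → ℝ) (C : ℝ) (hn : ∀ x, 0 ≤ n x)
    (h1 : ∀ x, r x ≤ C * n x) (h2 : ∀ x, ∃ y, n y ≤ n x ^ 2 ∧ r x ^ 2 ≤ r y) (x : T) :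
    r x ≤ n x := by
  by_contra! h
  have hC : ∀ y, r y ≤ |C| * n y := fun y =>
    (h1 y).trans (mul_le_mul_of_nonneg_right (le_abs_self C) (hn y))
  have hrx : 0 < r x := (hn x).trans_lt h
  have hnx : 0 < n x := by
    rcases (hn x).eq_or_lt with h0 | h0
    · have := hC x
      rw [← h0, mul_zero] at this
      exact absurd this (not_le.2 hrx)
    · exact h0
  have key : ∀ k : ℕ, ∃ y, n y ≤ n x ^ 2 ^ k ∧ r x ^ 2 ^ k ≤ r y := fun k => by
    induction k with
    | zero => exact ⟨x, by simp, by simp⟩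
    | succ k ih =>
      obtain ⟨y, hy1, hy2⟩ := ih
      obtain ⟨w, hw1, hw2⟩ := h2 y
      refine ⟨w, hw1.trans ?_, le_trans ?_ hw2⟩
      · rw [pow_succ 2 k, pow_mul]; exact pow_le_pow_left₀ (hn y) hy1 2
      · rw [pow_succ 2 k, pow_mul]; exact pow_le_pow_left₀ (by positivity) hy2 2
  obtain ⟨k, hk⟩ := pow_unbounded_of_one_lt |C| ((one_lt_div hnx).2 h)
  have h3 : |C| < (r x / n x) ^ 2 ^ k := hk.trans_le
    (pow_le_pow_right₀ ((one_lt_div hnx).2 h).le (Nat.lt_two_pow_self).le)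
  obtain ⟨y, hy1, hy2⟩ := key k
  rw [div_pow, lt_div_iff₀ (by positivity)] at h3
  have := hC y
  have h4 : |C| * n y ≤ |C| * n x ^ 2 ^ k := mul_le_mul_of_nonneg_left hy1 (abs_nonneg C)
  linarith

section Separating

variable {D K : Type*} [NonUnitalCStarAlgebra D] {E : K → Type*}
  [∀ k, NonUnitalCStarAlgebra (E k)]

/-- A separating family of ⋆-homomorphisms determines the norm. -/
theorem norm_le_of_separating (π : ∀ k, D →⋆ₙₐ[ℂ] E k) (hπ : ∀ x, (∀ k, π k x = 0) → x = 0)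
    {x : D} {c : ℝ} (hc : 0 ≤ c) (h : ∀ k, ‖π k x‖ ≤ c) : ‖x‖ ≤ c := by
  let Φ : D →⋆ₙₐ[ℂ] lp E ⊤ :=
    { toFun := fun x => ⟨fun k => π k x, memℓp_infty ⟨‖x‖, by
        rintro _ ⟨k, rfl⟩
        exact NonUnitalStarAlgHom.norm_apply_le (π k) x⟩⟩
      map_smul' := fun c x => Subtype.ext (funext fun k => map_smul (π k) c x)
      map_zero' := Subtype.ext (funext fun k => map_zero (π k))
      map_add' := fun x y => Subtype.ext (funext fun k => map_add (π k) x y)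
      map_mul' := fun x y => Subtype.ext (funext fun k => map_mul (π k) x y)
      map_star' := fun x => Subtype.ext (funext fun k => map_star (π k) x) }
  have hΦ : Function.Injective Φ := by
    refine (injective_iff_map_eq_zero Φ).2 fun x hx => hπ x fun k => ?_
    exact congrArg (fun f : lp E ⊤ => f k) hx
  rw [← NonUnitalStarAlgHom.norm_map Φ hΦ]
  exact lp.norm_le_of_forall_le hc h

attribute [local instance] CStarAlgebra.spectralOrder CStarAlgebra.spectralOrderedRing in
theorem matNorm_le_of_separating {n : Type*} [Fintype n] (π : ∀ k, D →⋆ₙₐ[ℂ] E k)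
    (hπ : ∀ x, (∀ k, π k x = 0) → x = 0) {M : CStarMatrix n n D} {c : ℝ} (hc : 0 ≤ c)
    (h : ∀ k, matNorm (CStarMatrix.ofMatrix fun i j => π k (M i j)) ≤ c) : matNorm M ≤ c := by
  refine norm_le_of_separating (E := fun k => CStarMatrix n n (E k))
    (fun k => CStarMatrix.mapₙₐ (π k)) (fun M hM => ?_) hc h
  ext i j
  exact hπ _ fun k => congrArg (fun N : CStarMatrix n n (E k) => N i j) (hM k)

end Separating

/-! ### Finite matrices -/

section FiniteMatrixEstimates

variable {B C : Type*} [NonUnitalCStarAlgebra B] [NonUnitalCStarAlgebra C]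
  {n : Type*} [Fintype n]

theorem matNorm_le_card_mul (M : CStarMatrix n n B) {c : ℝ} (hc : 0 ≤ c) (h : ∀ i j, ‖M i j‖ ≤ c) :
    matNorm M ≤ Fintype.card n * c := by
  have : ∀ s : Set n, s.encard ≤ (Fintype.card n : ℕ) := fun s =>
    (Set.encard_le_encard (Set.subset_univ s)).trans (by rw [Set.encard_univ]; simp)
  exact matNorm_le_of_sparse M c hc _ h (fun i => this _) (fun j => this _)

theorem matNorm_tmul_le {A : Type*} [NonUnitalCStarAlgebra A] (a : A) (M : CStarMatrix n n B) :
    matNorm (CStarMatrix.ofMatrix fun i j => MaxTensor.tmul a (M i j)) ≤ ‖a‖ * matNorm M := by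
  refine le_of_le_mul_of_sq_le (T := A × CStarMatrix n n B)
    (fun p => matNorm (CStarMatrix.ofMatrix fun i j => MaxTensor.tmul p.1 (p.2 i j)))
    (fun p => ‖p.1‖ * matNorm p.2) (Fintype.card n)
    (fun p => mul_nonneg (norm_nonneg _) (matNorm_nonneg _)) (fun p => ?_) (fun p => ?_) (a, M)
  · refine matNorm_le_card_mul _ (mul_nonneg (norm_nonneg _) (matNorm_nonneg _)) fun i j => ?_
    exact (MaxTensor.norm_tmul_le _ _).trans
      (mul_le_mul_of_nonneg_left (norm_entry_le_matNorm p.2 i j) (norm_nonneg _))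
  · refine ⟨(star p.1 * p.1, star p.2 * p.2), ?_, ?_⟩
    · dsimp only
      rw [CStarRing.norm_star_mul_self, matNorm_star_mul_self]
      exact le_of_eq (by ring)
    · dsimp only
      rw [sq, ← matNorm_star_mul_self]
      refine le_of_eq (congrArg matNorm ?_)
      ext i j
      rw [CStarMatrix.mul_apply]
      change _ = MaxTensor.tmulₗ (star p.1 * p.1) ((star p.2 * p.2) i j)
      rw [CStarMatrix.mul_apply, map_sum]
      refine Finset.sum_congr rfl fun k _ => ?_
      change star (MaxTensor.tmul p.1 (p.2 k i)) * MaxTensor.tmul p.1 (p.2 k j) = _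
      rw [MaxTensor.star_tmul, MaxTensor.tmul_mul_tmul]
      rfl

attribute [local instance] CStarAlgebra.spectralOrder CStarAlgebra.spectralOrderedRing in
theorem matNorm_diag_mul_le (g : n → ℂ) {c : ℝ} (hc : 0 ≤ c) (hg : ∀ i, ‖g i‖ ≤ c)
    (M : CStarMatrix n n B) :
    matNorm (CStarMatrix.ofMatrix fun i j => g i • M i j) ≤ c * matNorm M := by
  set S : CStarMatrix n n B := CStarMatrix.ofMatrix fun i j => g i • M i j with hS
  set S' : CStarMatrix n n B :=
    CStarMatrix.ofMatrix fun i j => ((√(c ^ 2 - ‖g i‖ ^ 2) : ℝ) : ℂ) • M i j with hS'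
  have hs : star S * S + star S' * S' = ((c ^ 2 : ℝ) : ℂ) • (star M * M) := by
    ext i j
    rw [CStarMatrix.add_apply, CStarMatrix.smul_apply, CStarMatrix.mul_apply, CStarMatrix.mul_apply,
      CStarMatrix.mul_apply, ← Finset.sum_add_distrib, Finset.smul_sum]
    refine Finset.sum_congr rfl fun k _ => ?_
    change star (g k • M k i) * (g k • M k j) + star (((√(c ^ 2 - ‖g k‖ ^ 2) : ℝ) : ℂ) • M k i) *
      (((√(c ^ 2 - ‖g k‖ ^ 2) : ℝ) : ℂ) • M k j) = ((c ^ 2 : ℝ) : ℂ) • (star (M k i) * M k j)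
    simp only [star_smul, smul_mul_smul_comm, ← add_smul]
    congr 1
    have h0 : 0 ≤ c ^ 2 - ‖g k‖ ^ 2 :=
      sub_nonneg.2 (pow_le_pow_left₀ (norm_nonneg _) (hg k) 2)
    have e1 : star (g k) * g k = ((‖g k‖ ^ 2 : ℝ) : ℂ) := by
      rw [Complex.star_def, mul_comm, Complex.mul_conj, Complex.normSq_eq_norm_sq]
    have e2 : star ((√(c ^ 2 - ‖g k‖ ^ 2) : ℝ) : ℂ) * ((√(c ^ 2 - ‖g k‖ ^ 2) : ℝ) : ℂ) =
        ((c ^ 2 - ‖g k‖ ^ 2 : ℝ) : ℂ) := by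
      rw [Complex.star_def, Complex.conj_ofReal, ← Complex.ofReal_mul, Real.mul_self_sqrt h0]
    rw [e1, e2, ← Complex.ofReal_add]
    congr 1
    ring
  have h1 : star S * S ≤ ((c ^ 2 : ℝ) : ℂ) • (star M * M) := by
    rw [← hs]; exact le_add_of_nonneg_right (star_mul_self_nonneg S')
  have h2 := CStarAlgebra.norm_le_norm_of_nonneg_of_le (star_mul_self_nonneg S) h1
  have h3 : matNorm S * matNorm S ≤ (c * matNorm M) * (c * matNorm M) := by
    calc matNorm S * matNorm S = ‖star S * S‖ := CStarRing.norm_star_mul_self.symm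
      _ ≤ _ := h2
      _ = c ^ 2 * ‖star M * M‖ := by rw [norm_smul]; simp
      _ = (c * matNorm M) * (c * matNorm M) := by
        rw [CStarRing.norm_star_mul_self]; change c ^ 2 * (matNorm M * matNorm M) = _; ring
  exact abs_le_of_sq_le_sq' (by nlinarith) (mul_nonneg hc (matNorm_nonneg M)) |>.2

end FiniteMatrixEstimates

/-! ### Tensor products -/

namespace MaxTensor

variable {A B C D : Type*} [NonUnitalCStarAlgebra A] [NonUnitalCStarAlgebra B]
  [NonUnitalCStarAlgebra C] [NonUnitalCStarAlgebra D]

theorem tmul_add (a : A) (b b' : B) : tmul a (b + b') = tmul a b + tmul a b' :=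
  map_add (tmulₗ a) b b'
theorem tmul_smul (a : A) (c : ℂ) (b : B) : tmul a (c • b) = c • tmul a b :=
  map_smul (tmulₗ a) c b
theorem tmul_zero (a : A) : tmul a (0 : B) = 0 := map_zero (tmulₗ a)
theorem add_tmul (a a' : A) (b : B) : tmul (a + a') b = tmul a b + tmul a' b := by
  simp only [tmul, map_add, LinearMap.add_apply]
theorem smul_tmul (c : ℂ) (a : A) (b : B) : tmul (c • a) b = c • tmul a b := by
  simp only [tmul, map_smul, LinearMap.smul_apply]
theorem continuous_tmul (a : A) : Continuous fun b : B => tmul a b := (tmulL a).continuous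

/-- A closed set which contains the elementary tensors and is closed under addition is
everything. -/
theorem induction_closed {p : MaxTensor A B → Prop} (hp : IsClosed {x | p x})
    (h : ∀ a b, p (tmul a b)) (hadd : ∀ x y, p x → p y → p (x + y)) (x : MaxTensor A B) : p x := by
  refine CStarCompletion.ind x hp fun t => ?_
  rw [← AlgTensor.of_unof t]
  induction AlgTensor.unof A B t using TensorProduct.induction_on with
  | zero =>
    have h0 := h (0 : A) (0 : B)
    rw [tmul_zero] at h0
    rwa [map_zero, CStarCompletion.mk_zero]
  | tmul a b => exact h a b
  | add s t hs ht => rw [map_add, CStarCompletion.mk_add]; exact hadd _ _ hs ht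

theorem ext_hom₃ {f g : MaxTensor A (MaxTensor B C) →⋆ₙₐ[ℂ] D}
    (h : ∀ a b c, f (tmul a (tmul b c)) = g (tmul a (tmul b c))) : f = g :=
  ext_hom fun a x => by
    refine induction_closed (p := fun x => f (tmul a x) = g (tmul a x)) (isClosed_eq
      ((map_continuous f).comp (continuous_tmul a)) ((map_continuous g).comp (continuous_tmul a)))
      (h a) (fun x y hx hy => ?_) x
    rw [tmul_add, map_add, map_add, hx, hy]

/-- Two ⋆-homomorphisms on `A ⊗ B` agree if they agree on `a ⊗ b` for all `b` in a set whose
closed linear span is everything. -/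
theorem ext_hom_of_span {f g : MaxTensor A B →⋆ₙₐ[ℂ] D} {s : Set B}
    (hs : closure (Submodule.span ℂ s : Set B) = Set.univ)
    (h : ∀ a, ∀ b ∈ s, f (tmul a b) = g (tmul a b)) : f = g :=
  ext_hom fun a b => by
    have hb : b ∈ closure (Submodule.span ℂ s : Set B) := hs ▸ Set.mem_univ b
    refine closure_minimal (t := {b | f (tmul a b) = g (tmul a b)}) (fun b hb => ?_) (isClosed_eq
      ((map_continuous f).comp (continuous_tmul a))
      ((map_continuous g).comp (continuous_tmul a))) hb
    refine Submodule.span_induction (p := fun b _ => f (tmul a b) = g (tmul a b)) (h a) ?_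
      (fun x y _ _ hx hy => ?_) (fun c x _ hx => ?_) hb
    · rw [tmul_zero, map_zero, map_zero]
    · rw [tmul_add, map_add, map_add, hx, hy]
    · rw [tmul_smul, map_smul, map_smul, hx]

end MaxTensor

end

/-! ### Coordinates on completed matrix algebras -/

noncomputable section

/-- The finite corner of an arbitrary matrix. -/
def cornerFn {X B : Type*} (F : Finset X) (k : X → X → B) : CStarMatrix F F B :=
  CStarMatrix.ofMatrix fun i j => k i j

namespace MatrixAlgebra

open ControlledMatrix

variable {X : Type*} {𝓔 : SupportFamily X} {B C D : Type*} [NonUnitalCStarAlgebra B]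
  [NonUnitalCStarAlgebra C] [NonUnitalCStarAlgebra D]

theorem coeff_sub (m n : MatrixAlgebra 𝓔 B) (x y : X) :
    coeff (m - n) x y = coeff m x y - coeff n x y := map_sub (coeffL 𝓔 B x y) m n

attribute [local instance] CStarAlgebra.spectralOrder CStarAlgebra.spectralOrderedRing in
theorem matNorm_cornerFn_coeff_le (m : MatrixAlgebra 𝓔 B) (F : Finset X) :
    matNorm (cornerFn F (coeff m)) ≤ ‖m‖ := by
  let L : MatrixAlgebra 𝓔 B →L[ℂ] CStarMatrix F F B := CStarCompletion.liftCLM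
    ({ toFun := corner F
       map_add' := fun _ _ => rfl
       map_smul' := fun _ _ => rfl } : ControlledMatrix 𝓔 B →ₗ[ℂ] CStarMatrix F F B) 1
    fun m => by rw [one_mul]; exact matNorm_corner_le m F
  have hL : ∀ a : ControlledMatrix 𝓔 B, L (CStarCompletion.mk a) = corner F a :=
    CStarCompletion.liftCLM_mk _ _ _
  have hent : ∀ i j : F, Continuous fun M : CStarMatrix F F B => M i j := fun i j =>
    (LinearMap.mkContinuous ({ toFun := fun M => M i j
                               map_add' := fun _ _ => rfl
                               map_smul' := fun _ _ => rfl } : CStarMatrix F F B →ₗ[ℂ] B) 1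
      fun M => by rw [one_mul]; exact norm_entry_le_matNorm M i j).continuous
  have h1 : ∀ m, L m = cornerFn F (coeff m) := fun m => by
    ext i j
    refine CStarCompletion.ind m (isClosed_eq ((hent i j).comp L.continuous)
      (continuous_coeff (i : X) (j : X))) fun a => ?_
    rw [hL]
    exact (coeff_mk a i j).symm
  rw [← h1]
  refine CStarCompletion.ind m (isClosed_le (continuous_norm.comp L.continuous) continuous_norm)
    fun a => ?_
  rw [hL, CStarCompletion.norm_mk]
  exact matNorm_corner_le a F

theorem norm_le_of_corners {m : MatrixAlgebra 𝓔 B} {c : ℝ}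
    (h : ∀ F, matNorm (cornerFn F (coeff m)) ≤ c) : ‖m‖ ≤ c := by
  refine le_of_forall_pos_le_add fun δ hδ => ?_
  obtain ⟨_, ⟨a, rfl⟩, ha⟩ := Metric.mem_closure_iff.1
    (CStarCompletion.denseRange_mk (T := ControlledMatrix 𝓔 B) m) (δ / 2) (half_pos hδ)
  rw [dist_comm, dist_eq_norm] at ha
  have h2 : ‖CStarCompletion.mk a‖ ≤ c + δ / 2 := by
    rw [CStarCompletion.norm_mk]
    refine ciSup_le fun F => ?_
    have e : corner F a = cornerFn F (coeff m) + cornerFn F (coeff (CStarCompletion.mk a - m)) := by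
      ext i j
      change entry a i j = coeff m (i : X) j + coeff (CStarCompletion.mk a - m) (i : X) j
      rw [coeff_sub, coeff_mk]; abel
    rw [e]
    exact (matNorm_add_le _ _).trans (add_le_add (h F)
      ((matNorm_cornerFn_coeff_le _ F).trans ha.le))
  calc ‖m‖ = ‖CStarCompletion.mk a - (CStarCompletion.mk a - m)‖ := by rw [sub_sub_cancel]
    _ ≤ _ := norm_sub_le _ _
    _ ≤ _ := by linarith

theorem norm_coeff_le (m : MatrixAlgebra 𝓔 B) (x y : X) : ‖coeff m x y‖ ≤ ‖m‖ := by
  classical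
  exact (norm_entry_le_matNorm (cornerFn {x, y} (coeff m)) ⟨x, by simp⟩ ⟨y, by simp⟩).trans
    (matNorm_cornerFn_coeff_le m _)

theorem ext_coeff {m n : MatrixAlgebra 𝓔 B} (h : ∀ x y, coeff m x y = coeff n x y) : m = n := by
  rw [← sub_eq_zero, ← norm_le_zero_iff]
  refine norm_le_of_corners fun F => le_of_eq ?_
  have : cornerFn F (coeff (m - n)) = 0 := by
    ext i j
    change coeff (m - n) (i : X) j = 0
    rw [coeff_sub, h, sub_self]
  rw [this, matNorm_zero]

/-- A matrix which is a limit of controlled matrices defines an element of the completion. -/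
theorem exists_of_approx (k : X → X → B) (h : ∀ δ > 0, ∃ a : ControlledMatrix 𝓔 B,
    ∀ F, matNorm (cornerFn F fun x y => k x y - entry a x y) ≤ δ) :
    ∃ m : MatrixAlgebra 𝓔 B, ∀ x y, coeff m x y = k x y := by
  classical
  have hpos : ∀ n : ℕ, (0 : ℝ) < 1 / (n + 1) := fun n => by positivity
  choose a ha using fun n : ℕ => h (1 / (n + 1)) (hpos n)
  have hlim : Tendsto (fun n : ℕ => (1 : ℝ) / (n + 1)) atTop (𝓝 0) :=
    tendsto_one_div_add_atTop_nhds_zero_nat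
  have hd : ∀ n p, ‖a n - a p‖ ≤ 1 / (n + 1) + 1 / (p + 1) := fun n p => by
    refine ciSup_le fun F => ?_
    have e : corner F (a n - a p) = -(cornerFn F fun x y => k x y - entry (a n) x y) +
        cornerFn F fun x y => k x y - entry (a p) x y := by
      ext i j
      change entry (a n) i j - entry (a p) i j = -(k i j - entry (a n) i j) +
        (k i j - entry (a p) i j)
      abel
    rw [e]
    exact (matNorm_add_le _ _).trans (add_le_add (by rw [matNorm_neg]; exact ha n F) (ha p F))
  have hc : CauchySeq fun n => (CStarCompletion.mk (a n) : MatrixAlgebra 𝓔 B) := by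
    refine Metric.cauchySeq_iff'.2 fun δ hδ => ?_
    obtain ⟨N, hN⟩ := (Metric.tendsto_atTop.1 hlim) (δ / 2) (half_pos hδ)
    refine ⟨N, fun n hn => ?_⟩
    have h0 : ∀ p ≥ N, (1 : ℝ) / (p + 1) < δ / 2 := fun p hp =>
      (le_abs_self _).trans_lt (by simpa [Real.dist_eq] using hN p hp)
    rw [dist_eq_norm]
    have e : (CStarCompletion.mk (a n) - CStarCompletion.mk (a N) : MatrixAlgebra 𝓔 B) =
        CStarCompletion.mk (a n - a N) := (map_sub CStarCompletion.mkHom (a n) (a N)).symm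
    rw [e, CStarCompletion.norm_mk]
    linarith [hd n N, h0 n hn, h0 N le_rfl]
  obtain ⟨m, hm⟩ := cauchySeq_tendsto_of_complete hc
  refine ⟨m, fun x y => tendsto_nhds_unique (((continuous_coeff x y).tendsto m).comp hm) ?_⟩
  rw [tendsto_iff_norm_sub_tendsto_zero]
  refine squeeze_zero (fun _ => norm_nonneg _) (fun n => ?_) hlim
  rw [Function.comp_apply, coeff_mk, norm_sub_rev]
  exact (norm_entry_le_matNorm (cornerFn {x, y} fun x y => k x y - entry (a n) x y)
    ⟨x, by simp⟩ ⟨y, by simp⟩).trans (ha n _)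

end MatrixAlgebra

/-! ### Completely bounded maps -/

section CompletelyBounded

variable {X : Type*} {𝓔 : SupportFamily X} {B C D : Type*} [NonUnitalCStarAlgebra B]
  [NonUnitalCStarAlgebra C] [NonUnitalCStarAlgebra D]

/-- A linear map is completely bounded by `K`, if its amplifications to finite matrices are bounded
by `K`. -/
def IsCompletelyBounded (r : B →L[ℂ] C) (K : ℝ) : Prop :=
  ∀ (n : ℕ) (M : CStarMatrix (Fin n) (Fin n) B),
    matNorm (CStarMatrix.ofMatrix fun i j => r (M i j)) ≤ K * matNorm M

theorem isCompletelyBounded_tmulL {A : Type*} [NonUnitalCStarAlgebra A] (a : A) :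
    IsCompletelyBounded (MaxTensor.tmulL (B := B) a) ‖a‖ := fun _ M => matNorm_tmul_le a M

theorem IsCompletelyBounded.matNorm_le {r : B →L[ℂ] C} {K : ℝ} (hK : 0 ≤ K)
    (hr : IsCompletelyBounded r K) {n : Type*} [Fintype n] (M : CStarMatrix n n B) :
    matNorm (CStarMatrix.ofMatrix fun i j => r (M i j)) ≤ K * matNorm M := by
  let e := Fintype.equivFin n
  let N : CStarMatrix (Fin (Fintype.card n)) (Fin (Fintype.card n)) B :=
    CStarMatrix.ofMatrix fun i j => M (e.symm i) (e.symm j)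
  have h1 : (CStarMatrix.ofMatrix fun i j => r (M i j) : CStarMatrix n n C) =
      CStarMatrix.ofMatrix fun i j =>
        (CStarMatrix.ofMatrix fun i j => r (N i j) : CStarMatrix _ _ C) (e i) (e j) := by
    ext i j
    change r (M i j) = r (M (e.symm (e i)) (e.symm (e j)))
    simp
  rw [h1]
  calc _ ≤ _ := matNorm_submatrix_le e e.injective _
    _ ≤ K * matNorm N := hr _ N
    _ ≤ _ := mul_le_mul_of_nonneg_left (matNorm_submatrix_le e.symm e.symm.injective M) hK

namespace ControlledMatrix

/-- Applying a bounded linear map to all entries of a matrix. -/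
def mapL (r : B →L[ℂ] C) : ControlledMatrix 𝓔 B →ₗ[ℂ] ControlledMatrix 𝓔 C where
  toFun m := ofEntries (fun x y => r (entry m x y))
    (𝓔.mono (fun p hp => show entry m p.1 p.2 ≠ 0 from fun h0 => hp (by simp [h0])) m.controlled)
    (by
      obtain ⟨K, _, hK⟩ := m.entry_bdd
      exact ⟨‖r‖ * K, fun x y => (r.le_opNorm _).trans
        (mul_le_mul_of_nonneg_left (hK x y) (norm_nonneg _))⟩)
  map_smul' c m := ext fun x y => map_smul r c _
  map_add' m n := ext fun x y => map_add r _ _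

theorem entry_mapL (r : B →L[ℂ] C) (m : ControlledMatrix 𝓔 B) (x y : X) :
    entry (mapL r m) x y = r (entry m x y) := rfl

theorem norm_mapL_le {r : B →L[ℂ] C} {K : ℝ} (hK : 0 ≤ K) (hr : IsCompletelyBounded r K)
    (m : ControlledMatrix 𝓔 B) : ‖mapL r m‖ ≤ K * ‖m‖ :=
  ciSup_le fun F => (hr.matNorm_le hK (corner F m)).trans
    (mul_le_mul_of_nonneg_left (matNorm_corner_le m F) hK)

end ControlledMatrix

namespace MatrixAlgebra

open ControlledMatrix

/-- Applying a completely bounded map to all entries. -/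
def mapCB (r : B →L[ℂ] C) {K : ℝ} (hK : 0 ≤ K) (hr : IsCompletelyBounded r K) :
    MatrixAlgebra 𝓔 B →L[ℂ] MatrixAlgebra 𝓔 C :=
  CStarCompletion.liftCLM (((CStarCompletion.mkHom : ControlledMatrix 𝓔 C →⋆ₙₐ[ℂ] MatrixAlgebra 𝓔 C) :
    ControlledMatrix 𝓔 C →ₗ[ℂ] MatrixAlgebra 𝓔 C) ∘ₗ mapL r) K fun m => by
      change ‖CStarCompletion.mk (mapL r m)‖ ≤ _
      rw [CStarCompletion.norm_mk]
      exact norm_mapL_le hK hr m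

theorem mapCB_mk (r : B →L[ℂ] C) {K : ℝ} (hK : 0 ≤ K) (hr : IsCompletelyBounded r K)
    (m : ControlledMatrix 𝓔 B) :
    mapCB r hK hr (CStarCompletion.mk m) = CStarCompletion.mk (mapL r m) :=
  CStarCompletion.liftCLM_mk _ _ _ m

theorem coeff_mapCB (r : B →L[ℂ] C) {K : ℝ} (hK : 0 ≤ K) (hr : IsCompletelyBounded r K)
    (m : MatrixAlgebra 𝓔 B) (x y : X) : coeff (mapCB r hK hr m) x y = r (coeff m x y) := by
  refine CStarCompletion.ind m (isClosed_eq ((continuous_coeff x y).comp (mapCB r hK hr).continuous)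
    (r.continuous.comp (continuous_coeff x y))) fun a => ?_
  rw [mapCB_mk, coeff_mk, coeff_mk, entry_mapL]

/-- The map `m ↦ a ⊗ m`, applied to all entries. -/
def lab {A : Type*} [NonUnitalCStarAlgebra A] (a : A) :
    MatrixAlgebra 𝓔 B →L[ℂ] MatrixAlgebra 𝓔 (MaxTensor A B) :=
  mapCB (MaxTensor.tmulL a) (norm_nonneg a) (isCompletelyBounded_tmulL a)

variable {A : Type*} [NonUnitalCStarAlgebra A]

theorem lab_mk (a : A) (m : ControlledMatrix 𝓔 B) :
    lab a (CStarCompletion.mk m) = CStarCompletion.mk (mapL (MaxTensor.tmulL a) m) :=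
  mapCB_mk _ _ _ m

theorem coeff_lab (a : A) (m : MatrixAlgebra 𝓔 B) (x y : X) :
    coeff (lab a m) x y = MaxTensor.tmul a (coeff m x y) := coeff_mapCB _ _ _ m x y

theorem lab_mul (a a' : A) (m n : MatrixAlgebra 𝓔 B) : lab a m * lab a' n = lab (a * a') (m * n) := by
  refine CStarCompletion.ind₂ m n (isClosed_eq
    (((lab a).continuous.comp continuous_fst).mul ((lab a').continuous.comp continuous_snd))
    ((lab (a * a')).continuous.comp (continuous_fst.mul continuous_snd))) fun m n => ?_
  rw [← CStarCompletion.mk_mul, lab_mk, lab_mk, lab_mk, ← CStarCompletion.mk_mul]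
  congr 1
  refine ControlledMatrix.ext fun x y => ?_
  have h : ∀ z, entry m x z ≠ 0 → z ∈ (m.row_finite x).toFinset := by simp
  rw [entry_mapL, entry_mul_eq_sum _ _ x y _ h, map_sum,
    entry_mul_eq_sum _ _ x y (m.row_finite x).toFinset fun z hz => h z fun h0 => hz (by
      rw [entry_mapL, h0, map_zero])]
  exact Finset.sum_congr rfl fun z _ => MaxTensor.tmul_mul_tmul _ _ _ _

end MatrixAlgebra

end CompletelyBounded

end

/-! ### Zero objects and pullbacks of C⋆-algebras -/

noncomputable section

namespace CStar

theorem comp_apply {A B C : CStar.{u}} (f : A ⟶ B) (g : B ⟶ C) (a : A) : (f ≫ g) a = g (f a) := rfl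

theorem map_comp_apply (F : CStarEndo.{u}) {A B C : CStar.{u}} (f : A ⟶ B) (g : B ⟶ C)
    (x : F.obj A) : F.map (f ≫ g) x = F.map g (F.map f x) := by
  rw [F.map_comp]; rfl

theorem map_id_apply (F : CStarEndo.{u}) {A : CStar.{u}} (x : F.obj A) : F.map (𝟙 A) x = x := by
  rw [F.map_id]; rfl

theorem congr_hom {A B : CStar.{u}} {f g : A ⟶ B} (h : f = g) (a : A) : f a = g a := by rw [h]

/-- The zero homomorphism. -/
def zeroHom (A B : CStar.{u}) : A ⟶ B :=
  ({ toFun := fun _ => 0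
     map_smul' := fun _ _ => (smul_zero _).symm
     map_zero' := rfl
     map_add' := fun _ _ => (add_zero _).symm
     map_mul' := fun _ _ => (mul_zero _).symm
     map_star' := fun _ => (star_zero _).symm } : A →⋆ₙₐ[ℂ] B)

theorem isZero_iff_subsingleton (Z : CStar.{u}) : Limits.IsZero Z ↔ Subsingleton Z := by
  constructor
  · intro h
    have h1 : 𝟙 Z = zeroHom Z Z := h.eq_of_src _ _
    refine ⟨fun a b => ?_⟩
    have ha : ∀ a : Z, a = 0 := fun a => congr_hom h1 a
    rw [ha a, ha b]
  · intro h
    refine ⟨fun Y => ⟨⟨⟨zeroHom Z Y⟩, fun f => hom_ext fun a => ?_⟩⟩,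
      fun Y => ⟨⟨⟨zeroHom Y Z⟩, fun f => hom_ext fun a => Subsingleton.elim _ _⟩⟩⟩
    rw [Subsingleton.elim a 0, map_zero, map_zero]

end CStar

section Pullback

variable {P B₁ B₂ B : CStar.{u}}

/-- The algebra of pairs which are identified by two ⋆-homomorphisms. -/
def pullbackAlg (φ₁ : B₁ ⟶ B) (φ₂ : B₂ ⟶ B) : NonUnitalStarSubalgebra ℂ (B₁ × B₂) where
  carrier := {p | φ₁ p.1 = φ₂ p.2}
  zero_mem' := by
    change φ₁ 0 = φ₂ 0
    rw [map_zero, map_zero]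
  add_mem' {p q} hp hq := by
    change φ₁ (p.1 + q.1) = φ₂ (p.2 + q.2)
    rw [map_add, map_add, hp, hq]
  mul_mem' {p q} hp hq := by
    change φ₁ (p.1 * q.1) = φ₂ (p.2 * q.2)
    rw [map_mul, map_mul, hp, hq]
  smul_mem' c p hp := by
    change φ₁ (c • p.1) = φ₂ (c • p.2)
    rw [map_smul, map_smul, hp]
  star_mem' {p} hp := by
    change φ₁ (star p.1) = φ₂ (star p.2)
    rw [map_star, map_star, hp]

instance (φ₁ : B₁ ⟶ B) (φ₂ : B₂ ⟶ B) : IsClosed (pullbackAlg φ₁ φ₂ : Set (B₁ × B₂)) :=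
  isClosed_eq ((map_continuous (ConcreteCategory.hom φ₁)).comp continuous_fst)
    ((map_continuous (ConcreteCategory.hom φ₂)).comp continuous_snd)

/-- A commutative square is a pullback, in terms of elements. -/
structure IsExplicitPullback (p₁ : P ⟶ B₁) (p₂ : P ⟶ B₂) (φ₁ : B₁ ⟶ B) (φ₂ : B₂ ⟶ B) : Prop where
  comm : ∀ x, φ₁ (p₁ x) = φ₂ (p₂ x)
  inj : ∀ x, p₁ x = 0 → p₂ x = 0 → x = 0
  surj : ∀ b₁ b₂, φ₁ b₁ = φ₂ b₂ → ∃ x, p₁ x = b₁ ∧ p₂ x = b₂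

theorem IsExplicitPullback.eq {p₁ : P ⟶ B₁} {p₂ : P ⟶ B₂} {φ₁ : B₁ ⟶ B} {φ₂ : B₂ ⟶ B}
    (h : IsExplicitPullback p₁ p₂ φ₁ φ₂) {x y : P} (h₁ : p₁ x = p₁ y) (h₂ : p₂ x = p₂ y) : x = y :=
  sub_eq_zero.1 (h.inj _ (by rw [map_sub, h₁, sub_self]) (by rw [map_sub, h₂, sub_self]))

theorem isExplicitPullback_of_isPullback {p₁ : P ⟶ B₁} {p₂ : P ⟶ B₂} {φ₁ : B₁ ⟶ B} {φ₂ : B₂ ⟶ B}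
    (h : IsPullback p₁ p₂ φ₁ φ₂) : IsExplicitPullback p₁ p₂ φ₁ φ₂ := by
  have hcomm : ∀ x, φ₁ (p₁ x) = φ₂ (p₂ x) := fun x => CStar.congr_hom h.w x
  let Q : CStar.{u} := ⟨pullbackAlg φ₁ φ₂⟩
  let q₁ : Q ⟶ B₁ := (((NonUnitalStarAlgHom.fst ℂ B₁ B₂).comp
    (NonUnitalStarSubalgebraClass.subtype (pullbackAlg φ₁ φ₂))) : pullbackAlg φ₁ φ₂ →⋆ₙₐ[ℂ] B₁)
  let q₂ : Q ⟶ B₂ := (((NonUnitalStarAlgHom.snd ℂ B₁ B₂).comp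
    (NonUnitalStarSubalgebraClass.subtype (pullbackAlg φ₁ φ₂))) : pullbackAlg φ₁ φ₂ →⋆ₙₐ[ℂ] B₂)
  let k : P ⟶ Q :=
    ({ toFun := fun x => ⟨(p₁ x, p₂ x), hcomm x⟩
       map_smul' := fun c x => Subtype.ext (Prod.ext (map_smul (ConcreteCategory.hom p₁) c x)
        (map_smul (ConcreteCategory.hom p₂) c x))
       map_zero' := Subtype.ext (Prod.ext (map_zero (ConcreteCategory.hom p₁))
        (map_zero (ConcreteCategory.hom p₂)))
       map_add' := fun x y => Subtype.ext (Prod.ext (map_add (ConcreteCategory.hom p₁) x y)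
        (map_add (ConcreteCategory.hom p₂) x y))
       map_mul' := fun x y => Subtype.ext (Prod.ext (map_mul (ConcreteCategory.hom p₁) x y)
        (map_mul (ConcreteCategory.hom p₂) x y))
       map_star' := fun x => Subtype.ext (Prod.ext (map_star (ConcreteCategory.hom p₁) x)
        (map_star (ConcreteCategory.hom p₂) x)) } : P →⋆ₙₐ[ℂ] pullbackAlg φ₁ φ₂)
  have hq : q₁ ≫ φ₁ = q₂ ≫ φ₂ := CStar.hom_ext fun x => x.2
  have hk : k ≫ h.lift q₁ q₂ hq = 𝟙 P := by
    refine h.hom_ext ?_ ?_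
    · rw [Category.assoc, h.lift_fst, Category.id_comp]; rfl
    · rw [Category.assoc, h.lift_snd, Category.id_comp]; rfl
  refine ⟨hcomm, fun x h₁ h₂ => ?_, fun b₁ b₂ hb => ?_⟩
  · have h0 : k x = 0 := Subtype.ext (Prod.ext h₁ h₂)
    have h3 := CStar.congr_hom hk x
    rw [CStar.comp_apply, h0, map_zero] at h3
    exact h3.symm
  · refine ⟨h.lift q₁ q₂ hq ⟨(b₁, b₂), hb⟩, ?_, ?_⟩
    · exact CStar.congr_hom (h.lift_fst q₁ q₂ hq) ⟨(b₁, b₂), hb⟩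
    · exact CStar.congr_hom (h.lift_snd q₁ q₂ hq) ⟨(b₁, b₂), hb⟩

namespace IsExplicitPullback

variable {p₁ : P ⟶ B₁} {p₂ : P ⟶ B₂} {φ₁ : B₁ ⟶ B} {φ₂ : B₂ ⟶ B}

theorem isPullback (h : IsExplicitPullback p₁ p₂ φ₁ φ₂) : IsPullback p₁ p₂ φ₁ φ₂ := by
  refine ⟨⟨CStar.hom_ext h.comm⟩, ⟨Limits.PullbackCone.IsLimit.mk _ (fun s => ?_) (fun s => ?_)
    (fun s => ?_) (fun s m h₁ h₂ => ?_)⟩⟩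
  · have hs : ∀ x, φ₁ (s.fst x) = φ₂ (s.snd x) := fun x => CStar.congr_hom s.condition x
    choose f hf₁ hf₂ using fun x => h.surj _ _ (hs x)
    exact ({ toFun := f
             map_smul' := fun c x => h.eq (by simp only [hf₁, map_smul, MonoidHom.id_apply])
              (by simp only [hf₂, map_smul, MonoidHom.id_apply])
             map_zero' := h.eq (by simp only [hf₁, map_zero]) (by simp only [hf₂, map_zero])
             map_add' := fun x y => h.eq (by simp only [hf₁, map_add]) (by simp only [hf₂, map_add])
             map_mul' := fun x y => h.eq (by simp only [hf₁, map_mul]) (by simp only [hf₂, map_mul])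
             map_star' := fun x => h.eq (by simp only [hf₁, map_star])
              (by simp only [hf₂, map_star]) } : s.pt →⋆ₙₐ[ℂ] P)
  · have hs : ∀ x, φ₁ (s.fst x) = φ₂ (s.snd x) := fun x => CStar.congr_hom s.condition x
    exact CStar.hom_ext fun x => (h.surj _ _ (hs x)).choose_spec.1
  · have hs : ∀ x, φ₁ (s.fst x) = φ₂ (s.snd x) := fun x => CStar.congr_hom s.condition x
    exact CStar.hom_ext fun x => (h.surj _ _ (hs x)).choose_spec.2
  · have hs : ∀ x, φ₁ (s.fst x) = φ₂ (s.snd x) := fun x => CStar.congr_hom s.condition x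
    refine CStar.hom_ext fun x => h.eq ?_ ?_
    · exact (CStar.congr_hom h₁ x).trans (h.surj _ _ (hs x)).choose_spec.1.symm
    · exact (CStar.congr_hom h₂ x).trans (h.surj _ _ (hs x)).choose_spec.2.symm

theorem matNorm_le (h : IsExplicitPullback p₁ p₂ φ₁ φ₂) {n : Type*} [Fintype n]
    (M : CStarMatrix n n P) {c : ℝ} (hc : 0 ≤ c)
    (h₁ : matNorm (CStarMatrix.ofMatrix fun i j => p₁ (M i j)) ≤ c)
    (h₂ : matNorm (CStarMatrix.ofMatrix fun i j => p₂ (M i j)) ≤ c) : matNorm M ≤ c := by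
  let E : Bool → CStar.{u} := fun b => Bool.rec (motive := fun _ => CStar.{u}) B₁ B₂ b
  let _ : ∀ b, NonUnitalCStarAlgebra (E b).carrier := fun b => (E b).str
  let π : ∀ b, P ⟶ E b := fun b => Bool.rec (motive := fun b => P ⟶ E b) p₁ p₂ b
  refine matNorm_le_of_separating (E := fun b => (E b).carrier) (fun b => ConcreteCategory.hom (π b))
    (fun x hx => h.inj x (hx false) (hx true))
    hc fun b => ?_
  cases b
  · exact h₁
  · exact h₂

theorem norm_le (h : IsExplicitPullback p₁ p₂ φ₁ φ₂) (x : P) {c : ℝ} (hc : 0 ≤ c)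
    (h₁ : ‖p₁ x‖ ≤ c) (h₂ : ‖p₂ x‖ ≤ c) : ‖x‖ ≤ c := by
  let E : Bool → CStar.{u} := fun b => Bool.rec (motive := fun _ => CStar.{u}) B₁ B₂ b
  let _ : ∀ b, NonUnitalCStarAlgebra (E b).carrier := fun b => (E b).str
  let π : ∀ b, P ⟶ E b := fun b => Bool.rec (motive := fun b => P ⟶ E b) p₁ p₂ b
  refine norm_le_of_separating (E := fun b => (E b).carrier) (fun b => ConcreteCategory.hom (π b))
    (fun x hx => h.inj x (hx false) (hx true))
    hc fun b => ?_
  cases b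
  · exact h₁
  · exact h₂

theorem exists_section (h : IsExplicitPullback p₁ p₂ φ₁ φ₂) {σ : B ⟶ B₂} (hσ : ∀ b, φ₂ (σ b) = b) :
    ∃ s : B₁ ⟶ P, s ≫ p₁ = 𝟙 B₁ ∧ s ≫ p₂ = φ₁ ≫ σ := by
  have hw : 𝟙 B₁ ≫ φ₁ = (φ₁ ≫ σ) ≫ φ₂ := CStar.hom_ext fun b => (hσ _).symm
  exact ⟨h.isPullback.lift _ _ hw, h.isPullback.lift_fst _ _ hw, h.isPullback.lift_snd _ _ hw⟩

/-- The linear retraction `b ↦ b - σ φ₂ b` of `B₂` onto the kernel of `φ₂`, as a completely bounded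
map into the pullback. -/
theorem exists_retraction (h : IsExplicitPullback p₁ p₂ φ₁ φ₂) {σ : B ⟶ B₂}
    (hσ : ∀ b, φ₂ (σ b) = b) : ∃ r : (B₂ : Type u) →L[ℂ] P, IsCompletelyBounded r 2 ∧
      (∀ b, p₁ (r b) = 0) ∧ ∀ b, p₂ (r b) = b - σ (φ₂ b) := by
  have h0 : ∀ b : B₂, φ₁ 0 = φ₂ (b - σ (φ₂ b)) := fun b => by
    rw [map_zero, map_sub, hσ, sub_self]
  choose f hf₁ hf₂ using fun b => h.surj _ _ (h0 b)
  let l : (B₂ : Type u) →ₗ[ℂ] P :=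
    { toFun := f
      map_add' := fun x y => h.eq (by simp only [hf₁, map_add, add_zero])
        (by simp only [hf₂, map_add]; abel)
      map_smul' := fun c x => h.eq (by simp only [hf₁, map_smul, smul_zero])
        (by simp only [hf₂, map_smul, smul_sub, RingHom.id_apply]) }
  have hl₁ : ∀ b, p₁ (l b) = 0 := hf₁
  have hl₂ : ∀ b, p₂ (l b) = b - σ (φ₂ b) := hf₂
  have hn : ∀ b : B₂, ‖l b‖ ≤ 2 * ‖b‖ := fun b => by
    refine h.norm_le _ (by positivity) (by rw [hl₁, norm_zero]; positivity) ?_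
    rw [hl₂]
    refine (norm_sub_le _ _).trans ?_
    have h1 : ‖σ (φ₂ b)‖ ≤ ‖b‖ :=
      (NonUnitalStarAlgHom.norm_apply_le (ConcreteCategory.hom σ) _).trans
        (NonUnitalStarAlgHom.norm_apply_le (ConcreteCategory.hom φ₂) _)
    linarith
  refine ⟨l.mkContinuous 2 hn, fun n M => ?_, hl₁, hl₂⟩
  have hM := matNorm_nonneg M
  refine h.matNorm_le _ (by positivity) ?_ ?_
  · have e : (CStarMatrix.ofMatrix fun i j => p₁ (l (M i j)) : CStarMatrix (Fin n) (Fin n) B₁) = 0 := by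
      ext i j
      exact hl₁ _
    change matNorm (CStarMatrix.ofMatrix fun i j => p₁ (l (M i j))) ≤ _
    rw [e, matNorm_zero]
    positivity
  · have e : (CStarMatrix.ofMatrix fun i j => p₂ (l (M i j)) : CStarMatrix (Fin n) (Fin n) B₂) =
        M + -(CStarMatrix.mapₙₐ (ConcreteCategory.hom (φ₂ ≫ σ)) M) := by
      ext i j
      rw [CStarMatrix.add_apply, CStarMatrix.neg_apply, ← sub_eq_add_neg]
      exact hl₂ _
    change matNorm (CStarMatrix.ofMatrix fun i j => p₂ (l (M i j))) ≤ _
    rw [e, two_mul]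
    refine (matNorm_add_le _ _).trans (add_le_add le_rfl ?_)
    rw [matNorm_neg]
    exact matNorm_hom_le _ M

end IsExplicitPullback

end Pullback

/-- A criterion for decency. -/
theorem isDecent_of_retractions {F : CStarEndo.{u}}
    (hz : ∀ Z : CStar.{u}, Subsingleton Z → Subsingleton (F.obj Z))
    (hF : ∀ {P B₁ B₂ B : CStar.{u}} (p₁ : P ⟶ B₁) (p₂ : P ⟶ B₂) (φ₁ : B₁ ⟶ B) (φ₂ : B₂ ⟶ B)
      (σ : B ⟶ B₂), (∀ b, φ₂ (σ b) = b) → IsExplicitPullback p₁ p₂ φ₁ φ₂ →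
        (∀ x : F.obj P, F.map p₁ x = 0 → F.map p₂ x = 0 → x = 0) ∧
        ∀ y : F.obj B₂, ∃ w : F.obj P, F.map p₁ w = 0 ∧ F.map p₂ w = y - F.map (φ₂ ≫ σ) y) :
    IsDecent F where
  zero Z hZ := (CStar.isZero_iff_subsingleton _).2 (hz Z ((CStar.isZero_iff_subsingleton Z).1 hZ))
  pullback {P B₁ B₂ B} p₁ p₂ φ₁ φ₂ hs h := by
    obtain ⟨⟨σ, hσ⟩⟩ := hs.exists_splitEpi
    have hσ' : ∀ b, φ₂ (σ b) = b := fun b => CStar.congr_hom hσ b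
    have h' := isExplicitPullback_of_isPullback h
    obtain ⟨hinj, hE⟩ := hF p₁ p₂ φ₁ φ₂ σ hσ' h'
    obtain ⟨s, hs₁, hs₂⟩ := h'.exists_section hσ'
    have hcomm : ∀ x, F.map φ₁ (F.map p₁ x) = F.map φ₂ (F.map p₂ x) := fun x => by
      rw [← CStar.map_comp_apply, ← CStar.map_comp_apply, h.w]
    refine IsExplicitPullback.isPullback ⟨hcomm, hinj, fun x₁ x₂ hx => ?_⟩
    have hu : F.map p₁ (F.map s x₁) = x₁ := by
      rw [← CStar.map_comp_apply, hs₁, CStar.map_id_apply]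
    obtain ⟨w, hw₁, hw₂⟩ := hE (x₂ - F.map p₂ (F.map s x₁))
    refine ⟨F.map s x₁ + w, ?_, ?_⟩
    · rw [map_add, hu, hw₁, add_zero]
    · have h0 : F.map φ₂ (x₂ - F.map p₂ (F.map s x₁)) = 0 := by
        rw [map_sub, ← hcomm, hu, hx, sub_self]
      rw [map_add, hw₂, CStar.map_comp_apply, h0, map_zero]
      abel

end

/-! ### Endofunctors with coordinates -/

noncomputable section

/-- The map `b ↦ a ⊗ b`. -/
def tensL {A B : CStar.{u}} (a : A) : (B : Type u) →L[ℂ] tensorObj A B := MaxTensor.tmulL a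

theorem isCompletelyBounded_tensL {A B : CStar.{u}} (a : A) :
    IsCompletelyBounded (tensL (B := B) a) ‖a‖ := isCompletelyBounded_tmulL a

/-- The functoriality of `A ⊗ –`. -/
def tensMap (A : CStar.{u}) {B C : CStar.{u}} (φ : B ⟶ C) : tensorObj A B ⟶ tensorObj A C :=
  (tensorFunctor A).map φ

/-- The functoriality of `– ⊗ B`. -/
def tensMapLeft {A A' : CStar.{u}} (φ : A ⟶ A') (B : CStar.{u}) : tensorObj A B ⟶ tensorObj A' B :=
  (tensorFunctorMap φ).app B

/-- The map `A ⊗ (A' ⊗ B) → (A ⊗ A') ⊗ B`. -/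
def tensAssoc (A A' B : CStar.{u}) :
    tensorObj A (tensorObj A' B) ⟶ tensorObj (tensorObj A A') B := tensorAssoc A A' B

/-- The map `B → ℂ ⊗ B`. -/
def tensUnit (B : CStar.{u}) : B ⟶ tensorObj complexObj B := tensorUnit B

/-- A natural family of linear coordinates `F B → B` on an endofunctor `F`, to which completely
bounded maps can be applied. -/
structure Coordinates (F : CStarEndo.{u}) (ι : Type*) where
  ev : ∀ B : CStar.{u}, ι → (F.obj B : Type u) →ₗ[ℂ] B
  ext : ∀ {B : CStar.{u}} {x y : F.obj B}, (∀ i, ev B i x = ev B i y) → x = y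
  map : ∀ {B C : CStar.{u}} (φ : B ⟶ C) (x : F.obj B) (i : ι), ev C i (F.map φ x) = φ (ev B i x)
  ev_star : ∀ i, ∃ j, ∀ (B : CStar.{u}) (x : F.obj B), ev B i (star x) = star (ev B j x)
  lift : ∀ {B C : CStar.{u}} (r : (B : Type u) →L[ℂ] C) (K : ℝ), 0 ≤ K → IsCompletelyBounded r K →
    ∀ x : F.obj B, ∃ y : F.obj C, (∀ i, ev C i y = r (ev B i x)) ∧ ‖y‖ ≤ K * ‖x‖
  mul : ∀ {A B : CStar.{u}} (a a' : A) (x x' : F.obj B) (y y' z : F.obj (tensorObj A B)),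
    (∀ i, ev _ i y = tensL a (ev B i x)) → (∀ i, ev _ i y' = tensL a' (ev B i x')) →
    (∀ i, ev _ i z = tensL (a * a') (ev B i (x * x'))) → y * y' = z

namespace Coordinates

variable {F₀ F : CStarEndo.{u}} {ι : Type*} (c : Coordinates F₀ ι)

/-- The element with the coordinates `a ⊗ x i`. -/
def lab {A B : CStar.{u}} (a : A) (x : F₀.obj B) : F₀.obj (tensorObj A B) :=
  (c.lift (tensL a) ‖a‖ (norm_nonneg a) (isCompletelyBounded_tensL a) x).choose

theorem ev_lab {A B : CStar.{u}} (a : A) (x : F₀.obj B) (i : ι) :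
    c.ev _ i (c.lab a x) = tensL a (c.ev B i x) :=
  (c.lift (tensL a) ‖a‖ (norm_nonneg a) (isCompletelyBounded_tensL a) x).choose_spec.1 i

theorem norm_lab_le {A B : CStar.{u}} (a : A) (x : F₀.obj B) : ‖c.lab a x‖ ≤ ‖a‖ * ‖x‖ :=
  (c.lift (tensL a) ‖a‖ (norm_nonneg a) (isCompletelyBounded_tensL a) x).choose_spec.2

theorem eq_lab {A B : CStar.{u}} {a : A} {x : F₀.obj B} {y : F₀.obj (tensorObj A B)}
    (h : ∀ i, c.ev _ i y = tensL a (c.ev B i x)) : y = c.lab a x :=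
  c.ext fun i => by rw [h, ev_lab]

theorem lab_add {A B : CStar.{u}} (a : A) (x y : F₀.obj B) :
    c.lab a (x + y) = c.lab a x + c.lab a y :=
  (c.eq_lab fun i => by simp only [map_add, ev_lab]).symm

theorem lab_smul {A B : CStar.{u}} (a : A) (z : ℂ) (x : F₀.obj B) :
    c.lab a (z • x) = z • c.lab a x :=
  (c.eq_lab fun i => by simp only [map_smul, ev_lab]).symm

theorem lab_sub {A B : CStar.{u}} (a : A) (x y : F₀.obj B) :
    c.lab a (x - y) = c.lab a x - c.lab a y :=
  (c.eq_lab fun i => by simp only [map_sub, ev_lab]).symm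

theorem add_lab {A B : CStar.{u}} (a a' : A) (x : F₀.obj B) :
    c.lab (a + a') x = c.lab a x + c.lab a' x :=
  (c.eq_lab fun i => by rw [map_add, ev_lab, ev_lab]; exact (MaxTensor.add_tmul _ _ _).symm).symm

theorem smul_lab {A B : CStar.{u}} (z : ℂ) (a : A) (x : F₀.obj B) :
    c.lab (z • a) x = z • c.lab a x :=
  (c.eq_lab fun i => by rw [map_smul, ev_lab]; exact (MaxTensor.smul_tmul _ _ _).symm).symm

theorem lab_mul_lab {A B : CStar.{u}} (a a' : A) (x x' : F₀.obj B) :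
    c.lab a x * c.lab a' x' = c.lab (a * a') (x * x') :=
  c.mul a a' x x' _ _ _ (c.ev_lab a x) (c.ev_lab a' x') (c.ev_lab _ _)

theorem star_lab {A B : CStar.{u}} (a : A) (x : F₀.obj B) :
    star (c.lab a x) = c.lab (star a) (star x) :=
  c.eq_lab fun i => by
    obtain ⟨j, hj⟩ := c.ev_star i
    rw [hj, hj, ev_lab]
    exact MaxTensor.star_tmul _ _

theorem map_lab {A B C : CStar.{u}} (φ : B ⟶ C) (a : A) (x : F₀.obj B) :
    F₀.map (tensMap A φ) (c.lab a x) = c.lab a (F₀.map φ x) :=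
  c.eq_lab fun i => by
    refine (c.map _ _ i).trans ?_
    rw [c.map]
    refine (congrArg _ (c.ev_lab a x i)).trans ?_
    exact MaxTensor.map_tmul _ _ _ _

theorem map_lab_left {A A' B : CStar.{u}} (φ : A ⟶ A') (a : A) (x : F₀.obj B) :
    F₀.map (tensMapLeft φ B) (c.lab a x) = c.lab (φ a) x :=
  c.eq_lab fun i => by
    refine (c.map _ _ i).trans ?_
    refine (congrArg _ (c.ev_lab a x i)).trans ?_
    exact MaxTensor.map_tmul _ _ _ _

theorem map_assoc_lab {A A' B : CStar.{u}} (a : A) (a' : A') (x : F₀.obj B) :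
    F₀.map (tensAssoc A A' B) (c.lab a (c.lab a' x)) =
      c.lab (A := tensorObj A A') (MaxTensor.tmul a a') x :=
  c.eq_lab fun i => by
    refine (c.map _ _ i).trans ?_
    refine (congrArg _ ((c.ev_lab a _ i).trans (congrArg _ (c.ev_lab a' x i)))).trans ?_
    exact MaxTensor.assocInv_tmul _ _ _

theorem map_unit {B : CStar.{u}} (x : F₀.obj B) :
    F₀.map (tensUnit B) x = c.lab (A := complexObj) (1 : PUnit.{u + 1} → ℂ) x :=
  c.eq_lab fun i => c.map _ _ i

/-- An endofunctor with coordinates, and a quotient of it which is compatible with completely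
bounded maps. -/
structure Presentation (c : Coordinates F₀ ι) (F : CStarEndo.{u}) where
  π : F₀ ⟶ F
  surj : ∀ B : CStar.{u}, Function.Surjective (π.app B)
  ker : ∀ {B C : CStar.{u}} (r : (B : Type u) →L[ℂ] C) (K : ℝ), 0 ≤ K → IsCompletelyBounded r K →
    ∀ (x : F₀.obj B) (y : F₀.obj C), (∀ i, c.ev C i y = r (c.ev B i x)) → π.app B x = 0 →
      π.app C y = 0

/-- The presentation of the endofunctor itself. -/
def presentation (c : Coordinates F₀ ι) : Presentation c F₀ where
  π := 𝟙 F₀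
  surj B x := ⟨x, rfl⟩
  ker {B C} r K _ _ x y h hx := by
    have h0 : x = 0 := hx
    have hy : y = 0 := c.ext fun i => by rw [h, h0, map_zero, map_zero, map_zero]
    exact hy

namespace Presentation

variable {c} (q : Presentation c F)

/-- The quotient map. -/
def proj (B : CStar.{u}) : (F₀.obj B : Type u) →⋆ₙₐ[ℂ] F.obj B := q.π.app B

theorem proj_surjective (B : CStar.{u}) : Function.Surjective (q.proj B) := q.surj B

theorem map_proj {B C : CStar.{u}} (φ : B ⟶ C) (x : F₀.obj B) :
    F.map φ (q.proj B x) = q.proj C (F₀.map φ x) :=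
  (CStar.congr_hom (q.π.naturality φ) x).symm

theorem proj_lab_congr {A B : CStar.{u}} (a : A) {x x' : F₀.obj B} (h : q.proj B x = q.proj B x') :
    q.proj _ (c.lab a x) = q.proj _ (c.lab a x') := by
  rw [← sub_eq_zero, ← map_sub, ← lab_sub]
  refine q.ker (tensL a) ‖a‖ (norm_nonneg a) (isCompletelyBounded_tensL a) _ _ (c.ev_lab a _) ?_
  change q.proj B (x - x') = 0
  rw [map_sub, h, sub_self]

/-- The labeling, as a bilinear map. -/
def labBilin (A B : CStar.{u}) : (A : Type u) →ₗ[ℂ] (F.obj B : Type u) →ₗ[ℂ] F.obj (tensorObj A B) :=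
  LinearMap.mk₂ ℂ (fun a y => q.proj _ (c.lab a (Function.surjInv (q.proj_surjective B) y)))
    (fun a a' y => by rw [add_lab, map_add])
    (fun z a y => by rw [smul_lab, map_smul])
    (fun a y y' => by
      rw [← map_add, ← lab_add]
      refine q.proj_lab_congr a ?_
      rw [map_add]; simp only [Function.surjInv_eq])
    (fun z a y => by
      rw [← map_smul, ← lab_smul]
      refine q.proj_lab_congr a ?_
      rw [map_smul]; simp only [Function.surjInv_eq])

theorem labBilin_proj {A B : CStar.{u}} (a : A) (x : F₀.obj B) :
    q.labBilin A B a (q.proj B x) = q.proj _ (c.lab a x) :=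
  q.proj_lab_congr a (Function.surjInv_eq _ _)

theorem labBilin_mul {A B : CStar.{u}} (a : A) (y : F.obj B) (a' : A) (y' : F.obj B) :
    q.labBilin A B a y * q.labBilin A B a' y' = q.labBilin A B (a * a') (y * y') := by
  obtain ⟨x, rfl⟩ := q.proj_surjective B y
  obtain ⟨x', rfl⟩ := q.proj_surjective B y'
  rw [← map_mul, labBilin_proj, labBilin_proj, labBilin_proj, ← map_mul, lab_mul_lab]

theorem labBilin_star {A B : CStar.{u}} (a : A) (y : F.obj B) :
    star (q.labBilin A B a y) = q.labBilin A B (star a) (star y) := by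
  obtain ⟨x, rfl⟩ := q.proj_surjective B y
  rw [← map_star (q.proj B), labBilin_proj, labBilin_proj, ← map_star (q.proj _), star_lab]

theorem norm_labBilin_le {A B : CStar.{u}} (a : A) (y : F.obj B) :
    ‖q.labBilin A B a y‖ ≤ ‖a‖ * ‖y‖ := by
  let f : (F₀.obj B : Type u) →L[ℂ] F.obj B :=
    ⟨(q.proj B : (F₀.obj B : Type u) →ₗ[ℂ] F.obj B), map_continuous (q.proj B)⟩
  obtain ⟨C, hC, hf⟩ := f.exists_preimage_norm_le (q.proj_surjective B)
  refine le_of_le_mul_of_sq_le (T := A × F.obj B) (fun p => ‖q.labBilin A B p.1 p.2‖)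
    (fun p => ‖p.1‖ * ‖p.2‖) C (fun p => by positivity) (fun p => ?_) (fun p => ?_) (a, y)
  · obtain ⟨x, hx, hxC⟩ := hf p.2
    have hx' : q.proj B x = p.2 := hx
    rw [← hx', labBilin_proj, hx']
    calc _ ≤ ‖c.lab p.1 x‖ := NonUnitalStarAlgHom.norm_apply_le _ _
      _ ≤ ‖p.1‖ * ‖x‖ := c.norm_lab_le _ _
      _ ≤ ‖p.1‖ * (C * ‖p.2‖) := by gcongr
      _ = _ := by ring
  · refine ⟨(star p.1 * p.1, star p.2 * p.2), ?_, ?_⟩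
    · dsimp only
      rw [CStarRing.norm_star_mul_self, CStarRing.norm_star_mul_self]
      exact le_of_eq (by ring)
    · dsimp only
      rw [← labBilin_mul, ← labBilin_star, CStarRing.norm_star_mul_self, sq]

/-- The labeling. -/
def label (A B : CStar.{u}) : MaxTensor A (F.obj B) →⋆ₙₐ[ℂ] F.obj (tensorObj A B) :=
  MaxTensor.lift (q.labBilin A B) q.labBilin_mul q.labBilin_star q.norm_labBilin_le

theorem label_tmul {A B : CStar.{u}} (a : A) (x : F₀.obj B) :
    q.label A B (MaxTensor.tmul a (q.proj B x)) = q.proj _ (c.lab a x) := by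
  rw [label, MaxTensor.lift_tmul, labBilin_proj]

theorem decent (q : Presentation c F) : IsDecent F := by
  refine isDecent_of_retractions (fun Z hZ => ?_) fun {P B₁ B₂ B} p₁ p₂ φ₁ φ₂ σ hσ h => ?_
  · have : Subsingleton (F₀.obj Z) := ⟨fun x y => c.ext fun i => Subsingleton.elim _ _⟩
    exact (q.proj_surjective Z).subsingleton
  · obtain ⟨r, hr, hr₁, hr₂⟩ := h.exists_retraction hσ
    obtain ⟨s, hs₁, hs₂⟩ := h.exists_section hσ
    have hinj : ∀ x : F₀.obj P, F₀.map p₁ x = 0 → F₀.map p₂ x = 0 → x = 0 := fun x h₁ h₂ =>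
      c.ext fun i => by
        rw [map_zero]
        refine h.inj _ ?_ ?_
        · rw [← c.map, h₁, map_zero]
        · rw [← c.map, h₂, map_zero]
    have hw : ∀ y : F₀.obj B₂, ∃ w : F₀.obj P, (∀ i, c.ev P i w = r (c.ev B₂ i y)) ∧
        F₀.map p₁ w = 0 ∧ F₀.map p₂ w = y - F₀.map (φ₂ ≫ σ) y := fun y => by
      obtain ⟨w, hw, -⟩ := c.lift r 2 zero_le_two hr y
      refine ⟨w, hw, c.ext fun i => ?_, c.ext fun i => ?_⟩
      · rw [c.map, hw, hr₁, map_zero]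
      · rw [c.map, hw, hr₂, map_sub, c.map]
        rfl
    refine ⟨fun x h₁ h₂ => ?_, fun y => ?_⟩
    · obtain ⟨x, rfl⟩ := q.proj_surjective P x
      rw [map_proj] at h₁ h₂
      set y := x - F₀.map s (F₀.map p₁ x) with hy
      have hxy : q.proj P x = q.proj P y := by
        rw [hy, map_sub, ← q.map_proj s, h₁, map_zero, sub_zero]
      have hy₁ : F₀.map p₁ y = 0 := by
        rw [hy, map_sub, ← CStar.map_comp_apply _ s p₁, hs₁, CStar.map_id_apply, sub_self]
      have hy₂ : q.proj B₂ (F₀.map p₂ y) = 0 := by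
        rw [← map_proj, ← hxy, map_proj, h₂]
      obtain ⟨w, hw, hw₁, hw₂⟩ := hw (F₀.map p₂ y)
      have h0 : F₀.map (φ₂ ≫ σ) (F₀.map p₂ y) = 0 := by
        rw [CStar.map_comp_apply, ← CStar.map_comp_apply _ p₂ φ₂, ← h.isPullback.w,
          CStar.map_comp_apply, hy₁, map_zero, map_zero]
      have hwy : y = w := sub_eq_zero.1 (hinj _ (by rw [map_sub, hy₁, hw₁, sub_zero]) (by
        rw [map_sub, hw₂, h0, sub_zero, sub_self]))
      rw [hxy, hwy]
      exact q.ker r 2 zero_le_two hr _ _ hw hy₂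
    · obtain ⟨y, rfl⟩ := q.proj_surjective B₂ y
      obtain ⟨w, -, hw₁, hw₂⟩ := hw y
      refine ⟨q.proj P w, ?_, ?_⟩
      · rw [map_proj, hw₁, map_zero]
      · rw [map_proj, hw₂, map_sub, map_proj]

/-- The good endofunctor defined by a presentation. -/
def good : GoodStructure F where
  κ A :=
    { app := fun B => q.label A B
      naturality := fun B C φ => by
        refine MaxTensor.ext_hom fun a y => ?_
        obtain ⟨x, rfl⟩ := q.proj_surjective B y
        change q.label A C (MaxTensor.map (NonUnitalStarAlgHom.id ℂ A) (F.map φ)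
          (MaxTensor.tmul a (q.proj B x))) =
            F.map (tensMap A φ) (q.label A B (MaxTensor.tmul a (q.proj B x)))
        rw [MaxTensor.map_tmul, label_tmul, map_proj, map_lab]
        change q.label A C (MaxTensor.tmul a (F.map φ (q.proj B x))) = _
        rw [map_proj, label_tmul] }
  natural {A A'} φ B := by
    refine MaxTensor.ext_hom fun a y => ?_
    obtain ⟨x, rfl⟩ := q.proj_surjective B y
    change F.map (tensMapLeft φ B) (q.label A B (MaxTensor.tmul a (q.proj B x))) =
      q.label A' B (MaxTensor.map φ (NonUnitalStarAlgHom.id ℂ _) (MaxTensor.tmul a (q.proj B x)))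
    rw [MaxTensor.map_tmul, label_tmul, map_proj, map_lab_left]
    exact (q.label_tmul _ _).symm
  assoc A A' B := by
    refine MaxTensor.ext_hom₃ fun a a' y => ?_
    obtain ⟨x, rfl⟩ := q.proj_surjective B y
    change F.map (tensAssoc A A' B) (q.label A (tensorObj A' B)
      (MaxTensor.map (NonUnitalStarAlgHom.id ℂ A) (q.label A' B)
        (MaxTensor.tmul a (MaxTensor.tmul a' (q.proj B x))))) =
      q.label (tensorObj A A') B (MaxTensor.assocInv
        (MaxTensor.tmul a (MaxTensor.tmul a' (q.proj B x))))
    rw [MaxTensor.map_tmul, MaxTensor.assocInv_tmul, label_tmul]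
    change F.map (tensAssoc A A' B) (q.label A (tensorObj A' B)
      (MaxTensor.tmul a (q.proj _ (c.lab a' x)))) = _
    rw [label_tmul, map_proj, map_assoc_lab]
    exact (q.label_tmul (A := tensorObj A A') _ _).symm
  unit B := by
    refine CStar.hom_ext fun y => ?_
    obtain ⟨x, rfl⟩ := q.proj_surjective B y
    change _ = F.map (tensUnit B) (q.proj B x)
    rw [map_proj, map_unit]
    exact q.label_tmul (A := complexObj) _ _
  decent := q.decent

theorem good_κ_tmul {A B : CStar.{u}} (a : A) (x : F₀.obj B) (y : F₀.obj (tensorObj A B))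
    (h : ∀ i, c.ev _ i y = tensL a (c.ev B i x)) :
    (q.good.κ A).app B (MaxTensor.tmul a (q.proj B x) : MaxTensor A (F.obj B)) = q.proj _ y := by
  rw [c.eq_lab h]
  exact q.label_tmul a x

end Presentation

end Coordinates

end

/-! ### The good endofunctors -/

noncomputable section

theorem IsCompletelyBounded.norm_le {B C : Type*} [NonUnitalCStarAlgebra B] [NonUnitalCStarAlgebra C]
    {r : B →L[ℂ] C} {K : ℝ} (hK : 0 ≤ K) (hr : IsCompletelyBounded r K) (b : B) :
    ‖r b‖ ≤ K * ‖b‖ := by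
  have h1 := norm_entry_le_matNorm (CStarMatrix.ofMatrix fun i j =>
    r ((CStarMatrix.ofMatrix fun _ _ => b : CStarMatrix (Fin 1) (Fin 1) B) i j)) 0 0
  have h2 := matNorm_le_card_mul (CStarMatrix.ofMatrix fun _ _ => b : CStarMatrix (Fin 1) (Fin 1) B)
    (norm_nonneg b) fun _ _ => le_rfl
  refine h1.trans ((hr 1 _).trans (mul_le_mul_of_nonneg_left (h2.trans ?_) hK))
  simp

namespace relC0

variable {𝒳 : Type*} [MetricSpace 𝒳] {𝒳₀ : Set 𝒳} {B C : Type*} [NonUnitalCStarAlgebra B]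
  [NonUnitalCStarAlgebra C]

theorem norm_apply_le (f : relC0 B 𝒳₀) (z : 𝒳) : ‖f.1 z‖ ≤ ‖f‖ :=
  f.1.toBCF.norm_coe_le_norm z

theorem norm_le {f : relC0 B 𝒳₀} {c : ℝ} (hc : 0 ≤ c) (h : ∀ z, ‖f.1 z‖ ≤ c) : ‖f‖ ≤ c :=
  (BoundedContinuousFunction.norm_le (f := f.1.toBCF) hc).2 h

theorem ext {f g : relC0 B 𝒳₀} (h : ∀ z, f.1 z = g.1 z) : f = g :=
  Subtype.ext (ZeroAtInftyContinuousMap.ext h)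

/-- The function with given values. -/
def of (f : 𝒳 → B) (hf : Continuous f) (h : Tendsto f (cocompact 𝒳) (𝓝 0)) (h₀ : ∀ z ∈ 𝒳₀, f z = 0) :
    relC0 B 𝒳₀ := ⟨⟨⟨f, hf⟩, h⟩, h₀⟩

/-- Composition with a bounded linear map. -/
def compL (r : B →L[ℂ] C) (f : relC0 B 𝒳₀) : relC0 C 𝒳₀ :=
  of (fun z => r (f.1 z)) (r.continuous.comp f.1.continuous)
    (by
      have h := (r.continuous.tendsto 0).comp f.1.zero_at_infty'
      rw [map_zero] at h
      exact h)
    fun z hz => by rw [f.2 z hz, map_zero]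

end relC0

/-- Composition of a function on the interval with a bounded linear map. -/
def cylinderCompL {B C : Type*} [NonUnitalCStarAlgebra B] [NonUnitalCStarAlgebra C]
    (r : B →L[ℂ] C) (f : C(unitInterval, B)) : C(unitInterval, C) :=
  ⟨fun t => r (f t), r.continuous.comp f.continuous⟩

/-- Evaluation as coordinates on the cylinder functor. -/
def cylinderCoordinates : Coordinates cylinderFunctor.{u} unitInterval where
  ev B t := { toFun := fun f : C(unitInterval, B) => f t
              map_add' := fun _ _ => rfl
              map_smul' := fun _ _ => rfl }
  ext {B} x y h := (ContinuousMap.ext h : (x : C(unitInterval, B)) = y)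
  map φ x t := rfl
  ev_star t := ⟨t, fun B x => rfl⟩
  lift {B C} r K hK hr x := by
    let f : C(unitInterval, B) := x
    refine ⟨cylinderCompL r f, fun t => rfl, ?_⟩
    refine (ContinuousMap.norm_le _ (by positivity)).2 fun t => ?_
    exact (hr.norm_le hK _).trans (mul_le_mul_of_nonneg_left (f.norm_coe_le_norm t) hK)
  mul {A B} a a' x x' y y' z hy hy' hz := by
    refine (ContinuousMap.ext fun t => ?_ :
      ((y * y' : cylinderFunctor.obj (tensorObj A B)) : C(unitInterval, tensorObj A B)) = z)
    refine Eq.trans ?_ (hz t).symm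
    refine (congrArg₂ (· * ·) (hy t) (hy' t)).trans ?_
    exact MaxTensor.tmul_mul_tmul _ _ _ _

/-- Evaluation as coordinates on `C₀(𝒳, 𝒳₀, –)`. -/
def relC0Coordinates {𝒳 : Type u} [MetricSpace 𝒳] (𝒳₀ : Set 𝒳) :
    Coordinates (relC0Functor 𝒳₀) 𝒳 where
  ev B z := { toFun := fun f : relC0 B 𝒳₀ => f.1 z
              map_add' := fun _ _ => rfl
              map_smul' := fun _ _ => rfl }
  ext {B} x y h := (relC0.ext h : (x : relC0 B 𝒳₀) = y)
  map φ x t := rfl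
  ev_star t := ⟨t, fun B x => rfl⟩
  lift {B C} r K hK hr x := by
    let f : relC0 B 𝒳₀ := x
    refine ⟨relC0.compL r f, fun t => rfl, ?_⟩
    refine relC0.norm_le (f := relC0.compL r f) (by positivity) fun t => ?_
    exact (hr.norm_le hK _).trans (mul_le_mul_of_nonneg_left (relC0.norm_apply_le f t) hK)
  mul {A B} a a' x x' y y' z hy hy' hz := by
    refine (relC0.ext fun t => ?_ :
      ((y * y' : (relC0Functor 𝒳₀).obj (tensorObj A B)) : relC0 (tensorObj A B) 𝒳₀) = z)
    refine Eq.trans ?_ (hz t).symm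
    refine (congrArg₂ (· * ·) (hy t) (hy' t)).trans ?_
    exact MaxTensor.tmul_mul_tmul _ _ _ _

/-- The endofunctor `B ↦ C_b([0,∞), B)`. -/
def bddFunctor : CStarEndo.{u} where
  obj B := ⟨ℝ≥0 →ᵇ B⟩
  map φ := bddMap φ
  map_id _ := rfl
  map_comp _ _ := rfl

/-- Composition of a bounded function with a bounded linear map. -/
def bddCompL {B C : Type*} [NonUnitalCStarAlgebra B] [NonUnitalCStarAlgebra C]
    (r : B →L[ℂ] C) (f : ℝ≥0 →ᵇ B) : ℝ≥0 →ᵇ C :=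
  BoundedContinuousFunction.ofNormedAddCommGroup (fun t => r (f t)) (r.continuous.comp f.continuous)
    (‖r‖ * ‖f‖) fun t => (r.le_opNorm _).trans
      (mul_le_mul_of_nonneg_left (f.norm_coe_le_norm t) (norm_nonneg r))

/-- Evaluation as coordinates on `C_b([0,∞), –)`. -/
def bddCoordinates : Coordinates bddFunctor.{u} ℝ≥0 where
  ev B t := { toFun := fun f : ℝ≥0 →ᵇ B => f t
              map_add' := fun _ _ => rfl
              map_smul' := fun _ _ => rfl }
  ext {B} x y h := (BoundedContinuousFunction.ext h : (x : ℝ≥0 →ᵇ B) = y)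
  map φ x t := rfl
  ev_star t := ⟨t, fun B x => rfl⟩
  lift {B C} r K hK hr x := by
    let f : ℝ≥0 →ᵇ B := x
    refine ⟨bddCompL r f, fun t => rfl, ?_⟩
    refine (BoundedContinuousFunction.norm_le (f := bddCompL r f) (by positivity)).2 fun t => ?_
    exact (hr.norm_le hK _).trans (mul_le_mul_of_nonneg_left (f.norm_coe_le_norm t) hK)
  mul {A B} a a' x x' y y' z hy hy' hz := by
    refine (BoundedContinuousFunction.ext fun t => ?_ :
      ((y * y' : bddFunctor.obj (tensorObj A B)) : ℝ≥0 →ᵇ tensorObj A B) = z)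
    refine Eq.trans ?_ (hz t).symm
    refine (congrArg₂ (· * ·) (hy t) (hy' t)).trans ?_
    exact MaxTensor.tmul_mul_tmul _ _ _ _

/-- The presentation of `𝔄` as a quotient of `C_b([0,∞), –)`. -/
def asymptoticPresentation : bddCoordinates.{u}.Presentation asymptoticFunctor where
  π := { app := fun B => ((vanishingIdeal B).projHom : (ℝ≥0 →ᵇ B) →⋆ₙₐ[ℂ] AsymptoticAlgebra B)
         naturality := fun B C φ => rfl }
  surj B := CStarIdeal.proj_surjective (J := vanishingIdeal B)
  ker {B C} r K hK hr x y h hx := by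
    let f : ℝ≥0 →ᵇ B := x
    let g : ℝ≥0 →ᵇ C := y
    have hf : (vanishingIdeal B).proj f = (vanishingIdeal B).proj 0 := hx
    rw [CStarIdeal.proj_eq_iff, sub_zero] at hf
    change (vanishingIdeal C).proj g = (vanishingIdeal C).proj 0
    rw [CStarIdeal.proj_eq_iff, sub_zero]
    have h1 : Tendsto (fun t => r (f t)) atTop (𝓝 0) := by
      have := (r.continuous.tendsto 0).comp (show Tendsto f atTop (𝓝 0) from hf)
      rw [map_zero] at this
      exact this
    exact h1.congr fun t => (h t).symm

theorem matrixAlgebra_norm_mapCB_le {X B C : Type*} {𝓔 : SupportFamily X} [NonUnitalCStarAlgebra B]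
    [NonUnitalCStarAlgebra C] {r : B →L[ℂ] C} {K : ℝ} (hK : 0 ≤ K) (hr : IsCompletelyBounded r K)
    (m : MatrixAlgebra 𝓔 B) : ‖MatrixAlgebra.mapCB r hK hr m‖ ≤ K * ‖m‖ := by
  refine CStarCompletion.ind m (isClosed_le (MatrixAlgebra.mapCB r hK hr).continuous.norm
    (continuous_const.mul continuous_norm)) fun m => ?_
  rw [MatrixAlgebra.mapCB_mk, CStarCompletion.norm_mk, CStarCompletion.norm_mk]
  exact ControlledMatrix.norm_mapL_le hK hr m

/-- Matrix coefficients as coordinates on `𝕂`. -/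
def compactCoordinates : Coordinates compactFunctor.{u} (ℕ × ℕ) where
  ev B p := (MatrixAlgebra.coeffL (finiteSupports ℕ) B p.1 p.2).toLinearMap
  ext {B} x y h := (MatrixAlgebra.ext_coeff fun i j => h (i, j) : (x : CompactMatrices B) = y)
  map φ x p := MatrixAlgebra.coeff_map φ x p.1 p.2
  ev_star p := ⟨(p.2, p.1), fun B x => MatrixAlgebra.coeff_star (B := B) x p.1 p.2⟩
  lift {B C} r K hK hr x :=
    ⟨MatrixAlgebra.mapCB r hK hr x, fun p => MatrixAlgebra.coeff_mapCB r hK hr x p.1 p.2,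
      matrixAlgebra_norm_mapCB_le hK hr x⟩
  mul {A B} a a' x x' y y' z hy hy' hz := by
    have e : ∀ (a : A) (x : CompactMatrices B) (y : CompactMatrices (MaxTensor A B)),
        (∀ p : ℕ × ℕ, MatrixAlgebra.coeff y p.1 p.2 =
          MaxTensor.tmul a (MatrixAlgebra.coeff x p.1 p.2)) → y = MatrixAlgebra.lab a x :=
      fun a x y h => MatrixAlgebra.ext_coeff fun i j => by rw [MatrixAlgebra.coeff_lab, h (i, j)]
    have h1 := e a x y hy
    have h2 := e a' x' y' hy'
    have h3 := e (a * a') _ z hz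
    refine (congrArg₂ (· * ·) h1 h2).trans (Eq.trans ?_ h3.symm)
    exact MatrixAlgebra.lab_mul a a' _ _

section Roe

variable {X : Type u} [MetricSpace X] (hX : BoundedGeometry X) (X₀ : Set X)

/-- The uniform Roe functor. -/
def roeFunctor : CStarEndo.{u} where
  obj B := ⟨UniformRoe hX B⟩
  map φ := MatrixAlgebra.map φ
  map_id _ := MatrixAlgebra.map_id
  map_comp φ ψ := MatrixAlgebra.map_comp ψ φ

/-- Matrix coefficients as coordinates on the uniform Roe functor. -/
def roeCoordinates : Coordinates (roeFunctor hX) (X × X) where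
  ev B p := (MatrixAlgebra.coeffL (finitePropagation hX) B p.1 p.2).toLinearMap
  ext {B} x y h := (MatrixAlgebra.ext_coeff fun i j => h (i, j) : (x : UniformRoe hX B) = y)
  map φ x p := MatrixAlgebra.coeff_map φ x p.1 p.2
  ev_star p := ⟨(p.2, p.1), fun B x => MatrixAlgebra.coeff_star (B := B) x p.1 p.2⟩
  lift {B C} r K hK hr x :=
    ⟨MatrixAlgebra.mapCB r hK hr x, fun p => MatrixAlgebra.coeff_mapCB r hK hr x p.1 p.2,
      matrixAlgebra_norm_mapCB_le hK hr x⟩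
  mul {A B} a a' x x' y y' z hy hy' hz := by
    have e : ∀ (a : A) (x : UniformRoe hX B) (y : UniformRoe hX (MaxTensor A B)),
        (∀ p : X × X, MatrixAlgebra.coeff y p.1 p.2 =
          MaxTensor.tmul a (MatrixAlgebra.coeff x p.1 p.2)) → y = MatrixAlgebra.lab a x :=
      fun a x y h => MatrixAlgebra.ext_coeff fun i j => by rw [MatrixAlgebra.coeff_lab, h (i, j)]
    have h1 := e a x y hy
    have h2 := e a' x' y' hy'
    have h3 := e (a * a') _ z hz
    refine (congrArg₂ (· * ·) h1 h2).trans (Eq.trans ?_ h3.symm)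
    exact MatrixAlgebra.lab_mul a a' _ _

theorem mapCB_mem_relativeIdeal {B C : Type*} [NonUnitalCStarAlgebra B] [NonUnitalCStarAlgebra C]
    {r : B →L[ℂ] C} {K : ℝ} (hK : 0 ≤ K) (hr : IsCompletelyBounded r K) {m : UniformRoe hX B}
    (hm : m ∈ (relativeIdeal hX X₀ B).toSubmodule) :
    MatrixAlgebra.mapCB r hK hr m ∈ (relativeIdeal hX X₀ C).toSubmodule := by
  refine map_mem_closure (MatrixAlgebra.mapCB r hK hr).continuous hm fun m hm => ?_
  obtain ⟨R, hR⟩ := hm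
  refine ⟨R, fun x y h => hR x y fun h0 => h ?_⟩
  rw [MatrixAlgebra.coeff_mapCB, h0, map_zero]

/-- The presentation of the relative uniform Roe functor as a quotient. -/
def relRoePresentation : (roeCoordinates hX).Presentation (relRoeFunctor hX X₀) where
  π := { app := fun B => ((relativeIdeal hX X₀ B).projHom :
            UniformRoe hX B →⋆ₙₐ[ℂ] RelativeRoe hX X₀ B)
         naturality := fun B C φ => rfl }
  surj B := CStarIdeal.proj_surjective (J := relativeIdeal hX X₀ B)
  ker {B C} r K hK hr x y h hx := by
    let m : UniformRoe hX B := x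
    let n : UniformRoe hX C := y
    have hm : (relativeIdeal hX X₀ B).proj m = (relativeIdeal hX X₀ B).proj 0 := hx
    rw [CStarIdeal.proj_eq_iff, sub_zero] at hm
    change (relativeIdeal hX X₀ C).proj n = (relativeIdeal hX X₀ C).proj 0
    rw [CStarIdeal.proj_eq_iff, sub_zero]
    have hn : n = MatrixAlgebra.mapCB r hK hr m := MatrixAlgebra.ext_coeff fun x y =>
      (h (x, y)).trans (MatrixAlgebra.coeff_mapCB r hK hr m x y).symm
    rw [hn]
    exact mapCB_mem_relativeIdeal hX X₀ hK hr hm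

end Roe

/-! The labelings. -/

/-- The cylinder functor as a good endofunctor. -/
def cylinderGood : GoodStructure cylinderFunctor.{u} := cylinderCoordinates.presentation.good

/-- The asymptotic algebra functor as a good endofunctor. -/
def asymptoticGood : GoodStructure asymptoticFunctor.{u} := asymptoticPresentation.good

/-- The stabilization functor as a good endofunctor. -/
def compactGood : GoodStructure compactFunctor.{u} := compactCoordinates.presentation.good

/-- The functor `C₀(𝒳, 𝒳₀, –)` as a good endofunctor. -/
def relC0Good {𝒳 : Type u} [MetricSpace 𝒳] (𝒳₀ : Set 𝒳) : GoodStructure (relC0Functor 𝒳₀) :=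
  (relC0Coordinates 𝒳₀).presentation.good

/-- The relative uniform Roe functor as a good endofunctor. -/
def relRoeGood {X : Type u} [MetricSpace X] (hX : BoundedGeometry X) (X₀ : Set X) :
    GoodStructure (relRoeFunctor hX X₀) := (relRoePresentation hX X₀).good

section Labels

variable {A B : CStar.{u}}

theorem cylinderGood_label (a : A) (f : C(unitInterval, B)) :
    cylinderGood.label A B (MaxTensor.tmul a f) = cylinderCompL (MaxTensor.tmulL a) f :=
  cylinderCoordinates.presentation.good_κ_tmul a f (cylinderCompL (MaxTensor.tmulL a) f) fun _ => rfl

theorem isCylinderLabeling_cylinderGood : IsCylinderLabeling cylinderGood.{u} := fun _ _ a f =>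
  ⟨_, fun _ => rfl, cylinderGood_label a f⟩

theorem relC0Good_label {𝒳 : Type u} [MetricSpace 𝒳] (𝒳₀ : Set 𝒳) (a : A) (f : relC0 B 𝒳₀) :
    (relC0Good 𝒳₀).label A B (MaxTensor.tmul a f) = relC0.compL (MaxTensor.tmulL a) f :=
  (relC0Coordinates 𝒳₀).presentation.good_κ_tmul a f (relC0.compL (MaxTensor.tmulL a) f)
    fun _ => rfl

theorem isC0Labeling_relC0Good {𝒳 : Type u} [MetricSpace 𝒳] (𝒳₀ : Set 𝒳) :
    IsC0Labeling 𝒳₀ (relC0Good 𝒳₀) := fun _ _ a f =>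
  ⟨_, fun _ => rfl, relC0Good_label 𝒳₀ a f⟩

theorem asymptoticGood_label (a : A) (f : ℝ≥0 →ᵇ B) :
    asymptoticGood.label A B (MaxTensor.tmul a (asClass f)) =
      asClass (bddCompL (MaxTensor.tmulL a) f) :=
  asymptoticPresentation.good_κ_tmul a f (bddCompL (MaxTensor.tmulL a) f) fun _ => rfl

theorem isAsymptoticLabeling_asymptoticGood : IsAsymptoticLabeling asymptoticGood.{u} :=
  fun _ _ a f => ⟨_, fun _ => rfl, asymptoticGood_label a f⟩

theorem compactGood_label (a : A) (m : CompactMatrices B) :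
    compactGood.label A B (MaxTensor.tmul a m) = MatrixAlgebra.lab a m :=
  compactCoordinates.presentation.good_κ_tmul a m (MatrixAlgebra.lab a m)
    fun p => MatrixAlgebra.coeff_lab a m p.1 p.2

theorem isCompactLabeling_compactGood : IsCompactLabeling compactGood.{u} :=
  fun _ _ a m => ⟨_, fun i j => MatrixAlgebra.coeff_lab a m i j, compactGood_label a m⟩

theorem relRoeGood_label {X : Type u} [MetricSpace X] (hX : BoundedGeometry X) (X₀ : Set X) (a : A)
    (m : UniformRoe hX B) : (relRoeGood hX X₀).label A B (MaxTensor.tmul a (qmat hX X₀ m)) =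
      qmat hX X₀ (MatrixAlgebra.lab a m) :=
  (relRoePresentation hX X₀).good_κ_tmul a m (MatrixAlgebra.lab a m)
    fun p => MatrixAlgebra.coeff_lab a m p.1 p.2

theorem isRoeLabeling_relRoeGood {X : Type u} [MetricSpace X] (hX : BoundedGeometry X) (X₀ : Set X) :
    IsRoeLabeling hX X₀ (relRoeGood hX X₀) :=
  fun _ _ a m => ⟨_, fun i j => MatrixAlgebra.coeff_lab a m i j, relRoeGood_label hX X₀ a m⟩

end Labels

end

/-! ### The tensor product of `C₀(𝒳, 𝒳₀)` with a C⋆-algebra -/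

noncomputable section

section Nuclearity

variable {𝒳 : Type*} [MetricSpace 𝒳] {𝒳₀ : Set 𝒳}

/-- A function which vanishes at infinity and on `𝒳₀` is approximated by combinations of its values,
where the coefficients are given by a square partition of unity. -/
theorem exists_approx_by_values {E : Type*} [NormedAddCommGroup E] [NormedSpace ℂ E] (G : 𝒳 → E)
    (hG : Continuous G) (hinf : Tendsto G (cocompact 𝒳) (𝓝 0)) (h₀ : ∀ z ∈ 𝒳₀, G z = 0) {δ : ℝ}
    (hδ : 0 < δ) : ∃ (J : Finset 𝒳) (g : J → relC0 ℂ 𝒳₀), (∀ j, star (g j) = g j) ∧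
      ‖∑ j, g j * g j‖ ≤ 1 ∧ ∀ z, ‖G z - ∑ j, (g j * g j).1 z • G j‖ ≤ δ := by
  have hK : IsCompact {z | δ ≤ ‖G z‖} := by
    have h1 : {z | ‖G z‖ < δ} ∈ cocompact 𝒳 := by
      have := hinf.norm
      rw [norm_zero] at this
      exact this (Iio_mem_nhds hδ)
    obtain ⟨t, ht, hts⟩ := mem_cocompact.1 h1
    refine ht.of_isClosed_subset (isClosed_le continuous_const hG.norm) fun z hz => ?_
    by_contra hzt
    exact (not_lt.2 (show δ ≤ ‖G z‖ from hz)) (hts hzt)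
  obtain ⟨J, hJK, hJ⟩ := hK.elim_nhds_subcover (fun j => G ⁻¹' Metric.ball (G j) δ)
    fun j _ => hG.continuousAt (Metric.ball_mem_nhds _ hδ)
  let φ₀ : E → ℝ := fun e => max 0 (δ - ‖e‖)
  let φ : J → E → ℝ := fun j e => max 0 (δ - ‖e - G j‖)
  let Φ : E → ℝ := fun e => φ₀ e + ∑ j, φ j e
  have hφ₀ : ∀ e, 0 ≤ φ₀ e := fun e => le_max_left _ _
  have hφ : ∀ j e, 0 ≤ φ j e := fun j e => le_max_left _ _
  have cφ₀ : Continuous φ₀ := by fun_prop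
  have cφ : ∀ j, Continuous (φ j) := fun j => by fun_prop
  have cΦ : Continuous Φ := by fun_prop
  have hΦ : ∀ z, 0 < Φ (G z) := fun z => by
    by_cases hz : δ ≤ ‖G z‖
    · obtain ⟨j, hj, hzj⟩ := Set.mem_iUnion₂.1 (hJ hz)
      have h1 : ‖G z - G j‖ < δ := by rwa [← dist_eq_norm]
      have h2 : 0 < φ ⟨j, hj⟩ (G z) := lt_max_of_lt_right (sub_pos.2 h1)
      exact add_pos_of_nonneg_of_pos (hφ₀ _) (Finset.sum_pos' (fun _ _ => hφ _ _)
        ⟨⟨j, hj⟩, Finset.mem_univ _, h2⟩)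
    · exact add_pos_of_pos_of_nonneg (lt_max_of_lt_right (sub_pos.2 (not_le.1 hz)))
        (Finset.sum_nonneg fun _ _ => hφ _ _)
  have hφ0 : ∀ j, φ j 0 = 0 := fun j => by
    have : δ ≤ ‖G j‖ := hJK j j.2
    simp only [φ, zero_sub, norm_neg]
    exact max_eq_left (sub_nonpos.2 this)
  have hΦ0 : Φ 0 ≠ 0 := by
    simp only [Φ, hφ0, Finset.sum_const_zero, add_zero, φ₀, norm_zero, sub_zero, max_eq_right hδ.le]
    exact hδ.ne'
  let h : J → 𝒳 → ℝ := fun j z => φ j (G z) / Φ (G z)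
  have hh : ∀ j z, 0 ≤ h j z := fun j z => div_nonneg (hφ _ _) (hΦ z).le
  have ch : ∀ j, Continuous (h j) := fun j =>
    ((cφ j).comp hG).div (cΦ.comp hG) fun z => (hΦ z).ne'
  have hlim : ∀ j, Tendsto (h j) (cocompact 𝒳) (𝓝 0) := fun j => by
    have := (((cφ j).tendsto 0).comp hinf).div ((cΦ.tendsto 0).comp hinf) hΦ0
    rwa [hφ0, zero_div] at this
  let g : J → relC0 ℂ 𝒳₀ := fun j => relC0.of (fun z => ((√(h j z) : ℝ) : ℂ))
    (Complex.continuous_ofReal.comp (Real.continuous_sqrt.comp (ch j)))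
    (by
      have := ((Complex.continuous_ofReal.comp Real.continuous_sqrt).tendsto 0).comp (hlim j)
      rw [Function.comp_apply, Real.sqrt_zero, Complex.ofReal_zero] at this
      exact this)
    fun z hz => by
      change ((√(φ j (G z) / Φ (G z)) : ℝ) : ℂ) = 0
      rw [h₀ z hz, hφ0, zero_div, Real.sqrt_zero, Complex.ofReal_zero]
  have hg : ∀ j z, (g j * g j).1 z = ((h j z : ℝ) : ℂ) := fun j z => by
    change ((√(h j z) : ℝ) : ℂ) * ((√(h j z) : ℝ) : ℂ) = _
    rw [← Complex.ofReal_mul, Real.mul_self_sqrt (hh j z)]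
  have hsum : ∀ z, φ₀ (G z) / Φ (G z) + ∑ j, h j z = 1 := fun z => by
    rw [← Finset.sum_div, ← add_div]
    exact div_self (hΦ z).ne'
  refine ⟨J, g, fun j => relC0.ext fun z => Complex.conj_ofReal _, ?_, fun z => ?_⟩
  · refine relC0.norm_le zero_le_one fun z => ?_
    have e : (∑ j, g j * g j).1 z = ((∑ j, h j z : ℝ) : ℂ) := by
      have h1 : (∑ j, g j * g j).1 z = ∑ j, (g j * g j).1 z :=
        map_sum (({ toFun := fun f : relC0 ℂ 𝒳₀ => f.1 z
                    map_zero' := rfl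
                    map_add' := fun _ _ => rfl } : relC0 ℂ 𝒳₀ →+ ℂ)) _ _
      rw [h1, Complex.ofReal_sum]
      exact Finset.sum_congr rfl fun j _ => hg j z
    rw [e, Complex.norm_real, Real.norm_of_nonneg (Finset.sum_nonneg fun j _ => hh j z)]
    have := hsum z
    have h2 : 0 ≤ φ₀ (G z) / Φ (G z) := div_nonneg (hφ₀ _) (hΦ z).le
    linarith
  · have e : G z - ∑ j, (g j * g j).1 z • G j = ((φ₀ (G z) / Φ (G z) : ℝ) : ℂ) • G z +
        ∑ j, ((h j z : ℝ) : ℂ) • (G z - G j) := by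
      have h1 : G z = ((φ₀ (G z) / Φ (G z) : ℝ) : ℂ) • G z + ∑ j, ((h j z : ℝ) : ℂ) • G z := by
        rw [← Finset.sum_smul, ← add_smul, ← Complex.ofReal_sum, ← Complex.ofReal_add, hsum,
          Complex.ofReal_one, one_smul]
      simp only [hg, smul_sub, Finset.sum_sub_distrib]
      rw [← add_sub_assoc, ← h1]
    have key : ∀ (p : ℝ) (e : E), 0 ≤ p → (p ≠ 0 → ‖e‖ ≤ δ) → ‖((p : ℝ) : ℂ) • e‖ ≤ p * δ := by
      intro p e hp he
      rw [norm_smul, Complex.norm_real, Real.norm_of_nonneg hp]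
      rcases eq_or_ne p 0 with rfl | h
      · simp
      · exact mul_le_mul_of_nonneg_left (he h) hp
    rw [e]
    calc _ ≤ φ₀ (G z) / Φ (G z) * δ + ∑ j, h j z * δ := by
          refine (norm_add_le _ _).trans (add_le_add ?_ ((norm_sum_le _ _).trans
            (Finset.sum_le_sum fun j _ => ?_)))
          · refine key _ _ (div_nonneg (hφ₀ _) (hΦ z).le) fun hp => ?_
            by_contra! hlt
            exact hp (by simp only [φ₀]; rw [max_eq_left (by linarith), zero_div])
          · refine key _ _ (hh j z) fun hp => ?_
            by_contra! hlt
            exact hp (by simp only [h, φ]; rw [max_eq_left (by linarith), zero_div])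
      _ = δ := by rw [← Finset.sum_mul, ← add_mul, hsum, one_mul]

variable {D : Type*} [NonUnitalCStarAlgebra D]

variable (𝒳₀ D) in
/-- The bilinear map `(f, d) ↦ f ⊗ d`. -/
def relC0TensorBilin : relC0 ℂ 𝒳₀ →ₗ[ℂ] D →ₗ[ℂ] relC0 D 𝒳₀ :=
  LinearMap.mk₂ ℂ (relC0Tensor 𝒳₀)
    (fun f g d => relC0.ext fun z => add_smul _ _ _)
    (fun c f d => relC0.ext fun z => by
      change (c * f.1 z) • d = c • (f.1 z • d)
      exact mul_smul _ _ _)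
    (fun f d d' => relC0.ext fun z => smul_add _ _ _)
    (fun c f d => relC0.ext fun z => by
      change f.1 z • (c • d) = c • (f.1 z • d)
      exact smul_comm _ _ _)

theorem relC0Tensor_mul (f g : relC0 ℂ 𝒳₀) (d d' : D) :
    relC0Tensor 𝒳₀ f d * relC0Tensor 𝒳₀ g d' = relC0Tensor 𝒳₀ (f * g) (d * d') :=
  relC0.ext fun _ => smul_mul_smul_comm _ _ _ _

theorem relC0Tensor_star (f : relC0 ℂ 𝒳₀) (d : D) :
    star (relC0Tensor 𝒳₀ f d) = relC0Tensor 𝒳₀ (star f) (star d) :=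
  relC0.ext fun _ => star_smul _ _

theorem norm_relC0Tensor_le (f : relC0 ℂ 𝒳₀) (d : D) : ‖relC0Tensor 𝒳₀ f d‖ ≤ ‖f‖ * ‖d‖ :=
  relC0.norm_le (by positivity) fun z => by
    change ‖f.1 z • d‖ ≤ _
    rw [norm_smul]
    exact mul_le_mul_of_nonneg_right (relC0.norm_apply_le f z) (norm_nonneg d)

variable (𝒳₀ D) in
/-- The canonical map `C₀(𝒳, 𝒳₀) ⊗ D → C₀(𝒳, 𝒳₀, D)`. -/
def tensorToRelC0 : MaxTensor (relC0 ℂ 𝒳₀) D →⋆ₙₐ[ℂ] relC0 D 𝒳₀ :=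
  MaxTensor.lift (relC0TensorBilin 𝒳₀ D) (fun f d g d' => relC0Tensor_mul f g d d')
    relC0Tensor_star norm_relC0Tensor_le

theorem tensorToRelC0_tmul (f : relC0 ℂ 𝒳₀) (d : D) :
    tensorToRelC0 𝒳₀ D (MaxTensor.tmul f d) = relC0Tensor 𝒳₀ f d := MaxTensor.lift_tmul _ _ _ _ f d

variable (𝒳₀ D) in
/-- Evaluation at a point. -/
def relC0Eval (z : 𝒳) : relC0 D 𝒳₀ →ₗ[ℂ] D where
  toFun f := f.1 z
  map_add' _ _ := rfl
  map_smul' _ _ := rfl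

theorem exists_approx_tensor (t : relC0 ℂ 𝒳₀ ⊗[ℂ] D) {ε : ℝ} (hε : 0 < ε) :
    ∃ (J : Finset 𝒳) (g : J → relC0 ℂ 𝒳₀), (∀ j, star (g j) = g j) ∧ ‖∑ j, g j * g j‖ ≤ 1 ∧
      ‖(CStarCompletion.mk (AlgTensor.of _ _ t) : MaxTensor (relC0 ℂ 𝒳₀) D) - ∑ j,
        MaxTensor.tmul (g j * g j) (relC0Eval 𝒳₀ D j (tensorToRelC0 𝒳₀ D
          (CStarCompletion.mk (AlgTensor.of _ _ t))))‖ ≤ ε := by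
  obtain ⟨S, hS⟩ := TensorProduct.exists_finset t
  have ht : (CStarCompletion.mk (AlgTensor.of _ _ t) : MaxTensor (relC0 ℂ 𝒳₀) D) =
      ∑ p ∈ S, MaxTensor.tmul p.1 p.2 := by
    rw [hS]
    exact map_sum (CStarCompletion.mkHom.comp (AlgTensor.of _ _) :
      relC0 ℂ 𝒳₀ ⊗[ℂ] D →⋆ₙₐ[ℂ] MaxTensor (relC0 ℂ 𝒳₀) D) _ _
  let c : ℝ := ∑ p ∈ S, ‖p.2‖
  have hc : 0 ≤ c := Finset.sum_nonneg fun _ _ => norm_nonneg _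
  have hδ : 0 < ε / (c + 1) := by positivity
  let G : 𝒳 → (S → ℂ) := fun z p => p.1.1.1 z
  have hG : Continuous G := continuous_pi fun p => p.1.1.1.continuous
  have hinf : Tendsto G (cocompact 𝒳) (𝓝 0) := tendsto_pi_nhds.2 fun p => p.1.1.1.zero_at_infty'
  obtain ⟨J, g, hg, hg1, hJ⟩ := exists_approx_by_values (𝒳₀ := 𝒳₀) G hG hinf
    (fun z hz => funext fun p => p.1.1.2 z hz) hδ
  refine ⟨J, g, hg, hg1, ?_⟩
  rw [ht]
  have e1 : ∀ j : J, MaxTensor.tmul (g j * g j) (relC0Eval 𝒳₀ D j (tensorToRelC0 𝒳₀ D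
      (∑ p ∈ S, MaxTensor.tmul p.1 p.2))) =
      ∑ p ∈ S, MaxTensor.tmul ((p.1.1 (j : 𝒳)) • (g j * g j)) p.2 := fun j => by
    rw [map_sum, map_sum]
    refine (map_sum (MaxTensor.tmulₗ (g j * g j)) _ _).trans (Finset.sum_congr rfl fun p _ => ?_)
    rw [tensorToRelC0_tmul, MaxTensor.smul_tmul]
    exact MaxTensor.tmul_smul _ _ _
  have e2 : ∑ p ∈ S, MaxTensor.tmul p.1 p.2 - ∑ j : J, MaxTensor.tmul (g j * g j) (relC0Eval 𝒳₀ D j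
      (tensorToRelC0 𝒳₀ D (∑ p ∈ S, MaxTensor.tmul p.1 p.2))) =
      ∑ p ∈ S, MaxTensor.tmul (p.1 - ∑ j : J, (p.1.1 (j : 𝒳)) • (g j * g j)) p.2 := by
    simp only [e1]
    rw [Finset.sum_comm, ← Finset.sum_sub_distrib]
    refine Finset.sum_congr rfl fun p _ => ?_
    have := map_sub ((MaxTensor.tmulₗ (A := relC0 ℂ 𝒳₀) (B := D)).flip p.2) p.1
      (∑ j : J, (p.1.1 (j : 𝒳)) • (g j * g j))
    rw [map_sum] at this
    exact this.symm
  rw [e2]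
  have hp : ∀ p ∈ S, ‖p.1 - ∑ j : J, (p.1.1 (j : 𝒳)) • (g j * g j)‖ ≤ ε / (c + 1) := fun p hp => by
    refine relC0.norm_le hδ.le fun z => ?_
    have h1 := (norm_le_pi_norm (G z - ∑ j, (g j * g j).1 z • G j) ⟨p, hp⟩).trans (hJ z)
    rw [Pi.sub_apply, Finset.sum_apply] at h1
    have h2 : (p.1 - ∑ j : J, (p.1.1 (j : 𝒳)) • (g j * g j)).1 z =
        p.1.1 z - ∑ j : J, (g j * g j).1 z • p.1.1 (j : 𝒳) := by
      have := map_sub (relC0Eval 𝒳₀ ℂ z) p.1 (∑ j : J, (p.1.1 (j : 𝒳)) • (g j * g j))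
      rw [map_sum] at this
      refine this.trans (congrArg _ (Finset.sum_congr rfl fun j _ => ?_))
      exact mul_comm _ _
    rw [h2]
    exact h1
  calc _ ≤ ∑ p ∈ S, ε / (c + 1) * ‖p.2‖ := (norm_sum_le _ _).trans (Finset.sum_le_sum fun p hpS =>
        (MaxTensor.norm_tmul_le _ _).trans (mul_le_mul_of_nonneg_right (hp p hpS) (norm_nonneg _)))
    _ = ε / (c + 1) * c := by rw [← Finset.mul_sum]
    _ ≤ ε := by
      rw [div_mul_eq_mul_div, div_le_iff₀ (by positivity)]
      nlinarith

attribute [local instance] CStarAlgebra.spectralOrder CStarAlgebra.spectralOrderedRing in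
theorem norm_sum_tmul_le {A : Type*} [NonUnitalCStarAlgebra A] {J : Type*} [Fintype J] (g : J → A)
    (hg : ∀ j, star (g j) = g j) (hg1 : ‖∑ j, g j * g j‖ ≤ 1) (b : J → D) {s : ℝ}
    (hb : ∀ j, ‖b j‖ ≤ s) :
    ‖∑ j, MaxTensor.tmul (g j * g j) (star (b j) * b j)‖ ≤ s ^ 2 := by
  have hu := CStarAlgebra.increasingApproximateUnit D
  have := hu.neBot
  have ht : Tendsto (fun e : D => ‖∑ j, MaxTensor.tmul (g j * g j) (e * (star (b j) * b j * e))‖)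
      (CStarAlgebra.approximateUnit D) (𝓝 ‖∑ j, MaxTensor.tmul (g j * g j) (star (b j) * b j)‖) := by
    refine Tendsto.norm (tendsto_finsetSum _ fun j _ => ?_)
    refine ((MaxTensor.continuous_tmul (g j * g j)).tendsto _).comp ?_
    have h1 := hu.tendsto_mul_left (star (b j) * b j)
    have h2 : Tendsto (fun e : D => e * (star (b j) * b j)) (CStarAlgebra.approximateUnit D)
        (𝓝 (star (b j) * b j)) := hu.tendsto_mul_right _
    have h3 : Tendsto (fun e : D => e * (star (b j) * b j * e - star (b j) * b j))
        (CStarAlgebra.approximateUnit D) (𝓝 0) := by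
      have h4 : Tendsto (fun e : D => ‖star (b j) * b j * e - star (b j) * b j‖)
          (CStarAlgebra.approximateUnit D) (𝓝 0) := by
        simpa using (h1.sub_const (star (b j) * b j)).norm
      refine squeeze_zero_norm' (hu.eventually_norm.mono fun e he => ?_) h4
      exact (norm_mul_le _ _).trans (mul_le_of_le_one_left (norm_nonneg _) he)
    have h5 := h3.add h2
    rw [zero_add] at h5
    refine h5.congr fun e => ?_
    rw [mul_sub, sub_add_cancel]
  refine le_of_tendsto ht ((hu.eventually_norm.and hu.eventually_nonneg).mono fun e he => ?_)
  obtain ⟨he1, he0⟩ := he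
  have hse : star e = e := (IsSelfAdjoint.of_nonneg he0).star_eq
  have hsum : ∀ d : D, ∀ j, MaxTensor.tmul (g j * g j) (star d * d) =
      star (MaxTensor.tmul (g j) d) * MaxTensor.tmul (g j) d := fun d j => by
    rw [MaxTensor.star_tmul, MaxTensor.tmul_mul_tmul, hg]
  have hpos : 0 ≤ ∑ j, MaxTensor.tmul (g j * g j) (e * (star (b j) * b j * e)) := by
    refine Finset.sum_nonneg fun j _ => ?_
    have : e * (star (b j) * b j * e) = star (b j * e) * (b j * e) := by
      rw [star_mul, hse]; noncomm_ring
    rw [this, hsum]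
    exact star_mul_self_nonneg _
  have hle : ∑ j, MaxTensor.tmul (g j * g j) (e * (star (b j) * b j * e)) ≤
      ∑ j, MaxTensor.tmul (g j * g j) (((s ^ 2 : ℝ) : ℂ) • (e * e)) := by
    refine Finset.sum_le_sum fun j _ => ?_
    rw [← sub_nonneg]
    have h1 : e * (star (b j) * b j * e) ≤ ((s ^ 2 : ℝ) : ℂ) • (e * e) := by
      have h2 : star e * (star (b j) * b j) * e ≤ ‖star (b j) * b j‖ • (star e * e) :=
        CStarAlgebra.star_left_conjugate_le_norm_smul (.star_mul_self _)
      rw [hse, mul_assoc] at h2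
      refine h2.trans ?_
      have h3 : ((s ^ 2 : ℝ) : ℂ) • (e * e) = (s ^ 2) • (e * e) := by
        rw [Complex.coe_smul]
      rw [h3]
      refine smul_le_smul_of_nonneg_right ?_ (by
        have := star_mul_self_nonneg e
        rwa [hse] at this)
      rw [CStarRing.norm_star_mul_self, sq]
      exact mul_self_le_mul_self (norm_nonneg _) (hb j)
    obtain ⟨k, hk⟩ := CStarAlgebra.nonneg_iff_eq_star_mul_self.1 (sub_nonneg.2 h1)
    have h4 : MaxTensor.tmul (g j * g j) (((s ^ 2 : ℝ) : ℂ) • (e * e)) -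
        MaxTensor.tmul (g j * g j) (e * (star (b j) * b j * e)) =
        star (MaxTensor.tmul (g j) k) * MaxTensor.tmul (g j) k := by
      rw [← hsum, ← hk]
      exact (map_sub (MaxTensor.tmulₗ (g j * g j)) _ _).symm
    rw [h4]
    exact star_mul_self_nonneg _
  refine (CStarAlgebra.norm_le_norm_of_nonneg_of_le hpos hle).trans ?_
  have h6 : ∑ j, MaxTensor.tmul (g j * g j) (((s ^ 2 : ℝ) : ℂ) • (e * e)) =
      MaxTensor.tmul (∑ j, g j * g j) (((s ^ 2 : ℝ) : ℂ) • (e * e)) :=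
    (map_sum ((MaxTensor.tmulₗ (A := A) (B := D)).flip _) _ _).symm
  rw [h6]
  refine (MaxTensor.norm_tmul_le _ _).trans ?_
  rw [norm_smul, Complex.norm_real, Real.norm_of_nonneg (by positivity)]
  have h7 : ‖e * e‖ ≤ 1 := (norm_mul_le _ _).trans (mul_le_one₀ he1 (norm_nonneg _) he1)
  calc _ ≤ 1 * (s ^ 2 * 1) := by gcongr
    _ = _ := by ring

theorem norm_tensorToRelC0 (x : MaxTensor (relC0 ℂ 𝒳₀) D) : ‖tensorToRelC0 𝒳₀ D x‖ = ‖x‖ := by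
  refine le_antisymm (NonUnitalStarAlgHom.norm_apply_le _ _) ?_
  refine CStarCompletion.ind x (isClosed_le continuous_norm
    (continuous_norm.comp (map_continuous (tensorToRelC0 𝒳₀ D)))) fun t => ?_
  set y : MaxTensor (relC0 ℂ 𝒳₀) D := CStarCompletion.mk t with hy
  have hyt : star y * y =
      CStarCompletion.mk (AlgTensor.of _ _ (AlgTensor.unof _ _ (star t * t))) := by
    rw [AlgTensor.of_unof, CStarCompletion.mk_mul, CStarCompletion.mk_star]
  have key : ‖star y * y‖ ≤ ‖tensorToRelC0 𝒳₀ D y‖ ^ 2 := by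
    refine le_of_forall_pos_le_add fun ε hε => ?_
    obtain ⟨J, g, hg, hg1, hJ⟩ := exists_approx_tensor (AlgTensor.unof _ _ (star t * t)) hε
    rw [← hyt] at hJ
    have h1 : ∀ j : J, relC0Eval 𝒳₀ D j (tensorToRelC0 𝒳₀ D (star y * y)) =
        star (relC0Eval 𝒳₀ D j (tensorToRelC0 𝒳₀ D y)) *
          relC0Eval 𝒳₀ D j (tensorToRelC0 𝒳₀ D y) := fun j => by
      rw [map_mul, map_star]; rfl
    simp only [h1] at hJ
    have h2 := norm_sum_tmul_le g hg hg1 (fun j : J => relC0Eval 𝒳₀ D j (tensorToRelC0 𝒳₀ D y))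
      (fun j => relC0.norm_apply_le _ _)
    have h3 := norm_le_norm_add_norm_sub' (star y * y)
      (∑ j : J, MaxTensor.tmul (g j * g j) (star (relC0Eval 𝒳₀ D j (tensorToRelC0 𝒳₀ D y)) *
          relC0Eval 𝒳₀ D j (tensorToRelC0 𝒳₀ D y)))
    linarith
  rw [CStarRing.norm_star_mul_self, ← sq] at key
  exact abs_le_of_sq_le_sq' key (norm_nonneg _) |>.2

theorem closure_span_relC0Tensor : closure (Submodule.span ℂ
    {F : relC0 D 𝒳₀ | ∃ f d, F = relC0Tensor 𝒳₀ f d} : Set (relC0 D 𝒳₀)) = Set.univ := by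
  refine Set.eq_univ_of_forall fun F => Metric.mem_closure_iff.2 fun ε hε => ?_
  obtain ⟨J, g, -, -, hJ⟩ := exists_approx_by_values (𝒳₀ := 𝒳₀) F.1 F.1.continuous
    F.1.zero_at_infty' F.2 (half_pos hε)
  refine ⟨∑ j : J, relC0Tensor 𝒳₀ (g j * g j) (F.1 j), Submodule.sum_mem _ fun j _ =>
    Submodule.subset_span ⟨_, _, rfl⟩, ?_⟩
  rw [dist_eq_norm]
  refine (relC0.norm_le (half_pos hε).le fun z => ?_).trans_lt (half_lt_self hε)
  have h1 : (F - ∑ j : J, relC0Tensor 𝒳₀ (g j * g j) (F.1 j)).1 z =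
      F.1 z - ∑ j : J, (g j * g j).1 z • F.1 j := by
    have := map_sub (relC0Eval 𝒳₀ D z) F (∑ j : J, relC0Tensor 𝒳₀ (g j * g j) (F.1 j))
    rw [map_sum] at this
    exact this
  rw [h1]
  exact hJ z

theorem tensorToRelC0_bijective : Function.Bijective (tensorToRelC0 𝒳₀ D) := by
  have hiso : Isometry (tensorToRelC0 𝒳₀ D) :=
    AddMonoidHomClass.isometry_of_norm _ norm_tensorToRelC0
  refine ⟨hiso.injective, fun F => ?_⟩
  have hcl : IsClosed (Set.range (tensorToRelC0 𝒳₀ D)) := hiso.isClosedEmbedding.isClosed_range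
  have hF : F ∈ closure (Submodule.span ℂ
      {F : relC0 D 𝒳₀ | ∃ f d, F = relC0Tensor 𝒳₀ f d} : Set (relC0 D 𝒳₀)) := by
    rw [closure_span_relC0Tensor]; trivial
  refine closure_minimal (fun F hF => ?_) hcl hF
  refine Submodule.span_induction (p := fun F _ => F ∈ Set.range (tensorToRelC0 𝒳₀ D)) ?_ ?_ ?_ ?_ hF
  · rintro _ ⟨f, d, rfl⟩
    exact ⟨_, tensorToRelC0_tmul f d⟩
  · exact ⟨0, map_zero _⟩
  · rintro _ _ _ _ ⟨x, rfl⟩ ⟨y, rfl⟩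
    exact ⟨x + y, map_add _ _ _⟩
  · rintro c _ _ ⟨x, rfl⟩
    exact ⟨c • x, map_smul _ _ _⟩

variable (𝒳₀ D) in
/-- The inverse `C₀(𝒳, 𝒳₀, D) → C₀(𝒳, 𝒳₀) ⊗ D` of the canonical map. -/
def relC0ToTensor : relC0 D 𝒳₀ →⋆ₙₐ[ℂ] MaxTensor (relC0 ℂ 𝒳₀) D :=
  ((StarAlgEquiv.ofBijective (tensorToRelC0 𝒳₀ D) tensorToRelC0_bijective).symm :
    relC0 D 𝒳₀ ≃⋆ₐ[ℂ] MaxTensor (relC0 ℂ 𝒳₀) D)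

theorem relC0ToTensor_tensor (f : relC0 ℂ 𝒳₀) (d : D) :
    relC0ToTensor 𝒳₀ D (relC0Tensor 𝒳₀ f d) = MaxTensor.tmul f d := by
  rw [← tensorToRelC0_tmul]
  exact (StarAlgEquiv.ofBijective (tensorToRelC0 𝒳₀ D) tensorToRelC0_bijective).symm_apply_apply _

theorem relC0_hom_ext {C : Type*} [NonUnitalCStarAlgebra C] {φ ψ : relC0 D 𝒳₀ →⋆ₙₐ[ℂ] C}
    (h : ∀ f d, φ (relC0Tensor 𝒳₀ f d) = ψ (relC0Tensor 𝒳₀ f d)) : φ = ψ := by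
  refine NonUnitalStarAlgHom.ext fun F => ?_
  obtain ⟨x, rfl⟩ := tensorToRelC0_bijective.2 F
  have : φ.comp (tensorToRelC0 𝒳₀ D) = ψ.comp (tensorToRelC0 𝒳₀ D) :=
    MaxTensor.ext_hom fun f d => by
      rw [NonUnitalStarAlgHom.comp_apply, NonUnitalStarAlgHom.comp_apply, tensorToRelC0_tmul, h]
  exact congrArg (fun k => k x) this

end Nuclearity

end

/-! ### Labeled natural transformations -/

noncomputable section

theorem isLabeled_of_tmul {F G : CStarEndo.{u}} {gF : GoodStructure F} {gG : GoodStructure G}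
    {γ : F ⟶ G} (h : ∀ (A B : CStar.{u}) (a : A) (x : F.obj B),
      gG.label A B (MaxTensor.tmul a (γ.app B x)) =
        γ.app (tensorObj A B) (gF.label A B (MaxTensor.tmul a x))) : IsLabeled gF gG γ :=
  fun A B => MaxTensor.ext_hom (A := A) (B := F.obj B) fun a x => by
    refine Eq.trans ?_ (h A B a x)
    exact congrArg (gG.label A B) (MaxTensor.map_tmul (NonUnitalStarAlgHom.id ℂ A) (γ.app B) a x)

theorem comp_label {F G : CStarEndo.{u}} (gF : GoodStructure F) (gG : GoodStructure G)
    (A B : CStar.{u}) (x : MaxTensor A (G.obj (F.obj B))) :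
    (gF.comp gG).label A B x = G.map (gF.label A B : tensorObj A (F.obj B) ⟶ _)
      (gG.label A (F.obj B) x) := rfl

theorem cylinder_eval_labeled (t : unitInterval) (A B : CStar.{u}) :
    (tensorFunctor A).map (evalAt t B) = (cylinderGood.κ A).app B ≫ evalAt t (tensorObj A B) :=
  MaxTensor.ext_hom (A := A) (B := C(unitInterval, B)) fun a f => by
    refine (MaxTensor.map_tmul (NonUnitalStarAlgHom.id ℂ A) (evalAt t B) a f).trans ?_
    exact (congrArg (evalAt t (tensorObj A B)) (cylinderGood_label a f)).symm

theorem isLabeled_eval {F G : CStarEndo.{u}} {gF : GoodStructure F} {gG : GoodStructure G}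
    {Γ : F ⟶ cylinderFunctor ⋙ G} (hΓ : IsLabeled gF (cylinderGood.comp gG) Γ) {γ : F ⟶ G}
    (t : unitInterval) (h : ∀ B : CStar.{u}, Γ.app B ≫ G.map (evalAt t B) = γ.app B) :
    IsLabeled gF gG γ := fun A B => by
  have h1 := hΓ A B
  have h2 := (gG.κ A).naturality (evalAt t B)
  have h3 : ((cylinderGood.comp gG).κ A).app B =
    (gG.κ A).app (cylinderFunctor.obj B) ≫ G.map ((cylinderGood.κ A).app B) := rfl
  rw [h3] at h1
  simp only [Functor.comp_map, Functor.comp_obj] at h1 h2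
  have h4 := h ((tensorFunctor A).obj B)
  have h5 : G.map ((tensorFunctor A).map (evalAt t B)) =
      G.map ((cylinderGood.κ A).app B) ≫ G.map (evalAt t ((tensorFunctor A).obj B)) :=
    (congrArg G.map (cylinder_eval_labeled t A B)).trans (G.map_comp _ _)
  rw [← h, ← h4, (tensorFunctor A).map_comp, Category.assoc, h2, h5]
  rw [← Category.assoc, ← Category.assoc, ← Category.assoc]
  refine congrArg (· ≫ _) ?_
  rw [Category.assoc]
  exact h1

/-- Two natural transformations are homotopic, if they are the endpoints of a labeled natural
transformation. -/
theorem labeledHomotopic_of_endpoints {F G : CStarEndo.{u}} {gF : GoodStructure F}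
    {gG : GoodStructure G} {γ₀ γ₁ : F ⟶ G} (Γ : F ⟶ cylinderFunctor ⋙ G)
    (hΓ : IsLabeled gF (cylinderGood.comp gG) Γ)
    (h₀ : ∀ B : CStar.{u}, Γ.app B ≫ G.map (evalAt 0 B) = γ₀.app B)
    (h₁ : ∀ B : CStar.{u}, Γ.app B ≫ G.map (evalAt 1 B) = γ₁.app B) :
    LabeledHomotopic cylinderGood gF gG γ₀ γ₁ :=
  ⟨isLabeled_eval hΓ 0 h₀, isLabeled_eval hΓ 1 h₁, Γ, hΓ, h₀, h₁⟩

theorem relRoe_map_qmat {X : Type*} [MetricSpace X] (hX : BoundedGeometry X) (X₀ : Set X)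
    {B C : Type*} [NonUnitalCStarAlgebra B] [NonUnitalCStarAlgebra C] (φ : B →⋆ₙₐ[ℂ] C)
    (m : UniformRoe hX B) :
    RelativeRoe.map hX X₀ φ (qmat hX X₀ m) = qmat hX X₀ (MatrixAlgebra.map φ m) := rfl

end

/-! ### The unit -/

noncomputable section

namespace IsSquarePartition

variable {𝒳 : Type*} [MetricSpace 𝒳] {Δ : ℝ} {X : Set 𝒳} {α : X → C(𝒳, ℝ)}

theorem dist_lt (hα : IsSquarePartition Δ X α) {x : X} {z : 𝒳} (h : α x z ≠ 0) :
    dist (x : 𝒳) z < Δ := by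
  rw [dist_comm]
  exact hα.support_subset x h

theorem dist_lt_two_mul (hα : IsSquarePartition Δ X α) {x y : X} {z : 𝒳} (hx : α x z ≠ 0)
    (hy : α y z ≠ 0) : dist x y < 2 * Δ := by
  have := dist_triangle_right (x : 𝒳) y z
  have h1 := hα.dist_lt hx
  have h2 := hα.dist_lt hy
  change dist (x : 𝒳) y < 2 * Δ
  linarith

theorem abs_le_one (hα : IsSquarePartition Δ X α) (x : X) (z : 𝒳) : |α x z| ≤ 1 := by
  have := le_hasSum (hα.hasSum z) x fun y _ => sq_nonneg _
  exact (sq_le_one_iff_abs_le_one _).1 this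

theorem sum_eq_one (hα : IsSquarePartition Δ X α) {z : 𝒳} {G : Finset X}
    (hG : ∀ x, α x z ≠ 0 → x ∈ G) : ∑ x ∈ G, α x z ^ 2 = 1 :=
  (hasSum_sum_of_ne_finset_zero fun x hx => by
    have : α x z = 0 := by by_contra h; exact hx (hG x h)
    rw [this]; ring).unique (hα.hasSum z)

end IsSquarePartition

theorem BoundedGeometry.finite_ball {X : Type*} [MetricSpace X] (hX : BoundedGeometry X) (x : X)
    (R : ℝ) : (Metric.ball x R).Finite := by
  obtain ⟨N, hN⟩ := hX R
  exact Set.finite_of_encard_le_coe (hN x)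

theorem BoundedGeometry.finite_of_isBounded {𝒳 : Type*} [MetricSpace 𝒳] {X : Set 𝒳}
    (hX : BoundedGeometry X) {s : Set 𝒳} (hs : Bornology.IsBounded s) :
    {x : X | (x : 𝒳) ∈ s}.Finite := by
  rcases Set.eq_empty_or_nonempty {x : X | (x : 𝒳) ∈ s} with h | ⟨x, hx⟩
  · rw [h]; exact Set.finite_empty
  · obtain ⟨R, hR⟩ := hs.subset_ball (x : 𝒳)
    exact (hX.finite_ball x R).subset fun y hy => hR hy

theorem IsSquarePartition.finite_support {𝒳 : Type*} [MetricSpace 𝒳] {Δ : ℝ} {X : Set 𝒳}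
    {α : X → C(𝒳, ℝ)} (hα : IsSquarePartition Δ X α) (hX : BoundedGeometry X) (z : 𝒳) :
    {x | α x z ≠ 0}.Finite :=
  (hX.finite_of_isBounded (Metric.isBounded_ball (x := z) (r := Δ))).subset fun _ hx =>
    hα.dist_lt hx

section Unit

variable {𝒳 : Type*} [MetricSpace 𝒳] {𝒳₀ : Set 𝒳} {Δ : ℝ} {X : Set 𝒳} {α : X → C(𝒳, ℝ)}

theorem cutoff_eq_zero_or_one (Δ : ℝ) (𝒳₀ : Set 𝒳) (x : 𝒳) :
    cutoff Δ 𝒳₀ x = 0 ∨ cutoff Δ 𝒳₀ x = 1 := by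
  unfold cutoff
  split_ifs
  · exact .inr rfl
  · exact .inl rfl

theorem cutoff_eq_zero_of_dist_lt {x z : 𝒳} (hz : z ∈ 𝒳₀) (h : dist x z < Δ) :
    cutoff Δ 𝒳₀ x = 0 := by
  unfold cutoff
  refine if_neg (not_lt.2 ((Metric.infEDist_le_edist_of_mem hz).trans ?_))
  rw [edist_dist]
  exact ENNReal.ofReal_le_ofReal h.le

theorem mem_nbhdOf_of_cutoff_eq_zero (hΔ : 0 < Δ) (hX : IsSeparatedNet Δ X) {x : X}
    (h : cutoff Δ 𝒳₀ x = 0) : x ∈ nbhdOf (discretePart Δ 𝒳₀ X) (3 * Δ) := by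
  unfold cutoff at h
  have h1 : Metric.infEDist (x : 𝒳) 𝒳₀ ≤ ENNReal.ofReal Δ := by
    by_contra h'
    rw [if_pos (not_le.1 h')] at h
    exact one_ne_zero h
  have h2 : Metric.infEDist (x : 𝒳) 𝒳₀ < ENNReal.ofReal (2 * Δ) :=
    h1.trans_lt ((ENNReal.ofReal_lt_ofReal_iff (by linarith)).2 (by linarith))
  obtain ⟨p, hp, hxp⟩ := Metric.infEDist_lt_iff.1 h2
  rw [edist_dist, ENNReal.ofReal_lt_ofReal_iff (by linarith)] at hxp
  obtain ⟨y, hy, hpy⟩ := hX.net p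
  refine ⟨⟨y, hy⟩, ⟨p, hp, by rw [dist_comm]; exact hpy⟩, ?_⟩
  have := dist_triangle (x : 𝒳) p y
  change dist (x : 𝒳) y < 3 * Δ
  linarith

variable [ProperSpace 𝒳]

theorem IsSquarePartition.tendsto_cocompact (hα : IsSquarePartition Δ X α) (x : X) :
    Tendsto (α x) (cocompact 𝒳) (𝓝 0) := by
  refine tendsto_const_nhds.congr' ?_
  refine mem_cocompact.2 ⟨Metric.closedBall x Δ, isCompact_closedBall _ _, fun z hz => ?_⟩
  by_contra h
  have h1 : α x z ≠ 0 := fun h' => h h'.symm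
  have := hα.dist_lt h1
  rw [dist_comm] at this
  exact hz (Metric.mem_closedBall.2 this.le)

variable (𝒳₀) in
/-- The function `χ_x α_x`. -/
def unitBump (hα : IsSquarePartition Δ X α) (x : X) : relC0 ℂ 𝒳₀ :=
  relC0.of (fun z => ((cutoff Δ 𝒳₀ x * α x z : ℝ) : ℂ)) (by fun_prop)
    (by
      have := (Complex.continuous_ofReal.tendsto _).comp
        ((hα.tendsto_cocompact x).const_mul (cutoff Δ 𝒳₀ x))
      rw [mul_zero, Complex.ofReal_zero] at this
      exact this)
    fun z hz => by
      rcases eq_or_ne (α x z) 0 with h | h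
      · rw [h, mul_zero, Complex.ofReal_zero]
      · rw [cutoff_eq_zero_of_dist_lt hz (hα.dist_lt h), zero_mul, Complex.ofReal_zero]

theorem unitBump_apply (hα : IsSquarePartition Δ X α) (x : X) (z : 𝒳) :
    (unitBump 𝒳₀ hα x).1 z = ((cutoff Δ 𝒳₀ x * α x z : ℝ) : ℂ) := rfl

theorem star_unitBump (hα : IsSquarePartition Δ X α) (x : X) :
    star (unitBump 𝒳₀ hα x) = unitBump 𝒳₀ hα x :=
  relC0.ext fun _ => Complex.conj_ofReal _

theorem norm_unitBump_le (hα : IsSquarePartition Δ X α) (x : X) : ‖unitBump 𝒳₀ hα x‖ ≤ 1 :=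
  relC0.norm_le zero_le_one fun z => by
    rw [unitBump_apply, Complex.norm_real, norm_mul]
    refine mul_le_one₀ ?_ (norm_nonneg _) (hα.abs_le_one x z)
    rcases cutoff_eq_zero_or_one Δ 𝒳₀ x with h | h <;> simp [h]

theorem unitBump_mul_eq_zero (hα : IsSquarePartition Δ X α) {x y : X} (h : 2 * Δ ≤ dist x y) :
    unitBump 𝒳₀ hα x * unitBump 𝒳₀ hα y = 0 :=
  relC0.ext fun z => by
    change ((cutoff Δ 𝒳₀ x * α x z : ℝ) : ℂ) * ((cutoff Δ 𝒳₀ y * α y z : ℝ) : ℂ) = 0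
    by_contra h'
    rw [← Complex.ofReal_mul] at h'
    have h1 := Complex.ofReal_ne_zero.1 h'
    exact not_lt.2 h (hα.dist_lt_two_mul (right_ne_zero_of_mul (left_ne_zero_of_mul h1))
      (right_ne_zero_of_mul (right_ne_zero_of_mul h1)))

variable {A : Type*} [NonUnitalCStarAlgebra A]

variable (𝒳₀) in
/-- The matrix `χ_x χ_y α_x α_y ⊗ a`. -/
def unitMatrix (hX : BoundedGeometry X) (hα : IsSquarePartition Δ X α) (a : A) :
    ControlledMatrix (finitePropagation hX) (relC0 A 𝒳₀) :=
  ControlledMatrix.ofEntries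
    (fun x y => relC0Tensor 𝒳₀ (unitBump 𝒳₀ hα x * unitBump 𝒳₀ hα y) a)
    ⟨2 * Δ, fun p hp => by
      by_contra h
      refine hp ?_
      change relC0Tensor 𝒳₀ (unitBump 𝒳₀ hα p.1 * unitBump 𝒳₀ hα p.2) a = 0
      rw [unitBump_mul_eq_zero hα (not_le.1 h).le]
      exact relC0.ext fun z => zero_smul _ _⟩
    ⟨‖a‖, fun x y => by
      refine (norm_relC0Tensor_le _ _).trans (mul_le_of_le_one_left (norm_nonneg _) ?_)
      exact (norm_mul_le _ _).trans
        (mul_le_one₀ (norm_unitBump_le hα x) (norm_nonneg _) (norm_unitBump_le hα y))⟩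

theorem entry_unitMatrix (hX : BoundedGeometry X) (hα : IsSquarePartition Δ X α) (a : A) (x y : X) :
    (unitMatrix 𝒳₀ hX hα a).entry x y =
      relC0Tensor 𝒳₀ (unitBump 𝒳₀ hα x * unitBump 𝒳₀ hα y) a := rfl

theorem unitMatrix_star (hX : BoundedGeometry X) (hα : IsSquarePartition Δ X α) (a : A) :
    unitMatrix 𝒳₀ hX hα (star a) = star (unitMatrix 𝒳₀ hX hα a) :=
  ControlledMatrix.ext fun x y => by
    rw [ControlledMatrix.entry_star, entry_unitMatrix, entry_unitMatrix, relC0Tensor_star, star_mul,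
      star_unitBump, star_unitBump]

theorem unitMatrix_mul_sub_mem (hΔ : 0 < Δ) (hX : BoundedGeometry X) (hnet : IsSeparatedNet Δ X)
    (hα : IsSquarePartition Δ X α) (a b : A) :
    (CStarCompletion.mk (unitMatrix 𝒳₀ hX hα (a * b)) : UniformRoe hX (relC0 A 𝒳₀)) -
      CStarCompletion.mk (unitMatrix 𝒳₀ hX hα a) * CStarCompletion.mk (unitMatrix 𝒳₀ hX hα b) ∈
      (relativeIdeal hX (discretePart Δ 𝒳₀ X) (relC0 A 𝒳₀)).toSubmodule := by
  refine subset_closure ⟨5 * Δ, fun x y h => ?_⟩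
  rw [MatrixAlgebra.coeff_sub, ← CStarCompletion.mk_mul, MatrixAlgebra.coeff_mk,
    MatrixAlgebra.coeff_mk, ControlledMatrix.entry_mul_eq_sum _ _ x y
      (hX.finite_ball x (2 * Δ)).toFinset fun z hz => by
        rw [Set.Finite.mem_toFinset, Metric.mem_ball, dist_comm]
        by_contra hd
        refine hz ?_
        rw [entry_unitMatrix, unitBump_mul_eq_zero hα (not_lt.1 hd)]
        exact relC0.ext fun z => zero_smul _ _] at h
  obtain ⟨w, hw⟩ : ∃ w, (relC0Tensor 𝒳₀ (unitBump 𝒳₀ hα x * unitBump 𝒳₀ hα y) (a * b) -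
      ∑ z ∈ (hX.finite_ball x (2 * Δ)).toFinset, (unitMatrix 𝒳₀ hX hα a).entry x z *
        (unitMatrix 𝒳₀ hX hα b).entry z y).1 w ≠ 0 := by
    by_contra! hw
    exact h (relC0.ext hw)
  have e : (relC0Tensor 𝒳₀ (unitBump 𝒳₀ hα x * unitBump 𝒳₀ hα y) (a * b) -
      ∑ z ∈ (hX.finite_ball x (2 * Δ)).toFinset, (unitMatrix 𝒳₀ hX hα a).entry x z *
        (unitMatrix 𝒳₀ hX hα b).entry z y).1 w =
      ((cutoff Δ 𝒳₀ x * α x w * (cutoff Δ 𝒳₀ y * α y w) *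
        (1 - ∑ z ∈ (hX.finite_ball x (2 * Δ)).toFinset, (cutoff Δ 𝒳₀ z * α z w) ^ 2) : ℝ) : ℂ) •
        (a * b) := by
    have h1 := map_sub (relC0Eval 𝒳₀ A w)
      (relC0Tensor 𝒳₀ (unitBump 𝒳₀ hα x * unitBump 𝒳₀ hα y) (a * b))
      (∑ z ∈ (hX.finite_ball x (2 * Δ)).toFinset, (unitMatrix 𝒳₀ hX hα a).entry x z *
        (unitMatrix 𝒳₀ hX hα b).entry z y)
    rw [map_sum] at h1
    refine h1.trans ?_
    have h2 : ∀ z, relC0Eval 𝒳₀ A w ((unitMatrix 𝒳₀ hX hα a).entry x z *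
        (unitMatrix 𝒳₀ hX hα b).entry z y) = ((cutoff Δ 𝒳₀ x * α x w * (cutoff Δ 𝒳₀ y * α y w) *
        (cutoff Δ 𝒳₀ z * α z w) ^ 2 : ℝ) : ℂ) • (a * b) := fun z => by
      rw [entry_unitMatrix, entry_unitMatrix, relC0Tensor_mul]
      change ((((cutoff Δ 𝒳₀ x * α x w : ℝ) : ℂ) * ((cutoff Δ 𝒳₀ z * α z w : ℝ) : ℂ)) *
        (((cutoff Δ 𝒳₀ z * α z w : ℝ) : ℂ) * ((cutoff Δ 𝒳₀ y * α y w : ℝ) : ℂ))) • (a * b) = _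
      congr 1
      push_cast
      ring
    have h3 : relC0Eval 𝒳₀ A w (relC0Tensor 𝒳₀ (unitBump 𝒳₀ hα x * unitBump 𝒳₀ hα y) (a * b)) =
        ((cutoff Δ 𝒳₀ x * α x w * (cutoff Δ 𝒳₀ y * α y w) : ℝ) : ℂ) • (a * b) := by
      change (((cutoff Δ 𝒳₀ x * α x w : ℝ) : ℂ) * ((cutoff Δ 𝒳₀ y * α y w : ℝ) : ℂ)) • (a * b) = _
      congr 1
      push_cast
      ring
    rw [h3]
    simp only [h2]
    rw [← Finset.sum_smul, ← sub_smul]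
    congr 1
    push_cast
    rw [mul_sub, mul_one, Finset.mul_sum]
  rw [e] at hw
  have hw' := Complex.ofReal_ne_zero.1 (left_ne_zero_of_smul hw)
  have hx : α x w ≠ 0 := right_ne_zero_of_mul (left_ne_zero_of_mul (left_ne_zero_of_mul hw'))
  have hy : α y w ≠ 0 := right_ne_zero_of_mul (right_ne_zero_of_mul (left_ne_zero_of_mul hw'))
  have hsum := right_ne_zero_of_mul hw'
  have h1 : ∑ z ∈ (hX.finite_ball x (2 * Δ)).toFinset, α z w ^ 2 = 1 :=
    hα.sum_eq_one fun z hz => by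
      rw [Set.Finite.mem_toFinset, Metric.mem_ball]
      exact hα.dist_lt_two_mul hz hx
  obtain ⟨z, -, hz⟩ : ∃ z ∈ (hX.finite_ball x (2 * Δ)).toFinset,
      (cutoff Δ 𝒳₀ z * α z w) ^ 2 ≠ α z w ^ 2 := by
    by_contra! hz
    rw [Finset.sum_congr rfl hz, h1, sub_self] at hsum
    exact hsum rfl
  have hcz : cutoff Δ 𝒳₀ (z : 𝒳) = 0 := by
    rcases cutoff_eq_zero_or_one Δ 𝒳₀ (z : 𝒳) with h' | h'
    · exact h'
    · rw [h', one_mul] at hz; exact (hz rfl).elim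
  have hαz : α z w ≠ 0 := fun h' => hz (by rw [h', mul_zero])
  obtain ⟨v, hv, hd⟩ := mem_nbhdOf_of_cutoff_eq_zero hΔ hnet hcz
  have key : ∀ x' : X, α x' w ≠ 0 → dist x' v < 5 * Δ := fun x' hx' => by
    have := hα.dist_lt_two_mul hx' hαz
    have := dist_triangle x' z v
    linarith
  exact ⟨⟨v, hv, key x hx⟩, ⟨v, hv, key y hy⟩⟩

variable (𝒳₀) in
/-- The unit `a ↦ qmat (χ_x χ_y α_x α_y ⊗ a)` of the asymptotic adjunction. -/
def unitHom (hΔ : 0 < Δ) (hX : BoundedGeometry X) (hnet : IsSeparatedNet Δ X)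
    (hα : IsSquarePartition Δ X α) (A : Type*) [NonUnitalCStarAlgebra A] :
    A →⋆ₙₐ[ℂ] RelativeRoe hX (discretePart Δ 𝒳₀ X) (relC0 A 𝒳₀) where
  toFun a := qmat hX _ (CStarCompletion.mk (unitMatrix 𝒳₀ hX hα a))
  map_smul' c a := by
    have : unitMatrix 𝒳₀ hX hα (c • a) = c • unitMatrix 𝒳₀ hX hα a :=
      ControlledMatrix.ext fun x y => map_smul (relC0TensorBilin 𝒳₀ A _) c a
    rw [this, CStarCompletion.mk_smul]
    rfl
  map_zero' := by
    have : unitMatrix 𝒳₀ hX hα (0 : A) = 0 :=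
      ControlledMatrix.ext fun x y => map_zero (relC0TensorBilin 𝒳₀ A _)
    rw [this, CStarCompletion.mk_zero]
    rfl
  map_add' a b := by
    have : unitMatrix 𝒳₀ hX hα (a + b) = unitMatrix 𝒳₀ hX hα a + unitMatrix 𝒳₀ hX hα b :=
      ControlledMatrix.ext fun x y => map_add (relC0TensorBilin 𝒳₀ A _) a b
    rw [this, CStarCompletion.mk_add]
    rfl
  map_mul' a b := CStarIdeal.proj_eq_iff.2 (unitMatrix_mul_sub_mem hΔ hX hnet hα a b)
  map_star' a := by
    rw [unitMatrix_star, CStarCompletion.mk_star]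
    rfl

end Unit

section UnitTransformation

variable {𝒳 : Type u} [MetricSpace 𝒳] [ProperSpace 𝒳] {𝒳₀ : Set 𝒳} {Δ : ℝ} {X : Set 𝒳}
  {α : X → C(𝒳, ℝ)}

variable (𝒳₀) in
/-- The unit as a natural transformation. -/
def unitTransformation (hΔ : 0 < Δ) (hX : BoundedGeometry X) (hnet : IsSeparatedNet Δ X)
    (hα : IsSquarePartition Δ X α) :
    𝟭 CStar.{u} ⟶ relC0Functor 𝒳₀ ⋙ relRoeFunctor hX (discretePart Δ 𝒳₀ X) where
  app A := unitHom 𝒳₀ hΔ hX hnet hα A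
  naturality A B φ := NonUnitalStarAlgHom.ext fun (a : A) => by
    change qmat hX (discretePart Δ 𝒳₀ X) (CStarCompletion.mk (unitMatrix 𝒳₀ hX hα (φ a))) =
      qmat hX (discretePart Δ 𝒳₀ X) (MatrixAlgebra.map (relC0Map 𝒳₀ φ)
        (CStarCompletion.mk (unitMatrix 𝒳₀ hX hα a)))
    rw [MatrixAlgebra.map_mk]
    refine congrArg (fun m => qmat hX (discretePart Δ 𝒳₀ X) (CStarCompletion.mk m))
      (ControlledMatrix.ext fun x y => relC0.ext fun z => ?_)
    exact (map_smul (show A →⋆ₙₐ[ℂ] B from φ) _ a).symm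

theorem isRoeUnit_unitTransformation (hΔ : 0 < Δ) (hX : BoundedGeometry X)
    (hnet : IsSeparatedNet Δ X) (hα : IsSquarePartition Δ X α) :
    IsRoeUnit 𝒳₀ Δ X hX α (unitTransformation 𝒳₀ hΔ hX hnet hα) := fun A a =>
  ⟨CStarCompletion.mk (unitMatrix 𝒳₀ hX hα a), fun x y z => by
    rw [MatrixAlgebra.coeff_mk]
    change (((cutoff Δ 𝒳₀ x * α x z : ℝ) : ℂ) * ((cutoff Δ 𝒳₀ y * α y z : ℝ) : ℂ)) • a = _
    rw [← Complex.ofReal_mul, mul_mul_mul_comm], rfl⟩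

theorem isLabeled_unitTransformation (hΔ : 0 < Δ) (hX : BoundedGeometry X)
    (hnet : IsSeparatedNet Δ X) (hα : IsSquarePartition Δ X α) :
    IsLabeled GoodStructure.id ((relC0Good 𝒳₀).comp (relRoeGood hX (discretePart Δ 𝒳₀ X)))
      (unitTransformation 𝒳₀ hΔ hX hnet hα) := isLabeled_of_tmul fun A B a b => by
  rw [comp_label]
  refine (congrArg _ (relRoeGood_label (B := (relC0Functor 𝒳₀).obj B) hX (discretePart Δ 𝒳₀ X) a
    (CStarCompletion.mk (unitMatrix 𝒳₀ hX hα b)))).trans ?_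
  refine congrArg (qmat hX (discretePart Δ 𝒳₀ X)) (MatrixAlgebra.ext_coeff fun x y => ?_)
  refine Eq.trans (MatrixAlgebra.coeff_map _ _ _ _) (Eq.trans ?_ (MatrixAlgebra.coeff_mk _ _ _).symm)
  refine (congrArg ((relC0Good 𝒳₀).label A B) ((MatrixAlgebra.coeff_lab a _ x y).trans
    (congrArg (MaxTensor.tmul a) (MatrixAlgebra.coeff_mk (unitMatrix 𝒳₀ hX hα b) x y)))).trans ?_
  refine (relC0Good_label 𝒳₀ a _).trans (relC0.ext fun z => ?_)
  exact MaxTensor.tmul_smul a _ b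

end UnitTransformation

end

/-! ### Products and compressions of matrices -/

noncomputable section

section Kernels

variable {X Y : Type*} {B : Type*} [NonUnitalCStarAlgebra B]

theorem matNorm_mul_diag_le {n : Type*} [Fintype n] (g : n → ℂ) {c : ℝ} (hc : 0 ≤ c)
    (hg : ∀ i, ‖g i‖ ≤ c) (M : CStarMatrix n n B) :
    matNorm (CStarMatrix.ofMatrix fun i j => g j • M i j) ≤ c * matNorm M := by
  have h := matNorm_diag_mul_le (fun i => star (g i)) hc (fun i => by rw [norm_star]; exact hg i)
    (star M)
  rw [matNorm_star] at h
  rw [← matNorm_star]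
  refine le_trans (le_of_eq (congrArg matNorm ?_)) h
  ext i j
  exact star_smul _ _

theorem matNorm_cornerFn_smul_le (g : X → ℂ) {c : ℝ} (hc : 0 ≤ c) (hg : ∀ x, ‖g x‖ ≤ c)
    (k : X → X → B) (F : Finset X) :
    matNorm (cornerFn F fun x y => g x • k x y) ≤ c * matNorm (cornerFn F k) :=
  matNorm_diag_mul_le (fun i : F => g i) hc (fun i => hg i) (cornerFn F k)

/-- The matrix obtained by transport along an injection, with zeros elsewhere. -/
def pushKernel (e : X → Y) (k : X → X → B) (i j : Y) : B :=
  Function.extend (Prod.map e e) (fun p => k p.1 p.2) 0 (i, j)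

theorem pushKernel_apply {e : X → Y} (he : Function.Injective e) (k : X → X → B) (x y : X) :
    pushKernel e k (e x) (e y) = k x y :=
  (he.prodMap he).extend_apply (fun p : X × X => k p.1 p.2) 0 (x, y)

theorem pushKernel_of_notMem (e : X → Y) (k : X → X → B) {i j : Y}
    (h : i ∉ Set.range e ∨ j ∉ Set.range e) : pushKernel e k i j = 0 := by
  refine Function.extend_apply' _ _ _ ?_
  rintro ⟨⟨x, y⟩, hxy⟩
  obtain ⟨h1, h2⟩ := Prod.mk.inj hxy
  exact h.elim (fun h => h ⟨x, h1⟩) fun h => h ⟨y, h2⟩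

theorem eq_pushKernel {e : X → Y} (he : Function.Injective e) {k : X → X → B} {l : Y → Y → B}
    (h : ∀ x y, l (e x) (e y) = k x y)
    (h₀ : ∀ i j, i ∉ Set.range e ∨ j ∉ Set.range e → l i j = 0) (i j : Y) :
    l i j = pushKernel e k i j := by
  by_cases hi : i ∈ Set.range e
  · by_cases hj : j ∈ Set.range e
    · obtain ⟨x, rfl⟩ := hi
      obtain ⟨y, rfl⟩ := hj
      rw [h, pushKernel_apply he]
    · rw [h₀ i j (.inr hj), pushKernel_of_notMem e k (.inr hj)]
  · rw [h₀ i j (.inl hi), pushKernel_of_notMem e k (.inl hi)]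

theorem pushKernel_congr₂ {C D : Type*} [NonUnitalCStarAlgebra C] [NonUnitalCStarAlgebra D]
    {e : X → Y} (he : Function.Injective e) {k : X → X → B} {l : X → X → C} {n : X → X → D}
    (φ : B → C → D) (h0 : φ 0 0 = 0) (h : ∀ x y, n x y = φ (k x y) (l x y)) (i j : Y) :
    pushKernel e n i j = φ (pushKernel e k i j) (pushKernel e l i j) := by
  refine (eq_pushKernel he (l := fun i j => φ (pushKernel e k i j) (pushKernel e l i j))
    (fun x y => ?_) (fun i j hij => ?_) i j).symm
  · rw [pushKernel_apply he, pushKernel_apply he, h]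
  · rw [pushKernel_of_notMem e _ hij, pushKernel_of_notMem e _ hij, h0]

theorem pushKernel_map {C : Type*} [NonUnitalCStarAlgebra C]
    {e : X → Y} (he : Function.Injective e) {k : X → X → B} {n : X → X → C}
    (φ : B → C) (h0 : φ 0 = 0) (h : ∀ x y, n x y = φ (k x y)) (i j : Y) :
    pushKernel e n i j = φ (pushKernel e k i j) :=
  pushKernel_congr₂ he (l := k) (fun b _ => φ b) h0 h i j

theorem matNorm_cornerFn_pushKernel_le {e : X → Y} (he : Function.Injective e) {k : X → X → B}
    {c : ℝ} (h : ∀ F, matNorm (cornerFn F k) ≤ c) (F : Finset Y) :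
    matNorm (cornerFn F (pushKernel e k)) ≤ c := by
  classical
  let F₀ : Finset Y := F.filter fun i => i ∈ Set.range e
  have hr : ∀ i : F₀, ∃ x, e x = i := fun i => (Finset.mem_filter.1 i.2).2
  choose r hr using hr
  let G : Finset X := Finset.univ.image r
  let s : F₀ → G := fun i => ⟨r i, Finset.mem_image_of_mem r (Finset.mem_univ i)⟩
  have hs : Function.Injective s := fun i j hij => by
    have h1 : r i = r j := congrArg Subtype.val hij
    exact Subtype.ext (by rw [← hr i, ← hr j, h1])
  have h1 : matNorm (cornerFn F₀ (pushKernel e k)) ≤ c := by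
    refine le_trans ?_ ((matNorm_submatrix_le s hs (cornerFn G k)).trans (h G))
    refine le_of_eq (congrArg matNorm ?_)
    ext i j
    change pushKernel e k i j = k (r i) (r j)
    rw [← hr i, ← hr j, pushKernel_apply he]
  refine le_trans (le_of_eq (congrArg matNorm ?_))
    ((matNorm_hom_le (ControlledMatrix.extZero F₀ F (Finset.filter_subset _ _)) _).trans h1)
  ext i j
  change pushKernel e k i j = ControlledMatrix.extZeroFun F₀ F _ i j
  rw [ControlledMatrix.extZeroFun_apply]
  split_ifs with hi hj
  · rfl
  · exact pushKernel_of_notMem e k (.inr fun h' => hj (Finset.mem_filter.2 ⟨j.2, h'⟩))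
  · exact pushKernel_of_notMem e k (.inl fun h' => hi (Finset.mem_filter.2 ⟨i.2, h'⟩))

namespace MatrixAlgebra

variable {𝓔 : SupportFamily X}

open ControlledMatrix in
/-- The coefficients of a product, if the relevant row of the first factor is finite. -/
theorem coeff_mul_eq_sum (P Q : MatrixAlgebra 𝓔 B) (x y : X) (G : Finset X)
    (hG : ∀ z, coeff P x z ≠ 0 → z ∈ G) :
    coeff (P * Q) x y = ∑ z ∈ G, coeff P x z * coeff Q z y := by
  classical
  have key : ∀ a : ControlledMatrix 𝓔 B,
      ‖coeff (CStarCompletion.mk a * Q) x y - ∑ z ∈ G, entry a x z * coeff Q z y‖ ≤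
        ‖CStarCompletion.mk a - P‖ * ‖Q‖ := fun a => by
    let R : ControlledMatrix 𝓔 B := ofEntries
      (fun i j => if i = x ∧ j ∉ G then entry a i j else 0)
      (𝓔.mono (fun p hp => by
        by_contra h
        have h' : entry a p.1 p.2 = 0 := by by_contra h''; exact h h''
        refine hp ?_
        dsimp only
        rw [h', ite_self]) a.controlled)
      (by
        obtain ⟨C, hC, h⟩ := a.entry_bdd
        refine ⟨C, fun i j => ?_⟩
        split_ifs
        · exact h i j
        · rw [norm_zero]; exact hC)
    have hR : ∀ i j, entry R i j = if i = x ∧ j ∉ G then entry a i j else 0 := fun _ _ => rfl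
    have e1 : coeff (CStarCompletion.mk a * Q) x y - ∑ z ∈ G, entry a x z * coeff Q z y =
        coeff (CStarCompletion.mk R * Q) x y := by
      have h1 : ∀ (b : ControlledMatrix 𝓔 B) (H : Finset X), (∀ z, entry b x z ≠ 0 → z ∈ H) →
          coeff (CStarCompletion.mk b * Q) x y = ∑ z ∈ H, entry b x z * coeff Q z y :=
        fun b H hH => by
          rw [coeff_mk_mul]
          refine Finset.sum_subset (fun z hz => hH z (by simpa using hz)) fun z _ hz => ?_
          have : entry b x z = 0 := by by_contra h; exact hz (by simpa using h)
          rw [this, zero_mul]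
      have hH : ∀ z, entry a x z ≠ 0 → z ∈ (a.row_finite x).toFinset ∪ G := fun z hz =>
        Finset.mem_union_left _ (by simpa using hz)
      rw [h1 a _ hH, h1 R ((a.row_finite x).toFinset ∪ G) fun z hz => hH z fun h => hz (by
        rw [hR, h, ite_self]), sub_eq_iff_eq_add]
      have h2 : ∑ z ∈ G, entry a x z * coeff Q z y = ∑ z ∈ (a.row_finite x).toFinset ∪ G,
          if z ∈ G then entry a x z * coeff Q z y else 0 := by
        rw [← Finset.sum_filter]
        refine Finset.sum_congr ?_ fun _ _ => rfl
        ext z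
        simp only [Finset.mem_filter, Finset.mem_union]
        tauto
      rw [h2, ← Finset.sum_add_distrib]
      refine Finset.sum_congr rfl fun z _ => ?_
      rw [hR]
      by_cases hz : z ∈ G <;> simp [hz]
    rw [e1]
    refine (norm_coeff_le _ _ _).trans ((norm_mul_le _ _).trans
      (mul_le_mul_of_nonneg_right ?_ (norm_nonneg _)))
    refine norm_le_of_corners fun F => ?_
    have h3 := matNorm_diag_mul_le (fun i : F => if (i : X) = x then (1 : ℂ) else 0) zero_le_one
      (fun i => by split_ifs <;> simp) (cornerFn F (coeff (CStarCompletion.mk a - P)))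
    have h4 := matNorm_mul_diag_le (fun i : F => if (i : X) ∈ G then (0 : ℂ) else 1) zero_le_one
      (fun i => by split_ifs <;> simp) (CStarMatrix.ofMatrix fun i j : F =>
        (if (i : X) = x then (1 : ℂ) else 0) • cornerFn F (coeff (CStarCompletion.mk a - P)) i j)
    rw [one_mul] at h3 h4
    refine le_trans (le_of_eq (congrArg matNorm ?_))
      (h4.trans (h3.trans (matNorm_cornerFn_coeff_le _ F)))
    ext i j
    change coeff (CStarCompletion.mk R) (i : X) j = (if (j : X) ∈ G then (0 : ℂ) else 1) •
      ((if (i : X) = x then (1 : ℂ) else 0) • coeff (CStarCompletion.mk a - P) (i : X) j)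
    rw [coeff_mk, hR, coeff_sub, coeff_mk]
    by_cases hi : (i : X) = x
    · by_cases hj : (j : X) ∈ G
      · simp [hj]
      · have : coeff P x j = 0 := by by_contra h; exact hj (hG _ h)
        simp [hi, hj, this]
    · simp [hi]
  obtain ⟨a, ha⟩ : ∃ a : ℕ → ControlledMatrix 𝓔 B,
      Tendsto (fun n => (CStarCompletion.mk (a n) : MatrixAlgebra 𝓔 B)) atTop (𝓝 P) := by
    obtain ⟨b, hb, hbP⟩ := mem_closure_iff_seq_limit.1
      (CStarCompletion.denseRange_mk (T := ControlledMatrix 𝓔 B) P)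
    choose a ha using hb
    exact ⟨a, by simpa only [ha] using hbP⟩
  have h1 : Tendsto (fun n => coeff (CStarCompletion.mk (a n) * Q) x y -
      ∑ z ∈ G, entry (a n) x z * coeff Q z y) atTop (𝓝 0) := by
    refine squeeze_zero_norm (fun n => key (a n)) ?_
    have := (tendsto_iff_norm_sub_tendsto_zero.1 ha).mul_const ‖Q‖
    rwa [zero_mul] at this
  have h2 : Tendsto (fun n => coeff (CStarCompletion.mk (a n) * Q) x y -
      ∑ z ∈ G, entry (a n) x z * coeff Q z y) atTop
      (𝓝 (coeff (P * Q) x y - ∑ z ∈ G, coeff P x z * coeff Q z y)) := by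
    refine Tendsto.sub (((continuous_coeff x y).tendsto _).comp (ha.mul_const Q)) ?_
    refine tendsto_finsetSum _ fun z _ => Tendsto.mul_const _ ?_
    exact (((continuous_coeff x z).tendsto P).comp ha).congr fun n => coeff_mk _ _ _
  exact sub_eq_zero.1 (tendsto_nhds_unique h2 h1)

/-- Two matrices differ by little, if the difference of their coefficients is transported from a
matrix with small corners. -/
theorem norm_le_of_pushKernel {Z : Type*} {𝓔 : SupportFamily Y} {e : Z → Y}
    (he : Function.Injective e) {m : MatrixAlgebra 𝓔 B} {k : Z → Z → B}
    (hm : ∀ i j, coeff m i j = pushKernel e k i j) {c : ℝ}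
    (h : ∀ F, matNorm (cornerFn F k) ≤ c) : ‖m‖ ≤ c := by
  refine norm_le_of_corners fun F => ?_
  have : coeff m = pushKernel e k := funext fun i => funext fun j => hm i j
  rw [this]
  exact matNorm_cornerFn_pushKernel_le he h F

end MatrixAlgebra

open ControlledMatrix MatrixAlgebra in
theorem exists_compress {𝓔 : SupportFamily X} {e : X → ℕ} (he : Function.Injective e) {g : X → ℂ}
    (hg : Tendsto g cofinite (𝓝 0)) (m : MatrixAlgebra 𝓔 B) : ∃ K : CompactMatrices B,
      ∀ i j, coeff K i j = pushKernel e (fun x y => g x • coeff m x y) i j := by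
  classical
  refine exists_of_approx _ fun δ hδ => ?_
  have hfin : ∀ δ > 0, {x | δ ≤ ‖g x‖}.Finite := fun δ hδ => by
    have := (tendsto_zero_iff_norm_tendsto_zero.1 hg).eventually (gt_mem_nhds hδ)
    refine (Filter.eventually_cofinite.1 this).subset fun x hx => ?_
    exact not_lt.2 hx
  obtain ⟨c, hc0, hc⟩ : ∃ c, 0 ≤ c ∧ ∀ x, ‖g x‖ ≤ c := by
    refine ⟨1 + ∑ x ∈ (hfin 1 one_pos).toFinset, ‖g x‖, by positivity, fun x => ?_⟩
    by_cases hx : 1 ≤ ‖g x‖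
    · refine le_trans ?_ (le_add_of_nonneg_left zero_le_one)
      exact Finset.single_le_sum (f := fun x => ‖g x‖) (fun _ _ => norm_nonneg _) (by simpa using hx)
    · exact (not_le.1 hx).le.trans (le_add_of_nonneg_right (by positivity))
  let δ₁ : ℝ := δ / (2 * (‖m‖ + 1))
  let δ₂ : ℝ := δ / (2 * (c + 1))
  have hδ₁ : 0 < δ₁ := by positivity
  have hδ₂ : 0 < δ₂ := by positivity
  obtain ⟨_, ⟨a, rfl⟩, ha⟩ := Metric.mem_closure_iff.1
    (CStarCompletion.denseRange_mk (T := ControlledMatrix 𝓔 B) m) δ₂ hδ₂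
  rw [dist_eq_norm] at ha
  let G : Finset X := (hfin δ₁ hδ₁).toFinset
  let g' : X → ℂ := fun x => if x ∈ G then g x else 0
  have hg' : ∀ x, ‖g' x‖ ≤ c := fun x => by
    simp only [g']; split_ifs
    · exact hc x
    · rw [norm_zero]; exact hc0
  have hgg' : ∀ x, ‖g x - g' x‖ ≤ δ₁ := fun x => by
    simp only [g']; split_ifs with hx
    · rw [sub_self, norm_zero]; exact hδ₁.le
    · rw [sub_zero]
      by_contra h
      exact hx (by simpa [G] using (not_le.1 h).le)
  have hfs : (matSupport (pushKernel e fun x y => g' x • entry a x y)).Finite := by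
    refine (((G.finite_toSet.biUnion fun x _ => (a.row_finite x).image fun y => (x, y))).image
      (Prod.map e e)).subset ?_
    rintro ⟨i, j⟩ hij
    have hi : i ∈ Set.range e ∧ j ∈ Set.range e := by
      by_contra h
      exact hij (pushKernel_of_notMem e _ (not_and_or.1 h))
    obtain ⟨⟨x, rfl⟩, ⟨y, rfl⟩⟩ := hi
    have hxy : g' x • entry a x y ≠ 0 := by
      have : pushKernel e (fun x y => g' x • entry a x y) (e x) (e y) ≠ 0 := hij
      rwa [pushKernel_apply he] at this
    refine ⟨(x, y), Set.mem_biUnion (x := x) ?_ ⟨y, right_ne_zero_of_smul hxy, rfl⟩, rfl⟩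
    by_contra h
    exact left_ne_zero_of_smul hxy (if_neg h)
  obtain ⟨C, hC0, hC⟩ := a.entry_bdd
  have hbd : ∀ i j, ‖pushKernel e (fun x y => g' x • entry a x y) i j‖ ≤ c * C := fun i j => by
    by_cases h : i ∈ Set.range e ∧ j ∈ Set.range e
    · obtain ⟨⟨x, rfl⟩, ⟨y, rfl⟩⟩ := h
      rw [pushKernel_apply he, norm_smul]
      exact mul_le_mul (hg' x) (hC x y) (norm_nonneg _) hc0
    · rw [pushKernel_of_notMem e _ (not_and_or.1 h), norm_zero]
      positivity
  refine ⟨ofEntries (pushKernel e fun x y => g' x • entry a x y) hfs ⟨c * C, hbd⟩, fun F => ?_⟩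
  have e1 : (fun i j => pushKernel e (fun x y => g x • coeff m x y) i j -
      entry (ofEntries (𝓔 := finiteSupports ℕ) (pushKernel e fun x y => g' x • entry a x y) hfs
        ⟨c * C, hbd⟩) i j) =
      pushKernel e fun x y => (g x - g' x) • coeff m x y +
        g' x • coeff (m - CStarCompletion.mk a) x y := by
    funext i j
    change pushKernel e (fun x y => g x • coeff m x y) i j -
      pushKernel e (fun x y => g' x • entry a x y) i j = _
    refine (pushKernel_congr₂ he (fun b c : B => b - c) (sub_zero (0 : B)) (fun x y => ?_) i j).symm
    rw [coeff_sub, coeff_mk, sub_smul, smul_sub]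
    abel
  rw [e1]
  refine matNorm_cornerFn_pushKernel_le he (fun F => ?_) F
  have h1 := matNorm_cornerFn_smul_le _ hδ₁.le hgg' (coeff m) F
  have h2 := matNorm_cornerFn_smul_le _ hc0 hg' (coeff (m - CStarCompletion.mk a)) F
  have h3 := matNorm_cornerFn_coeff_le m F
  have h4 := (matNorm_cornerFn_coeff_le (m - CStarCompletion.mk a) F).trans ha.le
  refine (matNorm_add_le (cornerFn F fun x y => (g x - g' x) • coeff m x y)
    (cornerFn F fun x y => g' x • coeff (m - CStarCompletion.mk a) x y)).trans ?_
  have h5 : δ₁ * ‖m‖ ≤ δ / 2 := by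
    simp only [δ₁]
    rw [div_mul_eq_mul_div, div_le_div_iff₀ (by positivity) two_pos]
    nlinarith [norm_nonneg m]
  have h6 : c * δ₂ ≤ δ / 2 := by
    simp only [δ₂]
    rw [mul_div_assoc', div_le_div_iff₀ (by positivity) two_pos]
    nlinarith
  have h7 := mul_le_mul_of_nonneg_left h3 hδ₁.le
  have h8 := mul_le_mul_of_nonneg_left h4 hc0
  linarith

end Kernels

/-! ### The compression of a matrix by a null sequence -/

section Compress

open MatrixAlgebra

variable {X : Type*} {B : Type*} [NonUnitalCStarAlgebra B] {𝓔 : SupportFamily X} {e : X → ℕ}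

/-- The compact matrix `diag g · m`, where `g` is a null sequence. -/
def compress (he : Function.Injective e) (g : X → ℂ) (hg : Tendsto g cofinite (𝓝 0))
    (m : MatrixAlgebra 𝓔 B) : CompactMatrices B := (exists_compress he hg m).choose

theorem coeff_compress (he : Function.Injective e) (g : X → ℂ) (hg : Tendsto g cofinite (𝓝 0))
    (m : MatrixAlgebra 𝓔 B) (i j : ℕ) : coeff (compress he g hg m) i j =
      pushKernel e (fun x y => g x • coeff m x y) i j := (exists_compress he hg m).choose_spec i j

theorem eq_compress (he : Function.Injective e) {g : X → ℂ} (hg : Tendsto g cofinite (𝓝 0))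
    {m : MatrixAlgebra 𝓔 B} {K : CompactMatrices B}
    (h : ∀ i j, coeff K i j = pushKernel e (fun x y => g x • coeff m x y) i j) :
    K = compress he g hg m := ext_coeff fun i j => by rw [h, coeff_compress]

theorem compress_add (he : Function.Injective e) (g : X → ℂ) (hg : Tendsto g cofinite (𝓝 0))
    (m n : MatrixAlgebra 𝓔 B) :
    compress he g hg (m + n) = compress he g hg m + compress he g hg n := ext_coeff fun i j => by
  rw [coeff_add, coeff_compress, coeff_compress, coeff_compress]
  exact pushKernel_congr₂ he (· + ·) (add_zero 0) (fun x y => by rw [coeff_add, smul_add]) i j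

theorem compress_smul (he : Function.Injective e) (g : X → ℂ) (hg : Tendsto g cofinite (𝓝 0))
    (c : ℂ) (m : MatrixAlgebra 𝓔 B) :
    compress he g hg (c • m) = c • compress he g hg m := ext_coeff fun i j => by
  rw [coeff_smul, coeff_compress, coeff_compress]
  exact pushKernel_map he (c • ·) (smul_zero c) (fun x y => by rw [coeff_smul, smul_comm]) i j

theorem compress_sub (he : Function.Injective e) (g : X → ℂ) (hg : Tendsto g cofinite (𝓝 0))
    (m n : MatrixAlgebra 𝓔 B) :
    compress he g hg (m - n) = compress he g hg m - compress he g hg n := ext_coeff fun i j => by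
  rw [coeff_sub, coeff_compress, coeff_compress, coeff_compress]
  exact pushKernel_congr₂ he (· - ·) (sub_zero 0) (fun x y => by rw [coeff_sub, smul_sub]) i j

theorem norm_compress_le (he : Function.Injective e) {g : X → ℂ} (hg : Tendsto g cofinite (𝓝 0))
    (m : MatrixAlgebra 𝓔 B) {c : ℝ} (hc : 0 ≤ c) (h : ∀ x, ‖g x‖ ≤ c) :
    ‖compress he g hg m‖ ≤ c * ‖m‖ :=
  norm_le_of_pushKernel he (coeff_compress he g hg m) fun F =>
    (matNorm_cornerFn_smul_le g hc h _ F).trans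
      (mul_le_mul_of_nonneg_left (matNorm_cornerFn_coeff_le m F) hc)

theorem norm_compress_sub_compress_le (he : Function.Injective e) {g h : X → ℂ}
    (hg : Tendsto g cofinite (𝓝 0)) (hh : Tendsto h cofinite (𝓝 0))
    (m : MatrixAlgebra 𝓔 B) {c : ℝ} (hc : 0 ≤ c) (hgh : ∀ x, ‖g x - h x‖ ≤ c) :
    ‖compress he g hg m - compress he h hh m‖ ≤ c * ‖m‖ := by
  refine norm_le_of_pushKernel he (k := fun x y => (g x - h x) • coeff m x y) (fun i j => ?_)
    fun F => (matNorm_cornerFn_smul_le _ hc hgh _ F).trans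
      (mul_le_mul_of_nonneg_left (matNorm_cornerFn_coeff_le m F) hc)
  rw [coeff_sub, coeff_compress, coeff_compress]
  exact (pushKernel_congr₂ he (· - ·) (sub_zero 0) (fun x y => sub_smul _ _ _) i j).symm

theorem map_compress {C : Type*} [NonUnitalCStarAlgebra C] (φ : B →⋆ₙₐ[ℂ] C)
    (he : Function.Injective e) (g : X → ℂ) (hg : Tendsto g cofinite (𝓝 0))
    (m : MatrixAlgebra 𝓔 B) : MatrixAlgebra.map φ (compress he g hg m) =
      compress he g hg (MatrixAlgebra.map φ m) := eq_compress he hg fun i j => by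
  rw [coeff_map, coeff_compress]
  exact (pushKernel_map he φ (map_zero φ) (fun x y => by rw [coeff_map, map_smul]) i j).symm

theorem lab_compress {A : Type*} [NonUnitalCStarAlgebra A] (a : A)
    (he : Function.Injective e) (g : X → ℂ) (hg : Tendsto g cofinite (𝓝 0))
    (m : MatrixAlgebra 𝓔 B) : lab a (compress he g hg m) = compress he g hg (lab a m) :=
  eq_compress he hg fun i j => by
    rw [coeff_lab, coeff_compress]
    exact (pushKernel_map he (MaxTensor.tmul a) (MaxTensor.tmul_zero a)
      (fun x y => by rw [coeff_lab, MaxTensor.tmul_smul]) i j).symm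

/-- The commutator of a controlled matrix with a diagonal matrix has small corners, if the diagonal
matrix varies slowly. -/
theorem exists_commutator_bound (M : ControlledMatrix 𝓔 B) : ∃ K : ℝ, 0 ≤ K ∧
    ∀ (h : X → ℂ) (δ : ℝ), 0 ≤ δ → (∀ x y, M.entry x y ≠ 0 → ‖h y - h x‖ ≤ δ) →
      ∀ F, matNorm (cornerFn F fun x y => (h y - h x) • M.entry x y) ≤ K * δ := by
  obtain ⟨N₁, h₁⟩ := M.row_bdd
  obtain ⟨N₂, h₂⟩ := M.col_bdd
  obtain ⟨C, hC0, hC⟩ := M.entry_bdd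
  refine ⟨(max N₁ N₂ : ℕ) * C, by positivity, fun h δ hδ hh F => ?_⟩
  have hN : ∀ {p q : ℕ} (s : Set X) (s' : Set F), s.encard ≤ p → p ≤ q →
      (∀ i ∈ s', (i : X) ∈ s) → s'.encard ≤ q := fun {p q} s s' hs hpq hs' => by
    rw [← Subtype.val_injective.encard_image]
    refine (Set.encard_le_encard ?_).trans (hs.trans (by exact_mod_cast hpq))
    rintro _ ⟨i, hi, rfl⟩
    exact hs' i hi
  refine (matNorm_le_of_sparse _ (C * δ) (by positivity) (max N₁ N₂) (fun i j => ?_)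
    (fun i => hN _ _ (h₁ i) (le_max_left _ _) fun j hj => right_ne_zero_of_smul hj)
    (fun j => hN _ _ (h₂ j) (le_max_right _ _) fun i hi => right_ne_zero_of_smul hi)).trans
    (le_of_eq (by ring))
  change ‖(h j - h i) • M.entry i j‖ ≤ _
  rw [norm_smul]
  by_cases h0 : M.entry (i : X) j = 0
  · rw [h0, norm_zero, mul_zero]; positivity
  · rw [mul_comm]
    exact mul_le_mul (hC _ _) (hh _ _ h0) (norm_nonneg _) hC0

open ControlledMatrix in
/-- The commutator of a controlled matrix with a bounded diagonal matrix. -/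
def diagCommutator (M : ControlledMatrix 𝓔 B) (h : X → ℂ) {c : ℝ} (hc : ∀ x, ‖h x‖ ≤ c) :
    ControlledMatrix 𝓔 B :=
  ofEntries (fun x y => (h y - h x) • M.entry x y)
    (𝓔.mono (fun _ hp => right_ne_zero_of_smul hp) M.controlled)
    (by
      obtain ⟨C, hC0, hC⟩ := M.entry_bdd
      refine ⟨(c + c) * C, fun x y => ?_⟩
      rw [norm_smul]
      have : 0 ≤ c := (norm_nonneg _).trans (hc x)
      exact mul_le_mul ((norm_sub_le _ _).trans (add_le_add (hc y) (hc x))) (hC x y) (norm_nonneg _)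
        (by positivity))

theorem norm_diagCommutator_le (M : ControlledMatrix 𝓔 B) (h : X → ℂ) {c : ℝ} (hc : ∀ x, ‖h x‖ ≤ c)
    {K : ℝ} (hK : ∀ F, matNorm (cornerFn F fun x y => (h y - h x) • M.entry x y) ≤ K) :
    ‖(CStarCompletion.mk (diagCommutator M h hc) : MatrixAlgebra 𝓔 B)‖ ≤ K := by
  rw [CStarCompletion.norm_mk]
  exact ciSup_le hK

theorem compress_mul_compress (he : Function.Injective e) {g h k : X → ℂ}
    (hg : Tendsto g cofinite (𝓝 0)) (hh : Tendsto h cofinite (𝓝 0))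
    (hk : Tendsto k cofinite (𝓝 0)) (hghk : ∀ x, k x = g x * h x) {c : ℝ} (hc : ∀ x, ‖h x‖ ≤ c)
    (M : ControlledMatrix 𝓔 B) (n : MatrixAlgebra 𝓔 B) :
    compress he g hg (CStarCompletion.mk M) * compress he h hh n -
      compress he k hk (CStarCompletion.mk M * n) =
      compress he g hg (CStarCompletion.mk (diagCommutator M h hc) * n) := by
  classical
  refine eq_compress he hg fun i j => ?_
  rw [coeff_sub, coeff_compress]
  have hrow : ∀ i, (∀ z, coeff (compress he g hg (CStarCompletion.mk M)) i z ≠ 0 →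
      i ∈ Set.range e) := fun i z hz => by
    by_contra h
    rw [coeff_compress] at hz
    exact hz (pushKernel_of_notMem e _ (.inl h))
  refine eq_pushKernel he (l := fun i j => coeff (compress he g hg (CStarCompletion.mk M) *
    compress he h hh n) i j - pushKernel e (fun x y => k x • coeff (CStarCompletion.mk M * n) x y) i j)
    (fun x y => ?_) (fun i j hij => ?_) i j
  · have hG : ∀ z, coeff (compress he g hg (CStarCompletion.mk M)) (e x) z ≠ 0 →
        z ∈ (M.row_finite x).toFinset.map ⟨e, he⟩ := fun z hz => by
      rw [coeff_compress] at hz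
      have hz' : z ∈ Set.range e := by
        by_contra h
        exact hz (pushKernel_of_notMem e _ (.inr h))
      obtain ⟨w, rfl⟩ := hz'
      rw [pushKernel_apply he, coeff_mk] at hz
      exact Finset.mem_map.2 ⟨w, by simpa using right_ne_zero_of_smul hz, rfl⟩
    rw [coeff_mul_eq_sum _ _ _ _ _ hG, pushKernel_apply he, Finset.sum_map, coeff_mk_mul]
    have h1 : ∀ z, coeff (compress he g hg (CStarCompletion.mk M)) (e x) (e z) *
        coeff (compress he h hh n) (e z) (e y) =
        (g x * h z) • (M.entry x z * coeff n z y) := fun z => by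
      rw [coeff_compress, coeff_compress, pushKernel_apply he, pushKernel_apply he, coeff_mk,
        smul_mul_smul_comm]
    have h2 : coeff (CStarCompletion.mk (diagCommutator M h hc) * n) x y =
        ∑ z ∈ (M.row_finite x).toFinset, (h z - h x) • (M.entry x z * coeff n z y) := by
      rw [coeff_mul_eq_sum _ _ _ _ (M.row_finite x).toFinset fun z hz => ?_]
      · refine Finset.sum_congr rfl fun z _ => ?_
        rw [coeff_mk, ← smul_mul_assoc]
        rfl
      · rw [coeff_mk] at hz
        have : (h z - h x) • M.entry x z ≠ 0 := hz
        simpa using right_ne_zero_of_smul this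
    rw [h2, hghk, Finset.smul_sum, Finset.smul_sum, ← Finset.sum_sub_distrib]
    refine Finset.sum_congr rfl fun z _ => ?_
    refine (congrArg (· - _) (h1 z)).trans ?_
    rw [← sub_smul, smul_smul, mul_sub]
  · rw [pushKernel_of_notMem e _ hij, sub_zero]
    rcases hij with hi | hj
    · rw [coeff_mul_eq_sum _ _ _ _ ∅ fun z hz => (hi (hrow i z hz)).elim, Finset.sum_empty]
    · have h3 : ∀ P Q : CompactMatrices B, (∀ z, coeff Q z j = 0) → coeff (P * Q) i j = 0 :=
        fun P Q hQ => by
          have : coeff (star Q * star P) j i = 0 := by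
            rw [coeff_mul_eq_sum _ _ _ _ ∅ fun z hz => (hz (by
              rw [coeff_star, hQ, star_zero])).elim, Finset.sum_empty]
          rw [← star_mul, coeff_star] at this
          exact star_eq_zero.1 this
      exact h3 _ _ fun z => by rw [coeff_compress, pushKernel_of_notMem e _ (.inr hj)]

end Compress

end

/-! ### The counit -/

noncomputable section

section Counit

variable {𝒳 : Type*} [MetricSpace 𝒳] {𝒳₀ : Set 𝒳} {sc : ℝ≥0 → 𝒳 → 𝒳} {Δ : ℝ} {X : Set 𝒳}
  {D : Type*} [NonUnitalCStarAlgebra D]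

theorem relC0.isCompact_le_norm (f : relC0 D 𝒳₀) {δ : ℝ} (hδ : 0 < δ) :
    IsCompact {z | δ ≤ ‖f.1 z‖} := by
  have h := (tendsto_zero_iff_norm_tendsto_zero.1 f.1.zero_at_infty').eventually (gt_mem_nhds hδ)
  obtain ⟨t, ht, hts⟩ := mem_cocompact.1 h
  refine ht.of_isClosed_subset (isClosed_le continuous_const f.1.continuous.norm) fun z hz => ?_
  by_contra hzt
  exact (not_lt.2 (show δ ≤ ‖f.1 z‖ from hz)) (hts hzt)

theorem IsScaling.finite_large (hsc : IsScaling 𝒳₀ sc) (hX : BoundedGeometry X) (f : relC0 D 𝒳₀)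
    {δ : ℝ} (hδ : 0 < δ) (T : ℝ≥0) : {x : X | ∃ t ≤ T, δ ≤ ‖f.1 (sc t x)‖}.Finite := by
  refine (hX.finite_of_isBounded (hsc.bounded _ T (relC0.isCompact_le_norm f hδ).isBounded)).subset ?_
  rintro x ⟨t, ht, hx⟩
  exact Set.mem_biUnion (Set.mem_Iic.2 ht) hx

theorem IsScaling.tendsto_cofinite (hsc : IsScaling 𝒳₀ sc) (hX : BoundedGeometry X)
    (f : relC0 D 𝒳₀) (t : ℝ≥0) : Tendsto (fun x : X => f.1 (sc t x)) cofinite (𝓝 0) := by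
  refine tendsto_zero_iff_norm_tendsto_zero.2 (Metric.tendsto_nhds.2 fun δ hδ => ?_)
  refine Filter.eventually_cofinite.2 ((hsc.finite_large hX f hδ t).subset fun x hx => ?_)
  refine ⟨t, le_rfl, ?_⟩
  simpa [Real.dist_eq] using hx

theorem IsScaling.continuous_right (hsc : IsScaling 𝒳₀ sc) (z : 𝒳) : Continuous fun t => sc t z :=
  hsc.continuous.comp (continuous_const.prodMk continuous_id)

theorem IsScaling.eventually_norm_sub_le (hsc : IsScaling 𝒳₀ sc) (hX : BoundedGeometry X)
    (f : relC0 D 𝒳₀) (t₀ : ℝ≥0) {δ : ℝ} (hδ : 0 < δ) :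
    ∀ᶠ t in 𝓝 t₀, ∀ x : X, ‖f.1 (sc t x) - f.1 (sc t₀ x)‖ ≤ δ := by
  have hfin := hsc.finite_large hX f (half_pos hδ) (t₀ + 1)
  have h1 : ∀ᶠ t in 𝓝 t₀, ∀ x ∈ {x : X | ∃ t ≤ t₀ + 1, δ / 2 ≤ ‖f.1 (sc t x)‖},
      ‖f.1 (sc t x) - f.1 (sc t₀ x)‖ ≤ δ := by
    refine (Filter.eventually_all_finite hfin).2 fun x _ => ?_
    have hc : Continuous fun t => f.1 (sc t x) := f.1.continuous.comp (hsc.continuous_right _)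
    filter_upwards [Metric.continuousAt_iff'.1 hc.continuousAt δ hδ] with t ht
    rw [← dist_eq_norm]
    exact ht.le
  have h2 : ∀ᶠ t in 𝓝 t₀, t ≤ t₀ + 1 := (gt_mem_nhds (lt_add_one t₀)).mono fun _ h => h.le
  filter_upwards [h1, h2] with t ht ht2 x
  by_cases hx : ∃ t ≤ t₀ + 1, δ / 2 ≤ ‖f.1 (sc t x)‖
  · exact ht x hx
  · push Not at hx
    refine (norm_sub_le _ _).trans ?_
    have h3 := hx t ht2
    have h4 := hx t₀ (le_add_of_nonneg_right zero_le_one)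
    linarith

theorem IsScaling.eventually_norm_sub_le_of_dist_le (hsc : IsScaling 𝒳₀ sc) {E : Type*}
    [NormedAddCommGroup E] {f : 𝒳 → E} (hf : UniformContinuous f) (R : ℝ) {δ : ℝ} (hδ : 0 < δ) :
    ∀ᶠ t in atTop, ∀ z w : 𝒳, dist z w ≤ R → ‖f (sc t z) - f (sc t w)‖ ≤ δ := by
  obtain ⟨r, hr, hfr⟩ := Metric.uniformContinuous_iff.1 hf δ hδ
  obtain ⟨ρ, h1, h2, h3⟩ := hsc.contracting
  have h4 := (h3 R.toNNReal).2.eventually (gt_mem_nhds (Real.toNNReal_pos.2 hr))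
  filter_upwards [h4] with t ht z w hzw
  rw [← dist_eq_norm]
  refine (hfr ?_).le
  have h5 : nndist z w ≤ R.toNNReal := by
    rw [← NNReal.coe_le_coe, coe_nndist]
    exact hzw.trans (Real.le_coe_toNNReal R)
  have h6 := ((h1 t z w).trans (h2 t h5)).trans_lt ht
  rw [← NNReal.coe_lt_coe, coe_nndist, Real.coe_toNNReal _ hr.le] at h6
  exact h6

theorem relC0.uniformContinuous (f : relC0 D 𝒳₀) : UniformContinuous f.1 :=
  ZeroAtInftyContinuousMap.uniformContinuous f.1

variable {e : X → ℕ} {A : Type*} [NonUnitalCStarAlgebra A]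

/-- The function `t ↦ diag (f (sc_t x)) · m`. -/
def counitFun (hsc : IsScaling 𝒳₀ sc) (hX : BoundedGeometry X) (he : Function.Injective e)
    (f : relC0 ℂ 𝒳₀) (m : UniformRoe hX A) : ℝ≥0 →ᵇ CompactMatrices A :=
  BoundedContinuousFunction.ofNormedAddCommGroup
    (fun t => compress he (fun x : X => f.1 (sc t x)) (hsc.tendsto_cofinite hX f t) m)
    (continuous_iff_continuousAt.2 fun t₀ => by
      refine Metric.continuousAt_iff'.2 fun δ hδ => ?_
      have hδ' : 0 < δ / (‖m‖ + 1) := by positivity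
      filter_upwards [hsc.eventually_norm_sub_le hX f t₀ hδ'] with t ht
      rw [dist_eq_norm]
      refine (norm_compress_sub_compress_le he _ _ m hδ'.le ht).trans_lt ?_
      rw [div_mul_eq_mul_div, div_lt_iff₀ (by positivity)]
      nlinarith [norm_nonneg m])
    (‖f‖ * ‖m‖)
    fun t => norm_compress_le he _ m (norm_nonneg f) fun x => relC0.norm_apply_le f _

theorem counitFun_apply (hsc : IsScaling 𝒳₀ sc) (hX : BoundedGeometry X)
    (he : Function.Injective e) (f : relC0 ℂ 𝒳₀) (m : UniformRoe hX A) (t : ℝ≥0) :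
    counitFun hsc hX he f m t =
      compress he (fun x : X => f.1 (sc t x)) (hsc.tendsto_cofinite hX f t) m := rfl

theorem norm_counitFun_le (hsc : IsScaling 𝒳₀ sc) (hX : BoundedGeometry X)
    (he : Function.Injective e) (f : relC0 ℂ 𝒳₀) (m : UniformRoe hX A) :
    ‖counitFun hsc hX he f m‖ ≤ ‖f‖ * ‖m‖ :=
  BoundedContinuousFunction.norm_ofNormedAddCommGroup_le _ (by positivity) _

theorem counitFun_add (hsc : IsScaling 𝒳₀ sc) (hX : BoundedGeometry X)
    (he : Function.Injective e) (f : relC0 ℂ 𝒳₀) (m n : UniformRoe hX A) :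
    counitFun hsc hX he f (m + n) = counitFun hsc hX he f m + counitFun hsc hX he f n :=
  BoundedContinuousFunction.ext fun t => compress_add he _ (hsc.tendsto_cofinite hX f t) m n

theorem counitFun_sub (hsc : IsScaling 𝒳₀ sc) (hX : BoundedGeometry X)
    (he : Function.Injective e) (f : relC0 ℂ 𝒳₀) (m n : UniformRoe hX A) :
    counitFun hsc hX he f (m - n) = counitFun hsc hX he f m - counitFun hsc hX he f n :=
  BoundedContinuousFunction.ext fun t => compress_sub he _ (hsc.tendsto_cofinite hX f t) m n

theorem counitFun_smul (hsc : IsScaling 𝒳₀ sc) (hX : BoundedGeometry X)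
    (he : Function.Injective e) (f : relC0 ℂ 𝒳₀) (c : ℂ) (m : UniformRoe hX A) :
    counitFun hsc hX he f (c • m) = c • counitFun hsc hX he f m :=
  BoundedContinuousFunction.ext fun t => compress_smul he _ (hsc.tendsto_cofinite hX f t) c m

theorem counitFun_add_left (hsc : IsScaling 𝒳₀ sc) (hX : BoundedGeometry X)
    (he : Function.Injective e) (f g : relC0 ℂ 𝒳₀) (m : UniformRoe hX A) :
    counitFun hsc hX he (f + g) m = counitFun hsc hX he f m + counitFun hsc hX he g m :=
  BoundedContinuousFunction.ext fun t => (eq_compress he (hsc.tendsto_cofinite hX _ t) fun i j => by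
    rw [BoundedContinuousFunction.add_apply, counitFun_apply, counitFun_apply,
      MatrixAlgebra.coeff_add, coeff_compress, coeff_compress]
    exact (pushKernel_congr₂ he (· + ·) (add_zero 0) (fun x y => add_smul _ _ _) i j).symm).symm

theorem counitFun_smul_left (hsc : IsScaling 𝒳₀ sc) (hX : BoundedGeometry X)
    (he : Function.Injective e) (c : ℂ) (f : relC0 ℂ 𝒳₀) (m : UniformRoe hX A) :
    counitFun hsc hX he (c • f) m = c • counitFun hsc hX he f m :=
  BoundedContinuousFunction.ext fun t => (eq_compress he (hsc.tendsto_cofinite hX _ t) fun i j => by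
    rw [BoundedContinuousFunction.smul_apply, counitFun_apply, MatrixAlgebra.coeff_smul,
      coeff_compress]
    exact (pushKernel_map he (c • ·) (smul_zero c) (fun x y => smul_assoc _ _ _) i j).symm).symm

theorem continuous_counitFun (hsc : IsScaling 𝒳₀ sc) (hX : BoundedGeometry X)
    (he : Function.Injective e) (f : relC0 ℂ 𝒳₀) :
    Continuous fun m : UniformRoe hX A => counitFun hsc hX he f m :=
  (LinearMap.mkContinuous
    ({ toFun := counitFun hsc hX he f
       map_add' := counitFun_add hsc hX he f
       map_smul' := counitFun_smul hsc hX he f } :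
      UniformRoe hX A →ₗ[ℂ] (ℝ≥0 →ᵇ CompactMatrices A)) ‖f‖
    (norm_counitFun_le hsc hX he f)).continuous

theorem counitFun_mem_vanishingIdeal (hsc : IsScaling 𝒳₀ sc) (hX : BoundedGeometry X)
    (he : Function.Injective e) (f : relC0 ℂ 𝒳₀) {m : UniformRoe hX A}
    (hm : m ∈ (relativeIdeal hX (discretePart Δ 𝒳₀ X) A).toSubmodule) :
    counitFun hsc hX he f m ∈ (vanishingIdeal (CompactMatrices A)).toSubmodule := by
  refine closure_minimal (t := {m | counitFun hsc hX he f m ∈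
    (vanishingIdeal (CompactMatrices A)).toSubmodule}) ?_
    ((vanishingIdeal (CompactMatrices A)).isClosed'.preimage (continuous_counitFun hsc hX he f)) hm
  rintro m ⟨R, hR⟩
  change Tendsto (counitFun hsc hX he f m) atTop (𝓝 0)
  refine Metric.tendsto_nhds.2 fun δ hδ => ?_
  have hδ' : 0 < δ / (‖m‖ + 1) := by positivity
  filter_upwards [hsc.eventually_norm_sub_le_of_dist_le (relC0.uniformContinuous f) (R + Δ) hδ'] with t ht
  rw [dist_zero_right, counitFun_apply]
  refine lt_of_le_of_lt (b := δ / (‖m‖ + 1) * ‖m‖) ?_ (by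
    rw [div_mul_eq_mul_div, div_lt_iff₀ (by positivity)]
    nlinarith [norm_nonneg m])
  classical
  let g : X → ℂ := fun x => if x ∈ nbhdOf (discretePart Δ 𝒳₀ X) R then f.1 (sc t x) else 0
  have hg : ∀ x, ‖g x‖ ≤ δ / (‖m‖ + 1) := fun x => by
    simp only [g]
    split_ifs with hx
    · obtain ⟨y, ⟨z, hz, hyz⟩, hxy⟩ := hx
      have h1 := ht x z (by
        have h2 := dist_triangle (x : 𝒳) y z
        have h3 : dist (x : 𝒳) y < R := hxy
        linarith)
      rwa [f.2 _ (hsc.mapsTo t hz), sub_zero] at h1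
    · rw [norm_zero]; exact hδ'.le
  refine MatrixAlgebra.norm_le_of_pushKernel he (k := fun x y => g x • MatrixAlgebra.coeff m x y)
    (fun i j => ?_) fun F => (matNorm_cornerFn_smul_le _ hδ'.le hg _ F).trans
      (mul_le_mul_of_nonneg_left (MatrixAlgebra.matNorm_cornerFn_coeff_le m F) hδ'.le)
  rw [coeff_compress]
  refine congrArg (fun k => pushKernel e k i j) (funext fun x => funext fun y => ?_)
  by_cases h0 : MatrixAlgebra.coeff m x y = 0
  · rw [h0, smul_zero, smul_zero]
  · simp only [g, if_pos (hR x y h0).1]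

theorem counitFun_mul_mem (hsc : IsScaling 𝒳₀ sc) (hX : BoundedGeometry X)
    (he : Function.Injective e) (f g : relC0 ℂ 𝒳₀) (m n : UniformRoe hX A) :
    counitFun hsc hX he f m * counitFun hsc hX he g n - counitFun hsc hX he (f * g) (m * n) ∈
      (vanishingIdeal (CompactMatrices A)).toSubmodule := by
  refine CStarCompletion.ind m ((vanishingIdeal (CompactMatrices A)).isClosed'.preimage
    (((continuous_counitFun hsc hX he f).mul continuous_const).sub
      ((continuous_counitFun hsc hX he (f * g)).comp (continuous_id.mul continuous_const))))
    fun M => ?_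
  obtain ⟨K, hK0, hK⟩ := exists_commutator_bound M
  obtain ⟨R, hR⟩ := M.controlled
  change Tendsto (fun t => counitFun hsc hX he f (CStarCompletion.mk M) t *
    counitFun hsc hX he g n t - counitFun hsc hX he (f * g) (CStarCompletion.mk M * n) t) atTop (𝓝 0)
  refine Metric.tendsto_nhds.2 fun δ hδ => ?_
  have hδ' : 0 < δ / (‖f‖ * (K * ‖n‖) + 1) := by positivity
  filter_upwards [hsc.eventually_norm_sub_le_of_dist_le (relC0.uniformContinuous g) R hδ'] with t ht
  rw [dist_zero_right, counitFun_apply, counitFun_apply, counitFun_apply,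
    compress_mul_compress he (g := fun x : X => f.1 (sc t x)) (h := fun x : X => g.1 (sc t x))
      (k := fun x : X => (f * g).1 (sc t x)) (hsc.tendsto_cofinite hX f t)
      (hsc.tendsto_cofinite hX g t) (hsc.tendsto_cofinite hX (f * g) t) (fun x => rfl)
      (fun x => relC0.norm_apply_le g _)]
  have h1 : ‖(CStarCompletion.mk (diagCommutator M (fun x : X => g.1 (sc t x))
      fun x => relC0.norm_apply_le g _) : UniformRoe hX A)‖ ≤ K * (δ / (‖f‖ * (K * ‖n‖) + 1)) := by
    refine norm_diagCommutator_le M _ _ (hK _ _ hδ'.le fun x y hxy => ht y x ?_)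
    rw [dist_comm]
    exact hR (x, y) hxy
  refine (norm_compress_le he _ _ (norm_nonneg f) fun x => relC0.norm_apply_le f _).trans_lt ?_
  calc _ ≤ ‖f‖ * (K * (δ / (‖f‖ * (K * ‖n‖) + 1)) * ‖n‖) :=
        mul_le_mul_of_nonneg_left ((norm_mul_le _ _).trans
          (mul_le_mul_of_nonneg_right h1 (norm_nonneg n))) (norm_nonneg f)
    _ = δ / (‖f‖ * (K * ‖n‖) + 1) * (‖f‖ * (K * ‖n‖)) := by ring
    _ < δ := by
      rw [div_mul_eq_mul_div, div_lt_iff₀ (by positivity)]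
      have : 0 ≤ ‖f‖ * (K * ‖n‖) := by positivity
      nlinarith

theorem star_counitFun_sub_mem (hsc : IsScaling 𝒳₀ sc) (hX : BoundedGeometry X)
    (he : Function.Injective e) (f : relC0 ℂ 𝒳₀) (m : UniformRoe hX A) :
    star (counitFun hsc hX he f m) - counitFun hsc hX he (star f) (star m) ∈
      (vanishingIdeal (CompactMatrices A)).toSubmodule := by
  refine CStarCompletion.ind m ((vanishingIdeal (CompactMatrices A)).isClosed'.preimage
    (((continuous_counitFun hsc hX he f).star).sub
      ((continuous_counitFun hsc hX he (star f)).comp continuous_star))) fun M => ?_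
  obtain ⟨K, hK0, hK⟩ := exists_commutator_bound (star M)
  obtain ⟨R, hR⟩ := (star M).controlled
  change Tendsto (fun t => star (counitFun hsc hX he f (CStarCompletion.mk M) t) -
    counitFun hsc hX he (star f) (star (CStarCompletion.mk M)) t) atTop (𝓝 0)
  refine Metric.tendsto_nhds.2 fun δ hδ => ?_
  have hδ' : 0 < δ / (K + 1) := by positivity
  filter_upwards [hsc.eventually_norm_sub_le_of_dist_le (relC0.uniformContinuous (star f)) R hδ'] with t ht
  rw [dist_zero_right, counitFun_apply, counitFun_apply]
  refine lt_of_le_of_lt (b := K * (δ / (K + 1))) ?_ (by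
    rw [mul_div_assoc', div_lt_iff₀ (by positivity)]
    nlinarith)
  refine MatrixAlgebra.norm_le_of_pushKernel he
    (k := fun x y => ((star f).1 (sc t y) - (star f).1 (sc t x)) • (star M).entry x y)
    (fun i j => ?_) (hK _ _ hδ'.le fun x y hxy => ht y x (by
      rw [dist_comm]
      exact hR (x, y) hxy))
  rw [MatrixAlgebra.coeff_sub, MatrixAlgebra.coeff_star, coeff_compress, coeff_compress]
  refine eq_pushKernel he (l := fun i j => star (pushKernel e (fun x y : X => f.1 (sc t x) •
      MatrixAlgebra.coeff (CStarCompletion.mk M) x y) j i) - pushKernel e (fun x y : X =>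
      (star f).1 (sc t x) • MatrixAlgebra.coeff (star (CStarCompletion.mk M)) x y) i j)
    (fun x y => ?_) (fun i j hij => ?_) i j
  · rw [pushKernel_apply he, pushKernel_apply he, ← CStarCompletion.mk_star, MatrixAlgebra.coeff_mk,
      MatrixAlgebra.coeff_mk, star_smul, ControlledMatrix.entry_star, sub_smul]
    rfl
  · rw [pushKernel_of_notMem e _ hij, pushKernel_of_notMem e _ hij.symm, star_zero, sub_zero]

theorem asClass_counitFun_congr (hsc : IsScaling 𝒳₀ sc) (hX : BoundedGeometry X)
    (he : Function.Injective e) (f : relC0 ℂ 𝒳₀) {m n : UniformRoe hX A}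
    (h : qmat hX (discretePart Δ 𝒳₀ X) m = qmat hX (discretePart Δ 𝒳₀ X) n) :
    asClass (counitFun hsc hX he f m) = asClass (counitFun hsc hX he f n) := by
  refine CStarIdeal.proj_eq_iff.2 ?_
  rw [← counitFun_sub]
  exact counitFun_mem_vanishingIdeal hsc hX he f (CStarIdeal.proj_eq_iff.1 h)

variable (Δ A) in
/-- The bilinear map `(f, qmat m) ↦ as_t (diag (f (sc_t x)) · m)`. -/
def counitBilin (hsc : IsScaling 𝒳₀ sc) (hX : BoundedGeometry X) (he : Function.Injective e) :
    relC0 ℂ 𝒳₀ →ₗ[ℂ] RelativeRoe hX (discretePart Δ 𝒳₀ X) A →ₗ[ℂ]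
      AsymptoticAlgebra (CompactMatrices A) :=
  have hs : ∀ q : RelativeRoe hX (discretePart Δ 𝒳₀ X) A, qmat hX (discretePart Δ 𝒳₀ X)
      (Function.surjInv CStarIdeal.proj_surjective q) = q :=
    Function.surjInv_eq CStarIdeal.proj_surjective
  LinearMap.mk₂ ℂ
    (fun f q => asClass (counitFun hsc hX he f (Function.surjInv CStarIdeal.proj_surjective q)))
    (fun f g _ => congrArg asClass (counitFun_add_left hsc hX he f g _))
    (fun c f _ => congrArg asClass (counitFun_smul_left hsc hX he c f _))
    (fun f q q' => (asClass_counitFun_congr (Δ := Δ) hsc hX he f ((hs _).trans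
      (congrArg₂ (· + ·) (hs q) (hs q')).symm)).trans
        (congrArg asClass (counitFun_add hsc hX he f _ _)))
    (fun c f q => (asClass_counitFun_congr (Δ := Δ) hsc hX he f ((hs _).trans
      (congrArg (c • ·) (hs q)).symm)).trans (congrArg asClass (counitFun_smul hsc hX he f c _)))

theorem counitBilin_qmat (hsc : IsScaling 𝒳₀ sc) (hX : BoundedGeometry X)
    (he : Function.Injective e) (f : relC0 ℂ 𝒳₀) (m : UniformRoe hX A) :
    counitBilin Δ A hsc hX he f (qmat hX (discretePart Δ 𝒳₀ X) m) =
      asClass (counitFun hsc hX he f m) :=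
  asClass_counitFun_congr (Δ := Δ) hsc hX he f
    (Function.surjInv_eq CStarIdeal.proj_surjective _)

variable (Δ A) in
/-- The counit on the tensor product. -/
def counitTensor (hsc : IsScaling 𝒳₀ sc) (hX : BoundedGeometry X) (he : Function.Injective e) :
    MaxTensor (relC0 ℂ 𝒳₀) (RelativeRoe hX (discretePart Δ 𝒳₀ X) A) →⋆ₙₐ[ℂ]
      AsymptoticAlgebra (CompactMatrices A) :=
  MaxTensor.lift (counitBilin Δ A hsc hX he)
    (fun f q g q' => by
      obtain ⟨m, rfl⟩ := CStarIdeal.proj_surjective q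
      obtain ⟨n, rfl⟩ := CStarIdeal.proj_surjective q'
      refine (congrArg₂ (· * ·) (counitBilin_qmat hsc hX he f m)
        (counitBilin_qmat hsc hX he g n)).trans
        (Eq.trans ?_ (counitBilin_qmat hsc hX he (f * g) (m * n)).symm)
      exact CStarIdeal.proj_eq_iff.2 (counitFun_mul_mem hsc hX he f g m n))
    (fun f q => by
      obtain ⟨m, rfl⟩ := CStarIdeal.proj_surjective q
      refine (congrArg star (counitBilin_qmat hsc hX he f m)).trans
        (Eq.trans ?_ (counitBilin_qmat hsc hX he (star f) (star m)).symm)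
      exact CStarIdeal.proj_eq_iff.2 (star_counitFun_sub_mem hsc hX he f m))
    (fun f q => by
      refine le_of_forall_pos_le_add fun δ hδ => ?_
      have hδ' : 0 < δ / (‖f‖ + 1) := by positivity
      obtain ⟨m, rfl, hm⟩ := CStarIdeal.exists_norm_lt q hδ'
      refine (le_of_eq (congrArg norm (counitBilin_qmat hsc hX he f m))).trans ?_
      refine (CStarIdeal.norm_proj_le _).trans ((norm_counitFun_le hsc hX he f m).trans ?_)
      have h1 : ‖f‖ * (δ / (‖f‖ + 1)) ≤ δ := by
        rw [mul_div_assoc', div_le_iff₀ (by positivity)]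
        nlinarith [norm_nonneg f]
      have h2 := mul_le_mul_of_nonneg_left hm.le (norm_nonneg f)
      linarith)

variable (Δ A) in
/-- The counit of the asymptotic adjunction. -/
def counitHom (hsc : IsScaling 𝒳₀ sc) (hX : BoundedGeometry X) (he : Function.Injective e) :
    relC0 (RelativeRoe hX (discretePart Δ 𝒳₀ X) A) 𝒳₀ →⋆ₙₐ[ℂ]
      AsymptoticAlgebra (CompactMatrices A) :=
  (counitTensor Δ A hsc hX he).comp (relC0ToTensor 𝒳₀ _)

theorem counitHom_tensor (hsc : IsScaling 𝒳₀ sc) (hX : BoundedGeometry X)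
    (he : Function.Injective e) (f : relC0 ℂ 𝒳₀) (m : UniformRoe hX A) :
    counitHom Δ A hsc hX he (relC0Tensor 𝒳₀ f (qmat hX (discretePart Δ 𝒳₀ X) m)) =
      asClass (counitFun hsc hX he f m) := by
  refine (congrArg (counitTensor Δ A hsc hX he) (relC0ToTensor_tensor f _)).trans ?_
  exact (MaxTensor.lift_tmul _ _ _ _ _ _).trans (counitBilin_qmat hsc hX he f m)

end Counit

section CounitTransformation

theorem isLabeled_of_span {F G : CStarEndo.{u}} {gF : GoodStructure F} {gG : GoodStructure G}
    {γ : F ⟶ G} (s : ∀ B : CStar.{u}, Set (F.obj B))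
    (hs : ∀ B, closure (Submodule.span ℂ (s B) : Set (F.obj B)) = Set.univ)
    (h : ∀ (A B : CStar.{u}) (a : A), ∀ x ∈ s B, gG.label A B (MaxTensor.tmul a (γ.app B x)) =
        γ.app (tensorObj A B) (gF.label A B (MaxTensor.tmul a x))) : IsLabeled gF gG γ :=
  fun A B => MaxTensor.ext_hom_of_span (A := A) (B := F.obj B) (hs B) fun a x hx => by
    refine Eq.trans ?_ (h A B a x hx)
    exact congrArg (gG.label A B) (MaxTensor.map_tmul (NonUnitalStarAlgHom.id ℂ A) (γ.app B) a x)

variable {𝒳 : Type u} [MetricSpace 𝒳] {𝒳₀ : Set 𝒳} {sc : ℝ≥0 → 𝒳 → 𝒳} {Δ : ℝ} {X : Set 𝒳}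
  {e : X → ℕ}

theorem relC0Map_relC0Tensor {B C : Type*} [NonUnitalCStarAlgebra B] [NonUnitalCStarAlgebra C]
    (φ : B →⋆ₙₐ[ℂ] C) (f : relC0 ℂ 𝒳₀) (b : B) :
    relC0Map 𝒳₀ φ (relC0Tensor 𝒳₀ f b) = relC0Tensor 𝒳₀ f (φ b) :=
  relC0.ext fun _ => map_smul φ _ b

variable (Δ) in
/-- The counit as a natural transformation. -/
def counitTransformation (hsc : IsScaling 𝒳₀ sc) (hX : BoundedGeometry X)
    (he : Function.Injective e) :
    relRoeFunctor hX (discretePart Δ 𝒳₀ X) ⋙ relC0Functor 𝒳₀ ⟶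
      compactFunctor.{u} ⋙ asymptoticFunctor where
  app A := counitHom Δ A hsc hX he
  naturality A B φ := relC0_hom_ext (𝒳₀ := 𝒳₀) (D := RelativeRoe hX (discretePart Δ 𝒳₀ X) A)
    fun f q => by
      obtain ⟨m, rfl⟩ := CStarIdeal.proj_surjective q
      let φ' : A →⋆ₙₐ[ℂ] B := φ
      change counitHom Δ B hsc hX he (relC0Map 𝒳₀ (RelativeRoe.map hX (discretePart Δ 𝒳₀ X) φ')
          (relC0Tensor 𝒳₀ f (qmat hX (discretePart Δ 𝒳₀ X) m))) =
        asymptoticMap (MatrixAlgebra.map φ') (counitHom Δ A hsc hX he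
          (relC0Tensor 𝒳₀ f (qmat hX (discretePart Δ 𝒳₀ X) m)))
      rw [relC0Map_relC0Tensor, relRoe_map_qmat, counitHom_tensor, counitHom_tensor]
      refine congrArg asClass (BoundedContinuousFunction.ext fun t => ?_)
      exact (map_compress φ' he _ (hsc.tendsto_cofinite hX f t) m).symm

theorem isRoeCounit_counitTransformation (hsc : IsScaling 𝒳₀ sc) (hX : BoundedGeometry X)
    (he : Function.Injective e) :
    IsRoeCounit 𝒳₀ sc Δ X hX e (counitTransformation Δ hsc hX he) := fun A f m =>
  ⟨counitFun hsc hX he f m, fun t x y => by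
      rw [counitFun_apply, coeff_compress, pushKernel_apply he], fun t i j hij => by
      rw [counitFun_apply, coeff_compress, pushKernel_of_notMem e _ hij],
    counitHom_tensor hsc hX he f m⟩

theorem isLabeled_counitTransformation (hsc : IsScaling 𝒳₀ sc) (hX : BoundedGeometry X)
    (he : Function.Injective e) :
    IsLabeled ((relRoeGood hX (discretePart Δ 𝒳₀ X)).comp (relC0Good 𝒳₀))
      (compactGood.comp asymptoticGood) (counitTransformation Δ hsc hX he) := by
  refine isLabeled_of_span (fun B => {F : relC0 (RelativeRoe hX (discretePart Δ 𝒳₀ X) B) 𝒳₀ |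
    ∃ f d, F = relC0Tensor 𝒳₀ f d}) (fun B => closure_span_relC0Tensor) ?_
  rintro A B a _ ⟨f, q, rfl⟩
  obtain ⟨m, rfl⟩ := CStarIdeal.proj_surjective q
  rw [comp_label, comp_label]
  refine (congrArg _ (congrArg (fun y => asymptoticGood.label A (compactFunctor.obj B)
    (MaxTensor.tmul a y)) (counitHom_tensor hsc hX he f m))).trans ?_
  refine (congrArg _ (asymptoticGood_label (B := compactFunctor.obj B) a
    (counitFun hsc hX he f m))).trans ?_
  have hR : (relC0Functor 𝒳₀).map ((relRoeGood hX (discretePart Δ 𝒳₀ X)).label A B :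
      tensorObj A ((relRoeFunctor hX (discretePart Δ 𝒳₀ X)).obj B) ⟶ _)
      ((relC0Good 𝒳₀).label A ((relRoeFunctor hX (discretePart Δ 𝒳₀ X)).obj B)
        (MaxTensor.tmul a (relC0Tensor 𝒳₀ f (qmat hX (discretePart Δ 𝒳₀ X) m)))) =
      relC0Tensor 𝒳₀ f (qmat hX (discretePart Δ 𝒳₀ X) (MatrixAlgebra.lab a m)) := by
    refine (congrArg _ (relC0Good_label (B := (relRoeFunctor hX (discretePart Δ 𝒳₀ X)).obj B) 𝒳₀ a
      (relC0Tensor 𝒳₀ f (qmat hX (discretePart Δ 𝒳₀ X) m)))).trans (relC0.ext fun z => ?_)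
    refine (congrArg ((relRoeGood hX (discretePart Δ 𝒳₀ X)).label A B)
      (MaxTensor.tmul_smul a (f.1 z) (qmat hX (discretePart Δ 𝒳₀ X) m))).trans ?_
    refine (map_smul ((relRoeGood hX (discretePart Δ 𝒳₀ X)).label A B) (f.1 z) _).trans ?_
    exact congrArg (f.1 z • ·) (relRoeGood_label hX (discretePart Δ 𝒳₀ X) a m)
  refine Eq.trans ?_ (congrArg (counitHom Δ (MaxTensor A B) hsc hX he) hR).symm
  rw [counitHom_tensor]
  refine congrArg asClass (BoundedContinuousFunction.ext fun t => ?_)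
  refine (compactGood_label a _).trans ?_
  exact lab_compress a he _ (hsc.tendsto_cofinite hX f t) m

end CounitTransformation

end

/-! ### A path of isometries -/

noncomputable section

section RotationPath

/-- The auxiliary vectors `g₀ = e₀`, `gₙ₊₁ = c eₙ₊₁ - s gₙ`. -/
def rotAux (c s : ℝ) : ℕ → ℕ → ℝ
  | 0, k => if k = 0 then 1 else 0
  | n + 1, k => (if k = n + 1 then c else 0) - s * rotAux c s n k

/-- The columns `s eₙ₊₁ + c gₙ` of an isometry which interpolates between the identity (`c = 1`,
`s = 0`) and the shift (`c = 0`, `s = 1`). -/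
def rotIsom (c s : ℝ) (k n : ℕ) : ℝ := (if k = n + 1 then s else 0) + c * rotAux c s n k

theorem rotAux_eq_zero (c s : ℝ) : ∀ {n k : ℕ}, n < k → rotAux c s n k = 0
  | 0, k, h => if_neg h.ne'
  | n + 1, k, h => by
    rw [rotAux, if_neg h.ne', rotAux_eq_zero c s (n.lt_succ_self.trans h), mul_zero, sub_zero]

theorem rotIsom_eq_zero (c s : ℝ) {n k : ℕ} (h : n + 1 < k) : rotIsom c s k n = 0 := by
  rw [rotIsom, if_neg h.ne', rotAux_eq_zero c s (n.lt_succ_self.trans h), mul_zero, add_zero]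

theorem sum_ite_mul {K n : ℕ} (h : n < K) (a : ℝ) (v : ℕ → ℝ) :
    ∑ k ∈ Finset.range K, (if k = n then a else 0) * v k = a * v n := by
  simp [ite_mul, Finset.sum_ite_eq', h]

theorem sum_rotAux_sq {c s : ℝ} (hcs : c ^ 2 + s ^ 2 = 1) : ∀ {n K : ℕ}, n < K →
    ∑ k ∈ Finset.range K, rotAux c s n k * rotAux c s n k = 1
  | 0, K, h => by
    simp only [rotAux]
    rw [sum_ite_mul h, if_pos rfl, one_mul]
  | n + 1, K, h => by
    have ih := sum_rotAux_sq hcs (n.lt_succ_self.trans h)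
    have e : ∀ k, rotAux c s (n + 1) k * rotAux c s (n + 1) k =
        (if k = n + 1 then c else 0) * ((if k = n + 1 then c else 0) - 2 * s * rotAux c s n k) +
          s ^ 2 * (rotAux c s n k * rotAux c s n k) := fun k => by rw [rotAux]; ring
    simp only [e]
    rw [Finset.sum_add_distrib, ← Finset.mul_sum, ih, sum_ite_mul h,
      rotAux_eq_zero c s n.lt_succ_self, if_pos rfl]
    linarith

theorem sum_rotIsom_mul_rotAux {c s : ℝ} (hcs : c ^ 2 + s ^ 2 = 1) (n : ℕ) : ∀ {m K : ℕ}, n < m →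
    m < K → ∑ k ∈ Finset.range K, rotIsom c s k n * rotAux c s m k = 0
  | 0, _, h, _ => (Nat.not_lt_zero _ h).elim
  | m + 1, K, h, hK => by
    have e : ∀ k, rotIsom c s k n * rotAux c s (m + 1) k =
        (if k = m + 1 then c else 0) * rotIsom c s k n -
          s * (rotIsom c s k n * rotAux c s m k) := fun k => by rw [rotAux]; ring
    simp only [e]
    rw [Finset.sum_sub_distrib, ← Finset.mul_sum, sum_ite_mul hK]
    rcases (Nat.lt_succ_iff.1 h).eq_or_lt with rfl | h'
    · have e2 : ∀ k, rotIsom c s k n * rotAux c s n k =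
          (if k = n + 1 then s else 0) * rotAux c s n k + c * (rotAux c s n k * rotAux c s n k) :=
        fun k => by rw [rotIsom]; ring
      simp only [e2]
      rw [Finset.sum_add_distrib, ← Finset.mul_sum, sum_ite_mul hK,
        sum_rotAux_sq hcs (n.lt_succ_self.trans hK), rotIsom, if_pos rfl,
        rotAux_eq_zero c s n.lt_succ_self]
      ring
    · rw [sum_rotIsom_mul_rotAux hcs n h' (m.lt_succ_self.trans hK),
        rotIsom_eq_zero c s (Nat.succ_lt_succ h')]
      ring

theorem sum_rotIsom_mul_rotIsom_of_lt {c s : ℝ} (hcs : c ^ 2 + s ^ 2 = 1) {n m K : ℕ} (h : n < m)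
    (hK : m + 1 < K) : ∑ k ∈ Finset.range K, rotIsom c s k n * rotIsom c s k m = 0 := by
  have e : ∀ k, rotIsom c s k n * rotIsom c s k m = (if k = m + 1 then s else 0) * rotIsom c s k n +
      c * (rotIsom c s k n * rotAux c s m k) := fun k => by
    rw [show rotIsom c s k m = (if k = m + 1 then s else 0) + c * rotAux c s m k from rfl]; ring
  simp only [e]
  rw [Finset.sum_add_distrib, ← Finset.mul_sum, sum_ite_mul hK,
    sum_rotIsom_mul_rotAux hcs n h (m.lt_succ_self.trans hK),
    rotIsom_eq_zero c s (Nat.succ_lt_succ h)]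
  ring

theorem sum_rotIsom_mul_rotIsom {c s : ℝ} (hcs : c ^ 2 + s ^ 2 = 1) {n m K : ℕ} (hn : n + 1 < K)
    (hm : m + 1 < K) : ∑ k ∈ Finset.range K, rotIsom c s k n * rotIsom c s k m =
      if n = m then 1 else 0 := by
  rcases lt_trichotomy n m with h | rfl | h
  · rw [if_neg h.ne, sum_rotIsom_mul_rotIsom_of_lt hcs h hm]
  · rw [if_pos rfl]
    have e : ∀ k, rotIsom c s k n * rotIsom c s k n = (if k = n + 1 then s else 0) *
        ((if k = n + 1 then s else 0) + 2 * c * rotAux c s n k) +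
        c ^ 2 * (rotAux c s n k * rotAux c s n k) := fun k => by rw [rotIsom]; ring
    simp only [e]
    rw [Finset.sum_add_distrib, ← Finset.mul_sum, sum_ite_mul hn, if_pos rfl,
      sum_rotAux_sq hcs (n.lt_succ_self.trans hn), rotAux_eq_zero c s n.lt_succ_self]
    linarith
  · rw [if_neg h.ne']
    simp only [mul_comm (rotIsom c s _ n)]
    exact sum_rotIsom_mul_rotIsom_of_lt hcs h hn

theorem rotAux_one_zero (n k : ℕ) : rotAux 1 0 n k = if k = n then 1 else 0 := by
  cases n with
  | zero => rfl
  | succ n => rw [rotAux, zero_mul, sub_zero]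

theorem rotIsom_one_zero (k n : ℕ) : rotIsom 1 0 k n = if k = n then 1 else 0 := by
  rw [rotIsom, rotAux_one_zero, ite_self, zero_add, one_mul]

theorem rotIsom_zero_one (n : ℕ) : rotIsom 0 1 0 n = 0 := by
  rw [rotIsom, if_neg n.succ_ne_zero.symm, zero_mul, zero_add]

theorem continuous_rotIsom {c s : unitInterval → ℝ} (hc : Continuous c) (hs : Continuous s)
    (k n : ℕ) : Continuous fun r => rotIsom (c r) (s r) k n := by
  have h : ∀ n, Continuous fun r => rotAux (c r) (s r) n k := fun n => by
    induction n with
    | zero => exact continuous_const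
    | succ n ih =>
      simp only [rotAux]
      refine Continuous.sub ?_ (hs.mul ih)
      split_ifs
      · exact hc
      · exact continuous_const
  simp only [rotIsom]
  refine Continuous.add ?_ (hc.mul (h n))
  split_ifs
  · exact hs
  · exact continuous_const

/-- The angle of the first half of the path. -/
def pathAngle (r : unitInterval) : ℝ := min (Real.pi * r) (Real.pi / 2)

/-- The angle of the second half of the path. -/
def pathAngle' (r : unitInterval) : ℝ := max 0 (Real.pi * r - Real.pi / 2)

/-- The coefficient of `e₀` along the path. -/
def pathD (r : unitInterval) : ℝ := Real.sin (pathAngle' r)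

/-- The matrix coefficients of the path, which connects the identity with `0`. -/
def pathU (r : unitInterval) (i n : ℕ) : ℝ :=
  Real.cos (pathAngle' r) * rotIsom (Real.cos (pathAngle r)) (Real.sin (pathAngle r)) i n

theorem continuous_pathD : Continuous pathD :=
  Real.continuous_sin.comp (by unfold pathAngle'; fun_prop)

theorem continuous_pathU (i n : ℕ) : Continuous fun r => pathU r i n := by
  have h : Continuous pathAngle := by unfold pathAngle; fun_prop
  have h' : Continuous pathAngle' := by unfold pathAngle'; fun_prop
  exact (Real.continuous_cos.comp h').mul
    (continuous_rotIsom (Real.continuous_cos.comp h) (Real.continuous_sin.comp h) i n)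

theorem pathU_eq_zero (r : unitInterval) {i n : ℕ} (h : n + 1 < i) : pathU r i n = 0 := by
  rw [pathU, rotIsom_eq_zero _ _ h, mul_zero]

theorem sum_pathU_mul_pathU (r : unitInterval) {n m K : ℕ} (hn : n + 1 < K) (hm : m + 1 < K) :
    ∑ i ∈ Finset.range K, pathU r i n * pathU r i m = if n = m then 1 - pathD r ^ 2 else 0 := by
  have e : ∀ i, pathU r i n * pathU r i m = Real.cos (pathAngle' r) ^ 2 *
      (rotIsom (Real.cos (pathAngle r)) (Real.sin (pathAngle r)) i n *
        rotIsom (Real.cos (pathAngle r)) (Real.sin (pathAngle r)) i m) := fun i => by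
    simp only [pathU]; ring
  simp only [e]
  rw [← Finset.mul_sum, sum_rotIsom_mul_rotIsom (Real.cos_sq_add_sin_sq _) hn hm, pathD,
    ← Real.cos_sq']
  split_ifs <;> ring

theorem pathD_mul_pathU_zero (r : unitInterval) (n : ℕ) : pathD r * pathU r 0 n = 0 := by
  rcases le_total (Real.pi * r) (Real.pi / 2) with h | h
  · have : pathAngle' r = 0 := max_eq_left (by linarith)
    rw [pathD, this, Real.sin_zero, zero_mul]
  · have : pathAngle r = Real.pi / 2 := min_eq_right h
    rw [pathU, this, Real.cos_pi_div_two, Real.sin_pi_div_two, rotIsom_zero_one, mul_zero, mul_zero]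

theorem pathD_zero : pathD 0 = 0 := by
  have : pathAngle' 0 = 0 := max_eq_left (by simp [Real.pi_div_two_pos.le])
  rw [pathD, this, Real.sin_zero]

theorem pathU_zero (i n : ℕ) : pathU 0 i n = if i = n then 1 else 0 := by
  have h : pathAngle' 0 = 0 := max_eq_left (by simp [Real.pi_div_two_pos.le])
  have h' : pathAngle 0 = 0 := by simp [pathAngle, Real.pi_div_two_pos.le]
  rw [pathU, h, h', Real.cos_zero, Real.sin_zero, rotIsom_one_zero, one_mul]

theorem pathAngle'_one : pathAngle' 1 = Real.pi / 2 := by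
  have : Real.pi * ((1 : unitInterval) : ℝ) - Real.pi / 2 = Real.pi / 2 := by simp; ring
  rw [pathAngle', this, max_eq_right (by linarith [Real.pi_pos])]

theorem pathD_one : pathD 1 = 1 := by rw [pathD, pathAngle'_one, Real.sin_pi_div_two]

theorem pathU_one (i n : ℕ) : pathU 1 i n = 0 := by
  rw [pathU, pathAngle'_one, Real.cos_pi_div_two, zero_mul]

end RotationPath

end

/-! ### Estimates for matrices with coefficients in function algebras -/

noncomputable section

section Estimates

variable {B : Type*} [NonUnitalCStarAlgebra B]

open MatrixAlgebra

/-- A rank one matrix given by a vector of norm at most one. -/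
theorem matNorm_rankOne_le {n : Type*} [Fintype n] (w : n → ℝ) (hw : ∑ i, w i ^ 2 ≤ 1) (b : B) :
    matNorm (CStarMatrix.ofMatrix fun i j => ((w i * w j : ℝ) : ℂ) • b) ≤ ‖b‖ := by
  have h1 : ∀ i, |w i| ≤ 1 := fun i => by
    have := (Finset.single_le_sum (f := fun i => w i ^ 2) (fun i _ => sq_nonneg _)
      (Finset.mem_univ i)).trans hw
    exact (sq_le_one_iff_abs_le_one _).1 this
  refine le_of_le_mul_of_sq_le (T := B)
    (fun b => matNorm (CStarMatrix.ofMatrix fun i j => ((w i * w j : ℝ) : ℂ) • b))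
    (fun b => ‖b‖) (Fintype.card n) (fun b => norm_nonneg b) (fun b => ?_) (fun b => ?_) b
  · refine matNorm_le_card_mul _ (norm_nonneg b) fun i j => ?_
    change ‖((w i * w j : ℝ) : ℂ) • b‖ ≤ ‖b‖
    rw [norm_smul, Complex.norm_real, norm_mul]
    exact mul_le_of_le_one_left (norm_nonneg b) (mul_le_one₀ (h1 i) (norm_nonneg _) (h1 j))
  · refine ⟨star b * b, by rw [CStarRing.norm_star_mul_self, sq], ?_⟩
    rw [sq, ← matNorm_star_mul_self]
    have e : star (CStarMatrix.ofMatrix fun i j => ((w i * w j : ℝ) : ℂ) • b) *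
        (CStarMatrix.ofMatrix fun i j => ((w i * w j : ℝ) : ℂ) • b) = ((∑ i, w i ^ 2 : ℝ) : ℂ) •
          CStarMatrix.ofMatrix fun i j => ((w i * w j : ℝ) : ℂ) • (star b * b) := by
      ext i j
      rw [CStarMatrix.mul_apply, CStarMatrix.smul_apply]
      change ∑ k, star (((w k * w i : ℝ) : ℂ) • b) * (((w k * w j : ℝ) : ℂ) • b) =
        ((∑ i, w i ^ 2 : ℝ) : ℂ) • (((w i * w j : ℝ) : ℂ) • (star b * b))
      rw [smul_smul, Complex.ofReal_sum, Finset.sum_mul, Finset.sum_smul]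
      refine Finset.sum_congr rfl fun k _ => ?_
      rw [star_smul, smul_mul_smul_comm, Complex.star_def, Complex.conj_ofReal]
      congr 1
      push_cast
      ring
    rw [e, matNorm_smul, Complex.norm_real,
      Real.norm_of_nonneg (Finset.sum_nonneg fun i _ => sq_nonneg _)]
    exact mul_le_of_le_one_left (matNorm_nonneg _) hw

/-- The norm of a compact matrix with entries in a finite block. -/
theorem norm_le_of_block {m : CompactMatrices B} {K : ℕ} {δ : ℝ} (hδ : 0 ≤ δ)
    (h₀ : ∀ i j, coeff m i j ≠ 0 → i < K ∧ j < K) (h : ∀ i j, ‖coeff m i j‖ ≤ δ) :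
    ‖m‖ ≤ K * δ := by
  refine norm_le_of_corners fun F => ?_
  have hN : ∀ s : Set F, (∀ i ∈ s, (i : ℕ) < K) → s.encard ≤ K := fun s hs => by
    rw [← Subtype.val_injective.encard_image]
    refine (Set.encard_le_encard (t := (Finset.range K : Set ℕ)) ?_).trans
      (by rw [Set.encard_coe_eq_coe_finsetCard, Finset.card_range])
    rintro _ ⟨i, hi, rfl⟩
    exact Finset.mem_coe.2 (Finset.mem_range.2 (hs i hi))
  exact matNorm_le_of_sparse _ δ hδ K (fun i j => h i j) (fun i => hN _ fun j hj => (h₀ i j hj).2)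
    (fun j => hN _ fun i hi => (h₀ i j hi).1)

/-- A family of compact matrices is continuous, if it is coefficientwise continuous and locally has
entries in a finite block. -/
theorem continuous_of_block {T : Type*} [TopologicalSpace T] {m : T → CompactMatrices B}
    (hb : ∀ t₀, ∃ K : ℕ, ∀ᶠ t in 𝓝 t₀, ∀ i j, coeff (m t) i j ≠ 0 → i < K ∧ j < K)
    (hc : ∀ i j, Continuous fun t => coeff (m t) i j) : Continuous m := by
  refine continuous_iff_continuousAt.2 fun t₀ => Metric.continuousAt_iff'.2 fun δ hδ => ?_
  obtain ⟨K, hK⟩ := hb t₀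
  have hδ' : 0 < δ / (K + 1) := by positivity
  have h1 : ∀ᶠ t in 𝓝 t₀, ∀ i ∈ Finset.range K, ∀ j ∈ Finset.range K,
      ‖coeff (m t) i j - coeff (m t₀) i j‖ ≤ δ / (K + 1) := by
    refine (Filter.eventually_all_finset _).2 fun i _ => (Filter.eventually_all_finset _).2
      fun j _ => ?_
    filter_upwards [Metric.continuousAt_iff'.1 (hc i j).continuousAt _ hδ'] with t ht
    rw [← dist_eq_norm]
    exact ht.le
  have h2 := hK.self_of_nhds
  filter_upwards [hK, h1] with t ht ht1
  rw [dist_eq_norm]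
  have h3 : ∀ i j, coeff (m t - m t₀) i j ≠ 0 → i < K ∧ j < K := fun i j hij => by
    by_contra hn
    refine hij ?_
    have e1 : coeff (m t) i j = 0 := by by_contra h'; exact hn (ht i j h')
    have e2 : coeff (m t₀) i j = 0 := by by_contra h'; exact hn (h2 i j h')
    rw [coeff_sub, e1, e2, sub_zero]
  refine (norm_le_of_block hδ'.le h3 fun i j => ?_).trans_lt ?_
  · by_cases h0 : coeff (m t - m t₀) i j = 0
    · rw [h0, norm_zero]; exact hδ'.le
    · obtain ⟨hi, hj⟩ := h3 i j h0
      rw [coeff_sub]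
      exact ht1 i (Finset.mem_range.2 hi) j (Finset.mem_range.2 hj)
  · rw [mul_div_assoc', div_lt_iff₀ (by positivity)]
    nlinarith [(Nat.cast_nonneg K : (0 : ℝ) ≤ K)]

/-- The finitely supported matrix with given coefficients. -/
def blockControlled (k : ℕ → ℕ → B) (K : ℕ) (h₀ : ∀ i j, k i j ≠ 0 → i < K ∧ j < K) :
    ControlledMatrix (finiteSupports ℕ) B :=
  have hs : (matSupport k).Finite := ((Finset.range K ×ˢ Finset.range K).finite_toSet).subset
    fun p hp => Finset.mem_coe.2 (Finset.mem_product.2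
      ⟨Finset.mem_range.2 (h₀ p.1 p.2 hp).1, Finset.mem_range.2 (h₀ p.1 p.2 hp).2⟩)
  ControlledMatrix.ofEntries k hs
    ⟨∑ p ∈ Finset.range K ×ˢ Finset.range K, ‖k p.1 p.2‖, fun i j => by
      by_cases h : k i j = 0
      · rw [h, norm_zero]; positivity
      · exact Finset.single_le_sum (f := fun p : ℕ × ℕ => ‖k p.1 p.2‖) (fun _ _ => norm_nonneg _)
          (Finset.mem_product.2 ⟨Finset.mem_range.2 (h₀ i j h).1, Finset.mem_range.2 (h₀ i j h).2⟩ :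
            (i, j) ∈ Finset.range K ×ˢ Finset.range K)⟩

/-- The compact matrix with finitely many given coefficients. -/
def blockMatrix (k : ℕ → ℕ → B) (K : ℕ) (h₀ : ∀ i j, k i j ≠ 0 → i < K ∧ j < K) :
    CompactMatrices B := CStarCompletion.mk (blockControlled k K h₀)

theorem coeff_blockMatrix (k : ℕ → ℕ → B) (K : ℕ) (h₀ : ∀ i j, k i j ≠ 0 → i < K ∧ j < K) (i j : ℕ) :
    coeff (blockMatrix k K h₀) i j = k i j := coeff_mk _ _ _

end Estimates

end

/-! ### The homotopy for the left triangle -/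

noncomputable section

/-- The type of ⋆-homomorphisms between C⋆-algebras. -/
abbrev CStarHom (A B : Type*) [NonUnitalCStarAlgebra A] [NonUnitalCStarAlgebra B] : Type _ :=
  A →⋆ₙₐ[ℂ] B

/-- A pointwise continuous family of ⋆-homomorphisms. -/
def bddFamily {A B : Type*} [NonUnitalCStarAlgebra A] [NonUnitalCStarAlgebra B]
    (ψ : ℝ≥0 → CStarHom A B) (h : ∀ a, Continuous fun t => ψ t a) : CStarHom A (ℝ≥0 →ᵇ B) where
  toFun a := BoundedContinuousFunction.ofNormedAddCommGroup (fun t => ψ t a) (h a) ‖a‖ fun t =>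
    NonUnitalStarAlgHom.norm_apply_le (ψ t) a
  map_smul' c a := BoundedContinuousFunction.ext fun t => map_smul (ψ t) c a
  map_zero' := BoundedContinuousFunction.ext fun t => map_zero (ψ t)
  map_add' a b := BoundedContinuousFunction.ext fun t => map_add (ψ t) a b
  map_mul' a b := BoundedContinuousFunction.ext fun t => map_mul (ψ t) a b
  map_star' a := BoundedContinuousFunction.ext fun t => map_star (ψ t) a

section PathTime

/-- The reparametrized time `(1 - r) t`. -/
def pathTime (r : unitInterval) (t : ℝ≥0) : ℝ≥0 := unitInterval.toNNReal (unitInterval.symm r) * t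

theorem continuous_pathTime : Continuous fun p : unitInterval × ℝ≥0 => pathTime p.1 p.2 :=
  ((unitInterval.toNNReal_continuous.comp unitInterval.continuous_symm).comp continuous_fst).mul
    continuous_snd

theorem pathTime_zero (t : ℝ≥0) : pathTime 0 t = t := by
  rw [pathTime, unitInterval.symm_zero]
  exact one_mul t

theorem pathTime_one (t : ℝ≥0) : pathTime 1 t = 0 := by
  rw [pathTime, unitInterval.symm_one]
  exact zero_mul t

theorem pathTime_le (r : unitInterval) (t : ℝ≥0) : pathTime r t ≤ t :=
  mul_le_of_le_one_left t.2 (unitInterval.symm r).2.2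

end PathTime

section LeftVec

variable {𝒳 : Type*} [MetricSpace 𝒳] {Δ : ℝ} {X : Set 𝒳} {α : X → C(𝒳, ℝ)} {e : X → ℕ}

variable (α e) in
/-- The image of the vector `(α_x z)_x` under the path of isometries. -/
def leftVec (r : unitInterval) (z : 𝒳) (i : ℕ) : ℝ :=
  (∑ᶠ x : X, α x z * pathU r i (e x)) + if i = 0 then pathD r else 0

theorem leftVec_eq_sum {r : unitInterval} {z : 𝒳} {G : Finset X} (hG : ∀ x, α x z ≠ 0 → x ∈ G)
    (i : ℕ) : leftVec α e r z i =
      (∑ x ∈ G, α x z * pathU r i (e x)) + if i = 0 then pathD r else 0 := by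
  rw [leftVec, finsum_eq_sum_of_support_subset _ fun x hx => hG x (left_ne_zero_of_mul hx)]

theorem continuous_leftVec (hX : BoundedGeometry X) (hα : IsSquarePartition Δ X α) (i : ℕ) :
    Continuous fun p : 𝒳 × unitInterval => leftVec α e p.2 p.1 i := by
  unfold leftVec
  refine Continuous.add (continuous_finsum (fun x => ?_) fun p => ?_) ?_
  · exact ((α x).continuous.comp continuous_fst).mul ((continuous_pathU i (e x)).comp continuous_snd)
  · refine ⟨Metric.ball p.1 1 ×ˢ Set.univ, prod_mem_nhds (Metric.ball_mem_nhds _ one_pos) univ_mem,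
      (hX.finite_of_isBounded (Metric.isBounded_ball (x := p.1) (r := Δ + 1))).subset ?_⟩
    rintro x ⟨q, hq, hq', -⟩
    have h1 := hα.dist_lt (left_ne_zero_of_mul hq)
    have h2 : dist q.1 p.1 < 1 := hq'
    have h3 := dist_triangle (x : 𝒳) q.1 p.1
    change dist (x : 𝒳) p.1 < Δ + 1
    linarith
  · split_ifs
    · exact continuous_pathD.comp continuous_snd
    · exact continuous_const

theorem sum_leftVec_sq (hα : IsSquarePartition Δ X α) (he : Function.Injective e) (r : unitInterval)
    {z : 𝒳} {G : Finset X} (hG : ∀ x, α x z ≠ 0 → x ∈ G) {K : ℕ} (hK0 : 0 < K)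
    (hK : ∀ x ∈ G, e x + 1 < K) : ∑ i ∈ Finset.range K, leftVec α e r z i ^ 2 = 1 := by
  classical
  have e1 : ∀ i, leftVec α e r z i ^ 2 = (∑ x ∈ G, ∑ y ∈ G, α x z * α y z *
      (pathU r i (e x) * pathU r i (e y))) + if i = 0 then pathD r ^ 2 else 0 := fun i => by
    rw [leftVec_eq_sum hG, add_sq, sq (∑ x ∈ G, _), Finset.sum_mul_sum]
    have h0 : 2 * (∑ x ∈ G, α x z * pathU r i (e x)) * (if i = 0 then pathD r else 0) = 0 := by
      split_ifs with hi
      · subst hi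
        have : (∑ x ∈ G, α x z * pathU r 0 (e x)) * pathD r = 0 := by
          rw [Finset.sum_mul]
          refine Finset.sum_eq_zero fun x _ => ?_
          rw [mul_assoc, mul_comm _ (pathD r), pathD_mul_pathU_zero, mul_zero]
        rw [mul_assoc, this, mul_zero]
      · exact mul_zero _
    rw [h0, add_zero]
    congr 1
    · exact Finset.sum_congr rfl fun x _ => Finset.sum_congr rfl fun y _ => by ring
    · split_ifs <;> simp
  simp only [e1]
  rw [Finset.sum_add_distrib, Finset.sum_ite_eq', if_pos (Finset.mem_range.2 hK0), Finset.sum_comm]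
  have e2 : ∀ x ∈ G, ∑ i ∈ Finset.range K, ∑ y ∈ G, α x z * α y z *
      (pathU r i (e x) * pathU r i (e y)) = α x z ^ 2 * (1 - pathD r ^ 2) := fun x hx => by
    rw [Finset.sum_comm]
    have e3 : ∀ y ∈ G, ∑ i ∈ Finset.range K, α x z * α y z * (pathU r i (e x) * pathU r i (e y)) =
        if x = y then α x z ^ 2 * (1 - pathD r ^ 2) else 0 := fun y hy => by
      rw [← Finset.mul_sum, sum_pathU_mul_pathU r (hK x hx) (hK y hy)]
      by_cases hxy : x = y
      · subst hxy; rw [if_pos rfl, if_pos rfl]; ring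
      · rw [if_neg hxy, if_neg fun h => hxy (he h), mul_zero]
    rw [Finset.sum_congr rfl e3, Finset.sum_ite_eq, if_pos hx]
  rw [Finset.sum_congr rfl e2, ← Finset.sum_mul, hα.sum_eq_one hG]
  ring

/-- On a bounded set, the vectors lie in a fixed finite-dimensional space. -/
theorem exists_leftVec_bound (hX : BoundedGeometry X) (hα : IsSquarePartition Δ X α)
    (he : Function.Injective e) {s : Set 𝒳} (hs : Bornology.IsBounded s) :
    ∃ K : ℕ, ∀ z ∈ s, ∀ r, (∀ i, K ≤ i → leftVec α e r z i = 0) ∧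
      ∑ i ∈ Finset.range K, leftVec α e r z i ^ 2 = 1 := by
  have hG := hX.finite_of_isBounded (hs.cthickening (δ := Δ))
  have hG' : ∀ z ∈ s, ∀ x, α x z ≠ 0 → x ∈ hG.toFinset := fun z hz x hx => by
    rw [Set.Finite.mem_toFinset]
    exact Metric.mem_cthickening_of_dist_le _ z _ _ hz (hα.dist_lt hx).le
  have hK : ∀ x ∈ hG.toFinset, e x + 1 < hG.toFinset.sup e + 2 := fun x hx => by
    have := Finset.le_sup (f := e) hx
    omega
  refine ⟨hG.toFinset.sup e + 2, fun z hz r => ⟨fun i hi => ?_,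
    sum_leftVec_sq hα he r (hG' z hz) (by omega) hK⟩⟩
  rw [leftVec_eq_sum (hG' z hz), if_neg (by omega), add_zero]
  exact Finset.sum_eq_zero fun x hx => by rw [pathU_eq_zero r ((hK x hx).trans_le hi), mul_zero]

theorem sum_leftVec_sq_le (hX : BoundedGeometry X) (hα : IsSquarePartition Δ X α)
    (he : Function.Injective e) (r : unitInterval) (z : 𝒳) (F : Finset ℕ) :
    ∑ i ∈ F, leftVec α e r z i ^ 2 ≤ 1 := by
  obtain ⟨K, hK⟩ := exists_leftVec_bound hX hα he (Bornology.isBounded_singleton (x := z))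
  obtain ⟨h1, h2⟩ := hK z rfl r
  rw [← h2, Finset.sum_subset (Finset.subset_union_right (s₁ := F) (s₂ := Finset.range K))
    fun i _ hi => by rw [h1 i (not_lt.1 fun h => hi (Finset.mem_range.2 h))]; ring]
  exact Finset.sum_le_sum_of_subset_of_nonneg Finset.subset_union_left fun _ _ _ => sq_nonneg _

theorem abs_leftVec_le (hX : BoundedGeometry X) (hα : IsSquarePartition Δ X α)
    (he : Function.Injective e) (r : unitInterval) (z : 𝒳) (i : ℕ) : |leftVec α e r z i| ≤ 1 := by
  have := sum_leftVec_sq_le hX hα he r z {i}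
  rw [Finset.sum_singleton] at this
  exact (sq_le_one_iff_abs_le_one _).1 this

end LeftVec

section RelC0Cylinder

variable {𝒳 : Type*} [MetricSpace 𝒳] {𝒳₀ : Set 𝒳} {B : Type*} [NonUnitalCStarAlgebra B]

variable (𝒳₀ B) in
/-- Evaluation of functions on `𝒳 × [0,1]`. -/
def relC0CylinderEval (p : 𝒳 × unitInterval) :
    CStarHom (relC0 C(unitInterval, B) 𝒳₀) B where
  toFun f := f.1 p.1 p.2
  map_smul' _ _ := rfl
  map_zero' := rfl
  map_add' _ _ := rfl
  map_mul' _ _ := rfl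
  map_star' _ := rfl

theorem relC0CylinderEval_apply (p : 𝒳 × unitInterval) (f : relC0 C(unitInterval, B) 𝒳₀) :
    relC0CylinderEval 𝒳₀ B p f = f.1 p.1 p.2 := rfl

variable (𝒳₀ B) in
/-- Evaluation at `r ∈ [0,1]`. -/
def relC0EvalMap (r : unitInterval) : CStarHom (relC0 C(unitInterval, B) 𝒳₀) (relC0 B 𝒳₀) :=
  relC0Map 𝒳₀ (cylinderEval B r)

variable (𝒳₀) in
/-- Composition with a ⋆-homomorphism. -/
def relC0CylinderMap {C : Type*} [NonUnitalCStarAlgebra C] (φ : B →⋆ₙₐ[ℂ] C) :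
    CStarHom (relC0 C(unitInterval, B) 𝒳₀) (relC0 C(unitInterval, C) 𝒳₀) :=
  relC0Map 𝒳₀ (cylinderMap φ)

theorem relC0Cylinder_ext {f g : relC0 C(unitInterval, B) 𝒳₀} (h : ∀ z r, f.1 z r = g.1 z r) :
    f = g := relC0.ext fun z => ContinuousMap.ext (h z)

variable [ProperSpace 𝒳]

/-- The function in `C₀(𝒳, 𝒳₀, C([0,1], B))` given by a function on `𝒳 × [0,1]`. -/
def relC0OfCylinder (h : C(𝒳 × unitInterval, B))
    (hd : ∀ δ > 0, Bornology.IsBounded {z | ∃ r, δ ≤ ‖h (z, r)‖})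
    (h₀ : ∀ z ∈ 𝒳₀, ∀ r, h (z, r) = 0) : relC0 C(unitInterval, B) 𝒳₀ :=
  relC0.of (ContinuousMap.curry h) (ContinuousMap.curry h).continuous
    (by
      refine Metric.tendsto_nhds.2 fun δ hδ => ?_
      have hb := hd (δ / 2) (half_pos hδ)
      refine mem_cocompact.2 ⟨_, hb.isCompact_closure, fun z hz => ?_⟩
      have hz' : ∀ r, ‖h (z, r)‖ ≤ δ / 2 := fun r => by
        by_contra hr
        exact hz (subset_closure ⟨r, (not_le.1 hr).le⟩)
      change dist _ _ < δ
      rw [dist_zero_right]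
      exact ((ContinuousMap.norm_le _ (half_pos hδ).le).2 hz').trans_lt (half_lt_self hδ))
    fun z hz => ContinuousMap.ext (h₀ z hz)

/-- Multiplication with a continuous real function on `𝒳 × [0,1]` with values in `[-1,1]`. -/
def relC0CylinderSMul (w : C(𝒳 × unitInterval, ℝ)) (hw : ∀ p, |w p| ≤ 1)
    (g : relC0 C(unitInterval, B) 𝒳₀) : relC0 C(unitInterval, B) 𝒳₀ :=
  relC0OfCylinder
    ⟨fun p => ((w p : ℝ) : ℂ) • g.1 p.1 p.2, (Complex.continuous_ofReal.comp w.continuous).smul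
      (ContinuousMap.continuous_uncurry_of_continuous ⟨_, g.1.continuous⟩)⟩
    (fun δ hδ => (relC0.isCompact_le_norm g hδ).isBounded.subset (by
      rintro z ⟨r, hr⟩
      refine (show δ ≤ ‖((w (z, r) : ℝ) : ℂ) • g.1 z r‖ from hr).trans ?_
      rw [norm_smul, Complex.norm_real]
      exact (mul_le_of_le_one_left (norm_nonneg _) (hw _)).trans
        (ContinuousMap.norm_coe_le_norm (g.1 z) r)))
    fun z hz r => by
      change ((w (z, r) : ℝ) : ℂ) • g.1 z r = 0
      rw [g.2 z hz, ContinuousMap.zero_apply, smul_zero]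

end RelC0Cylinder

section LeftRank

variable {𝒳 : Type*} [MetricSpace 𝒳] [ProperSpace 𝒳] {𝒳₀ : Set 𝒳} {Δ : ℝ} {X : Set 𝒳}
  {α : X → C(𝒳, ℝ)} {e : X → ℕ} {B : Type*} [NonUnitalCStarAlgebra B]

/-- The coefficients `w_i w_j g` of a rank one projection times `g`. -/
def leftKernel (hX : BoundedGeometry X) (hα : IsSquarePartition Δ X α) (he : Function.Injective e)
    (g : relC0 C(unitInterval, B) 𝒳₀) (i j : ℕ) : relC0 C(unitInterval, B) 𝒳₀ :=
  relC0CylinderSMul ⟨fun p => leftVec α e p.2 p.1 i * leftVec α e p.2 p.1 j,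
    (continuous_leftVec hX hα i).mul (continuous_leftVec hX hα j)⟩
    (fun p => by
      change |leftVec α e p.2 p.1 i * leftVec α e p.2 p.1 j| ≤ 1
      rw [abs_mul]
      exact mul_le_one₀ (abs_leftVec_le hX hα he _ _ _) (abs_nonneg _)
        (abs_leftVec_le hX hα he _ _ _)) g

theorem leftKernel_apply (hX : BoundedGeometry X) (hα : IsSquarePartition Δ X α)
    (he : Function.Injective e) (g : relC0 C(unitInterval, B) 𝒳₀) (i j : ℕ) (z : 𝒳)
    (r : unitInterval) : (leftKernel hX hα he g i j).1 z r =
      ((leftVec α e r z i * leftVec α e r z j : ℝ) : ℂ) • g.1 z r := rfl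

theorem exists_leftRank (hX : BoundedGeometry X) (hα : IsSquarePartition Δ X α)
    (he : Function.Injective e) (g : relC0 C(unitInterval, B) 𝒳₀) :
    ∃ m : CompactMatrices (relC0 C(unitInterval, B) 𝒳₀),
      ∀ i j, MatrixAlgebra.coeff m i j = leftKernel hX hα he g i j := by
  refine MatrixAlgebra.exists_of_approx _ fun δ hδ => ?_
  obtain ⟨K, hK⟩ := exists_leftVec_bound hX hα he
    (relC0.isCompact_le_norm g (half_pos hδ)).isBounded
  refine ⟨blockControlled (fun i j => if i < K ∧ j < K then leftKernel hX hα he g i j else 0) K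
    fun i j h => by by_contra h'; exact h (if_neg h'), fun F => ?_⟩
  refine matNorm_le_of_separating (relC0CylinderEval 𝒳₀ B)
    (fun x hx => relC0Cylinder_ext fun z r => hx (z, r)) hδ.le fun p => ?_
  obtain ⟨z, r⟩ := p
  let w : F → ℝ := fun i => leftVec α e r z i
  let w' : F → ℝ := fun i => if (i : ℕ) < K then w i else 0
  have hw : ∑ i, w i ^ 2 ≤ 1 :=
    (Finset.sum_coe_sort F fun i => leftVec α e r z i ^ 2).trans_le
      (sum_leftVec_sq_le hX hα he r z F)
  have hw' : ∑ i, w' i ^ 2 ≤ 1 := (Finset.sum_le_sum fun i _ => by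
    simp only [w']; split_ifs
    · exact le_rfl
    · rw [zero_pow two_ne_zero]; exact sq_nonneg _).trans hw
  have e1 : (CStarMatrix.ofMatrix fun i j : F => relC0CylinderEval 𝒳₀ B (z, r)
      (leftKernel hX hα he g i j - ControlledMatrix.entry (blockControlled (fun i j =>
        if i < K ∧ j < K then leftKernel hX hα he g i j else 0) K
        fun i j h => by by_contra h'; exact h (if_neg h')) i j)) =
      (CStarMatrix.ofMatrix fun i j => ((w i * w j : ℝ) : ℂ) • g.1 z r) +
        -(CStarMatrix.ofMatrix fun i j => ((w' i * w' j : ℝ) : ℂ) • g.1 z r) := by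
    ext i j
    rw [CStarMatrix.add_apply, CStarMatrix.neg_apply, ← sub_eq_add_neg]
    change relC0CylinderEval 𝒳₀ B (z, r) (leftKernel hX hα he g i j -
      if (i : ℕ) < K ∧ (j : ℕ) < K then leftKernel hX hα he g i j else 0) =
        ((w i * w j : ℝ) : ℂ) • g.1 z r - ((w' i * w' j : ℝ) : ℂ) • g.1 z r
    rw [map_sub, relC0CylinderEval_apply, leftKernel_apply]
    congr 1
    by_cases hi : (i : ℕ) < K <;> by_cases hj : (j : ℕ) < K <;> simp [hi, hj, w', w,
      relC0CylinderEval_apply, leftKernel_apply]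
  refine (congrArg matNorm e1).trans_le ?_
  by_cases hz : δ / 2 ≤ ‖g.1 z‖
  · have h0 : w' = w := funext fun i => by
      simp only [w', w]
      split_ifs with hi
      · rfl
      · exact (((hK z hz r).1 i (not_lt.1 hi))).symm
    rw [h0, add_neg_cancel, matNorm_zero]
    exact hδ.le
  · have hg : ‖g.1 z r‖ ≤ δ / 2 := (ContinuousMap.norm_coe_le_norm (g.1 z) r).trans (not_le.1 hz).le
    refine (matNorm_add_le _ _).trans ?_
    rw [matNorm_neg]
    have h1 := matNorm_rankOne_le w hw (g.1 z r)
    have h2 := matNorm_rankOne_le w' hw' (g.1 z r)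
    linarith

/-- The matrix with coefficients `w_i w_j g`. -/
def leftRankMatrix (hX : BoundedGeometry X) (hα : IsSquarePartition Δ X α)
    (he : Function.Injective e) (g : relC0 C(unitInterval, B) 𝒳₀) :
    CompactMatrices (relC0 C(unitInterval, B) 𝒳₀) := (exists_leftRank hX hα he g).choose

theorem coeff_leftRankMatrix (hX : BoundedGeometry X) (hα : IsSquarePartition Δ X α)
    (he : Function.Injective e) (g : relC0 C(unitInterval, B) 𝒳₀) (i j : ℕ) :
    MatrixAlgebra.coeff (leftRankMatrix hX hα he g) i j = leftKernel hX hα he g i j :=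
  (exists_leftRank hX hα he g).choose_spec i j

theorem leftRankMatrix_mul (hX : BoundedGeometry X) (hα : IsSquarePartition Δ X α)
    (he : Function.Injective e) (g g' : relC0 C(unitInterval, B) 𝒳₀) :
    leftRankMatrix hX hα he (g * g') = leftRankMatrix hX hα he g * leftRankMatrix hX hα he g' := by
  refine MatrixAlgebra.ext_coeff fun i j => relC0Cylinder_ext fun z r => ?_
  obtain ⟨K, hK⟩ := exists_leftVec_bound hX hα he (Bornology.isBounded_singleton (x := z))
  obtain ⟨h1, h2⟩ := hK z rfl r
  have e1 : ∀ (g : relC0 C(unitInterval, B) 𝒳₀) (i j : ℕ),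
      MatrixAlgebra.coeff (MatrixAlgebra.map (relC0CylinderEval 𝒳₀ B (z, r))
        (leftRankMatrix hX hα he g)) i j =
        ((leftVec α e r z i * leftVec α e r z j : ℝ) : ℂ) • g.1 z r := fun g i j => by
    rw [MatrixAlgebra.coeff_map, coeff_leftRankMatrix, relC0CylinderEval_apply, leftKernel_apply]
  have e2 : (MatrixAlgebra.coeff (leftRankMatrix hX hα he g * leftRankMatrix hX hα he g') i j).1 z r
      = MatrixAlgebra.coeff (MatrixAlgebra.map (relC0CylinderEval 𝒳₀ B (z, r))
          (leftRankMatrix hX hα he g) * MatrixAlgebra.map (relC0CylinderEval 𝒳₀ B (z, r))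
          (leftRankMatrix hX hα he g')) i j := by
    rw [← map_mul, MatrixAlgebra.coeff_map]
    rfl
  rw [e2, MatrixAlgebra.coeff_mul_eq_sum _ _ i j (Finset.range K), coeff_leftRankMatrix,
    leftKernel_apply]
  · simp only [e1]
    have e3 : ∀ k, (((leftVec α e r z i * leftVec α e r z k : ℝ) : ℂ) • g.1 z r) *
        (((leftVec α e r z k * leftVec α e r z j : ℝ) : ℂ) • g'.1 z r) =
        ((leftVec α e r z i * leftVec α e r z j * leftVec α e r z k ^ 2 : ℝ) : ℂ) •
          (g.1 z r * g'.1 z r) := fun k => by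
      rw [smul_mul_smul_comm]
      congr 1
      push_cast
      ring
    simp only [e3]
    rw [← Finset.sum_smul, ← Complex.ofReal_sum, ← Finset.mul_sum, h2, mul_one]
    rfl
  · intro k hk
    rw [e1] at hk
    by_contra hk'
    refine hk ?_
    rw [h1 k (not_lt.1 fun h => hk' (Finset.mem_range.2 h)), mul_zero, Complex.ofReal_zero,
      zero_smul]

/-- The ⋆-homomorphism which sends `g` to `g` times the rank one projection onto the vector `w`. -/
def leftRank (hX : BoundedGeometry X) (hα : IsSquarePartition Δ X α) (he : Function.Injective e) :
    CStarHom (relC0 C(unitInterval, B) 𝒳₀) (CompactMatrices (relC0 C(unitInterval, B) 𝒳₀)) where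
  toFun := leftRankMatrix hX hα he
  map_smul' c g := MatrixAlgebra.ext_coeff fun i j => by
    rw [MatrixAlgebra.coeff_smul, coeff_leftRankMatrix, coeff_leftRankMatrix]
    exact relC0Cylinder_ext fun z r => smul_comm _ c (g.1 z r)
  map_zero' := MatrixAlgebra.ext_coeff fun i j => by
    rw [MatrixAlgebra.coeff_zero, coeff_leftRankMatrix]
    exact relC0Cylinder_ext fun z r => smul_zero _
  map_add' g g' := MatrixAlgebra.ext_coeff fun i j => by
    rw [MatrixAlgebra.coeff_add, coeff_leftRankMatrix, coeff_leftRankMatrix, coeff_leftRankMatrix]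
    exact relC0Cylinder_ext fun z r => smul_add _ (g.1 z r) (g'.1 z r)
  map_mul' := leftRankMatrix_mul hX hα he
  map_star' g := MatrixAlgebra.ext_coeff fun i j => by
    rw [MatrixAlgebra.coeff_star, coeff_leftRankMatrix, coeff_leftRankMatrix]
    refine relC0Cylinder_ext fun z r => ?_
    change _ = star (((leftVec α e r z j * leftVec α e r z i : ℝ) : ℂ) • g.1 z r)
    rw [star_smul, Complex.star_def, Complex.conj_ofReal, mul_comm]
    rfl

theorem coeff_leftRank (hX : BoundedGeometry X) (hα : IsSquarePartition Δ X α)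
    (he : Function.Injective e) (g : relC0 C(unitInterval, B) 𝒳₀) (i j : ℕ) :
    MatrixAlgebra.coeff (leftRank hX hα he g) i j = leftKernel hX hα he g i j :=
  coeff_leftRankMatrix hX hα he g i j

end LeftRank

section LeftScale

variable {𝒳 : Type*} [MetricSpace 𝒳] {𝒳₀ : Set 𝒳} {sc : ℝ≥0 → 𝒳 → 𝒳} {B : Type*}
  [NonUnitalCStarAlgebra B]

theorem IsScaling.isBounded_large (hsc : IsScaling 𝒳₀ sc) (f : relC0 B 𝒳₀) {δ : ℝ} (hδ : 0 < δ)
    (T : ℝ≥0) : Bornology.IsBounded {z | ∃ t ≤ T, δ ≤ ‖f.1 (sc t z)‖} := by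
  refine (hsc.bounded _ T (relC0.isCompact_le_norm f hδ).isBounded).subset ?_
  rintro x ⟨t, ht, hx⟩
  exact Set.mem_biUnion (Set.mem_Iic.2 ht) hx

variable [ProperSpace 𝒳]

/-- The function `(z, r) ↦ f (sc_{(1 - r) t} z)`. -/
def leftScaleAt (hsc : IsScaling 𝒳₀ sc) (f : relC0 B 𝒳₀) (t : ℝ≥0) :
    relC0 C(unitInterval, B) 𝒳₀ :=
  relC0OfCylinder ⟨fun p => f.1 (sc (pathTime p.2 t) p.1), f.1.continuous.comp
      (hsc.continuous.comp (continuous_fst.prodMk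
        (continuous_pathTime.comp (continuous_snd.prodMk continuous_const))))⟩
    (fun δ hδ => (hsc.isBounded_large f hδ t).subset (by
      rintro z ⟨r, hr⟩
      exact ⟨_, pathTime_le r t, hr⟩))
    fun z hz r => f.2 _ (hsc.mapsTo _ hz)

theorem continuous_leftScaleAt (hsc : IsScaling 𝒳₀ sc) (f : relC0 B 𝒳₀) :
    Continuous (leftScaleAt hsc f) := by
  refine continuous_iff_continuousAt.2 fun t₀ => Metric.continuousAt_iff'.2 fun δ hδ => ?_
  have hb := hsc.isBounded_large f (half_pos (half_pos hδ)) (t₀ + 1)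
  have hc : Continuous fun p : ℝ≥0 × (𝒳 × unitInterval) => f.1 (sc (pathTime p.2.2 p.1) p.2.1) :=
    f.1.continuous.comp (hsc.continuous.comp ((continuous_fst.comp continuous_snd).prodMk
      (continuous_pathTime.comp ((continuous_snd.comp continuous_snd).prodMk continuous_fst))))
  have h1 : ∀ᶠ t in 𝓝 t₀, ∀ p ∈ closure {z | ∃ t ≤ t₀ + 1, δ / 2 / 2 ≤ ‖f.1 (sc t z)‖} ×ˢ
      (Set.univ : Set unitInterval),
      ‖f.1 (sc (pathTime p.2 t) p.1) - f.1 (sc (pathTime p.2 t₀) p.1)‖ ≤ δ / 2 := by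
    refine (hb.isCompact_closure.prod isCompact_univ).eventually_forall_of_forall_eventually
      fun p _ => ?_
    have hc' : Continuous fun q : ℝ≥0 × (𝒳 × unitInterval) =>
        ‖f.1 (sc (pathTime q.2.2 q.1) q.2.1) - f.1 (sc (pathTime q.2.2 t₀) q.2.1)‖ :=
      (hc.sub (hc.comp (continuous_const.prodMk continuous_snd))).norm
    have h2 := hc'.tendsto (t₀, p)
    simp only [sub_self, norm_zero] at h2
    exact (h2.eventually (gt_mem_nhds (half_pos hδ))).mono fun q hq => hq.le
  have h2 : ∀ᶠ t in 𝓝 t₀, t ≤ t₀ + 1 := (gt_mem_nhds (lt_add_one t₀)).mono fun _ h => h.le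
  filter_upwards [h1, h2] with t ht ht2
  rw [dist_eq_norm]
  refine lt_of_le_of_lt (relC0.norm_le (half_pos hδ).le fun z =>
    (ContinuousMap.norm_le _ (half_pos hδ).le).2 fun r => ?_) (half_lt_self hδ)
  change ‖f.1 (sc (pathTime r t) z) - f.1 (sc (pathTime r t₀) z)‖ ≤ δ / 2
  by_cases hz : ∃ t ≤ t₀ + 1, δ / 2 / 2 ≤ ‖f.1 (sc t z)‖
  · exact ht (z, r) ⟨subset_closure hz, trivial⟩
  · push Not at hz
    refine (norm_sub_le _ _).trans ?_
    have h3 := hz _ ((pathTime_le r t).trans ht2)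
    have h4 := hz _ ((pathTime_le r t₀).trans (le_add_of_nonneg_right zero_le_one))
    linarith

/-- The ⋆-homomorphism which sends `f` to the family of functions `(z, r) ↦ f (sc_{(1 - r) t} z)`. -/
def leftScaleHom (hsc : IsScaling 𝒳₀ sc) (t : ℝ≥0) :
    CStarHom (relC0 B 𝒳₀) (relC0 C(unitInterval, B) 𝒳₀) where
  toFun f := leftScaleAt hsc f t
  map_smul' _ _ := rfl
  map_zero' := rfl
  map_add' _ _ := rfl
  map_mul' _ _ := rfl
  map_star' _ := rfl

variable (B) in
/-- The ⋆-homomorphism which sends `f` to the family of functions `(z, r) ↦ f (sc_{(1 - r) t} z)`. -/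
def leftScale (hsc : IsScaling 𝒳₀ sc) :
    CStarHom (relC0 B 𝒳₀) (ℝ≥0 →ᵇ relC0 C(unitInterval, B) 𝒳₀) :=
  bddFamily (leftScaleHom hsc) (continuous_leftScaleAt hsc)

end LeftScale

end

/-! ### The left triangle -/

noncomputable section

theorem div_add_one_mul_le {c δ : ℝ} (hc : 0 ≤ c) (hδ : 0 ≤ δ) : δ / (c + 1) * c ≤ δ := by
  rw [div_mul_eq_mul_div, div_le_iff₀ (by positivity)]
  nlinarith

section AsymptoticHom

variable {A B C : Type*} [NonUnitalCStarAlgebra A] [NonUnitalCStarAlgebra B] [NonUnitalCStarAlgebra C]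

/-- Postcomposition of a family of maps with a ⋆-homomorphism. -/
def bddFamilyComp (φ : B →⋆ₙₐ[ℂ] C) (ψ : A →⋆ₙₐ[ℂ] (ℝ≥0 →ᵇ B)) : A →⋆ₙₐ[ℂ] (ℝ≥0 →ᵇ C) :=
  (bddMap φ).comp ψ

/-- The ⋆-homomorphism into the asymptotic algebra given by a bounded continuous family. -/
def asymptoticHom (ψ : A →⋆ₙₐ[ℂ] (ℝ≥0 →ᵇ B)) : A →⋆ₙₐ[ℂ] AsymptoticAlgebra B :=
  (vanishingIdeal B).projHom.comp ψ

theorem asymptoticMap_asClass (φ : B →⋆ₙₐ[ℂ] C) (f : ℝ≥0 →ᵇ B) :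
    asymptoticMap φ (asClass f) = asClass (bddMap φ f) := rfl

theorem coeff_cornerEmbedding (b : B) (i j : ℕ) :
    MatrixAlgebra.coeff (cornerEmbedding B b) i j = if i = 0 ∧ j = 0 then b else 0 := by
  rw [cornerEmbedding_apply, MatrixAlgebra.coeff_mk, entry_cornerMatrix]

theorem asClass_eq_of_eventually {f g : ℝ≥0 →ᵇ B}
    (h : ∀ δ > 0, ∀ᶠ t in atTop, ‖f t - g t‖ ≤ δ) : asClass f = asClass g := by
  refine CStarIdeal.proj_eq_iff.2 ?_
  change Tendsto (fun t => f t - g t) atTop (𝓝 0)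
  refine Metric.tendsto_nhds.2 fun δ hδ => ?_
  filter_upwards [h (δ / 2) (half_pos hδ)] with t ht
  rw [dist_zero_right]
  exact ht.trans_lt (half_lt_self hδ)

theorem asClass_compact_ext {f g : ℝ≥0 →ᵇ CompactMatrices B}
    (h : ∀ t i j, MatrixAlgebra.coeff (f t) i j = MatrixAlgebra.coeff (g t) i j) :
    asClass f = asClass g :=
  congrArg asClass (BoundedContinuousFunction.ext fun t => MatrixAlgebra.ext_coeff (h t))

theorem coeff_bddMap_map (φ : B →⋆ₙₐ[ℂ] C) (f : ℝ≥0 →ᵇ CompactMatrices B) (t : ℝ≥0) (i j : ℕ) :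
    MatrixAlgebra.coeff (bddMap (MatrixAlgebra.map φ) f t) i j = φ (MatrixAlgebra.coeff (f t) i j) :=
  MatrixAlgebra.coeff_map φ (f t) i j

/-- The distance of two matrices which are indexed by a metric space of bounded geometry and agree
away from the diagonal. -/
theorem norm_sub_le_of_local {X : Type*} [MetricSpace X] {e : X → ℕ} (he : Function.Injective e)
    {R : ℝ} {N : ℕ} (hN : ∀ x : X, (Metric.ball x R).encard ≤ N) {m n : CompactMatrices B}
    (hm : ∀ i j, i ∉ Set.range e ∨ j ∉ Set.range e →
      MatrixAlgebra.coeff m i j = 0 ∧ MatrixAlgebra.coeff n i j = 0) {δ : ℝ} (hδ : 0 ≤ δ)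
    (h : ∀ x y, ‖MatrixAlgebra.coeff m (e x) (e y) - MatrixAlgebra.coeff n (e x) (e y)‖ ≤ δ)
    (h' : ∀ x y, R ≤ dist x y →
      MatrixAlgebra.coeff m (e x) (e y) = MatrixAlgebra.coeff n (e x) (e y)) :
    ‖m - n‖ ≤ N * δ := by
  let k : X → X → B := fun x y => MatrixAlgebra.coeff (m - n) (e x) (e y)
  have hk0 : ∀ x y, k x y ≠ 0 → dist x y < R := fun x y hxy => by
    by_contra hd
    refine hxy ?_
    simp only [k]
    rw [MatrixAlgebra.coeff_sub, h' x y (not_lt.1 hd), sub_self]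
  refine MatrixAlgebra.norm_le_of_pushKernel he (k := k) (fun i j =>
    eq_pushKernel he (fun x y => rfl) (fun i j hij => ?_) i j) fun F => ?_
  · rw [MatrixAlgebra.coeff_sub, (hm i j hij).1, (hm i j hij).2, sub_zero]
  · refine matNorm_le_of_sparse _ _ hδ N (fun x y => ?_) (fun x => ?_) fun y => ?_
    · refine (congrArg norm (MatrixAlgebra.coeff_sub m n (e x) (e y))).trans_le (h x y)
    · rw [← Subtype.val_injective.encard_image]
      refine (Set.encard_le_encard ?_).trans (hN x)
      rintro _ ⟨y, hy, rfl⟩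
      rw [Metric.mem_ball, dist_comm]
      exact hk0 x y hy
    · rw [← Subtype.val_injective.encard_image]
      refine (Set.encard_le_encard ?_).trans (hN y)
      rintro _ ⟨x, hx, rfl⟩
      exact hk0 x y hx

end AsymptoticHom

section LeftHom

variable {𝒳 : Type*} [MetricSpace 𝒳] {𝒳₀ : Set 𝒳} {sc : ℝ≥0 → 𝒳 → 𝒳} {Δ : ℝ} {X : Set 𝒳}
  {α : X → C(𝒳, ℝ)} {e : X → ℕ} {B : Type*} [NonUnitalCStarAlgebra B]

theorem leftVec_zero_apply (he : Function.Injective e) (z : 𝒳) (x : X) :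
    leftVec α e 0 z (e x) = α x z := by
  rw [leftVec, pathD_zero, ite_self, add_zero, finsum_eq_single _ x fun y hy => by
    rw [pathU_zero, if_neg fun h => hy (he h).symm, mul_zero], pathU_zero, if_pos rfl, mul_one]

theorem leftVec_zero_of_notMem {i : ℕ} (hi : i ∉ Set.range e) (z : 𝒳) :
    leftVec α e 0 z i = 0 := by
  rw [leftVec, pathD_zero, ite_self, add_zero]
  refine finsum_eq_zero_of_forall_eq_zero fun x => ?_
  rw [pathU_zero, if_neg fun h => hi ⟨x, h.symm⟩, mul_zero]

theorem leftVec_one (z : 𝒳) (i : ℕ) : leftVec α e 1 z i = if i = 0 then 1 else 0 := by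
  rw [leftVec, pathD_one, finsum_eq_zero_of_forall_eq_zero fun x => by rw [pathU_one, mul_zero],
    zero_add]

theorem eventually_norm_scaled_sub_le (hΔ : 0 < Δ) (hsc : IsScaling 𝒳₀ sc)
    (hnet : IsSeparatedNet Δ X) (hα : IsSquarePartition Δ X α) (h : relC0 ℂ 𝒳₀) {δ : ℝ}
    (hδ : 0 < δ) : ∀ᶠ t in atTop, ∀ (x y : X) (z : 𝒳),
      ‖((α x z * α y z : ℝ) : ℂ) * h.1 (sc t z) - h.1 (sc t x) *
        ((cutoff Δ 𝒳₀ x * α x z * (cutoff Δ 𝒳₀ y * α y z) : ℝ) : ℂ)‖ ≤ δ := by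
  filter_upwards [hsc.eventually_norm_sub_le_of_dist_le (relC0.uniformContinuous h) (5 * Δ) hδ]
    with t ht x y z
  by_cases hx : α x z = 0
  · simpa [hx] using hδ.le
  by_cases hy : α y z = 0
  · simpa [hy] using hδ.le
  have hxy : ‖((α x z * α y z : ℝ) : ℂ)‖ ≤ 1 := by
    rw [Complex.norm_real, norm_mul]
    exact mul_le_one₀ (hα.abs_le_one x z) (norm_nonneg _) (hα.abs_le_one y z)
  have hsmall : ∀ v : X, α v z ≠ 0 → cutoff Δ 𝒳₀ (v : 𝒳) = 0 →
      ‖((α x z * α y z : ℝ) : ℂ) * h.1 (sc t z)‖ ≤ δ := fun v hv hcv => by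
    obtain ⟨u, ⟨p, hp, hup⟩, hvu⟩ := mem_nbhdOf_of_cutoff_eq_zero hΔ hnet hcv
    have h1 := ht z p (by
      have h2 := dist_triangle4 z (v : 𝒳) u p
      have h3 := hα.dist_lt hv
      have h4 : dist (v : 𝒳) u < 3 * Δ := hvu
      rw [dist_comm] at h3
      linarith)
    rw [h.2 _ (hsc.mapsTo t hp), sub_zero] at h1
    rw [norm_mul]
    exact (mul_le_of_le_one_left (norm_nonneg _) hxy).trans h1
  rcases cutoff_eq_zero_or_one Δ 𝒳₀ (x : 𝒳) with hcx | hcx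
  · simpa [hcx] using hsmall x hx hcx
  rcases cutoff_eq_zero_or_one Δ 𝒳₀ (y : 𝒳) with hcy | hcy
  · simpa [hcy] using hsmall y hy hcy
  have h1 := ht z x (by
    have h3 := hα.dist_lt hx
    rw [dist_comm] at h3
    linarith)
  have e1 : ((α x z * α y z : ℝ) : ℂ) * h.1 (sc t z) - h.1 (sc t x) *
      ((cutoff Δ 𝒳₀ x * α x z * (cutoff Δ 𝒳₀ y * α y z) : ℝ) : ℂ) =
      ((α x z * α y z : ℝ) : ℂ) * (h.1 (sc t z) - h.1 (sc t x)) := by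
    rw [hcx, hcy, one_mul, one_mul]
    ring
  rw [e1, norm_mul]
  exact (mul_le_of_le_one_left (norm_nonneg _) hxy).trans h1

variable [ProperSpace 𝒳]

variable (B) in
/-- The homotopy for the left triangle, before passing to asymptotic classes. -/
def leftFun (hsc : IsScaling 𝒳₀ sc) (hX : BoundedGeometry X) (hα : IsSquarePartition Δ X α)
    (he : Function.Injective e) :
    CStarHom (relC0 B 𝒳₀) (ℝ≥0 →ᵇ CompactMatrices (relC0 C(unitInterval, B) 𝒳₀)) :=
  bddFamilyComp (leftRank hX hα he) (leftScale B hsc)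

theorem coeff_leftFun (hsc : IsScaling 𝒳₀ sc) (hX : BoundedGeometry X)
    (hα : IsSquarePartition Δ X α) (he : Function.Injective e) (f : relC0 B 𝒳₀) (t : ℝ≥0) (i j : ℕ)
    (z : 𝒳) (r : unitInterval) :
    (MatrixAlgebra.coeff (leftFun B hsc hX hα he f t) i j).1 z r =
      ((leftVec α e r z i * leftVec α e r z j : ℝ) : ℂ) • f.1 (sc (pathTime r t) z) := by
  have h := coeff_leftRank hX hα he (leftScaleAt hsc f t) i j
  exact (congrArg (fun g : relC0 C(unitInterval, B) 𝒳₀ => g.1 z r) h).trans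
    (leftKernel_apply hX hα he _ i j z r)

variable (B) in
/-- The homotopy for the left triangle. -/
def leftHom (hsc : IsScaling 𝒳₀ sc) (hX : BoundedGeometry X) (hα : IsSquarePartition Δ X α)
    (he : Function.Injective e) :
    CStarHom (relC0 B 𝒳₀) (AsymptoticAlgebra (CompactMatrices (relC0 C(unitInterval, B) 𝒳₀))) :=
  asymptoticHom (leftFun B hsc hX hα he)

set_option maxHeartbeats 400000 in
theorem asClass_leftFun_zero (hΔ : 0 < Δ) (hsc : IsScaling 𝒳₀ sc) (hX : BoundedGeometry X)
    (hnet : IsSeparatedNet Δ X) (hα : IsSquarePartition Δ X α) (he : Function.Injective e)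
    (h : relC0 ℂ 𝒳₀) (b : B) :
    asClass (bddMap (MatrixAlgebra.map (relC0EvalMap 𝒳₀ B 0))
        (leftFun B hsc hX hα he (relC0Tensor 𝒳₀ h b))) =
      asClass (counitFun hsc hX he h (CStarCompletion.mk (unitMatrix 𝒳₀ hX hα b))) := by
  obtain ⟨N, hN⟩ := hX (2 * Δ)
  refine asClass_eq_of_eventually fun δ hδ => ?_
  have hδ' : 0 < δ / (N * ‖b‖ + 1) := by positivity
  filter_upwards [eventually_norm_scaled_sub_le hΔ hsc hnet hα h hδ'] with t ht
  have h1 : ∀ i j z, (MatrixAlgebra.coeff (bddMap (MatrixAlgebra.map (relC0EvalMap 𝒳₀ B 0))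
      (leftFun B hsc hX hα he (relC0Tensor 𝒳₀ h b)) t) i j).1 z =
      ((leftVec α e 0 z i * leftVec α e 0 z j : ℝ) : ℂ) • h.1 (sc t z) • b := fun i j z => by
    rw [coeff_bddMap_map]
    refine (coeff_leftFun hsc hX hα he (relC0Tensor 𝒳₀ h b) t i j z 0).trans ?_
    rw [pathTime_zero]
    rfl
  have h2 : ∀ i j, MatrixAlgebra.coeff (counitFun hsc hX he h
      (CStarCompletion.mk (unitMatrix 𝒳₀ hX hα b)) t) i j = pushKernel e (fun x y : X =>
        h.1 (sc t x) • relC0Tensor 𝒳₀ (unitBump 𝒳₀ hα x * unitBump 𝒳₀ hα y) b) i j := fun i j => by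
    rw [counitFun_apply, coeff_compress]
    simp only [MatrixAlgebra.coeff_mk]
    rfl
  have h3 : ∀ x y z, (MatrixAlgebra.coeff (counitFun hsc hX he h
      (CStarCompletion.mk (unitMatrix 𝒳₀ hX hα b)) t) (e x) (e y)).1 z = (h.1 (sc t x) *
        ((cutoff Δ 𝒳₀ x * α x z * (cutoff Δ 𝒳₀ y * α y z) : ℝ) : ℂ)) • b := fun x y z => by
    rw [mul_smul, Complex.ofReal_mul (cutoff Δ 𝒳₀ x * α x z)]
    exact congrArg (fun g : relC0 B 𝒳₀ => g.1 z) ((h2 (e x) (e y)).trans (pushKernel_apply he _ x y))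
  have key := norm_sub_le_of_local he hN (m := bddMap (MatrixAlgebra.map (relC0EvalMap 𝒳₀ B 0)) (leftFun B hsc hX hα he (relC0Tensor 𝒳₀ h b)) t)
    (n := counitFun hsc hX he h (CStarCompletion.mk (unitMatrix 𝒳₀ hX hα b)) t)
    (δ := δ / (N * ‖b‖ + 1) * ‖b‖) ?_ (by positivity) ?_ ?_
  · refine key.trans ?_
    calc (N : ℝ) * (δ / (N * ‖b‖ + 1) * ‖b‖) = δ / (N * ‖b‖ + 1) * (N * ‖b‖) := by ring
      _ ≤ δ := div_add_one_mul_le (by positivity) hδ.le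
  · refine fun i j hij => ⟨relC0.ext fun z => (h1 i j z).trans ?_,
      (h2 i j).trans (pushKernel_of_notMem e _ hij)⟩
    rcases hij with hi | hj
    · rw [leftVec_zero_of_notMem hi, zero_mul, Complex.ofReal_zero, zero_smul]; rfl
    · rw [leftVec_zero_of_notMem hj, mul_zero, Complex.ofReal_zero, zero_smul]; rfl
  · intro x y
    refine relC0.norm_le (by positivity) fun z => ?_
    refine (congrArg norm ((congrArg₂ (· - ·) (h1 (e x) (e y) z) (h3 x y z)).trans
      (?_ : _ = (((α x z * α y z : ℝ) : ℂ) * h.1 (sc t z) - h.1 (sc t x) *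
        ((cutoff Δ 𝒳₀ x * α x z * (cutoff Δ 𝒳₀ y * α y z) : ℝ) : ℂ)) • b))).trans_le ?_
    · rw [leftVec_zero_apply he, leftVec_zero_apply he, sub_smul, smul_smul]
    · rw [norm_smul]
      exact mul_le_mul_of_nonneg_right (ht x y z) (norm_nonneg b)
  · intro x y hxy
    refine relC0.ext fun z => (h1 (e x) (e y) z).trans ((?_ : _ = _).trans (h3 x y z).symm)
    rw [leftVec_zero_apply he, leftVec_zero_apply he]
    have hxyz : α x z = 0 ∨ α y z = 0 := by
      by_contra! hne
      exact not_lt.2 hxy (hα.dist_lt_two_mul hne.1 hne.2)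
    rcases hxyz with h' | h' <;> simp [h']

theorem asClass_leftFun_one (hsc : IsScaling 𝒳₀ sc) (hX : BoundedGeometry X)
    (hα : IsSquarePartition Δ X α) (he : Function.Injective e) (f : relC0 B 𝒳₀) :
    asClass (bddMap (MatrixAlgebra.map (relC0EvalMap 𝒳₀ B 1)) (leftFun B hsc hX hα he f)) =
      asClass (BoundedContinuousFunction.const ℝ≥0 (cornerEmbedding (relC0 B 𝒳₀) f)) := by
  refine asClass_compact_ext fun t i j => ?_
  refine (coeff_bddMap_map _ _ t i j).trans ?_
  refine Eq.trans (relC0.ext fun z => (coeff_leftFun hsc hX hα he f t i j z 1).trans ?_)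
    (coeff_cornerEmbedding f i j).symm
  rw [leftVec_one, leftVec_one, pathTime_one, hsc.zero]
  by_cases hi : i = 0
  · by_cases hj : j = 0
    · rw [if_pos hi, if_pos hj, if_pos ⟨hi, hj⟩, mul_one, Complex.ofReal_one, one_smul]
    · rw [if_neg hj, mul_zero, Complex.ofReal_zero, zero_smul, if_neg fun h' => hj h'.2]; rfl
  · rw [if_neg hi, zero_mul, Complex.ofReal_zero, zero_smul, if_neg fun h' => hi h'.1]; rfl

theorem asClass_leftFun_map {C : Type*} [NonUnitalCStarAlgebra C] (hsc : IsScaling 𝒳₀ sc)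
    (hX : BoundedGeometry X) (hα : IsSquarePartition Δ X α) (he : Function.Injective e)
    (φ : B →⋆ₙₐ[ℂ] C) (f : relC0 B 𝒳₀) :
    asClass (leftFun C hsc hX hα he (relC0Map 𝒳₀ φ f)) =
      asClass (bddMap (MatrixAlgebra.map (relC0CylinderMap 𝒳₀ φ)) (leftFun B hsc hX hα he f)) := by
  refine asClass_compact_ext fun t i j => ?_
  refine Eq.trans ?_ (coeff_bddMap_map _ _ t i j).symm
  refine relC0Cylinder_ext fun z r => (coeff_leftFun hsc hX hα he _ t i j z r).trans ?_
  refine Eq.trans ?_ (congrArg φ (coeff_leftFun hsc hX hα he f t i j z r)).symm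
  exact (map_smul φ _ _).symm

end LeftHom

section LeftTriangle

variable {𝒳 : Type u} [MetricSpace 𝒳] {𝒳₀ : Set 𝒳} {sc : ℝ≥0 → 𝒳 → 𝒳} {Δ : ℝ} {X : Set 𝒳} {α : X → C(𝒳, ℝ)} {e : X → ℕ}

theorem asymptoticFunctor_map_asClass {B C : CStar.{u}} (φ : B →⋆ₙₐ[ℂ] C) (f : ℝ≥0 →ᵇ B) :
    asymptoticFunctor.map (φ : B ⟶ C) (asClass f) = asClass (bddMap φ f) := rfl

theorem stable_label {A D : CStar.{u}} (a : A) (f : ℝ≥0 →ᵇ CompactMatrices D) :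
    (compactGood.comp asymptoticGood).label A D (MaxTensor.tmul a (asClass f)) =
      asClass (bddMap (compactGood.label A D) (bddCompL (MaxTensor.tmulL a) f)) := by
  rw [comp_label]
  refine (congrArg _ (asymptoticGood_label (B := compactFunctor.obj D) a f)).trans ?_
  exact asymptoticFunctor_map_asClass (B := tensorObj A (compactFunctor.obj D)) _ _

theorem stable_map_label {A D E : CStar.{u}} (a : A) (f : ℝ≥0 →ᵇ CompactMatrices D)
    (g : ℝ≥0 →ᵇ CompactMatrices E) (l : tensorObj A D ⟶ E)
    (h : ∀ t i j, l (MaxTensor.tmul a ((f t).coeff i j)) = (g t).coeff i j) :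
    (compactFunctor.{u} ⋙ asymptoticFunctor).map l
      ((compactGood.comp asymptoticGood).label A D (MaxTensor.tmul a (asClass f))) =
      asClass g := by
  refine (congrArg _ (stable_label a f)).trans ?_
  change asClass (bddMap (MatrixAlgebra.map l) (bddMap (compactGood.label A D)
    (bddCompL (MaxTensor.tmulL a) f))) = asClass g
  refine asClass_compact_ext fun t i j => ?_
  refine (coeff_bddMap_map _ _ t i j).trans ?_
  refine Eq.trans ?_ (h t i j)
  refine congrArg l ?_
  refine (congrArg (fun m : CompactMatrices (MaxTensor A D) => MatrixAlgebra.coeff m i j)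
    (compactGood_label a (f t))).trans ?_
  exact MatrixAlgebra.coeff_lab a _ i j

theorem comp_comp_label {F G H : CStarEndo.{u}} (gF : GoodStructure F) (gG : GoodStructure G)
    (gH : GoodStructure H) (A B : CStar.{u}) (x : MaxTensor A (H.obj (G.obj (F.obj B)))) :
    (gF.comp (gG.comp gH)).label A B x = H.map ((gF.comp gG).label A B :
      tensorObj A (G.obj (F.obj B)) ⟶ _) (gH.label A (G.obj (F.obj B)) x) :=
  (congrArg (fun φ : H.obj (tensorObj A (G.obj (F.obj B))) ⟶ H.obj (G.obj (F.obj (tensorObj A B))) =>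
    φ (gH.label A (G.obj (F.obj B)) x))
    (H.map_comp ((gG.κ A).app (F.obj B)) (G.map ((gF.κ A).app B)))).symm

theorem isLabeled_of_stable {F G H : CStarEndo.{u}} {gF : GoodStructure F} {gG : GoodStructure G}
    {gH : GoodStructure H} {γ : F ⟶ G ⋙ (H ⋙ (compactFunctor.{u} ⋙ asymptoticFunctor))}
    (f : ∀ B : CStar.{u}, F.obj B → (ℝ≥0 →ᵇ CompactMatrices (H.obj (G.obj B))))
    (hf : ∀ B x, γ.app B x = asClass (f B x))
    (h : ∀ (A B : CStar.{u}) (a : A) (x : F.obj B) t i j, (gG.comp gH).label A B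
      (MaxTensor.tmul a (MatrixAlgebra.coeff (f B x t) i j)) =
      MatrixAlgebra.coeff (f (tensorObj A B) (gF.label A B (MaxTensor.tmul a x)) t) i j) :
    IsLabeled gF (gG.comp (gH.comp (compactGood.comp asymptoticGood))) γ := by
  refine isLabeled_of_tmul fun A B a x => ?_
  refine (congrArg (fun y => (gG.comp (gH.comp (compactGood.comp asymptoticGood))).label A B
    (MaxTensor.tmul a y)) (hf B x)).trans ?_
  refine (comp_comp_label gG gH (compactGood.comp asymptoticGood) A B
    (MaxTensor.tmul a (asClass (f B x)))).trans ?_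
  refine Eq.trans ?_ (hf (tensorObj A B) (gF.label A B (MaxTensor.tmul a x))).symm
  exact stable_map_label (D := H.obj (G.obj B)) (E := H.obj (G.obj (tensorObj A B))) a (f B x)
    (f (tensorObj A B) (gF.label A B (MaxTensor.tmul a x))) ((gG.comp gH).label A B) (h A B a x)

theorem cylinder_relC0_label {A B : CStar.{u}} (a : A) (f : relC0 C(unitInterval, B) 𝒳₀) (z : 𝒳)
    (r : unitInterval) :
    relC0CylinderEval 𝒳₀ (MaxTensor A B) (z, r)
      ((cylinderGood.comp (relC0Good 𝒳₀)).label A B (MaxTensor.tmul a f)) = MaxTensor.tmul a (f.1 z r) := by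
  refine (congrArg (fun g : relC0 C(unitInterval, MaxTensor A B) 𝒳₀ => g.1 z r)
    (congrArg ((relC0Functor 𝒳₀).map (cylinderGood.label A B : tensorObj A (cylinderFunctor.obj B) ⟶ _))
      (relC0Good_label (B := cylinderFunctor.obj B) 𝒳₀ a f))).trans ?_
  exact congrArg (fun g : C(unitInterval, MaxTensor A B) => g r) (cylinderGood_label a (f.1 z))

variable [ProperSpace 𝒳]

/-- The homotopy for the left triangle as a natural transformation. -/
def leftHomotopy (hsc : IsScaling 𝒳₀ sc) (hX : BoundedGeometry X) (hα : IsSquarePartition Δ X α)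
    (he : Function.Injective e) : relC0Functor 𝒳₀ ⟶
      cylinderFunctor ⋙ (relC0Functor 𝒳₀ ⋙ (compactFunctor.{u} ⋙ asymptoticFunctor)) where
  app B := leftHom B hsc hX hα he
  naturality B C φ := NonUnitalStarAlgHom.ext fun (f : relC0 B 𝒳₀) => by
    let φ' : B →⋆ₙₐ[ℂ] C := φ
    exact asClass_leftFun_map hsc hX hα he φ' f

theorem leftHomotopy_app (hsc : IsScaling 𝒳₀ sc) (hX : BoundedGeometry X)
    (hα : IsSquarePartition Δ X α) (he : Function.Injective e) (B : CStar.{u}) (f : relC0 B 𝒳₀) :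
    (leftHomotopy hsc hX hα he).app B f = asClass (leftFun B hsc hX hα he f) := rfl

theorem cylinder_relC0_label_coeff_leftFun (hsc : IsScaling 𝒳₀ sc) (hX : BoundedGeometry X)
    (hα : IsSquarePartition Δ X α) (he : Function.Injective e) {A B : CStar.{u}} (a : A)
    (f : relC0 B 𝒳₀) (t : ℝ≥0) (i j : ℕ) :
    (cylinderGood.comp (relC0Good 𝒳₀)).label A B
      (MaxTensor.tmul a (MatrixAlgebra.coeff (leftFun B hsc hX hα he f t) i j)) =
    MatrixAlgebra.coeff (leftFun (MaxTensor A B) hsc hX hα he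
      (relC0.compL (MaxTensor.tmulL a) f) t) i j := by
  refine relC0Cylinder_ext (B := MaxTensor A B) fun z r => ?_
  refine (cylinder_relC0_label a _ z r).trans ?_
  refine Eq.trans ?_ (coeff_leftFun (B := MaxTensor A B) hsc hX hα he _ t i j z r).symm
  refine (congrArg (MaxTensor.tmul a) (coeff_leftFun hsc hX hα he f t i j z r)).trans ?_
  exact MaxTensor.tmul_smul a _ _

theorem isLabeled_leftHomotopy (hsc : IsScaling 𝒳₀ sc) (hX : BoundedGeometry X)
    (hα : IsSquarePartition Δ X α) (he : Function.Injective e) :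
    IsLabeled (relC0Good 𝒳₀) (cylinderGood.comp ((relC0Good 𝒳₀).comp
      (compactGood.comp asymptoticGood))) (leftHomotopy hsc hX hα he) := by
  refine isLabeled_of_stable (gF := relC0Good 𝒳₀) (gG := cylinderGood) (gH := relC0Good 𝒳₀)
    (fun B f => leftFun B hsc hX hα he f) (fun B f => leftHomotopy_app hsc hX hα he B f)
    fun A B a f t i j => ?_
  refine (cylinder_relC0_label_coeff_leftFun hsc hX hα he a f t i j).trans ?_
  exact congrArg (fun g => MatrixAlgebra.coeff (leftFun (MaxTensor A B) hsc hX hα he g t) i j)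
    (relC0Good_label 𝒳₀ a f).symm

theorem leftHomotopy_zero (hΔ : 0 < Δ) (hsc : IsScaling 𝒳₀ sc) (hX : BoundedGeometry X)
    (hnet : IsSeparatedNet Δ X) (hα : IsSquarePartition Δ X α) (he : Function.Injective e)
    (B : CStar.{u}) :
    (leftHomotopy hsc hX hα he).app B ≫ (relC0Functor 𝒳₀ ⋙ (compactFunctor.{u} ⋙
      asymptoticFunctor)).map (evalAt 0 B) =
      (leftTriangle (unitTransformation 𝒳₀ hΔ hX hnet hα)
        (counitTransformation Δ hsc hX he)).app B :=
  relC0_hom_ext (𝒳₀ := 𝒳₀) (D := B) fun h b => by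
    change asClass (bddMap (MatrixAlgebra.map (relC0EvalMap 𝒳₀ B 0))
        (leftFun B hsc hX hα he (relC0Tensor 𝒳₀ h b))) = counitHom Δ (relC0 B 𝒳₀) hsc hX he
          (relC0Map 𝒳₀ (unitHom 𝒳₀ hΔ hX hnet hα B) (relC0Tensor 𝒳₀ h b))
    refine Eq.trans ?_ (congrArg (counitHom Δ (relC0 B 𝒳₀) hsc hX he)
      (relC0Map_relC0Tensor (unitHom 𝒳₀ hΔ hX hnet hα B) h b)).symm
    refine Eq.trans ?_ (counitHom_tensor hsc hX he h
      (CStarCompletion.mk (unitMatrix 𝒳₀ hX hα b))).symm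
    exact asClass_leftFun_zero hΔ hsc hX hnet hα he h b

theorem leftHomotopy_one (hsc : IsScaling 𝒳₀ sc) (hX : BoundedGeometry X)
    (hα : IsSquarePartition Δ X α) (he : Function.Injective e) (B : CStar.{u}) :
    (leftHomotopy hsc hX hα he).app B ≫ (relC0Functor 𝒳₀ ⋙ (compactFunctor.{u} ⋙
      asymptoticFunctor)).map (evalAt 1 B) = (alphaIotaLeft (relC0Functor 𝒳₀)).app B :=
  NonUnitalStarAlgHom.ext fun (f : relC0 B 𝒳₀) => by
    exact asClass_leftFun_one hsc hX hα he f

/-- The left triangle commutes up to homotopy. -/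
theorem left_triangle_homotopic (hΔ : 0 < Δ) (hsc : IsScaling 𝒳₀ sc) (hX : BoundedGeometry X)
    (hnet : IsSeparatedNet Δ X) (hα : IsSquarePartition Δ X α) (he : Function.Injective e) :
    LabeledHomotopic cylinderGood (relC0Good 𝒳₀)
      ((relC0Good 𝒳₀).comp (compactGood.comp asymptoticGood))
      (leftTriangle (unitTransformation 𝒳₀ hΔ hX hnet hα) (counitTransformation Δ hsc hX he))
      (alphaIotaLeft (relC0Functor 𝒳₀)) :=
  labeledHomotopic_of_endpoints (leftHomotopy hsc hX hα he) (isLabeled_leftHomotopy hsc hX hα he)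
    (leftHomotopy_zero hΔ hsc hX hnet hα he) (leftHomotopy_one hsc hX hα he)

end LeftTriangle

end

/-! ### Dilations of matrices -/

noncomputable section

section Dilation

variable {X : Type*} {B C : Type*} [NonUnitalCStarAlgebra B] [NonUnitalCStarAlgebra C]

/-- The sum of the entries of a matrix, weighted by the rank one matrix `v wᵀ`. -/
def weightedSum (H : Finset X) (v w : X → ℝ) (k : X → X → B) : B :=
  ∑ a ∈ H, ∑ b ∈ H, ((v a * w b : ℝ) : ℂ) • k a b

theorem weightedSum_add (H : Finset X) (v w : X → ℝ) (k l : X → X → B) :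
    weightedSum H v w (fun a b => k a b + l a b) = weightedSum H v w k + weightedSum H v w l := by
  simp only [weightedSum, smul_add, Finset.sum_add_distrib]

theorem weightedSum_smul (H : Finset X) (v w : X → ℝ) (c : ℂ) (k : X → X → B) :
    weightedSum H v w (fun a b => c • k a b) = c • weightedSum H v w k := by
  simp only [weightedSum, Finset.smul_sum, smul_comm c]

theorem weightedSum_zero (H : Finset X) (v w : X → ℝ) :
    weightedSum H v w (fun _ _ => (0 : B)) = 0 := by
  simp only [weightedSum, smul_zero, Finset.sum_const_zero]

theorem weightedSum_star (H : Finset X) (v w : X → ℝ) (k : X → X → B) :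
    weightedSum H v w (fun a b => star (k b a)) = star (weightedSum H w v k) := by
  simp only [weightedSum, star_sum, star_smul, Complex.star_def, Complex.conj_ofReal]
  rw [Finset.sum_comm]
  exact Finset.sum_congr rfl fun a _ => Finset.sum_congr rfl fun b _ => by rw [mul_comm]

theorem weightedSum_eq_zero {H : Finset X} {v w : X → ℝ} (k : X → X → B)
    (h : (∀ a ∈ H, v a = 0) ∨ ∀ b ∈ H, w b = 0) : weightedSum H v w k = 0 :=
  Finset.sum_eq_zero fun a ha => Finset.sum_eq_zero fun b hb => by
    rcases h with h | h
    · rw [h a ha, zero_mul, Complex.ofReal_zero, zero_smul]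
    · rw [h b hb, mul_zero, Complex.ofReal_zero, zero_smul]

theorem weightedSum_mul [DecidableEq X] {ι : Type*} {H : Finset X} (v w : X → ℝ) {Z : Finset ι}
    (u : ι → X → ℝ) (hu : ∀ b ∈ H, ∀ c ∈ H, ∑ z ∈ Z, u z b * u z c = if b = c then 1 else 0)
    (k l : X → X → B) : ∑ z ∈ Z, weightedSum H v (u z) k * weightedSum H (u z) w l =
      weightedSum H v w fun a d => ∑ b ∈ H, k a b * l b d := by
  have e1 : ∀ z, weightedSum H v (u z) k * weightedSum H (u z) w l =
      ∑ a ∈ H, ∑ b ∈ H, ∑ c ∈ H, ∑ d ∈ H,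
        ((u z b * u z c : ℝ) : ℂ) • ((v a * w d : ℝ) : ℂ) • (k a b * l c d) := fun z => by
    simp only [weightedSum, Finset.sum_mul]
    refine Finset.sum_congr rfl fun a _ => Finset.sum_congr rfl fun b _ => ?_
    rw [Finset.mul_sum]
    refine Finset.sum_congr rfl fun c _ => ?_
    rw [Finset.mul_sum]
    refine Finset.sum_congr rfl fun d _ => ?_
    rw [smul_mul_smul_comm, smul_smul, ← Complex.ofReal_mul, ← Complex.ofReal_mul]
    congr 2
    ring
  have e2 : ∀ a, ∀ b ∈ H, ∀ c ∈ H, ∑ z ∈ Z, ∑ d ∈ H,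
      ((u z b * u z c : ℝ) : ℂ) • ((v a * w d : ℝ) : ℂ) • (k a b * l c d) =
      if b = c then ∑ d ∈ H, ((v a * w d : ℝ) : ℂ) • (k a b * l c d) else 0 :=
    fun a b hb c hc => by
      simp only [← Finset.smul_sum]
      rw [← Finset.sum_smul, ← Complex.ofReal_sum, hu b hb c hc]
      split_ifs
      · rw [Complex.ofReal_one, one_smul]
      · rw [Complex.ofReal_zero, zero_smul]
  rw [Finset.sum_congr rfl fun z _ => e1 z, Finset.sum_comm]
  simp only [weightedSum, Finset.smul_sum]
  refine Finset.sum_congr rfl fun a _ => ?_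
  rw [Finset.sum_comm, Finset.sum_comm (s := H) (t := H)
    (f := fun d b => ((v a * w d : ℝ) : ℂ) • (k a b * l b d))]
  refine Finset.sum_congr rfl fun b hb => ?_
  rw [Finset.sum_comm, Finset.sum_congr rfl (e2 a b hb), Finset.sum_ite_eq, if_pos hb]

theorem MatrixAlgebra.coeff_sum {𝓔 : SupportFamily X} {ι : Type*} (s : Finset ι)
    (m : ι → MatrixAlgebra 𝓔 B) (x y : X) :
    coeff (∑ i ∈ s, m i) x y = ∑ i ∈ s, coeff (m i) x y := map_sum (coeffL 𝓔 B x y) m s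

/-- Dilations of finite matrices by an isometry are contractive. -/
theorem matNorm_dilation_le {H P : Type*} [Fintype H] [Fintype P] [DecidableEq H]
    (V : P → ℕ → H → ℝ) {K : ℕ} (hK : ∀ p i a, V p i a ≠ 0 → i < K)
    (hV : ∀ a b, ∑ z ∈ Finset.univ ×ˢ Finset.range K, V z.1 z.2 a * V z.1 z.2 b =
      if a = b then 1 else 0) (k : CStarMatrix H H B) (Q : CStarMatrix P P (CompactMatrices B))
    (hQ : ∀ p q i j, MatrixAlgebra.coeff (Q p q) i j =
      weightedSum Finset.univ (V p i) (V q j) fun a b => k a b) : matNorm Q ≤ matNorm k := by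
  have hV0 : ∀ p i, ¬ i < K → ∀ a, V p i a = 0 := fun p i hi a => by
    by_contra h
    exact hi (hK p i a h)
  have h0 : ∀ (k : CStarMatrix H H B) p q i j,
      weightedSum Finset.univ (V p i) (V q j) (fun a b => k a b) ≠ 0 → i < K ∧ j < K :=
    fun k p q i j h => by
      by_contra h'
      refine h (weightedSum_eq_zero _ ?_)
      rcases not_and_or.1 h' with h' | h'
      · exact .inl fun a _ => hV0 p i h' a
      · exact .inr fun a _ => hV0 q j h' a
  let D : CStarMatrix H H B → P → P → CompactMatrices B := fun k p q => blockMatrix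
    (fun i j => weightedSum Finset.univ (V p i) (V q j) fun a b => k a b) K (h0 k p q)
  have hD : ∀ k p q i j, MatrixAlgebra.coeff (D k p q) i j =
      weightedSum Finset.univ (V p i) (V q j) fun a b => k a b :=
    fun k p q i j => coeff_blockMatrix _ _ _ i j
  let θ : CStarMatrix H H B →⋆ₙₐ[ℂ] CStarMatrix P P (CompactMatrices B) :=
    { toFun := fun k => CStarMatrix.ofMatrix (D k)
      map_smul' := fun c k => by
        ext p q
        refine MatrixAlgebra.ext_coeff fun i j => (hD _ p q i j).trans ?_
        refine Eq.trans ?_ (MatrixAlgebra.coeff_smul c (D k p q) i j).symm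
        rw [hD]
        exact weightedSum_smul _ _ _ c _
      map_zero' := by
        ext p q
        refine MatrixAlgebra.ext_coeff fun i j => (hD _ p q i j).trans ?_
        refine Eq.trans ?_ (MatrixAlgebra.coeff_zero i j).symm
        exact weightedSum_zero _ _ _
      map_add' := fun k l => by
        ext p q
        refine MatrixAlgebra.ext_coeff fun i j => (hD _ p q i j).trans ?_
        refine Eq.trans ?_ (MatrixAlgebra.coeff_add (D k p q) (D l p q) i j).symm
        rw [hD, hD]
        exact weightedSum_add _ _ _ _ _
      map_mul' := fun k l => by
        ext p q
        refine MatrixAlgebra.ext_coeff fun i j => (hD _ p q i j).trans ?_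
        have e1 : (CStarMatrix.ofMatrix (D k) * CStarMatrix.ofMatrix (D l)) p q =
            ∑ r, D k p r * D l r q := rfl
        rw [e1, MatrixAlgebra.coeff_sum]
        have e2 : ∀ r, MatrixAlgebra.coeff (D k p r * D l r q) i j = ∑ n ∈ Finset.range K,
            weightedSum Finset.univ (V p i) (V r n) (fun a b => k a b) *
              weightedSum Finset.univ (V r n) (V q j) (fun a b => l a b) := fun r => by
          rw [MatrixAlgebra.coeff_mul_eq_sum _ _ i j (Finset.range K) fun n hn => ?_]
          · simp only [hD]
          · rw [hD] at hn
            exact Finset.mem_range.2 (h0 k p r i n hn).2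
        simp only [e2]
        rw [← Finset.sum_product' Finset.univ (Finset.range K) fun r n =>
          weightedSum Finset.univ (V p i) (V r n) (fun a b => k a b) *
              weightedSum Finset.univ (V r n) (V q j) (fun a b => l a b)]
        exact (weightedSum_mul (V p i) (V q j) (fun z : P × ℕ => V z.1 z.2)
          (fun b _ c _ => hV b c) (fun a b => k a b) fun a b => l a b).symm
      map_star' := fun k => by
        ext p q
        refine MatrixAlgebra.ext_coeff fun i j => (hD _ p q i j).trans ?_
        refine Eq.trans ?_ (MatrixAlgebra.coeff_star (D k q p) i j).symm
        rw [hD]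
        exact weightedSum_star _ _ _ _ }
  have e : Q = θ k := by
    ext p q
    exact MatrixAlgebra.ext_coeff fun i j => (hQ p q i j).trans (hD k p q i j).symm
  rw [e]
  exact matNorm_hom_le θ k

end Dilation

end

/-! ### The isometries for the right triangle -/

noncomputable section

/-- The reparametrized time, which runs backwards to `0` in the first half of the unit interval. -/
def halfTime (r : unitInterval) (t : ℝ≥0) : ℝ≥0 := Real.toNNReal (1 - 2 * r) * t

theorem continuous_halfTime : Continuous fun p : ℝ≥0 × unitInterval => halfTime p.2 p.1 := by
  unfold halfTime
  exact (continuous_real_toNNReal.comp (by fun_prop)).mul continuous_fst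

theorem halfTime_zero (t : ℝ≥0) : halfTime 0 t = t := by simp [halfTime]

theorem halfTime_le (r : unitInterval) (t : ℝ≥0) : halfTime r t ≤ t :=
  mul_le_of_le_one_left t.2 (Real.toNNReal_le_one.2 (by have := r.2.1; linarith))

theorem halfTime_eq_zero {r : unitInterval} (h : pathD r ≠ 0) (t : ℝ≥0) : halfTime r t = 0 := by
  rw [halfTime, Real.toNNReal_of_nonpos, zero_mul]
  by_contra! h'
  refine h ?_
  have : pathAngle' r = 0 := max_eq_left (by nlinarith [Real.pi_pos])
  rw [pathD, this, Real.sin_zero]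

section RightVec

variable {𝒳 : Type*} [MetricSpace 𝒳] {𝒳₀ : Set 𝒳} {sc : ℝ≥0 → 𝒳 → 𝒳} {Δ : ℝ} {X : Set 𝒳}
  {α : X → C(𝒳, ℝ)} {e : X → ℕ} {B : Type*} [NonUnitalCStarAlgebra B]

variable (sc α e) in
open Classical in
/-- The coefficients of the isometry `ℓ²(X) → ℓ²(X × ℕ)`. -/
def rightVec (r : unitInterval) (t : ℝ≥0) (x : X) (i : ℕ) (a : X) : ℝ :=
  α x (sc (halfTime r t) a) * pathU r i (e a) + if x = a ∧ i = 0 then pathD r else 0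

theorem dist_lt_of_rightVec_ne_zero (hΔ : 0 < Δ) (hsc : IsScaling 𝒳₀ sc)
    (hα : IsSquarePartition Δ X α) {r : unitInterval} {t : ℝ≥0} {x : X} {i : ℕ} {a : X}
    (h : rightVec sc α e r t x i a ≠ 0) : dist (sc (halfTime r t) a) x < Δ := by
  by_cases h1 : α x (sc (halfTime r t) a) = 0
  · rw [rightVec, h1, zero_mul, zero_add] at h
    have h2 : x = a ∧ i = 0 := by
      by_contra h'
      exact h (if_neg h')
    rw [if_pos h2] at h
    rw [halfTime_eq_zero h, hsc.zero, h2.1, dist_self]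
    exact hΔ
  · rw [dist_comm]
    exact hα.dist_lt h1

theorem le_of_rightVec_ne_zero {r : unitInterval} {t : ℝ≥0} {x : X} {i : ℕ} {a : X}
    (h : rightVec sc α e r t x i a ≠ 0) : i < e a + 2 := by
  by_contra! h'
  refine h ?_
  rw [rightVec, pathU_eq_zero r (by lia), mul_zero, if_neg (by lia), add_zero]

theorem continuous_rightVec (hsc : IsScaling 𝒳₀ sc) (x : X) (i : ℕ) (a : X) :
    Continuous fun p : ℝ≥0 × unitInterval => rightVec sc α e p.2 p.1 x i a := by
  unfold rightVec
  refine Continuous.add (Continuous.mul ?_ ((continuous_pathU i (e a)).comp continuous_snd)) ?_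
  · exact (α x).continuous.comp (hsc.continuous.comp (continuous_const.prodMk continuous_halfTime))
  · split_ifs
    · exact continuous_pathD.comp continuous_snd
    · exact continuous_const

theorem rightVec_mul_rightVec (r : unitInterval) (t : ℝ≥0) (x : X) (i : ℕ) (a b : X) :
    rightVec sc α e r t x i a * rightVec sc α e r t x i b =
      α x (sc (halfTime r t) a) * α x (sc (halfTime r t) b) * (pathU r i (e a) * pathU r i (e b)) +
        (open Classical in if a = b then (if x = a then (if i = 0 then pathD r ^ 2 else 0) else 0)
          else 0) := by
  classical
  unfold rightVec
  by_cases hi : i = 0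
  · subst hi
    by_cases hD : pathD r = 0
    · simp only [hD, ite_self, add_zero, zero_pow two_ne_zero]
      ring
    · have hU : ∀ n, pathU r 0 n = 0 := fun n =>
        (mul_eq_zero.1 (pathD_mul_pathU_zero r n)).resolve_left hD
      simp only [hU, mul_zero, zero_add, and_true, if_true]
      by_cases hxa : x = a
      · subst hxa
        by_cases hxb : x = b
        · simp only [if_pos hxb, if_true, sq]
        · simp only [if_neg hxb, mul_zero]
      · simp only [if_neg hxa, zero_mul, ite_self]
  · simp only [hi, and_false, if_false, ite_self, add_zero]
    ring

theorem sum_rightVec_mul_rightVec (hα : IsSquarePartition Δ X α) (he : Function.Injective e)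
    (r : unitInterval) (t : ℝ≥0) {a b : X} {P : Finset X} {K : ℕ}
    (hP : ∀ x, α x (sc (halfTime r t) a) ≠ 0 → x ∈ P) (ha : a ∈ P) (hKa : e a + 2 ≤ K)
    (hKb : e b + 2 ≤ K) : ∑ z ∈ P ×ˢ Finset.range K,
      rightVec sc α e r t z.1 z.2 a * rightVec sc α e r t z.1 z.2 b =
      open Classical in if a = b then 1 else 0 := by
  classical
  simp only [rightVec_mul_rightVec]
  rw [Finset.sum_add_distrib, Finset.sum_product, Finset.sum_product]
  have e1 : ∀ x, ∑ i ∈ Finset.range K, α x (sc (halfTime r t) a) * α x (sc (halfTime r t) b) *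
      (pathU r i (e a) * pathU r i (e b)) = if a = b then
        α x (sc (halfTime r t) a) ^ 2 * (1 - pathD r ^ 2) else 0 := fun x => by
    rw [← Finset.mul_sum, sum_pathU_mul_pathU r (by lia) (by lia)]
    by_cases hab : a = b
    · subst hab
      rw [if_pos rfl, if_pos rfl, sq (α x _)]
    · rw [if_neg hab, if_neg fun h => hab (he h), mul_zero]
  simp only [e1]
  by_cases hab : a = b
  · simp only [if_pos hab]
    rw [← Finset.sum_mul, hα.sum_eq_one hP]
    have e2 : ∀ x ∈ P, ∑ i ∈ Finset.range K, (if x = a then (if i = 0 then pathD r ^ 2 else 0) else 0) =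
        if a = x then pathD r ^ 2 else 0 := fun x _ => by
      by_cases hx : x = a
      · simp only [if_pos hx, if_pos hx.symm]
        rw [Finset.sum_ite_eq', if_pos (Finset.mem_range.2 (by lia))]
      · simp only [if_neg hx, if_neg (Ne.symm hx), Finset.sum_const_zero]
    rw [Finset.sum_congr rfl e2, Finset.sum_ite_eq, if_pos ha]
    ring
  · simp only [if_neg hab, Finset.sum_const_zero, add_zero]

variable (Δ) in
/-- The points of `X` which are scaled into the ball of radius `Δ` around `x` at a time `≤ T`. -/
def rightNear (hsc : IsScaling 𝒳₀ sc) (hX : BoundedGeometry X) (T : ℝ≥0) (x : X) : Finset X :=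
  (hX.finite_of_isBounded (hsc.bounded (Metric.ball (x : 𝒳) Δ) T Metric.isBounded_ball)).toFinset

theorem mem_rightNear_of_ne_zero (hΔ : 0 < Δ) (hsc : IsScaling 𝒳₀ sc) (hX : BoundedGeometry X)
    (hα : IsSquarePartition Δ X α) {r : unitInterval} {t T : ℝ≥0} (htT : t ≤ T) {x : X} {i : ℕ}
    {a : X} (h : rightVec sc α e r t x i a ≠ 0) : a ∈ rightNear Δ hsc hX T x := by
  refine (Set.Finite.mem_toFinset _).2 ?_
  refine Set.mem_iUnion₂.2 ⟨halfTime r t, (halfTime_le r t).trans htT, ?_⟩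
  exact dist_lt_of_rightVec_ne_zero hΔ hsc hα h

variable (sc α e) in
/-- The coefficients of the dilation of a matrix. -/
def rightCoeff (k : X → X → B) (r : unitInterval) (t : ℝ≥0) (x y : X) (i j : ℕ) : B :=
  ∑ᶠ p : X × X, ((rightVec sc α e r t x i p.1 * rightVec sc α e r t y j p.2 : ℝ) : ℂ) • k p.1 p.2

theorem rightCoeff_eq {k : X → X → B} {r : unitInterval} {t : ℝ≥0} {x y : X} {i j : ℕ}
    {H : Finset X} (hH : ∀ a b, rightVec sc α e r t x i a ≠ 0 → rightVec sc α e r t y j b ≠ 0 →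
      k a b ≠ 0 → a ∈ H ∧ b ∈ H) : rightCoeff sc α e k r t x y i j =
        weightedSum H (rightVec sc α e r t x i) (rightVec sc α e r t y j) k := by
  rw [rightCoeff, finsum_eq_sum_of_support_subset (s := H ×ˢ H), Finset.sum_product, weightedSum]
  rintro ⟨a, b⟩ hp
  have h1 := left_ne_zero_of_smul hp
  have h2 := right_ne_zero_of_smul hp
  have h3 := Complex.ofReal_ne_zero.1 h1
  obtain ⟨h4, h5⟩ := hH a b (left_ne_zero_of_mul h3) (right_ne_zero_of_mul h3) h2
  exact Finset.mem_coe.2 (Finset.mem_product.2 ⟨h4, h5⟩)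

open Classical in
theorem rightCoeff_eq_near (hΔ : 0 < Δ) (hsc : IsScaling 𝒳₀ sc) (hX : BoundedGeometry X)
    (hα : IsSquarePartition Δ X α) (k : X → X → B) (r : unitInterval) {t T : ℝ≥0} (htT : t ≤ T)
    (x y : X) (i j : ℕ) : rightCoeff sc α e k r t x y i j =
      weightedSum (rightNear Δ hsc hX T x ∪ rightNear Δ hsc hX T y) (rightVec sc α e r t x i)
        (rightVec sc α e r t y j) k :=
  rightCoeff_eq fun _ _ h h' _ =>
    ⟨Finset.mem_union_left _ (mem_rightNear_of_ne_zero hΔ hsc hX hα htT h),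
      Finset.mem_union_right _ (mem_rightNear_of_ne_zero hΔ hsc hX hα htT h')⟩

theorem exists_of_rightCoeff_ne_zero {k : X → X → B} {r : unitInterval} {t : ℝ≥0} {x y : X}
    {i j : ℕ} (h : rightCoeff sc α e k r t x y i j ≠ 0) : ∃ a b, rightVec sc α e r t x i a ≠ 0 ∧
      rightVec sc α e r t y j b ≠ 0 ∧ k a b ≠ 0 := by
  by_contra! h'
  refine h (finsum_eq_zero_of_forall_eq_zero fun p => ?_)
  by_contra hp
  have h3 := Complex.ofReal_ne_zero.1 (left_ne_zero_of_smul hp)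
  exact right_ne_zero_of_smul hp (h' p.1 p.2 (left_ne_zero_of_mul h3) (right_ne_zero_of_mul h3))

theorem continuous_rightCoeff (hΔ : 0 < Δ) (hsc : IsScaling 𝒳₀ sc) (hX : BoundedGeometry X)
    (hα : IsSquarePartition Δ X α) (k : X → X → B) (x y : X) (i j : ℕ) :
    Continuous fun p : ℝ≥0 × unitInterval => rightCoeff sc α e k p.2 p.1 x y i j := by
  classical
  refine continuous_iff_continuousAt.2 fun p₀ => ?_
  have h1 : Continuous fun p : ℝ≥0 × unitInterval =>
      weightedSum (rightNear Δ hsc hX (p₀.1 + 1) x ∪ rightNear Δ hsc hX (p₀.1 + 1) y)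
        (rightVec sc α e p.2 p.1 x i) (rightVec sc α e p.2 p.1 y j) k := by
    unfold weightedSum
    refine continuous_finsetSum _ fun a _ => continuous_finsetSum _ fun b _ => ?_
    exact (Complex.continuous_ofReal.comp ((continuous_rightVec hsc x i a).mul
      (continuous_rightVec hsc y j b))).smul continuous_const
  refine h1.continuousAt.congr ?_
  have h2 : ∀ᶠ p : ℝ≥0 × unitInterval in 𝓝 p₀, p.1 < p₀.1 + 1 :=
    continuous_fst.continuousAt.eventually (Iio_mem_nhds (lt_add_one p₀.1))
  filter_upwards [h2] with p hp
  exact (rightCoeff_eq_near hΔ hsc hX hα k p.2 hp.le x y i j).symm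

theorem matNorm_rightCoeff_le (hΔ : 0 < Δ) (hsc : IsScaling 𝒳₀ sc) (hX : BoundedGeometry X)
    (hα : IsSquarePartition Δ X α) (he : Function.Injective e) {k : X → X → B} {c : ℝ}
    (hc : ∀ H, matNorm (cornerFn H k) ≤ c) (r : unitInterval) (t : ℝ≥0) {F : Finset X}
    (Q : CStarMatrix F F (CompactMatrices B))
    (hQ : ∀ x y i j, MatrixAlgebra.coeff (Q x y) i j = rightCoeff sc α e k r t x y i j) :
    matNorm Q ≤ c := by
  classical
  let H : Finset X := F.biUnion (rightNear Δ hsc hX t)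
  let P : Finset X := (F ∪ H) ∪ H.biUnion fun a =>
    (hα.finite_support hX (sc (halfTime r t) a)).toFinset
  obtain ⟨K, hK⟩ : ∃ K : ℕ, ∀ a ∈ H, e a + 2 ≤ K :=
    ⟨H.sup (fun a => e a + 2), fun a ha => Finset.le_sup (f := fun a => e a + 2) ha⟩
  have hFP : F ⊆ P := Finset.subset_union_left.trans Finset.subset_union_left
  let V : P → ℕ → H → ℝ := fun x i a => rightVec sc α e r t x i a
  have hVK : ∀ p i a, V p i a ≠ 0 → i < K := fun p i a h =>
    (le_of_rightVec_ne_zero h).trans_le (hK a a.2)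
  let D : P → P → ℕ → ℕ → B := fun p q i j =>
    weightedSum Finset.univ (V p i) (V q j) fun a b => cornerFn H k a b
  have hD0 : ∀ p q i j, D p q i j ≠ 0 → i < K ∧ j < K := fun p q i j h => by
    by_contra h'
    refine h (weightedSum_eq_zero _ ?_)
    rcases not_and_or.1 h' with h' | h'
    · exact .inl fun a _ => by by_contra h2; exact h' (hVK p i a h2)
    · exact .inr fun a _ => by by_contra h2; exact h' (hVK q j a h2)
  let Q' : CStarMatrix P P (CompactMatrices B) :=
    CStarMatrix.ofMatrix fun p q => blockMatrix (D p q) K (hD0 p q)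
  have hQ' : matNorm Q' ≤ matNorm (cornerFn H k) := by
    refine matNorm_dilation_le V hVK (fun a b => ?_) (cornerFn H k) Q' fun p q i j =>
      coeff_blockMatrix _ _ _ i j
    have h1 := sum_rightVec_mul_rightVec (sc := sc) hα he r t (a := (a : X)) (b := (b : X))
      (P := P) (K := K)
      (fun x hx => Finset.mem_union_right _ (Finset.mem_biUnion.2 ⟨a, a.2,
        (Set.Finite.mem_toFinset _).2 hx⟩))
      (Finset.mem_union_left _ (Finset.mem_union_right _ a.2)) (hK a a.2) (hK b b.2)
    rw [Finset.sum_product] at h1 ⊢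
    refine (Finset.sum_coe_sort P fun x => ∑ i ∈ Finset.range K,
      rightVec sc α e r t x i a * rightVec sc α e r t x i b).trans (h1.trans ?_)
    simp only [Subtype.ext_iff]
  have e1 : Q = CStarMatrix.ofMatrix fun x y : F => Q' ⟨x, hFP x.2⟩ ⟨y, hFP y.2⟩ := by
    ext x y
    refine MatrixAlgebra.ext_coeff fun i j => (hQ x y i j).trans
      (Eq.trans ?_ (coeff_blockMatrix _ _ _ i j).symm)
    rw [rightCoeff_eq (H := H) fun a b h h' _ =>
      ⟨Finset.mem_biUnion.2 ⟨x, x.2, mem_rightNear_of_ne_zero hΔ hsc hX hα le_rfl h⟩,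
        Finset.mem_biUnion.2 ⟨y, y.2, mem_rightNear_of_ne_zero hΔ hsc hX hα le_rfl h'⟩⟩]
    simp only [D, V, weightedSum]
    refine (Finset.sum_coe_sort H fun a => ∑ b ∈ H, ((rightVec sc α e r t x i a *
      rightVec sc α e r t y j b : ℝ) : ℂ) • k a b).symm.trans ?_
    refine Finset.sum_congr rfl fun a _ => ?_
    exact (Finset.sum_coe_sort H fun b => ((rightVec sc α e r t x i a *
      rightVec sc α e r t y j b : ℝ) : ℂ) • k a b).symm
  rw [e1]
  exact (matNorm_submatrix_le (fun x : F => (⟨x, hFP x.2⟩ : P))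
    (fun x y h => Subtype.ext (congrArg (fun z : P => (z : X)) h)) Q').trans (hQ'.trans (hc H))

end RightVec

end

/-! ### The homotopy for the right triangle -/

noncomputable section

section StableEval

variable {B : Type*} [NonUnitalCStarAlgebra B]

variable (B) in
/-- Evaluation at a point of `[0,∞) × [0,1]`. -/
def stableEval (p : ℝ≥0 × unitInterval) :
    CStarHom (ℝ≥0 →ᵇ CompactMatrices C(unitInterval, B)) (CompactMatrices B) where
  toFun f := MatrixAlgebra.map (cylinderEval B p.2) (f p.1)
  map_smul' c f := map_smul (MatrixAlgebra.map (cylinderEval B p.2)) c (f p.1)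
  map_zero' := map_zero (MatrixAlgebra.map (cylinderEval B p.2))
  map_add' f g := map_add (MatrixAlgebra.map (cylinderEval B p.2)) (f p.1) (g p.1)
  map_mul' f g := map_mul (MatrixAlgebra.map (cylinderEval B p.2)) (f p.1) (g p.1)
  map_star' f := map_star (MatrixAlgebra.map (cylinderEval B p.2)) (f p.1)

theorem coeff_stableEval (p : ℝ≥0 × unitInterval) (f : ℝ≥0 →ᵇ CompactMatrices C(unitInterval, B))
    (i j : ℕ) : MatrixAlgebra.coeff (stableEval B p f) i j =
      MatrixAlgebra.coeff (f p.1) i j p.2 := MatrixAlgebra.coeff_map _ _ i j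

theorem stable_ext {f g : ℝ≥0 →ᵇ CompactMatrices C(unitInterval, B)}
    (h : ∀ p i j, MatrixAlgebra.coeff (stableEval B p f) i j =
      MatrixAlgebra.coeff (stableEval B p g) i j) : f = g :=
  BoundedContinuousFunction.ext fun t => MatrixAlgebra.ext_coeff fun i j =>
    ContinuousMap.ext fun r => by
      rw [← coeff_stableEval (t, r) f, h, coeff_stableEval]

theorem stableEval_separating (f : ℝ≥0 →ᵇ CompactMatrices C(unitInterval, B))
    (h : ∀ p, stableEval B p f = 0) : f = 0 :=
  stable_ext fun p i j => by rw [h p, map_zero]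

end StableEval

theorem weightedSum_congr {X B : Type*} [NonUnitalCStarAlgebra B] {H : Finset X} {v w : X → ℝ}
    {k l : X → X → B} (h : ∀ a ∈ H, ∀ b ∈ H, v a ≠ 0 → w b ≠ 0 → k a b = l a b) :
    weightedSum H v w k = weightedSum H v w l :=
  Finset.sum_congr rfl fun a ha => Finset.sum_congr rfl fun b hb => by
    by_cases hv : v a = 0
    · rw [hv, zero_mul, Complex.ofReal_zero, zero_smul, zero_smul]
    by_cases hw : w b = 0
    · rw [hw, mul_zero, Complex.ofReal_zero, zero_smul, zero_smul]
    rw [h a ha b hb hv hw]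

theorem IsScaling.exists_dist_le {𝒳 : Type*} [MetricSpace 𝒳] {𝒳₀ : Set 𝒳} {sc : ℝ≥0 → 𝒳 → 𝒳}
    (hsc : IsScaling 𝒳₀ sc) (R : ℝ) :
    ∃ C : ℝ, ∀ t z w, dist z w ≤ R → dist (sc t z) (sc t w) ≤ C := by
  obtain ⟨ρ, h1, h2, h3⟩ := hsc.contracting
  obtain ⟨C, hC⟩ := (h3 R.toNNReal).1
  refine ⟨C, fun t z w h => ?_⟩
  have h4 : nndist z w ≤ R.toNNReal := by
    rw [← NNReal.coe_le_coe, coe_nndist]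
    exact h.trans (Real.le_coe_toNNReal R)
  rw [← coe_nndist, NNReal.coe_le_coe]
  exact (h1 t z w).trans ((h2 t h4).trans (hC ⟨t, rfl⟩))

section RightHom

variable {𝒳 : Type*} [MetricSpace 𝒳] {𝒳₀ : Set 𝒳} {sc : ℝ≥0 → 𝒳 → 𝒳} {Δ : ℝ} {X : Set 𝒳}
  {α : X → C(𝒳, ℝ)} {e : X → ℕ} {B : Type*} [NonUnitalCStarAlgebra B]

open Classical in
variable (Δ e) in
/-- A bound for the size of the matrices `rightBlock`. -/
def rightHeight (hsc : IsScaling 𝒳₀ sc) (hX : BoundedGeometry X) (T : ℝ≥0) (x y : X) : ℕ :=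
  (rightNear Δ hsc hX T x ∪ rightNear Δ hsc hX T y).sup fun a => e a + 2

theorem lt_rightHeight (hΔ : 0 < Δ) (hsc : IsScaling 𝒳₀ sc) (hX : BoundedGeometry X)
    (hα : IsSquarePartition Δ X α) {k : X → X → B} {r : unitInterval} {t T : ℝ≥0} (htT : t ≤ T)
    {x y : X} {i j : ℕ} (h : rightCoeff sc α e k r t x y i j ≠ 0) :
    i < rightHeight Δ e hsc hX T x y ∧ j < rightHeight Δ e hsc hX T x y := by
  classical
  obtain ⟨a, b, ha, hb, -⟩ := exists_of_rightCoeff_ne_zero h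
  exact ⟨(le_of_rightVec_ne_zero ha).trans_le (Finset.le_sup (f := fun a => e a + 2)
      (Finset.mem_union_left _ (mem_rightNear_of_ne_zero hΔ hsc hX hα htT ha))),
    (le_of_rightVec_ne_zero hb).trans_le (Finset.le_sup (f := fun a => e a + 2)
      (Finset.mem_union_right _ (mem_rightNear_of_ne_zero hΔ hsc hX hα htT hb)))⟩

/-- The coefficients of the dilation as functions on the unit interval. -/
def rightCylinder (hΔ : 0 < Δ) (hsc : IsScaling 𝒳₀ sc) (hX : BoundedGeometry X)
    (hα : IsSquarePartition Δ X α) (k : X → X → B) (x y : X) (i j : ℕ) :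
    C(ℝ≥0, C(unitInterval, B)) :=
  ContinuousMap.curry ⟨fun p : ℝ≥0 × unitInterval => rightCoeff sc α e k p.2 p.1 x y i j,
    continuous_rightCoeff hΔ hsc hX hα k x y i j⟩

theorem rightCylinder_ne_zero (hΔ : 0 < Δ) (hsc : IsScaling 𝒳₀ sc) (hX : BoundedGeometry X)
    (hα : IsSquarePartition Δ X α) {k : X → X → B} {t T : ℝ≥0} (htT : t ≤ T) {x y : X} {i j : ℕ}
    (h : rightCylinder (e := e) hΔ hsc hX hα k x y i j t ≠ 0) :
    i < rightHeight Δ e hsc hX T x y ∧ j < rightHeight Δ e hsc hX T x y := by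
  obtain ⟨r, hr⟩ := DFunLike.ne_iff.1 h
  exact lt_rightHeight hΔ hsc hX hα htT hr

/-- The entries of the dilation at the time `t`. -/
def rightBlock (hΔ : 0 < Δ) (hsc : IsScaling 𝒳₀ sc) (hX : BoundedGeometry X)
    (hα : IsSquarePartition Δ X α) (e : X → ℕ) (k : X → X → B) (x y : X) (t : ℝ≥0) :
    CompactMatrices C(unitInterval, B) :=
  blockMatrix (fun i j => rightCylinder (e := e) hΔ hsc hX hα k x y i j t)
    (rightHeight Δ e hsc hX t x y) fun _ _ h => rightCylinder_ne_zero hΔ hsc hX hα le_rfl h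

theorem coeff_rightBlock (hΔ : 0 < Δ) (hsc : IsScaling 𝒳₀ sc) (hX : BoundedGeometry X)
    (hα : IsSquarePartition Δ X α) (k : X → X → B) (x y : X) (t : ℝ≥0) (i j : ℕ) :
    MatrixAlgebra.coeff (rightBlock hΔ hsc hX hα e k x y t) i j =
      rightCylinder (e := e) hΔ hsc hX hα k x y i j t := coeff_blockMatrix _ _ _ i j

theorem continuous_rightBlock (hΔ : 0 < Δ) (hsc : IsScaling 𝒳₀ sc) (hX : BoundedGeometry X)
    (hα : IsSquarePartition Δ X α) (k : X → X → B) (x y : X) :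
    Continuous (rightBlock hΔ hsc hX hα e k x y) := by
  refine continuous_of_block (fun t₀ => ⟨rightHeight Δ e hsc hX (t₀ + 1) x y, ?_⟩) fun i j => ?_
  · filter_upwards [Iio_mem_nhds (lt_add_one t₀)] with t ht i j h
    rw [coeff_rightBlock] at h
    exact rightCylinder_ne_zero hΔ hsc hX hα (le_of_lt ht) h
  · simp only [coeff_rightBlock]
    exact (rightCylinder (e := e) hΔ hsc hX hα k x y i j).continuous

theorem norm_rightBlock_le (hΔ : 0 < Δ) (hsc : IsScaling 𝒳₀ sc) (hX : BoundedGeometry X)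
    (hα : IsSquarePartition Δ X α) (he : Function.Injective e) {k : X → X → B} {c : ℝ}
    (hc : ∀ H, matNorm (cornerFn H k) ≤ c) (x y : X) (t : ℝ≥0) :
    ‖rightBlock hΔ hsc hX hα e k x y t‖ ≤ c := by
  classical
  refine norm_le_of_separating
    (fun r : unitInterval => MatrixAlgebra.map (𝓔 := finiteSupports ℕ) (cylinderEval B r))
    (fun m hm => MatrixAlgebra.ext_coeff fun i j => ContinuousMap.ext fun r => ?_)
    ((matNorm_nonneg _).trans (hc ∅)) fun r => ?_
  · have h := congrArg (fun m => MatrixAlgebra.coeff m i j) (hm r)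
    simp only [MatrixAlgebra.coeff_map, MatrixAlgebra.coeff_zero] at h
    rw [MatrixAlgebra.coeff_zero]
    exact h
  · let Q : CStarMatrix ({x, y} : Finset X) ({x, y} : Finset X) (CompactMatrices B) :=
      CStarMatrix.ofMatrix fun a b => MatrixAlgebra.map (cylinderEval B r)
        (rightBlock hΔ hsc hX hα e k a b t)
    have hQ : matNorm Q ≤ c := matNorm_rightCoeff_le hΔ hsc hX hα he hc r t Q fun a b i j => by
      refine (MatrixAlgebra.coeff_map _ _ i j).trans ?_
      rw [coeff_rightBlock]
      rfl
    exact (norm_entry_le_matNorm Q ⟨x, by simp⟩ ⟨y, by simp⟩).trans hQ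

/-- The entries of the dilation of an element of the uniform Roe algebra. -/
def rightEntry (hΔ : 0 < Δ) (hsc : IsScaling 𝒳₀ sc) (hX : BoundedGeometry X)
    (hα : IsSquarePartition Δ X α) (he : Function.Injective e) (m : UniformRoe hX B) (x y : X) :
    ℝ≥0 →ᵇ CompactMatrices C(unitInterval, B) :=
  BoundedContinuousFunction.ofNormedAddCommGroup
    (rightBlock hΔ hsc hX hα e (MatrixAlgebra.coeff m) x y)
    (continuous_rightBlock hΔ hsc hX hα _ x y) ‖m‖
    (norm_rightBlock_le hΔ hsc hX hα he (MatrixAlgebra.matNorm_cornerFn_coeff_le m) x y)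

theorem coeff_rightEntry (hΔ : 0 < Δ) (hsc : IsScaling 𝒳₀ sc) (hX : BoundedGeometry X)
    (hα : IsSquarePartition Δ X α) (he : Function.Injective e) (m : UniformRoe hX B) (x y : X)
    (t : ℝ≥0) (i j : ℕ) (r : unitInterval) :
    MatrixAlgebra.coeff (rightEntry hΔ hsc hX hα he m x y t) i j r =
      rightCoeff sc α e (MatrixAlgebra.coeff m) r t x y i j :=
  congrArg (fun f : C(unitInterval, B) => f r)
    (coeff_rightBlock hΔ hsc hX hα (MatrixAlgebra.coeff m) x y t i j)

theorem coeff_stableEval_rightEntry (hΔ : 0 < Δ) (hsc : IsScaling 𝒳₀ sc) (hX : BoundedGeometry X)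
    (hα : IsSquarePartition Δ X α) (he : Function.Injective e) (m : UniformRoe hX B) (x y : X)
    (p : ℝ≥0 × unitInterval) (i j : ℕ) :
    MatrixAlgebra.coeff (stableEval B p (rightEntry hΔ hsc hX hα he m x y)) i j =
      rightCoeff sc α e (MatrixAlgebra.coeff m) p.2 p.1 x y i j :=
  (coeff_stableEval p _ i j).trans (coeff_rightEntry hΔ hsc hX hα he m x y p.1 i j p.2)

theorem exists_of_rightEntry_ne_zero (hΔ : 0 < Δ) (hsc : IsScaling 𝒳₀ sc)
    (hX : BoundedGeometry X) (hα : IsSquarePartition Δ X α) (he : Function.Injective e)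
    {m : UniformRoe hX B} {x y : X} (h : rightEntry hΔ hsc hX hα he m x y ≠ 0) :
    ∃ (τ : ℝ≥0) (a b : X), dist (sc τ a) x < Δ ∧ dist (sc τ b) y < Δ ∧
      MatrixAlgebra.coeff m a b ≠ 0 := by
  by_contra! h'
  refine h (stable_ext fun p i j => ?_)
  rw [map_zero, MatrixAlgebra.coeff_zero, coeff_stableEval_rightEntry]
  by_contra h2
  obtain ⟨a, b, ha, hb, hab⟩ := exists_of_rightCoeff_ne_zero h2
  exact hab (h' _ a b (dist_lt_of_rightVec_ne_zero hΔ hsc hα ha)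
    (dist_lt_of_rightVec_ne_zero hΔ hsc hα hb))

theorem exists_dist_le_of_rightEntry_ne_zero (hΔ : 0 < Δ) (hsc : IsScaling 𝒳₀ sc)
    (hX : BoundedGeometry X) (hα : IsSquarePartition Δ X α) (he : Function.Injective e)
    (M : ControlledMatrix (finitePropagation hX) B) : ∃ R : ℝ, ∀ x y,
      rightEntry hΔ hsc hX hα he (CStarCompletion.mk M) x y ≠ 0 → dist x y ≤ R := by
  obtain ⟨R, hR⟩ := M.controlled
  obtain ⟨C, hC⟩ := hsc.exists_dist_le R
  refine ⟨Δ + C + Δ, fun x y h => ?_⟩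
  obtain ⟨τ, a, b, ha, hb, hab⟩ := exists_of_rightEntry_ne_zero hΔ hsc hX hα he h
  rw [MatrixAlgebra.coeff_mk] at hab
  have h1 := hC τ a b (hR (a, b) hab)
  have h2 := dist_triangle4 (x : 𝒳) (sc τ a) (sc τ b) y
  rw [dist_comm] at ha
  change dist (x : 𝒳) y ≤ _
  linarith

/-- The dilation of a matrix of finite propagation. -/
def rightControlled (hΔ : 0 < Δ) (hsc : IsScaling 𝒳₀ sc) (hX : BoundedGeometry X)
    (hα : IsSquarePartition Δ X α) (he : Function.Injective e)
    (M : ControlledMatrix (finitePropagation hX) B) :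
    ControlledMatrix (finitePropagation hX) (ℝ≥0 →ᵇ CompactMatrices C(unitInterval, B)) :=
  ControlledMatrix.ofEntries (rightEntry hΔ hsc hX hα he (CStarCompletion.mk M))
    (by
      obtain ⟨R, hR⟩ := exists_dist_le_of_rightEntry_ne_zero hΔ hsc hX hα he M
      exact ⟨R, fun p hp => hR p.1 p.2 hp⟩)
    ⟨‖(CStarCompletion.mk M : UniformRoe hX B)‖, fun x y =>
      BoundedContinuousFunction.norm_ofNormedAddCommGroup_le _ (norm_nonneg _) _⟩

theorem entry_rightControlled (hΔ : 0 < Δ) (hsc : IsScaling 𝒳₀ sc) (hX : BoundedGeometry X)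
    (hα : IsSquarePartition Δ X α) (he : Function.Injective e)
    (M : ControlledMatrix (finitePropagation hX) B) (x y : X) :
    (rightControlled hΔ hsc hX hα he M).entry x y =
      rightEntry hΔ hsc hX hα he (CStarCompletion.mk M) x y := rfl

theorem coeff_entry_rightControlled (hΔ : 0 < Δ) (hsc : IsScaling 𝒳₀ sc) (hX : BoundedGeometry X)
    (hα : IsSquarePartition Δ X α) (he : Function.Injective e)
    (M : ControlledMatrix (finitePropagation hX) B) (x y : X) (p : ℝ≥0 × unitInterval) (i j : ℕ) :
    MatrixAlgebra.coeff (stableEval B p ((rightControlled hΔ hsc hX hα he M).entry x y)) i j =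
      rightCoeff sc α e M.entry p.2 p.1 x y i j := by
  rw [entry_rightControlled, coeff_stableEval_rightEntry]
  congr 1
  funext a b
  exact MatrixAlgebra.coeff_mk M a b

theorem norm_rightControlled_le (hΔ : 0 < Δ) (hsc : IsScaling 𝒳₀ sc) (hX : BoundedGeometry X)
    (hα : IsSquarePartition Δ X α) (he : Function.Injective e)
    (M : ControlledMatrix (finitePropagation hX) B) :
    ‖rightControlled hΔ hsc hX hα he M‖ ≤ ‖M‖ :=
  ciSup_le fun _ => matNorm_le_of_separating (stableEval B) stableEval_separating (norm_nonneg M)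
    fun p => matNorm_rightCoeff_le hΔ hsc hX hα he (k := M.entry)
      (fun H => ControlledMatrix.matNorm_corner_le M H) p.2 p.1 _
      fun x y i j => coeff_entry_rightControlled hΔ hsc hX hα he M x y p i j

theorem rightControlled_mul (hΔ : 0 < Δ) (hsc : IsScaling 𝒳₀ sc) (hX : BoundedGeometry X)
    (hα : IsSquarePartition Δ X α) (he : Function.Injective e)
    (M N : ControlledMatrix (finitePropagation hX) B) :
    rightControlled hΔ hsc hX hα he (M * N) =
      rightControlled hΔ hsc hX hα he M * rightControlled hΔ hsc hX hα he N := by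
  classical
  refine ControlledMatrix.ext fun x y => stable_ext fun p i j => ?_
  rw [coeff_entry_rightControlled]
  obtain ⟨H₁, hH₁, hM⟩ := M.exists_finset (rightNear Δ hsc hX p.1 x)
  obtain ⟨H₂, hH₂, hN⟩ := (star N).exists_finset (rightNear Δ hsc hX p.1 y)
  obtain ⟨K, hK⟩ : ∃ K : ℕ, ∀ a ∈ H₁ ∪ H₂, e a + 2 ≤ K :=
    ⟨(H₁ ∪ H₂).sup (fun a => e a + 2), fun a ha => Finset.le_sup (f := fun a => e a + 2) ha⟩
  let P : Finset X := ((H₁ ∪ H₂) ∪ (H₁ ∪ H₂).biUnion fun a =>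
    (hα.finite_support hX (sc (halfTime p.2 p.1) a)).toFinset) ∪
      ((rightControlled hΔ hsc hX hα he M).row_finite x).toFinset
  have hx : ∀ {i a}, rightVec sc α e p.2 p.1 x i a ≠ 0 → a ∈ rightNear Δ hsc hX p.1 x :=
    fun h => mem_rightNear_of_ne_zero hΔ hsc hX hα le_rfl h
  have hy : ∀ {j b}, rightVec sc α e p.2 p.1 y j b ≠ 0 → b ∈ rightNear Δ hsc hX p.1 y :=
    fun h => mem_rightNear_of_ne_zero hΔ hsc hX hα le_rfl h
  have hN' : ∀ {a b}, b ∈ rightNear Δ hsc hX p.1 y → N.entry a b ≠ 0 → a ∈ H₂ := fun {a b} hb hab =>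
    hN b hb a (by rw [ControlledMatrix.entry_star]; exact star_ne_zero.2 hab)
  have e1 : ∀ z n, rightCoeff sc α e M.entry p.2 p.1 x z i n = weightedSum (H₁ ∪ H₂)
      (rightVec sc α e p.2 p.1 x i) (rightVec sc α e p.2 p.1 z n) M.entry := fun z n =>
    rightCoeff_eq fun a b ha _ hab => ⟨Finset.mem_union_left _ (hH₁ (hx ha)),
      Finset.mem_union_left _ (hM a (hx ha) b hab)⟩
  have e2 : ∀ z n, rightCoeff sc α e N.entry p.2 p.1 z y n j = weightedSum (H₁ ∪ H₂)
      (rightVec sc α e p.2 p.1 z n) (rightVec sc α e p.2 p.1 y j) N.entry := fun z n =>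
    rightCoeff_eq fun a b _ hb hab => ⟨Finset.mem_union_right _ (hN' (hy hb) hab),
      Finset.mem_union_right _ (hH₂ (hy hb))⟩
  have e3 : rightCoeff sc α e (M * N).entry p.2 p.1 x y i j = weightedSum (H₁ ∪ H₂)
      (rightVec sc α e p.2 p.1 x i) (rightVec sc α e p.2 p.1 y j)
        fun a d => ∑ b ∈ H₁ ∪ H₂, M.entry a b * N.entry b d := by
    rw [rightCoeff_eq (H := H₁ ∪ H₂) fun a b ha hb _ => ⟨Finset.mem_union_left _ (hH₁ (hx ha)),
      Finset.mem_union_right _ (hH₂ (hy hb))⟩]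
    exact weightedSum_congr fun a _ d _ ha _ => ControlledMatrix.entry_mul_eq_sum M N a d _
      fun z hz => Finset.mem_union_left _ (hM a (hx ha) z hz)
  have e4 : ∀ z, MatrixAlgebra.coeff (stableEval B p ((rightControlled hΔ hsc hX hα he M).entry x z *
      (rightControlled hΔ hsc hX hα he N).entry z y)) i j = ∑ n ∈ Finset.range K,
      rightCoeff sc α e M.entry p.2 p.1 x z i n * rightCoeff sc α e N.entry p.2 p.1 z y n j :=
    fun z => by
      rw [map_mul, MatrixAlgebra.coeff_mul_eq_sum _ _ i j (Finset.range K) fun n hn => ?_]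
      · exact Finset.sum_congr rfl fun n _ => by
          rw [coeff_entry_rightControlled, coeff_entry_rightControlled]
      · rw [coeff_entry_rightControlled] at hn
        obtain ⟨a, b, ha, hb, hab⟩ := exists_of_rightCoeff_ne_zero hn
        exact Finset.mem_range.2 ((le_of_rightVec_ne_zero hb).trans_le
          (hK b (Finset.mem_union_left _ (hM a (hx ha) b hab))))
  rw [ControlledMatrix.entry_mul_eq_sum _ _ x y P fun z hz =>
    Finset.mem_union_right _ ((Set.Finite.mem_toFinset _).2 hz), map_sum, MatrixAlgebra.coeff_sum,
    Finset.sum_congr rfl fun z _ => e4 z, ← Finset.sum_product' P (Finset.range K) fun z n =>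
      rightCoeff sc α e M.entry p.2 p.1 x z i n * rightCoeff sc α e N.entry p.2 p.1 z y n j, e3]
  simp only [e1, e2]
  refine (weightedSum_mul _ _ (fun z : X × ℕ => rightVec sc α e p.2 p.1 z.1 z.2)
    (fun b hb c hc => ?_) M.entry N.entry).symm
  refine (sum_rightVec_mul_rightVec hα he p.2 p.1 (fun z hz => Finset.mem_union_left _
    (Finset.mem_union_right _ (Finset.mem_biUnion.2 ⟨b, hb, (Set.Finite.mem_toFinset _).2 hz⟩)))
    (Finset.mem_union_left _ (Finset.mem_union_left _ hb)) (hK b hb) (hK c hc)).trans ?_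
  congr

end RightHom

end

/-! ### The homotopy for the right triangle as a ⋆-homomorphism -/

noncomputable section

section RightMat

variable {𝒳 : Type*} [MetricSpace 𝒳] {𝒳₀ : Set 𝒳} {sc : ℝ≥0 → 𝒳 → 𝒳} {Δ : ℝ} {X : Set 𝒳}
  {α : X → C(𝒳, ℝ)} {e : X → ℕ} {B C : Type*} [NonUnitalCStarAlgebra B] [NonUnitalCStarAlgebra C]

variable (B) in
/-- The dilation of matrices of finite propagation as a ⋆-homomorphism. -/
def rightControlledHom (hΔ : 0 < Δ) (hsc : IsScaling 𝒳₀ sc) (hX : BoundedGeometry X)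
    (hα : IsSquarePartition Δ X α) (he : Function.Injective e) :
    ControlledMatrix (finitePropagation hX) B →⋆ₙₐ[ℂ]
      ControlledMatrix (finitePropagation hX) (ℝ≥0 →ᵇ CompactMatrices C(unitInterval, B)) where
  toFun := rightControlled hΔ hsc hX hα he
  map_smul' c M := by
    refine ControlledMatrix.ext fun x y => stable_ext fun p i j => ?_
    rw [ControlledMatrix.entry_smul, map_smul, MatrixAlgebra.coeff_smul,
      coeff_entry_rightControlled, MonoidHom.id_apply, coeff_entry_rightControlled,
      rightCoeff_eq_near hΔ hsc hX hα _ _ le_rfl, rightCoeff_eq_near hΔ hsc hX hα _ _ le_rfl]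
    exact weightedSum_smul _ _ _ c M.entry
  map_zero' := by
    refine ControlledMatrix.ext fun x y => stable_ext fun p i j => ?_
    rw [ControlledMatrix.entry_zero, map_zero, MatrixAlgebra.coeff_zero,
      coeff_entry_rightControlled, rightCoeff_eq_near hΔ hsc hX hα _ _ le_rfl]
    exact weightedSum_zero _ _ _
  map_add' M N := by
    refine ControlledMatrix.ext fun x y => stable_ext fun p i j => ?_
    rw [ControlledMatrix.entry_add, map_add, MatrixAlgebra.coeff_add,
      coeff_entry_rightControlled, coeff_entry_rightControlled, coeff_entry_rightControlled,
      rightCoeff_eq_near hΔ hsc hX hα _ _ le_rfl, rightCoeff_eq_near hΔ hsc hX hα _ _ le_rfl,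
      rightCoeff_eq_near hΔ hsc hX hα _ _ le_rfl]
    exact weightedSum_add _ _ _ M.entry N.entry
  map_mul' := rightControlled_mul hΔ hsc hX hα he
  map_star' M := by
    classical
    refine ControlledMatrix.ext fun x y => stable_ext fun p i j => ?_
    rw [ControlledMatrix.entry_star, map_star, MatrixAlgebra.coeff_star,
      coeff_entry_rightControlled, coeff_entry_rightControlled,
      rightCoeff_eq_near hΔ hsc hX hα _ _ le_rfl, rightCoeff_eq_near hΔ hsc hX hα _ _ le_rfl,
      Finset.union_comm]
    exact weightedSum_star _ _ _ M.entry

variable (B) in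
/-- The dilation on the uniform Roe algebra. -/
def rightMat (hΔ : 0 < Δ) (hsc : IsScaling 𝒳₀ sc) (hX : BoundedGeometry X)
    (hα : IsSquarePartition Δ X α) (he : Function.Injective e) :
    CStarHom (UniformRoe hX B) (UniformRoe hX (ℝ≥0 →ᵇ CompactMatrices C(unitInterval, B))) :=
  CStarCompletion.lift (CStarCompletion.mkHom.comp (rightControlledHom B hΔ hsc hX hα he))
    fun M => (CStarCompletion.norm_mk _).trans_le (norm_rightControlled_le hΔ hsc hX hα he M)

theorem rightMat_mk (hΔ : 0 < Δ) (hsc : IsScaling 𝒳₀ sc) (hX : BoundedGeometry X)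
    (hα : IsSquarePartition Δ X α) (he : Function.Injective e)
    (M : ControlledMatrix (finitePropagation hX) B) :
    rightMat B hΔ hsc hX hα he (CStarCompletion.mk M) =
      CStarCompletion.mk (rightControlled hΔ hsc hX hα he M) := CStarCompletion.lift_mk _ _ M

theorem coeff_rightMat (hΔ : 0 < Δ) (hsc : IsScaling 𝒳₀ sc) (hX : BoundedGeometry X)
    (hα : IsSquarePartition Δ X α) (he : Function.Injective e) (m : UniformRoe hX B) (x y : X) :
    MatrixAlgebra.coeff (rightMat B hΔ hsc hX hα he m) x y = rightEntry hΔ hsc hX hα he m x y := by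
  refine stable_ext fun p i j => ?_
  rw [coeff_stableEval_rightEntry, rightCoeff_eq_near hΔ hsc hX hα _ _ le_rfl]
  refine CStarCompletion.ind m (isClosed_eq ?_ ?_) fun M => ?_
  · exact (MatrixAlgebra.continuous_coeff i j).comp ((map_continuous (stableEval B p)).comp
      ((MatrixAlgebra.continuous_coeff x y).comp (map_continuous (rightMat B hΔ hsc hX hα he))))
  · unfold weightedSum
    exact continuous_finsetSum _ fun a _ => continuous_finsetSum _ fun b _ =>
      (MatrixAlgebra.continuous_coeff a b).const_smul _
  · rw [rightMat_mk, MatrixAlgebra.coeff_mk, entry_rightControlled, coeff_stableEval_rightEntry,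
      rightCoeff_eq_near hΔ hsc hX hα _ _ le_rfl]

theorem rightMat_mem_relativeIdeal (hΔ : 0 < Δ) (hsc : IsScaling 𝒳₀ sc) (hX : BoundedGeometry X)
    (hnet : IsSeparatedNet Δ X) (hα : IsSquarePartition Δ X α) (he : Function.Injective e)
    (m : UniformRoe hX B) (hm : m ∈ (relativeIdeal hX (discretePart Δ 𝒳₀ X) B).toSubmodule) :
    rightMat B hΔ hsc hX hα he m ∈ (relativeIdeal hX (discretePart Δ 𝒳₀ X)
      (ℝ≥0 →ᵇ CompactMatrices C(unitInterval, B))).toSubmodule := by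
  refine map_mem_closure (map_continuous (rightMat B hΔ hsc hX hα he)) hm ?_
  rintro m ⟨R, hR⟩
  obtain ⟨D, hD⟩ := hsc.exists_dist_le (R + Δ)
  have key : ∀ {τ : ℝ≥0} {a x : X}, a ∈ nbhdOf (discretePart Δ 𝒳₀ X) R → dist (sc τ a) x < Δ →
      x ∈ nbhdOf (discretePart Δ 𝒳₀ X) (Δ + D + Δ) := by
    rintro τ a x ⟨b, ⟨z, hz, hbz⟩, hab⟩ hax
    obtain ⟨w, hw, hzw⟩ := hnet.net (sc τ z)
    refine ⟨⟨w, hw⟩, ⟨sc τ z, hsc.mapsTo τ hz, (dist_comm _ _).trans_lt hzw⟩, ?_⟩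
    have h1 := hD τ a z (by
      have h2 := dist_triangle (a : 𝒳) b z
      have h3 : dist (a : 𝒳) b < R := hab
      linarith)
    have h4 := dist_triangle4 (x : 𝒳) (sc τ a) (sc τ z) w
    rw [dist_comm] at hax
    change dist (x : 𝒳) w < _
    linarith
  refine ⟨Δ + D + Δ, fun x y h => ?_⟩
  rw [coeff_rightMat] at h
  obtain ⟨τ, a, b, ha, hb, hab⟩ := exists_of_rightEntry_ne_zero hΔ hsc hX hα he h
  exact ⟨key (hR a b hab).1 ha, key (hR a b hab).2 hb⟩

variable (B) in
/-- The matrix of the asymptotic classes of the entries of the dilation. -/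
def rightAsMat (hΔ : 0 < Δ) (hsc : IsScaling 𝒳₀ sc) (hX : BoundedGeometry X)
    (hα : IsSquarePartition Δ X α) (he : Function.Injective e) :
    CStarHom (UniformRoe hX B)
      (UniformRoe hX (AsymptoticAlgebra (CompactMatrices C(unitInterval, B)))) :=
  (MatrixAlgebra.map (vanishingIdeal (CompactMatrices C(unitInterval, B))).projHom).comp
    (rightMat B hΔ hsc hX hα he)

theorem coeff_rightAsMat (hΔ : 0 < Δ) (hsc : IsScaling 𝒳₀ sc) (hX : BoundedGeometry X)
    (hα : IsSquarePartition Δ X α) (he : Function.Injective e) (m : UniformRoe hX B) (x y : X) :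
    MatrixAlgebra.coeff (rightAsMat B hΔ hsc hX hα he m) x y =
      asClass (rightEntry hΔ hsc hX hα he m x y) := by
  refine (MatrixAlgebra.coeff_map _ _ x y).trans ?_
  exact congrArg asClass (coeff_rightMat hΔ hsc hX hα he m x y)

variable (B) in
/-- The homotopy for the right triangle. -/
def rightHom (hΔ : 0 < Δ) (hsc : IsScaling 𝒳₀ sc) (hX : BoundedGeometry X)
    (hnet : IsSeparatedNet Δ X) (hα : IsSquarePartition Δ X α) (he : Function.Injective e) :
    CStarHom (RelativeRoe hX (discretePart Δ 𝒳₀ X) B) (RelativeRoe hX (discretePart Δ 𝒳₀ X)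
      (AsymptoticAlgebra (CompactMatrices C(unitInterval, B)))) :=
  CStarIdeal.mapHom _ _ (rightAsMat B hΔ hsc hX hα he) fun m hm =>
    map_mem_relativeIdeal hX _ _ (rightMat_mem_relativeIdeal hΔ hsc hX hnet hα he m hm)

theorem rightHom_qmat (hΔ : 0 < Δ) (hsc : IsScaling 𝒳₀ sc) (hX : BoundedGeometry X)
    (hnet : IsSeparatedNet Δ X) (hα : IsSquarePartition Δ X α) (he : Function.Injective e)
    (m : UniformRoe hX B) :
    rightHom B hΔ hsc hX hnet hα he (qmat hX (discretePart Δ 𝒳₀ X) m) =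
      qmat hX (discretePart Δ 𝒳₀ X) (rightAsMat B hΔ hsc hX hα he m) := rfl

theorem rightCoeff_map (hΔ : 0 < Δ) (hsc : IsScaling 𝒳₀ sc) (hX : BoundedGeometry X)
    (hα : IsSquarePartition Δ X α) {k : X → X → B} {l : X → X → C} (L : B →ₗ[ℂ] C)
    (h : ∀ a b, L (k a b) = l a b) (r : unitInterval) (t : ℝ≥0) (x y : X) (i j : ℕ) :
    L (rightCoeff sc α e k r t x y i j) = rightCoeff sc α e l r t x y i j := by
  rw [rightCoeff_eq_near hΔ hsc hX hα _ _ le_rfl, rightCoeff_eq_near hΔ hsc hX hα _ _ le_rfl]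
  simp only [weightedSum, map_sum, map_smul, h]

theorem asymptoticMap_rightEntry (hΔ : 0 < Δ) (hsc : IsScaling 𝒳₀ sc) (hX : BoundedGeometry X)
    (hα : IsSquarePartition Δ X α) (he : Function.Injective e) (φ : B →⋆ₙₐ[ℂ] C)
    (m : UniformRoe hX B) (x y : X) :
    asymptoticMap (MatrixAlgebra.map (cylinderMap φ)) (asClass (rightEntry hΔ hsc hX hα he m x y)) =
      asClass (rightEntry hΔ hsc hX hα he (MatrixAlgebra.map φ m) x y) := by
  rw [asymptoticMap_asClass]
  refine asClass_compact_ext fun t i j => (coeff_bddMap_map _ _ t i j).trans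
    (ContinuousMap.ext fun r => ?_)
  refine (congrArg φ (coeff_rightEntry hΔ hsc hX hα he m x y t i j r)).trans ?_
  rw [coeff_rightEntry]
  exact rightCoeff_map hΔ hsc hX hα (φ : B →ₗ[ℂ] C) (fun a b => (MatrixAlgebra.coeff_map φ m a b).symm)
    r t x y i j

theorem map_rightHom (hΔ : 0 < Δ) (hsc : IsScaling 𝒳₀ sc) (hX : BoundedGeometry X)
    (hnet : IsSeparatedNet Δ X) (hα : IsSquarePartition Δ X α) (he : Function.Injective e)
    (φ : B →⋆ₙₐ[ℂ] C) (m : UniformRoe hX B) :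
    rightHom C hΔ hsc hX hnet hα he
        (RelativeRoe.map hX (discretePart Δ 𝒳₀ X) φ (qmat hX (discretePart Δ 𝒳₀ X) m)) =
      RelativeRoe.map hX (discretePart Δ 𝒳₀ X)
        (asymptoticMap (MatrixAlgebra.map (𝓔 := finiteSupports ℕ) (cylinderMap φ)))
        (rightHom B hΔ hsc hX hnet hα he (qmat hX (discretePart Δ 𝒳₀ X) m)) := by
  rw [relRoe_map_qmat, rightHom_qmat, rightHom_qmat, relRoe_map_qmat]
  refine congrArg (qmat hX (discretePart Δ 𝒳₀ X)) (MatrixAlgebra.ext_coeff fun x y => ?_)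
  rw [coeff_rightAsMat, MatrixAlgebra.coeff_map, coeff_rightAsMat]
  exact (asymptoticMap_rightEntry hΔ hsc hX hα he φ m x y).symm

theorem rightVec_one (r : X) (t : ℝ≥0) (i : ℕ) (a : X) : rightVec sc α e 1 t r i a =
    open Classical in if r = a ∧ i = 0 then 1 else 0 := by
  rw [rightVec, pathU_one, mul_zero, zero_add, pathD_one]

theorem rightCoeff_one (k : X → X → B) (t : ℝ≥0) (x y : X) (i j : ℕ) :
    rightCoeff sc α e k 1 t x y i j = if i = 0 ∧ j = 0 then k x y else 0 := by
  classical
  rw [rightCoeff, finsum_eq_single _ (x, y) fun p hp => ?_, rightVec_one, rightVec_one]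
  · by_cases hi : i = 0 <;> by_cases hj : j = 0 <;> simp [hi, hj]
  · rw [rightVec_one, rightVec_one]
    have : ¬ (x = p.1 ∧ y = p.2) := fun h => hp (Prod.ext h.1.symm h.2.symm)
    rcases not_and_or.1 this with h | h <;> simp [h]

theorem rightHom_one (hΔ : 0 < Δ) (hsc : IsScaling 𝒳₀ sc) (hX : BoundedGeometry X)
    (hnet : IsSeparatedNet Δ X) (hα : IsSquarePartition Δ X α) (he : Function.Injective e)
    (m : UniformRoe hX B) :
    RelativeRoe.map hX (discretePart Δ 𝒳₀ X)
        (asymptoticMap (MatrixAlgebra.map (𝓔 := finiteSupports ℕ) (cylinderEval B 1)))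
        (rightHom B hΔ hsc hX hnet hα he (qmat hX (discretePart Δ 𝒳₀ X) m)) =
      RelativeRoe.map hX (discretePart Δ 𝒳₀ X)
        ((asConst (CompactMatrices B)).comp (cornerEmbedding B))
        (qmat hX (discretePart Δ 𝒳₀ X) m) := by
  rw [relRoe_map_qmat, rightHom_qmat, relRoe_map_qmat]
  refine congrArg (qmat hX (discretePart Δ 𝒳₀ X)) (MatrixAlgebra.ext_coeff fun x y => ?_)
  rw [MatrixAlgebra.coeff_map, coeff_rightAsMat, MatrixAlgebra.coeff_map, asymptoticMap_asClass]
  refine asClass_compact_ext fun t i j => (coeff_bddMap_map _ _ t i j).trans ?_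
  refine (coeff_rightEntry hΔ hsc hX hα he m x y t i j 1).trans ?_
  rw [rightCoeff_one]
  exact (coeff_cornerEmbedding _ i j).symm

end RightMat

end

/-! ### The right triangle -/

noncomputable section

section RightZero

variable {𝒳 : Type*} [MetricSpace 𝒳] {𝒳₀ : Set 𝒳} {sc : ℝ≥0 → 𝒳 → 𝒳} {Δ : ℝ} {X : Set 𝒳}
  {α : X → C(𝒳, ℝ)} {e : X → ℕ} {B : Type*} [NonUnitalCStarAlgebra B]

theorem rightVec_zero (t : ℝ≥0) (x : X) (i : ℕ) (a : X) :
    rightVec sc α e 0 t x i a = α x (sc t a) * if i = e a then 1 else 0 := by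
  rw [rightVec, halfTime_zero, pathU_zero, pathD_zero, ite_self, add_zero]

theorem rightCoeff_zero (he : Function.Injective e) (k : X → X → B) (t : ℝ≥0) (x y : X) (i j : ℕ) :
    rightCoeff sc α e k 0 t x y i j =
      pushKernel e (fun a b => ((α x (sc t a) * α y (sc t b) : ℝ) : ℂ) • k a b) i j := by
  refine eq_pushKernel he (l := fun i j => rightCoeff sc α e k 0 t x y i j) (fun a b => ?_)
    (fun i j hij => ?_) i j
  · rw [rightCoeff, finsum_eq_single _ (a, b) fun p hp => ?_, rightVec_zero, rightVec_zero,
      if_pos rfl, if_pos rfl, mul_one, mul_one]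
    rw [rightVec_zero, rightVec_zero]
    have : ¬ (e a = e p.1 ∧ e b = e p.2) := fun h => hp (Prod.ext (he h.1.symm) (he h.2.symm))
    rcases not_and_or.1 this with h | h <;> simp [h]
  · refine finsum_eq_zero_of_forall_eq_zero fun p => ?_
    rw [rightVec_zero, rightVec_zero]
    rcases hij with h | h
    · rw [if_neg fun h' => h ⟨p.1, h'.symm⟩]
      simp
    · rw [if_neg (c := j = e p.2) fun h' => h ⟨p.2, h'.symm⟩]
      simp

theorem coeff_counitFun (hsc : IsScaling 𝒳₀ sc) (hX : BoundedGeometry X)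
    (he : Function.Injective e) (f : relC0 ℂ 𝒳₀) (m : UniformRoe hX B) (t : ℝ≥0) (i j : ℕ) :
    MatrixAlgebra.coeff (counitFun hsc hX he f m t) i j =
      pushKernel e (fun a b : X => f.1 (sc t a) • MatrixAlgebra.coeff m a b) i j := by
  rw [counitFun_apply, coeff_compress]

variable [ProperSpace 𝒳]

theorem counitFun_unitBump_eq_zero (hsc : IsScaling 𝒳₀ sc) (hX : BoundedGeometry X)
    (hα : IsSquarePartition Δ X α) (he : Function.Injective e) (m : UniformRoe hX B) {x y : X}
    (h : cutoff Δ 𝒳₀ x = 0 ∨ cutoff Δ 𝒳₀ y = 0) :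
    asClass (counitFun hsc hX he (unitBump 𝒳₀ hα x * unitBump 𝒳₀ hα y) m) = 0 := by
  have h1 : unitBump 𝒳₀ hα x * unitBump 𝒳₀ hα y = 0 := relC0.ext fun z => by
    change ((cutoff Δ 𝒳₀ x * α x z : ℝ) : ℂ) * ((cutoff Δ 𝒳₀ y * α y z : ℝ) : ℂ) = 0
    rcases h with h | h <;> simp [h]
  rw [h1]
  refine (asClass_compact_ext fun t i j => ?_).trans
    (map_zero (vanishingIdeal (CompactMatrices B)).projHom)
  rw [coeff_counitFun]
  refine (eq_pushKernel he (l := fun _ _ => (0 : B)) (fun a b => ?_) (fun _ _ _ => rfl) i j).symm.trans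
    (MatrixAlgebra.coeff_zero i j).symm
  exact (zero_smul ℂ _).symm

theorem asClass_rightEntry_zero (hΔ : 0 < Δ) (hsc : IsScaling 𝒳₀ sc) (hX : BoundedGeometry X)
    (hα : IsSquarePartition Δ X α) (he : Function.Injective e)
    (M : ControlledMatrix (finitePropagation hX) B) {x y : X} (hx : cutoff Δ 𝒳₀ x = 1)
    (hy : cutoff Δ 𝒳₀ y = 1) :
    asClass (bddMap (MatrixAlgebra.map (cylinderEval B 0))
        (rightEntry hΔ hsc hX hα he (CStarCompletion.mk M) x y)) =
      asClass (counitFun hsc hX he (unitBump 𝒳₀ hα x * unitBump 𝒳₀ hα y) (CStarCompletion.mk M)) := by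
  obtain ⟨K, hK0, hK⟩ := exists_commutator_bound M
  obtain ⟨R, hR⟩ := M.controlled
  refine asClass_eq_of_eventually fun δ hδ => ?_
  have hδ' : 0 < δ / (K + 1) := by positivity
  filter_upwards [hsc.eventually_norm_sub_le_of_dist_le
    (relC0.uniformContinuous (unitBump 𝒳₀ hα y)) R hδ'] with t ht
  have hxb : ∀ z, (unitBump 𝒳₀ hα x).1 z = ((α x z : ℝ) : ℂ) := fun z => by
    rw [unitBump_apply, hx, one_mul]
  have hyb : ∀ z, (unitBump 𝒳₀ hα y).1 z = ((α y z : ℝ) : ℂ) := fun z => by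
    rw [unitBump_apply, hy, one_mul]
  refine (MatrixAlgebra.norm_le_of_pushKernel he (c := 1 * (K * (δ / (K + 1))))
    (k := fun a b : X => ((α x (sc t a) : ℝ) : ℂ) •
      ((((α y (sc t b) : ℝ) : ℂ) - ((α y (sc t a) : ℝ) : ℂ)) • M.entry a b)) (fun i j => ?_)
    fun F => ?_).trans ?_
  · rw [MatrixAlgebra.coeff_sub, coeff_bddMap_map, coeff_counitFun]
    change MatrixAlgebra.coeff (rightEntry hΔ hsc hX hα he (CStarCompletion.mk M) x y t) i j 0 - _ = _
    rw [coeff_rightEntry, rightCoeff_zero he]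
    refine eq_pushKernel he (l := fun i j => pushKernel e (fun a b : X =>
      ((α x (sc t a) * α y (sc t b) : ℝ) : ℂ) • MatrixAlgebra.coeff (CStarCompletion.mk M) a b) i j -
      pushKernel e (fun a b : X => (unitBump 𝒳₀ hα x * unitBump 𝒳₀ hα y).1 (sc t a) •
        MatrixAlgebra.coeff (CStarCompletion.mk M) a b) i j) (fun a b => ?_) (fun i j hij => ?_) i j
    · rw [pushKernel_apply he, pushKernel_apply he, MatrixAlgebra.coeff_mk, smul_smul]
      have h1 : (unitBump 𝒳₀ hα x * unitBump 𝒳₀ hα y).1 (sc t a) =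
          ((α x (sc t a) : ℝ) : ℂ) * ((α y (sc t a) : ℝ) : ℂ) := by
        rw [← hxb, ← hyb]
        rfl
      rw [h1, ← sub_smul, mul_sub, Complex.ofReal_mul]
    · rw [pushKernel_of_notMem e _ hij, pushKernel_of_notMem e _ hij, sub_zero]
  · refine (matNorm_cornerFn_smul_le (fun a : X => ((α x (sc t a) : ℝ) : ℂ)) zero_le_one
      (fun a => ?_) _ F).trans (mul_le_mul_of_nonneg_left (hK (fun a : X => ((α y (sc t a) : ℝ) : ℂ))
        _ hδ'.le (fun a b hab => ?_) F) zero_le_one)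
    · rw [Complex.norm_real]
      exact hα.abs_le_one x _
    · rw [← hyb, ← hyb]
      exact ht b a (by rw [dist_comm]; exact hR (a, b) hab)
  · rw [one_mul, mul_comm]
    exact div_add_one_mul_le hK0 hδ.le

theorem rightAsMat_sub_mem (hΔ : 0 < Δ) (hsc : IsScaling 𝒳₀ sc) (hX : BoundedGeometry X)
    (hnet : IsSeparatedNet Δ X) (hα : IsSquarePartition Δ X α) (he : Function.Injective e)
    (M : ControlledMatrix (finitePropagation hX) B)
    {n : UniformRoe hX (AsymptoticAlgebra (CompactMatrices B))}
    (hn : ∀ x y, MatrixAlgebra.coeff n x y = asClass (counitFun hsc hX he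
      (unitBump 𝒳₀ hα x * unitBump 𝒳₀ hα y) (CStarCompletion.mk M))) :
    MatrixAlgebra.map (asymptoticMap (MatrixAlgebra.map (𝓔 := finiteSupports ℕ) (cylinderEval B 0)))
        (rightAsMat B hΔ hsc hX hα he (CStarCompletion.mk M)) - n ∈
      (relativeIdeal hX (discretePart Δ 𝒳₀ X)
        (AsymptoticAlgebra (CompactMatrices B))).toSubmodule := by
  obtain ⟨R, hR⟩ := exists_dist_le_of_rightEntry_ne_zero hΔ hsc hX hα he M
  refine subset_closure ⟨3 * Δ + |R|, fun x y h => ?_⟩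
  rw [MatrixAlgebra.coeff_sub, MatrixAlgebra.coeff_map, coeff_rightAsMat, asymptoticMap_asClass,
    hn] at h
  have hcut : cutoff Δ 𝒳₀ x = 0 ∨ cutoff Δ 𝒳₀ y = 0 := by
    by_contra! h'
    refine h (sub_eq_zero.2 (asClass_rightEntry_zero hΔ hsc hX hα he M
      ((cutoff_eq_zero_or_one Δ 𝒳₀ x).resolve_left h'.1)
      ((cutoff_eq_zero_or_one Δ 𝒳₀ y).resolve_left h'.2)))
  rw [counitFun_unitBump_eq_zero hsc hX hα he _ hcut, sub_zero] at h
  have hd : dist x y ≤ R := hR x y fun h0 => h (by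
    rw [h0, map_zero]
    exact map_zero (vanishingIdeal (CompactMatrices B)).projHom)
  have key : ∀ {u v : X}, cutoff Δ 𝒳₀ u = 0 → dist v u ≤ R →
      v ∈ nbhdOf (discretePart Δ 𝒳₀ X) (3 * Δ + |R|) := by
    intro u v hu huv
    obtain ⟨w, hw, huw⟩ := mem_nbhdOf_of_cutoff_eq_zero hΔ hnet hu
    refine ⟨w, hw, ?_⟩
    have h1 := dist_triangle v u w
    have h2 := le_abs_self R
    linarith
  have key' : ∀ {u : X}, cutoff Δ 𝒳₀ u = 0 → u ∈ nbhdOf (discretePart Δ 𝒳₀ X) (3 * Δ + |R|) :=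
    fun hu => nbhdOf_mono _ (by linarith [abs_nonneg R]) (mem_nbhdOf_of_cutoff_eq_zero hΔ hnet hu)
  rcases hcut with hc | hc
  · exact ⟨key' hc, key hc (by rwa [dist_comm])⟩
  · exact ⟨key hc hd, key' hc⟩

theorem rightHom_zero_mk (hΔ : 0 < Δ) (hsc : IsScaling 𝒳₀ sc) (hX : BoundedGeometry X)
    (hnet : IsSeparatedNet Δ X) (hα : IsSquarePartition Δ X α) (he : Function.Injective e)
    (M : ControlledMatrix (finitePropagation hX) B) :
    RelativeRoe.map hX (discretePart Δ 𝒳₀ X)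
        (asymptoticMap (MatrixAlgebra.map (𝓔 := finiteSupports ℕ) (cylinderEval B 0)))
        (rightHom B hΔ hsc hX hnet hα he
          (qmat hX (discretePart Δ 𝒳₀ X) (CStarCompletion.mk M))) =
      RelativeRoe.map hX (discretePart Δ 𝒳₀ X) (counitHom Δ B hsc hX he)
        (unitHom 𝒳₀ hΔ hX hnet hα (RelativeRoe hX (discretePart Δ 𝒳₀ X) B)
          (qmat hX (discretePart Δ 𝒳₀ X) (CStarCompletion.mk M))) := by
  refine CStarIdeal.proj_eq_iff.2 (rightAsMat_sub_mem hΔ hsc hX hnet hα he M (n :=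
    MatrixAlgebra.map (counitHom Δ B hsc hX he) (CStarCompletion.mk (unitMatrix 𝒳₀ hX hα
      (qmat hX (discretePart Δ 𝒳₀ X) (CStarCompletion.mk M))))) fun x y => ?_)
  refine (MatrixAlgebra.coeff_map _ _ x y).trans ?_
  refine (congrArg (counitHom Δ B hsc hX he) (MatrixAlgebra.coeff_mk _ x y)).trans ?_
  exact counitHom_tensor hsc hX he _ _

end RightZero

section RightTriangle

variable {𝒳 : Type u} [MetricSpace 𝒳] {𝒳₀ : Set 𝒳} {sc : ℝ≥0 → 𝒳 → 𝒳} {Δ : ℝ} {X : Set 𝒳} {α : X → C(𝒳, ℝ)} {e : X → ℕ}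

theorem relRoe_hom_ext {X : Type*} [MetricSpace X] {hX : BoundedGeometry X} {X₀ : Set X}
    {B C : Type*} [NonUnitalCStarAlgebra B] [NonUnitalCStarAlgebra C]
    {φ ψ : CStarHom (RelativeRoe hX X₀ B) C}
    (h : ∀ M : ControlledMatrix (finitePropagation hX) B,
      φ (qmat hX X₀ (CStarCompletion.mk M)) = ψ (qmat hX X₀ (CStarCompletion.mk M))) : φ = ψ := by
  have h1 : φ.comp (relativeIdeal hX X₀ B).projHom = ψ.comp (relativeIdeal hX X₀ B).projHom :=
    CStarCompletion.hom_ext h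
  refine NonUnitalStarAlgHom.ext fun q => ?_
  obtain ⟨m, rfl⟩ := CStarIdeal.proj_surjective q
  exact congrArg (fun f : CStarHom (UniformRoe hX B) C => f m) h1

/-- The homotopy for the right triangle as a natural transformation. -/
def rightHomotopy (hΔ : 0 < Δ) (hsc : IsScaling 𝒳₀ sc) (hX : BoundedGeometry X)
    (hnet : IsSeparatedNet Δ X) (hα : IsSquarePartition Δ X α) (he : Function.Injective e) :
    relRoeFunctor hX (discretePart Δ 𝒳₀ X) ⟶ cylinderFunctor ⋙
      ((compactFunctor.{u} ⋙ asymptoticFunctor) ⋙ relRoeFunctor hX (discretePart Δ 𝒳₀ X)) where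
  app B := rightHom B hΔ hsc hX hnet hα he
  naturality B C φ := NonUnitalStarAlgHom.ext
    fun (q : RelativeRoe hX (discretePart Δ 𝒳₀ X) B) => by
      let φ' : B →⋆ₙₐ[ℂ] C := φ
      obtain ⟨m, rfl⟩ := CStarIdeal.proj_surjective q
      exact map_rightHom hΔ hsc hX hnet hα he φ' m

theorem cylinder_stable_label_rightEntry (hΔ : 0 < Δ) (hsc : IsScaling 𝒳₀ sc)
    (hX : BoundedGeometry X) (hα : IsSquarePartition Δ X α) (he : Function.Injective e)
    {A B : CStar.{u}} (a : A) (m : UniformRoe hX B) (x y : X) :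
    (cylinderGood.comp (compactGood.comp asymptoticGood)).label A B
      (MaxTensor.tmul a (asClass (rightEntry hΔ hsc hX hα he m x y))) =
      asClass (rightEntry hΔ hsc hX hα he (MatrixAlgebra.lab a m) x y) := by
  refine (comp_label cylinderGood (compactGood.comp asymptoticGood) A B _).trans ?_
  refine stable_map_label (D := cylinderFunctor.obj B) (E := cylinderFunctor.obj (tensorObj A B)) a
    (rightEntry hΔ hsc hX hα he m x y) (rightEntry hΔ hsc hX hα he (MatrixAlgebra.lab a m) x y)
    (cylinderGood.label A B) fun t i j => ?_
  refine (cylinderGood_label a _).trans (ContinuousMap.ext fun r => ?_)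
  refine (congrArg (MaxTensor.tmul a) (coeff_rightEntry hΔ hsc hX hα he m x y t i j r)).trans ?_
  refine Eq.trans ?_ (coeff_rightEntry (B := MaxTensor A B) hΔ hsc hX hα he
    (MatrixAlgebra.lab a m) x y t i j r).symm
  exact rightCoeff_map hΔ hsc hX hα (B := B) (C := MaxTensor A B)
    (k := MatrixAlgebra.coeff m) (l := MatrixAlgebra.coeff (MatrixAlgebra.lab a m))
    (MaxTensor.tmulL (B := B) a).toLinearMap (fun p q => (MatrixAlgebra.coeff_lab a m p q).symm) r t x y i j

theorem relRoe_map_label {X : Type u} [MetricSpace X] {hX : BoundedGeometry X} {X₀ : Set X}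
    {A D E : CStar.{u}} (a : A) (m : UniformRoe hX D) (n : UniformRoe hX E) (l : tensorObj A D ⟶ E)
    (h : ∀ x y, l (MaxTensor.tmul a (MatrixAlgebra.coeff m x y)) = MatrixAlgebra.coeff n x y) :
    (relRoeFunctor hX X₀).map l ((relRoeGood hX X₀).label A D (MaxTensor.tmul a (qmat hX X₀ m))) =
      qmat hX X₀ n := by
  refine (congrArg ((relRoeFunctor hX X₀).map l) (relRoeGood_label hX X₀ a m)).trans ?_
  refine congrArg (qmat hX X₀) (MatrixAlgebra.ext_coeff fun x y => ?_)
  refine (MatrixAlgebra.coeff_map (B := MaxTensor A D) (C := E) l _ x y).trans ?_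
  exact (congrArg l (MatrixAlgebra.coeff_lab a m x y)).trans (h x y)

theorem isLabeled_of_relRoe {X : Type u} [MetricSpace X] {hX : BoundedGeometry X} {X₀ : Set X}
    {G H : CStarEndo.{u}} {gG : GoodStructure G} {gH : GoodStructure H}
    {γ : relRoeFunctor hX X₀ ⟶ G ⋙ (H ⋙ relRoeFunctor hX X₀)}
    (f : ∀ B : CStar.{u}, UniformRoe hX B → UniformRoe hX (H.obj (G.obj B)))
    (hf : ∀ (B : CStar.{u}) (m : UniformRoe hX B), γ.app B (qmat hX X₀ m) = qmat hX X₀ (f B m))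
    (h : ∀ (A B : CStar.{u}) (a : A) (m : UniformRoe hX B) x y, (gG.comp gH).label A B
      (MaxTensor.tmul a (MatrixAlgebra.coeff (f B m) x y)) =
      MatrixAlgebra.coeff (f (tensorObj A B) (MatrixAlgebra.lab a m)) x y) :
    IsLabeled (relRoeGood hX X₀) (gG.comp (gH.comp (relRoeGood hX X₀))) γ := by
  refine isLabeled_of_tmul fun A B a q => ?_
  obtain ⟨m, rfl⟩ := CStarIdeal.proj_surjective q
  refine (congrArg (fun y => (gG.comp (gH.comp (relRoeGood hX X₀))).label A B
    (MaxTensor.tmul a y)) (hf B m)).trans ?_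
  refine (comp_comp_label gG gH (relRoeGood hX X₀) A B
    (MaxTensor.tmul a (qmat hX X₀ (f B m)))).trans ?_
  refine Eq.trans ?_ (congrArg (γ.app (tensorObj A B)) (relRoeGood_label hX X₀ a m)).symm
  refine Eq.trans ?_ (hf (tensorObj A B) (MatrixAlgebra.lab a m)).symm
  exact relRoe_map_label (D := H.obj (G.obj B)) (E := H.obj (G.obj (tensorObj A B))) a (f B m)
    (f (tensorObj A B) (MatrixAlgebra.lab a m)) ((gG.comp gH).label A B) (h A B a m)

theorem isLabeled_rightHomotopy (hΔ : 0 < Δ) (hsc : IsScaling 𝒳₀ sc) (hX : BoundedGeometry X)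
    (hnet : IsSeparatedNet Δ X) (hα : IsSquarePartition Δ X α) (he : Function.Injective e) :
    IsLabeled (relRoeGood hX (discretePart Δ 𝒳₀ X)) (cylinderGood.comp
      ((compactGood.comp asymptoticGood).comp (relRoeGood hX (discretePart Δ 𝒳₀ X))))
      (rightHomotopy hΔ hsc hX hnet hα he) := by
  refine isLabeled_of_relRoe (gG := cylinderGood) (gH := compactGood.comp asymptoticGood)
    (fun B m => rightAsMat B hΔ hsc hX hα he m)
    (fun B m => rightHom_qmat hΔ hsc hX hnet hα he m) fun A B a m x y => ?_
  refine Eq.trans ?_ (coeff_rightAsMat (B := MaxTensor A B) hΔ hsc hX hα he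
    (MatrixAlgebra.lab a m) x y).symm
  refine Eq.trans ?_ (cylinder_stable_label_rightEntry hΔ hsc hX hα he a m x y)
  exact congrArg (fun b => (cylinderGood.comp (compactGood.comp asymptoticGood)).label A B
    (MaxTensor.tmul a b)) (coeff_rightAsMat hΔ hsc hX hα he m x y)

theorem rightHomotopy_one (hΔ : 0 < Δ) (hsc : IsScaling 𝒳₀ sc) (hX : BoundedGeometry X)
    (hnet : IsSeparatedNet Δ X) (hα : IsSquarePartition Δ X α) (he : Function.Injective e)
    (B : CStar.{u}) :
    (rightHomotopy hΔ hsc hX hnet hα he).app B ≫ ((compactFunctor.{u} ⋙ asymptoticFunctor) ⋙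
      relRoeFunctor hX (discretePart Δ 𝒳₀ X)).map (evalAt 1 B) =
      (alphaIotaRight (relRoeFunctor hX (discretePart Δ 𝒳₀ X))).app B :=
  relRoe_hom_ext (hX := hX) (X₀ := discretePart Δ 𝒳₀ X) (B := B)
    fun M => rightHom_one hΔ hsc hX hnet hα he (CStarCompletion.mk M)

variable [ProperSpace 𝒳]

theorem rightHomotopy_zero (hΔ : 0 < Δ) (hsc : IsScaling 𝒳₀ sc) (hX : BoundedGeometry X)
    (hnet : IsSeparatedNet Δ X) (hα : IsSquarePartition Δ X α) (he : Function.Injective e)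
    (B : CStar.{u}) :
    (rightHomotopy hΔ hsc hX hnet hα he).app B ≫ ((compactFunctor.{u} ⋙ asymptoticFunctor) ⋙
      relRoeFunctor hX (discretePart Δ 𝒳₀ X)).map (evalAt 0 B) =
      (rightTriangle (unitTransformation 𝒳₀ hΔ hX hnet hα)
        (counitTransformation Δ hsc hX he)).app B :=
  relRoe_hom_ext (hX := hX) (X₀ := discretePart Δ 𝒳₀ X) (B := B)
    fun M => rightHom_zero_mk hΔ hsc hX hnet hα he M

/-- The right triangle commutes up to homotopy. -/
theorem right_triangle_homotopic (hΔ : 0 < Δ) (hsc : IsScaling 𝒳₀ sc) (hX : BoundedGeometry X)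
    (hnet : IsSeparatedNet Δ X) (hα : IsSquarePartition Δ X α) (he : Function.Injective e) :
    LabeledHomotopic cylinderGood (relRoeGood hX (discretePart Δ 𝒳₀ X))
      ((compactGood.comp asymptoticGood).comp (relRoeGood hX (discretePart Δ 𝒳₀ X)))
      (rightTriangle (unitTransformation 𝒳₀ hΔ hX hnet hα) (counitTransformation Δ hsc hX he))
      (alphaIotaRight (relRoeFunctor hX (discretePart Δ 𝒳₀ X))) :=
  labeledHomotopic_of_endpoints (rightHomotopy hΔ hsc hX hnet hα he)
    (isLabeled_rightHomotopy hΔ hsc hX hnet hα he) (rightHomotopy_zero hΔ hsc hX hnet hα he)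
    (rightHomotopy_one hΔ hsc hX hnet hα he)

end RightTriangle

end

theorem theorem3p15 {𝒳 : Type u} [MetricSpace 𝒳] [ProperSpace 𝒳] (𝒳₀ : Set 𝒳)
    (h𝒳₀ : IsClosed 𝒳₀) (sc : ℝ≥0 → 𝒳 → 𝒳) (hsc : IsScaling 𝒳₀ sc) (Δ : ℝ) (hΔ : 0 < Δ)
    (X : Set 𝒳) (hX : IsSeparatedNet Δ X) (hbg : BoundedGeometry X)
    (α : X → C(𝒳, ℝ)) (hα : IsSquarePartition Δ X α)
    (e : X → ℕ) (he : Function.Injective e) :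
    ∃ (gI : GoodStructure cylinderFunctor.{u}) (gA : GoodStructure asymptoticFunctor.{u})
      (gK : GoodStructure compactFunctor.{u}) (gS : GoodStructure (relC0Functor 𝒳₀))
      (gN : GoodStructure (relRoeFunctor hbg (discretePart Δ 𝒳₀ X))),
      IsCylinderLabeling gI ∧ IsAsymptoticLabeling gA ∧ IsCompactLabeling gK ∧
      IsC0Labeling 𝒳₀ gS ∧ IsRoeLabeling hbg (discretePart Δ 𝒳₀ X) gN ∧
      ∃ (η : 𝟭 CStar.{u} ⟶ relC0Functor 𝒳₀ ⋙ relRoeFunctor hbg (discretePart Δ 𝒳₀ X))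
        (ε : relRoeFunctor hbg (discretePart Δ 𝒳₀ X) ⋙ relC0Functor 𝒳₀ ⟶
          compactFunctor.{u} ⋙ asymptoticFunctor),
        IsRoeUnit 𝒳₀ Δ X hbg α η ∧ IsRoeCounit 𝒳₀ sc Δ X hbg e ε ∧
        IsAsymptoticAdjunction η ε gI gA gK gS gN :=
  ⟨cylinderGood, asymptoticGood, compactGood, relC0Good 𝒳₀, relRoeGood hbg _,
    isCylinderLabeling_cylinderGood, isAsymptoticLabeling_asymptoticGood,
    isCompactLabeling_compactGood, isC0Labeling_relC0Good 𝒳₀, isRoeLabeling_relRoeGood hbg _,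
    unitTransformation 𝒳₀ hΔ hbg hX hα, counitTransformation Δ hsc hbg he,
    isRoeUnit_unitTransformation hΔ hbg hX hα, isRoeCounit_counitTransformation hsc hbg he,
    ⟨isLabeled_unitTransformation hΔ hbg hX hα, isLabeled_counitTransformation hsc hbg he,
      left_triangle_homotopic hΔ hsc hbg hX hα he, right_triangle_homotopic hΔ hsc hbg hX hα he⟩⟩
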